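/- Conventions. Let $e_1,\dots,e_7$ be the canonical basis of $\mathbb R^7\subset\mathbb C^7$ with the standard (bilinear) dot product. Let $\varpi^L_a$ and $\varpi^R_a$ ($a=1,\dots,8$) be the vectors $\frac12(\pm e_1\pm e_2\pm e_3\pm e_4)$ with an even, respectively odd, number of minus signs, and $\varpi^V_a$ the vectors $\pm e_1,\dots,\pm e_4$; write $\varpi^A_{-a}=-\varpi^A_a$, $-a\equiv a+4 \pmod 8$, with $\varpi^L_4=-\varpi^L_8=\frac12(e_1-e_2-e_3+e_4)$. Put $R(\mathbf{so}(8))=\{\pm e_i\pm e_j: 1\le i<j\le4\}$, $$\alpha^{L}_{a,\pm}=\varpi^L_a\pm\tfrac{e_5-e_7}{\sqrt2},\quad \alpha^{R}_{a,\pm}=\varpi^R_a\pm\tfrac{e_5-e_6}{\sqrt2},\quad \alpha^{V}_{a,\pm}=\varpi^V_a\pm\tfrac{e_6-e_7}{\sqrt2},$$ $$\alpha^{L,+}_{a,\pm}=\varpi^L_a\pm\tfrac{e_5+e_7}{\sqrt2},\quad \alpha^{R,+}_{a,\pm}=\varpi^R_a\pm\tfrac{e_5+e_6}{\sqrt2},\quad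 \alpha^{V,+}_{a,\pm}=\varpi^V_a\pm\tfrac{e_6+e_7}{\sqrt2},$$ $R(\mathbf e_6)=R(\mathbf{so}(8))\cup\{\alpha^{L}_{a,\pm},\alpha^{R}_{a,\pm},\alpha^{V}_{a,\pm}\}$ and $R(\mathbf e_7)=R(\mathbf e_6)\cup\{\pm\sqrt2e_5,\pm\sqrt2e_6,\pm\sqrt2e_7\}\cup\{\alpha^{L,+}_{a,\pm},\alpha^{R,+}_{a,\pm},\alpha^{V,+}_{a,\pm}\}$. Let $\mathbf e_7$ be a finite-dimensional complex Lie algebra with nondegenerate Killing form, with a Cartan subalgebra $\mathfrak H$ identified with $\mathbb C^7$ so that the set of roots is $R(\mathbf e_7)$ (a vector $\alpha$ acting as the linear form $u\mapsto\alpha\cdot u$). Let $\mathbf e_6$ and $\mathbf{so}(8)$ be the subalgebras generated by the root spaces of the roots in $R(\mathbf e_6)$, $R(\mathbf{so}(8))$. Let $$\alpha_1=\tfrac12(e_4-e_3-e_2-e_1)+\tfrac{e_5-e_6}{\sqrt2},\ \alpha_2=e_3-e_4,\ \alpha_3=e_2-e_3,\ \alpha_4=e_1-e_2,\ \alpha_5=-e_1+\tfrac{e_6-e_7}{\sqrt2},\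 \alpha_6=e_3+e_4,\ \alpha_7=\sqrt2e_7,$$ $\alpha_0=-\sqrt2e_5$ and $\varpi_7=\frac1{\sqrt2}(e_5+e_6+e_7)$. Let $(x,y)$ be the Killing form divided by $36$. A Chevalley basis is a family of root vectors $E_\alpha$, $\alpha\in R(\mathbf e_7)$, with $[E_\alpha,E_{-\alpha}]=\alpha\in\mathfrak H$ and $[E_\alpha,E_\beta]=\pm E_{\alpha+\beta}$ whenever $\alpha,\beta,\alpha+\beta$ are roots. Write $E^L_{a,\pm}$, $E^{L,+}_{a,\pm}$, etc. for the vectors $E_\alpha$ with $\alpha=\alpha^L_{a,\pm},\alpha^{L,+}_{a,\pm}$, etc., and $E_{j,\pm}$ for $\alpha=\pm\sqrt2e_j$, $j=5,6,7$. Let $\lambda_7$ be the linear map $e_1\mapsto\frac12(e_1+e_2+e_3-e_4)$, $e_2\mapsto\frac12(e_1+e_2-e_3+e_4)$, $e_3\mapsto\frac12(e_1-e_2+e_3+e_4)$, $e_4\mapsto\frac12(-e_1+e_2+e_3+e_4)$, $e_5\mapsto-e_7$, $e_6\mapsto-e_6$, $e_7\mapsto-e_5$. Number the weights so that $\varpi^V_a=e_a$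 for $a\le 4$ and $\varpi^V_a=\lambda_7\varpi^R_a$. Theorem. (1) The $\alpha_i$ are roots whose Gram matrix is the Cartan matrix $E_7$, $\alpha_i\cdot\varpi_7=\delta_{i7}$, and $\lambda_7$ is generated by $\varpi_7$: it belongs to the Weyl group, and $x\mapsto\lambda_7x+\varpi_7$ maps the fundamental alcove $\{x\in\mathbb R^7:\alpha_i\cdot x>0\ (1\le i\le7),\ -\alpha_0\cdot x<1\}$ onto itself. Moreover $\lambda_7^2=1$ and $\lambda_7$ exchanges $\alpha_1\leftrightarrow\alpha_5$, $\alpha_2\leftrightarrow\alpha_4$, $\alpha_7\leftrightarrow\alpha_0$ and fixes $\alpha_3$, $\alpha_6$. (2) There are a Chevalley basis $(E_\alpha)$ and a Lie algebra automorphism $\Lambda$ of $\mathbf e_7$ (again written $\lambda_7$) acting on $\mathfrak H=\mathbb C^7$ as $\lambda_7$ and with $\Lambda E_\alpha=E_{\lambda_7\alpha}$ for all roots $\alpha$. For every such pair $((E_\alpha),\Lambda)$ the following holds. (3) $\Lambda^2=1$, so $\mathbf e_7=\mathfrak g_0\oplus\mathfrak g_1$ with $\Lambda=(-1)^k$ on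 $\mathfrak g_k$, and this is a $\mathbb Z/2$-grading. One has $\mathfrak g_0=\tilde{\mathfrak g}_0\oplus V$, where $\tilde{\mathfrak g}_0=\mathbf e_6\cap\mathfrak g_0$ and $V$ is the $\Lambda$-invariant part of the complement $\mathcal I$ of $\mathbf e_6$ in $\mathbf e_7$ spanned by the $54$ root spaces outside $R(\mathbf e_6)$ and by $e_5+e_6+e_7\in\mathfrak H$. As a Lie algebra $\mathfrak g_0$ is the direct sum of a copy of $\mathbf e_6$ and a one-dimensional centre. (4) $\tilde{\mathfrak g}_0=\mathbf f_4$: it is semisimple with Cartan subalgebra $\tilde{\mathfrak H}_0=\mathfrak H\cap\tilde{\mathfrak g}_0=\{u\in\mathbb C^7: u_1-u_2-u_3+u_4=0,\ u_6=0,\ u_7=-u_5\}$, and its root system has the simple roots $$\tilde\alpha_1=e_3+e_4,\quad\tilde\alpha_2=e_2-e_3,\quad\tilde\alpha_3=\tfrac12(e_1-e_2+e_3-e_4),\quad\tilde\alpha_4=\tfrac14(-3e_1-e_2-e_3+e_4)+\tfrac1{2\sqrt2}(e_5-e_7)$$ with simple coroots $\tilde\alpha_1^\vee=\tilde\alpha_1$,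 $\tilde\alpha_2^\vee=\tilde\alpha_2$, $\tilde\alpha_3^\vee=2\tilde\alpha_3$, $\tilde\alpha_4^\vee=2\tilde\alpha_4$ and Cartan matrix of type $F_4$. (5) $\mathbf e_6$ is of type $E_6$ with simple roots $\alpha_1,\dots,\alpha_6$, and $\mathbf e_6=\mathbf f_4\oplus\underline{26}$ (dimensions $78=52+26$), where $\underline{26}=\mathbf e_6\cap\mathfrak g_1$ is the fundamental (irreducible highest weight) representation of $\mathbf f_4$ corresponding to $\tilde\alpha_4$. (6) Put $h^1_{\alpha_1}=\frac1{\sqrt2}(\alpha_1-\alpha_5)$, $h^1_{\alpha_2}=\frac1{\sqrt2}(\alpha_2-\alpha_4)$, $h^1_{e_5}=\frac1{\sqrt3}(e_5+e_6+e_7)$ in $\mathfrak H$. Let $\mathcal J$ be spanned by the $48$ root spaces of $R(\mathbf e_6)\setminus R(\mathbf{so}(8))$ and by $h^1_{\alpha_1},\tilde\alpha_4^\vee$, and $\mathcal J_k=\mathcal J\cap\mathfrak g_k$. Then, as vector spaces, $\mathbf e_6=\mathbf{so}(8)\oplus\mathcal J$ ($78=28+50$) and $\mathcal J=\mathcal J_0\oplus\mathcal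 J_1$; $\mathbf{so}(8)=\mathbf{so}(7)\oplus\underline 7$, where $\mathbf{so}(7)=\mathbf{so}(8)\cap\mathfrak g_0$ is of type $B_3$ with simple roots $\tilde\alpha_1,\tilde\alpha_2,\tilde\alpha_3$ and $\underline7=\mathbf{so}(8)\cap\mathfrak g_1$ is its fundamental representation corresponding to $\tilde\alpha_1$; and $$\mathbf f_4=\mathbf{so}(7)\oplus\mathcal J_0\ (52=21+31),\qquad \underline{26}=\mathcal J_1\oplus\underline7\ (26=19+7).$$ (7) $\mathbf e_7=\mathbf f_4\oplus V\oplus\mathfrak g_1$ with $133=52+27+54$, and $\mathbf e_7=\mathbf e_6\oplus\mathcal I$. (8) GS bases. For $k=0,1$ put $$t^{R,k}_{a,\pm}=\tfrac1{\sqrt2}(E^R_{a,\pm}+(-1)^kE^V_{a,\pm}),\quad t^{L,k}_{4,\pm}=\tfrac1{\sqrt2}(E^L_{4,\pm}+(-1)^kE^L_{8,\pm}),\quad t^{R,+,k}_{a,\pm}=\tfrac1{\sqrt2}(E^{R,+}_{a,\pm}+(-1)^kE^{V,+}_{a,\mp}),$$ $$t^{L,+,k}_{4,\pm}=\tfrac1{\sqrt2}(E^{L,+}_{4,\pm}+(-1)^kE^{L,+}_{8,\mp}),\quad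 t^{L,+,k}_{a,+}=\tfrac1{\sqrt2}(E^{L,+}_{a,+}+(-1)^kE^{L,+}_{a,-})\ (a\ne4,8),$$ $$t^k_{5,\pm}=\tfrac1{\sqrt2}(E_{5,\pm}+(-1)^kE_{7,\mp}),\quad t^k_{6,\pm}=\tfrac1{\sqrt2}(E_{6,\pm}+(-1)^kE_{6,\mp}).$$ Let $\beta_1,\beta_2,\beta_3=e_1-e_2,\ e_1-e_3,\ e_1+e_4$, with $\lambda_7\beta_j=e_3-e_4,\ e_2-e_4,\ e_2+e_3$, and $t^1_{\pm j}=\frac1{\sqrt2}(E_{\pm\beta_j}-E_{\pm\lambda_7\beta_j})$. Then bases are: $\mathbf{so}(7)$: $E_{\pm\gamma}$ for $\gamma\in\{e_2-e_3,e_1-e_4,e_3+e_4,e_2+e_4,e_1+e_3,e_1+e_2\}$, $E_{\pm\beta_j}+E_{\pm\lambda_7\beta_j}$, $\tilde\alpha^\vee_1,\tilde\alpha^\vee_2,\tilde\alpha^\vee_3$; $\mathcal J_0$: $\sqrt2\,t^{R,0}_{a,\pm}$, $E^L_{a,\pm}$ ($a\neq4,8$), $\sqrt2\,t^{L,0}_{4,\pm}$,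 $\tilde\alpha_4^\vee$ (together with the preceding ones these form a basis of $\mathbf f_4$); $\underline7$: $t^1_{\pm j}$, $h^1_{\alpha_2}$; $\mathcal J_1$: $t^{R,1}_{a,\pm}$, $t^{L,1}_{4,\pm}$, $h^1_{\alpha_1}$; $V$: $t^{R,+,0}_{a,\pm}$, $t^{L,+,0}_{a,+}$ ($a\ne4,8$), $t^{L,+,0}_{4,\pm}$, $t^0_{5,\pm}$, $t^0_{6,+}$; $\mathfrak g_1$: the bases of $\mathcal J_1$ and $\underline7$ together with $t^{R,+,1}_{a,\pm}$, $t^{L,+,1}_{a,+}$ ($a\neq4,8$), $t^{L,+,1}_{4,\pm}$, $t^1_{5,\pm}$, $t^1_{6,+}$, $h^1_{e_5}$. (9) Normalised Killing form. $(u,v)=u\cdot v$ for $u,v\in\mathfrak H=\mathbb C^7$, $(u,E_\alpha)=0$ for $u\in\mathfrak H$, and $(E_\alpha,E_\beta)=\delta_{\beta,-\alpha}$. On $\mathbf f_4$, among vectors of the same kind the product of vectors with opposite weights is $1$ for the vectors $E_{\pm\gamma}$ and $E^L_{a,\pm}$ ($a\ne4,8$) and $2$ for $E_{\pm\beta_j}+E_{\pm\lambda_7\beta_j}$,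 $\sqrt2\,t^{R,0}_{a,\pm}$ and $\sqrt2\,t^{L,0}_{4,\pm}$, all other products within each kind being $0$. With $\delta_k=1$ if $k_1=k_2=k$ and $\delta_k=0$ if $k_1\neq k_2$ (and all products of two vectors of one of the first seven kinds below that are not displayed, i.e. with other signs $\pm$, being $0$): $$(t^{R,+,k_1}_{a,\pm},t^{R,+,k_2}_{b,\mp})=\delta_{a,-b}\delta_k,\quad(t^{R,k_1}_{a,\pm},t^{R,k_2}_{b,\mp})=\delta_{a,-b}\delta_k,\quad(t^{L,+,k_1}_{4,\pm},t^{L,+,k_2}_{4,\pm})=(-1)^k\delta_k,$$ $$(t^{L,k_1}_{4,\pm},t^{L,k_2}_{4,\mp})=(-1)^k\delta_k,\quad(t^{L,+,k_1}_{a,+},t^{L,+,k_2}_{b,+})=(-1)^k\delta_{a,-b}\delta_k\ (a,b\neq4,8),$$ $$(t^1_{\pm i},t^1_{\mp j})=\delta_{ij},\quad(t^{k_1}_{5,\pm},t^{k_2}_{5,\mp})=\delta_k,\quad(t^{k_1}_{6,+},t^{k_2}_{6,-})=\delta_k,$$ and $(h^1_{\alpha_i},h^1_{\alpha_j})_{i,j=1,2}$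 is the Cartan matrix $A_2$, $(h^1_{e_5},h^1_{e_5})=1$, $(h^1_{e_5},h^1_{\alpha_i})=0$. -/

import Mathlib

open Matrix Module

namespace E7

noncomputable section

/-! ### Vectors in `ℝ⁷`, roots and weights

Coordinates are numbered from `0`, so that the basis vector written `e_j` in the usual notation has
its entry `1` in position `j - 1`. -/

/-- `1 / √2`. -/
def c : ℝ := (√2)⁻¹

/-- A real vector as a complex vector. -/
def toC (v : Fin 7 → ℝ) : Fin 7 → ℂ := fun i => (v i : ℂ)

/-- The `j`-th vector of the canonical basis. -/
def e (j : Fin 7) : Fin 7 → ℝ := fun i => if i = j then 1 else 0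

/-- Weights of the left spinor representation of `so(8)` (even number of minus signs);
the weight with index `a + 4` is the opposite of the weight with index `a`. -/
def wL : Fin 8 → Fin 7 → ℝ :=
  ![![1/2, 1/2, 1/2, 1/2, 0, 0, 0], ![1/2, 1/2, -1/2, -1/2, 0, 0, 0],
    ![1/2, -1/2, 1/2, -1/2, 0, 0, 0], ![1/2, -1/2, -1/2, 1/2, 0, 0, 0],
    ![-1/2, -1/2, -1/2, -1/2, 0, 0, 0], ![-1/2, -1/2, 1/2, 1/2, 0, 0, 0],
    ![-1/2, 1/2, -1/2, 1/2, 0, 0, 0], ![-1/2, 1/2, 1/2, -1/2, 0, 0, 0]]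

/-- Weights of the right spinor representation of `so(8)` (odd number of minus signs);
the weight with index `a + 4` is the opposite of the weight with index `a`. -/
def wR : Fin 8 → Fin 7 → ℝ :=
  ![![1/2, 1/2, 1/2, -1/2, 0, 0, 0], ![1/2, 1/2, -1/2, 1/2, 0, 0, 0],
    ![1/2, -1/2, 1/2, 1/2, 0, 0, 0], ![-1/2, 1/2, 1/2, 1/2, 0, 0, 0],
    ![-1/2, -1/2, -1/2, 1/2, 0, 0, 0], ![-1/2, -1/2, 1/2, -1/2, 0, 0, 0],
    ![-1/2, 1/2, -1/2, -1/2, 0, 0, 0], ![1/2, -1/2, -1/2, -1/2, 0, 0, 0]]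

/-- Weights of the vector representation of `so(8)`;
the weight with index `a + 4` is the opposite of the weight with index `a`. -/
def wV : Fin 8 → Fin 7 → ℝ :=
  ![e 0, e 1, e 2, e 3, -e 0, -e 1, -e 2, -e 3]

/-- The root `ϖ^L_a ± (e₅ - e₇) / √2`. -/
def aL (a : Fin 8) (s : ℤˣ) : Fin 7 → ℝ := wL a + s • c • (e 4 - e 6)
/-- The root `ϖ^R_a ± (e₅ - e₆) / √2`. -/
def aR (a : Fin 8) (s : ℤˣ) : Fin 7 → ℝ := wR a + s • c • (e 4 - e 5)
/-- The root `ϖ^V_a ± (e₆ - e₇) / √2`. -/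
def aV (a : Fin 8) (s : ℤˣ) : Fin 7 → ℝ := wV a + s • c • (e 5 - e 6)
/-- The root `ϖ^L_a ± (e₅ + e₇) / √2`. -/
def aLp (a : Fin 8) (s : ℤˣ) : Fin 7 → ℝ := wL a + s • c • (e 4 + e 6)
/-- The root `ϖ^R_a ± (e₅ + e₆) / √2`. -/
def aRp (a : Fin 8) (s : ℤˣ) : Fin 7 → ℝ := wR a + s • c • (e 4 + e 5)
/-- The root `ϖ^V_a ± (e₆ + e₇) / √2`. -/
def aVp (a : Fin 8) (s : ℤˣ) : Fin 7 → ℝ := wV a + s • c • (e 5 + e 6)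
/-- The roots `± √2 e₅`, `± √2 e₆`, `± √2 e₇` (for `j = 0, 1, 2`). -/
def aE (j : Fin 3) (s : ℤˣ) : Fin 7 → ℝ := s • √2 • ![e 4, e 5, e 6] j

/-- The roots of `so(8)`: all `± e_i ± e_j` with `i ≠ j` in `{1, 2, 3, 4}`. -/
def R8 : Set (Fin 7 → ℝ) :=
  {v | ∃ i j : Fin 4, ∃ s t : ℤˣ, i ≠ j ∧
    v = s • e (i.castLE (by decide)) + t • e (j.castLE (by decide))}

/-- The roots of `e₆`. -/
def R6 : Set (Fin 7 → ℝ) :=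
  R8 ∪ {v | ∃ a s, v = aL a s ∨ v = aR a s ∨ v = aV a s}

/-- The roots of `e₇`. -/
def R7 : Set (Fin 7 → ℝ) :=
  R6 ∪ {v | ∃ j s, v = aE j s} ∪ {v | ∃ a s, v = aLp a s ∨ v = aRp a s ∨ v = aVp a s}

/-- The simple roots `α₁, …, α₇` of `e₇`. -/
def simple : Fin 7 → Fin 7 → ℝ :=
  ![![-1/2, -1/2, -1/2, 1/2, c, -c, 0], ![0, 0, 1, -1, 0, 0, 0], ![0, 1, -1, 0, 0, 0, 0],
    ![1, -1, 0, 0, 0, 0, 0], ![-1, 0, 0, 0, 0, c, -c], ![0, 0, 1, 1, 0, 0, 0],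
    ![0, 0, 0, 0, 0, 0, √2]]

/-- The minimal root `α₀ = -√2 e₅`. -/
def alpha0 : Fin 7 → ℝ := ![0, 0, 0, 0, -√2, 0, 0]

/-- The relabelling of `α₁, …, α₇` that leads to the usual numbering of the diagram `E₇`. -/
def sigma7 : Fin 7 → Fin 7 := ![0, 2, 3, 4, 5, 1, 6]
/-- The relabelling of `α₁, …, α₆` that leads to the usual numbering of the diagram `E₆`. -/
def sigma6 : Fin 6 → Fin 6 := ![0, 2, 3, 4, 5, 1]

/-- The fundamental weight `ϖ₇ = (e₅ + e₆ + e₇) / √2`. -/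
def varpi7 : Fin 7 → ℝ := ![0, 0, 0, 0, c, c, c]

/-- The fundamental alcove. -/
def alcove : Set (Fin 7 → ℝ) :=
  {x | (∀ i, 0 < simple i ⬝ᵥ x) ∧ -(alpha0 ⬝ᵥ x) < 1}

/-- The reflection in a vector of squared length `2`. -/
def refl (β : Fin 7 → ℝ) : Module.End ℝ (Fin 7 → ℝ) :=
  LinearMap.id - (dotProductBilin ℝ ℝ β).smulRight β

/-- The matrix of `λ₇` in the canonical basis. -/
def lamMatrix (𝕜 : Type*) [Field 𝕜] : Matrix (Fin 7) (Fin 7) 𝕜 :=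
  !![1/2, 1/2, 1/2, -1/2, 0, 0, 0;
     1/2, 1/2, -1/2, 1/2, 0, 0, 0;
     1/2, -1/2, 1/2, 1/2, 0, 0, 0;
     -1/2, 1/2, 1/2, 1/2, 0, 0, 0;
     0, 0, 0, 0, 0, 0, -1;
     0, 0, 0, 0, 0, -1, 0;
     0, 0, 0, 0, -1, 0, 0]

/-- The map `λ₇` on `𝕜⁷`. -/
def lam (𝕜 : Type*) [Field 𝕜] : Module.End 𝕜 (Fin 7 → 𝕜) := Matrix.toLin' (lamMatrix 𝕜)

/-- The simple roots of `f₄`. -/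
def simpleF : Fin 4 → Fin 7 → ℝ :=
  ![![0, 0, 1, 1, 0, 0, 0], ![0, 1, -1, 0, 0, 0, 0], ![1/2, -1/2, 1/2, -1/2, 0, 0, 0],
    ![-3/4, -1/4, -1/4, 1/4, c/2, 0, -c/2]]

/-- The simple coroots of `f₄`. -/
def simpleCoF : Fin 4 → Fin 7 → ℝ :=
  ![![0, 0, 1, 1, 0, 0, 0], ![0, 1, -1, 0, 0, 0, 0], ![1, -1, 1, -1, 0, 0, 0],
    ![-3/2, -1/2, -1/2, 1/2, c, 0, -c]]

/-- The vector `h¹_{α₁} = (α₁ - α₅) / √2`, on which `λ₇` acts by `-1`. -/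
def hA1 : Fin 7 → ℝ := c • (simple 0 - simple 4)
/-- The vector `h¹_{α₂} = (α₂ - α₄) / √2`, on which `λ₇` acts by `-1`. -/
def hA2 : Fin 7 → ℝ := c • (simple 1 - simple 3)
/-- The vector `h¹_{e₅} = (e₅ + e₆ + e₇) / √3`, on which `λ₇` acts by `-1`. -/
def hE5 : Fin 7 → ℝ := (√3)⁻¹ • (e 4 + e 5 + e 6)

/-- Up to sign, the roots of `so(8)` that are fixed by `λ₇`:
`e₂ - e₃`, `e₁ - e₄`, `e₃ + e₄`, `e₂ + e₄`, `e₁ + e₃`, `e₁ + e₂`. -/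
def fix8 : Fin 6 → Fin 7 → ℝ :=
  ![e 1 - e 2, e 0 - e 3, e 2 + e 3, e 1 + e 3, e 0 + e 2, e 0 + e 1]

/-- Up to sign, representatives of the orbits of length two of `λ₇` on the roots of `so(8)`:
`e₁ - e₂`, `e₁ - e₃`, `e₁ + e₄`. -/
def mov8 : Fin 3 → Fin 7 → ℝ :=
  ![e 0 - e 1, e 0 - e 2, e 0 + e 3]

/-- The images of the roots `mov8 j` under `λ₇`: `e₃ - e₄`, `e₂ - e₄`, `e₂ + e₃`. -/
def mov8' : Fin 3 → Fin 7 → ℝ :=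
  ![e 2 - e 3, e 1 - e 3, e 1 + e 2]

/-! ### Lie algebras of type `E₇`, Chevalley bases, the lift of `λ₇` -/

section Lie

variable {L : Type*} [LieRing L] [LieAlgebra ℂ L] {H : LieSubalgebra ℂ L}
  (φ : H ≃ₗ[ℂ] (Fin 7 → ℂ))

/-- The element of the Cartan subalgebra with given coordinates. -/
def hh (u : Fin 7 → ℂ) : L := (φ.symm u : L)

/-- The linear form on the Cartan subalgebra defined by a vector of `ℝ⁷`. -/
def form (α : Fin 7 → ℝ) : Dual ℂ H := dotProductBilin ℂ ℂ (toC α) ∘ₗ φ.toLinearMap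

/-- `x` lies in the (root) space of weight `α`. -/
def IsRootVector (α : Fin 7 → ℝ) (x : L) : Prop :=
  ∀ u, ⁅hh φ u, x⁆ = (toC α ⬝ᵥ u) • x

/-- The invariant bilinear form, normalised so that roots have squared length `2`:
the Killing form divided by twice the Coxeter number `18`. -/
def kf (x y : L) : ℂ := killingForm ℂ L x y / 36

/-- A Chevalley basis (all roots have the same length): root vectors `E α` with
`[E α, E (-α)] = α^∨` and `[E α, E β] = ± E (α + β)`.  Values of `E` off the roots play no role. -/
structure IsChevalley (E : (Fin 7 → ℝ) → L) : Prop where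
  rootVector : ∀ α ∈ R7, IsRootVector φ α (E α)
  coroot : ∀ α ∈ R7, ⁅E α, E (-α)⁆ = hh φ (toC α)
  lie : ∀ α ∈ R7, ∀ β ∈ R7, α + β ∈ R7 → ⁅E α, E β⁆ = E (α + β) ∨ ⁅E α, E β⁆ = -E (α + β)

/-- `Λ` extends `λ₇` from the Cartan subalgebra to the Lie algebra: it acts on the Cartan
subalgebra through `λ₇` and permutes the vectors of the Chevalley basis as `λ₇` permutes
the roots. -/
structure IsLift (E : (Fin 7 → ℝ) → L) (Λ : L ≃ₗ⁅ℂ⁆ L) : Prop where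
  cartan : ∀ u, Λ (hh φ u) = hh φ (lam ℂ u)
  root : ∀ α ∈ R7, Λ (E α) = E (lam ℝ α)

/-- The homogeneous components `g₀`, `g₁` of the grading defined by `Λ`. -/
def grade (Λ : L ≃ₗ⁅ℂ⁆ L) (k : ZMod 2) : Submodule ℂ L :=
  Module.End.eigenspace (Λ : L →ₗ[ℂ] L) ((-1) ^ k.val)

/-- The subalgebra generated by the root spaces of the roots in `S`. -/
def rootSubalgebra (S : Set (Fin 7 → ℝ)) : LieSubalgebra ℂ L :=
  LieSubalgebra.lieSpan ℂ L {x | ∃ α ∈ S, IsRootVector φ α x}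

/-- The subalgebra `e₆`. -/
def e6 : LieSubalgebra ℂ L := rootSubalgebra φ R6
/-- The subalgebra `so(8)`. -/
def so8 : LieSubalgebra ℂ L := rootSubalgebra φ R8

/-- The elements of a subalgebra that are fixed by `Λ`. -/
def invPart (K : LieSubalgebra ℂ L) (Λ : L ≃ₗ⁅ℂ⁆ L) : LieSubalgebra ℂ L where
  carrier := {x | x ∈ K ∧ Λ x = x}
  add_mem' := fun ⟨h1, h2⟩ ⟨h3, h4⟩ => ⟨add_mem h1 h3, by rw [map_add, h2, h4]⟩
  zero_mem' := ⟨zero_mem _, map_zero _⟩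
  smul_mem' := fun t _ ⟨h1, h2⟩ => ⟨K.smul_mem t h1, by rw [map_smul, h2]⟩
  lie_mem' := fun ⟨h1, h2⟩ ⟨h3, h4⟩ => ⟨K.lie_mem h1 h3, by rw [LieEquiv.map_lie, h2, h4]⟩

/-- The elements of a subalgebra on which `Λ` acts by `-1`, as a module over the subalgebra of
its `Λ`-fixed elements. -/
def antiPart (K : LieSubalgebra ℂ L) (Λ : L ≃ₗ⁅ℂ⁆ L) : LieSubmodule ℂ (invPart K Λ) L where
  carrier := {x | x ∈ K ∧ Λ x = -x}
  add_mem' := fun ⟨h1, h2⟩ ⟨h3, h4⟩ => ⟨add_mem h1 h3, by rw [map_add, h2, h4]; abel⟩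
  zero_mem' := ⟨zero_mem _, by rw [map_zero, neg_zero]⟩
  smul_mem' := fun t _ ⟨h1, h2⟩ => ⟨K.smul_mem t h1, by rw [map_smul, h2, smul_neg]⟩
  lie_mem := fun {x m} ⟨h1, h2⟩ => ⟨K.lie_mem x.2.1 h1, by
    change Λ ⁅(x : L), m⁆ = -⁅(x : L), m⁆
    rw [LieEquiv.map_lie, x.2.2, h2, lie_neg]⟩

/-- The invariant subalgebra of `e₆`. -/
def f4 (Λ : L ≃ₗ⁅ℂ⁆ L) : LieSubalgebra ℂ L := invPart (e6 φ) Λ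
/-- The anti-invariant part of `e₆`. -/
def rep26 (Λ : L ≃ₗ⁅ℂ⁆ L) : LieSubmodule ℂ (f4 φ Λ) L := antiPart (e6 φ) Λ
/-- The invariant subalgebra of `so(8)`. -/
def so7 (Λ : L ≃ₗ⁅ℂ⁆ L) : LieSubalgebra ℂ L := invPart (so8 φ) Λ
/-- The anti-invariant part of `so(8)`. -/
def rep7 (Λ : L ≃ₗ⁅ℂ⁆ L) : LieSubmodule ℂ (so7 φ Λ) L := antiPart (so8 φ) Λ

/-- The complement of `so(8)` in `e₆` spanned by the remaining 48 root spaces and the two Cartan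
elements `h¹_{α₁}` and `α̃₄^∨`. -/
def spJ : Submodule ℂ L :=
  Submodule.span ℂ ({x | ∃ α ∈ R6 \ R8, IsRootVector φ α x} ∪
    {hh φ (toC hA1), hh φ (toC (simpleCoF 3))})

/-- The complement of `e₆` in `e₇` spanned by the remaining 54 root spaces and the Cartan element
`e₅ + e₆ + e₇`. -/
def spI : Submodule ℂ L :=
  Submodule.span ℂ ({x | ∃ α ∈ R7 \ R6, IsRootVector φ α x} ∪
    {hh φ (toC (e 4 + e 5 + e 6))})

/-- The graded components of `spJ`. -/
def spJk (Λ : L ≃ₗ⁅ℂ⁆ L) (k : ZMod 2) : Submodule ℂ L := spJ φ ⊓ grade Λ k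

/-- The invariant part of `spI`. -/
def spV (Λ : L ≃ₗ⁅ℂ⁆ L) : Submodule ℂ L := spI φ ⊓ grade Λ 0

/-! ### Types of subalgebras and fundamental representations -/

/-- The Cartan subalgebra `H ∩ K` of `K`. -/
def cartanIn (H K : LieSubalgebra ℂ L) : LieSubalgebra ℂ K := H.comap K.incl

/-- The coordinates of an element of `H ∩ K`. -/
def coord (K : LieSubalgebra ℂ L) (x : cartanIn H K) : Fin 7 → ℂ :=
  φ ⟨((x : K) : L), x.2⟩

/-- `K` has nondegenerate Killing form (it is semisimple), `H ∩ K` is a Cartan subalgebra of `K`,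
and `α`, `αv` are the simple roots and simple coroots of a base of the root system
of `(K, H ∩ K)`, the Cartan matrix being `A`. -/
def HasSimpleRoots [FiniteDimensional ℂ L] {ι : Type} (K : LieSubalgebra ℂ L) (A : Matrix ι ι ℤ)
    (α αv : ι → Fin 7 → ℝ) : Prop :=
  ∃ (_ : LieAlgebra.IsKilling ℂ K) (_ : (cartanIn H K).IsCartanSubalgebra)
    (b : (LieAlgebra.IsKilling.rootSystem (cartanIn H K)).Base) (ε : ι ≃ b.support), ∀ i,
      (∀ x, (LieAlgebra.IsKilling.rootSystem (cartanIn H K)).root (ε i) x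
        = toC (α i) ⬝ᵥ coord φ K x) ∧
      coord φ K ((LieAlgebra.IsKilling.rootSystem (cartanIn H K)).coroot (ε i)) = toC (αv i) ∧
      ∀ j, b.cartanMatrix (ε i) (ε j) = A i j

/-- `W` is the `i`-th fundamental representation of `K`, with respect to the simple roots `α` and
simple coroots `αv`: it is irreducible and has a highest weight vector whose weight takes the
value `1` at the `i`-th simple coroot and `0` at the others. -/
def IsFundamental {ι : Type} [DecidableEq ι] {K : LieSubalgebra ℂ L} (α αv : ι → Fin 7 → ℝ) (i : ι)
    (W : LieSubmodule ℂ K L) : Prop :=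
  LieModule.IsIrreducible ℂ K W ∧ ∃ v ∈ W, v ≠ 0 ∧
    (∀ j, ⁅hh φ (toC (αv j)), v⁆ = (if j = i then (1 : ℂ) else 0) • v) ∧
    ∀ j, ∀ x ∈ K, (∀ u, hh φ u ∈ K → ⁅hh φ u, x⁆ = (toC (α j) ⬝ᵥ u) • x) → ⁅x, v⁆ = 0

/-! ### Generators of the GS basis -/

variable (E : (Fin 7 → ℝ) → L)

/-- The generator `t^{R,k}_{a,±} = (E^R_{a,±} + (-1)^k E^V_{a,±}) / √2`. -/
def tR (k : ZMod 2) (a : Fin 8) (s : ℤˣ) : L :=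
  (c : ℂ) • (E (aR a s) + (-1 : ℂ) ^ k.val • E (aV a s))

/-- The generator `t^{L,k}_{4,±} = (E^L_{4,±} + (-1)^k E^L_{8,±}) / √2`. -/
def tL4 (k : ZMod 2) (s : ℤˣ) : L :=
  (c : ℂ) • (E (aL 3 s) + (-1 : ℂ) ^ k.val • E (aL 7 s))

/-- The generators `t^1` of the anti-invariant part of `so(8)`, of weights `± mov8 j`. -/
def tM (j : Fin 3) (s : ℤˣ) : L := (c : ℂ) • (E (s • mov8 j) - E (s • mov8' j))

/-- The generator `t^{R,+,k}_{a,±} = (E^{R,+}_{a,±} + (-1)^k E^{V,+}_{a,∓}) / √2`. -/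
def tRp (k : ZMod 2) (a : Fin 8) (s : ℤˣ) : L :=
  (c : ℂ) • (E (aRp a s) + (-1 : ℂ) ^ k.val • E (aVp a (-s)))

/-- The generator `t^{L,+,k}_{a,+} = (E^{L,+}_{a,+} + (-1)^k E^{L,+}_{a,-}) / √2`
(used for `a ≠ 4, 8`). -/
def tLp (k : ZMod 2) (a : Fin 8) : L :=
  (c : ℂ) • (E (aLp a 1) + (-1 : ℂ) ^ k.val • E (aLp a (-1)))

/-- The generator `t^{L,+,k}_{4,±} = (E^{L,+}_{4,±} + (-1)^k E^{L,+}_{8,∓}) / √2`. -/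
def tLp4 (k : ZMod 2) (s : ℤˣ) : L :=
  (c : ℂ) • (E (aLp 3 s) + (-1 : ℂ) ^ k.val • E (aLp 7 (-s)))

/-- The generator `t^k_{5,±} = (E_{5,±} + (-1)^k E_{7,∓}) / √2`. -/
def t5 (k : ZMod 2) (s : ℤˣ) : L :=
  (c : ℂ) • (E (aE 0 s) + (-1 : ℂ) ^ k.val • E (aE 2 (-s)))

/-- The generator `t^k_{6,±} = (E_{6,±} + (-1)^k E_{6,∓}) / √2`. -/
def t6 (k : ZMod 2) (s : ℤˣ) : L :=
  (c : ℂ) • (E (aE 1 s) + (-1 : ℂ) ^ k.val • E (aE 1 (-s)))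

/-- Labels of the generators of `so(7)`. -/
inductive LabelSo7
  | fix (j : Fin 6) (s : ℤˣ)
  | mov (j : Fin 3) (s : ℤˣ)
  | cartan (j : Fin 3)

/-- The generators of `so(7)`. -/
def basisSo7 : LabelSo7 → L
  | .fix j s => E (s • fix8 j)
  | .mov j s => E (s • mov8 j) + E (s • mov8' j)
  | .cartan j => hh φ (toC (simpleCoF j.castSucc))

/-- Labels of the generators of the seven-dimensional anti-invariant part of `so(8)`. -/
inductive Label7
  | mov (j : Fin 3) (s : ℤˣ)
  | cartan

/-- The generators of the anti-invariant part of `so(8)`. -/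
def basis7 : Label7 → L
  | .mov j s => tM E j s
  | .cartan => hh φ (toC hA2)

/-- Labels of the generators of `J₀`. -/
inductive LabelJ0
  | R (a : Fin 8) (s : ℤˣ)
  | L (a : Fin 8) (ha : a ≠ 3 ∧ a ≠ 7) (s : ℤˣ)
  | L4 (s : ℤˣ)
  | cartan

/-- The generators of `J₀`. -/
def basisJ0 : LabelJ0 → L
  | .R a s => ((√2 : ℝ) : ℂ) • tR E 0 a s
  | .L a _ s => E (aL a s)
  | .L4 s => ((√2 : ℝ) : ℂ) • tL4 E 0 s
  | .cartan => hh φ (toC (simpleCoF 3))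

/-- Labels of the generators of `J₁`. -/
inductive LabelJ1
  | R (a : Fin 8) (s : ℤˣ)
  | L4 (s : ℤˣ)
  | cartan

/-- The generators of `J₁`. -/
def basisJ1 : LabelJ1 → L
  | .R a s => tR E 1 a s
  | .L4 s => tL4 E 1 s
  | .cartan => hh φ (toC hA1)

/-- Labels of the generators built from the 54 root spaces outside `e₆`. -/
inductive LabelI
  | R (a : Fin 8) (s : ℤˣ)
  | L (a : Fin 8) (ha : a ≠ 3 ∧ a ≠ 7)
  | L4 (s : ℤˣ)
  | five (s : ℤˣ)
  | six

/-- The generators of degree `k` built from the 54 root spaces outside `e₆`. -/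
def basisI (k : ZMod 2) : LabelI → L
  | .R a s => tRp E k a s
  | .L a _ => tLp E k a
  | .L4 s => tLp4 E k s
  | .five s => t5 E k s
  | .six => t6 E k 1

/-- The generators of `g₁`. -/
def basisG1 : LabelJ1 ⊕ Label7 ⊕ LabelI ⊕ Unit → L :=
  Sum.elim (basisJ1 φ E) (Sum.elim (basis7 φ E) (Sum.elim (basisI E 1)
    (fun _ => hh φ (toC hE5))))

/-- The family `v` is a basis of the subspace `W`. -/
def IsBasisOf {ι : Type} (v : ι → L) (W : Submodule ℂ L) : Prop :=
  LinearIndependent ℂ v ∧ Submodule.span ℂ (Set.range v) = W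

/-- `W` is the (internal) direct sum of `A` and `B`. -/
def IsSum (W A B : Submodule ℂ L) : Prop := Disjoint A B ∧ A ⊔ B = W

end Lie

end

end E7

set_option autoImplicit false
set_option linter.unusedSectionVars false

namespace E7

noncomputable section

/-! ### Integral coordinates with respect to the simple roots -/

/-! Everything that concerns roots is moved to integers. In coordinates with respect to the simple
roots the scalar product is `dotZ`, `λ₇` is `lamZ`, and the roots are exactly the lattice vectors of
norm `2` (`mem_C7`). Hence one scalar product decides whether a sum of two roots is a root, and the
remaining statements about single roots are finite checks on 126 vectors. On the Lie algebra side,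
root spaces are lines, the Killing form on the Cartan subalgebra is the sum of the squares of the
roots, which is `36` times the dot product (`kf_hh_hh`), and a Chevalley basis together with the
Cartan subalgebra gives unique coordinates on the whole algebra.

Folding. A root of `e₆` is either fixed by `λ₇` or orthogonal to its image. So the vectors `E n`,
respectively `E n + E (λ₇ n)`, behave like root vectors with coroots `n`, respectively `n + λ₇ n`.
`IsFolding` isolates this situation for any closed set of roots with an isometric involution; it
covers `f₄` inside `e₆`, `so(7)` inside `so(8)`, and, with the identity, `e₆` itself. The main tool
is a Cartan element `ρ` that separates the orbits: a nonzero subspace stable under `ad ρ` contains a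
Cartan element or a vector supported on one orbit (`exists_mem_cases`). Applied to an abelian ideal
this gives semisimplicity (`IsFolding.isKilling`); applied to a submodule of the anti-invariant part
it gives irreducibility (`mem_of_stable`), since all moved roots are linked to one top root.
Generators `e, f, h` attached to representatives of the orbits of simple roots then produce the base
and its Cartan matrix (`hasSimpleRoots`).

GS bases. Applying `1 + (-1)^k Λ` to spanning sets of root vectors shows that the listed vectors
span. There are `21 + 31 + 27 + 54 = 133` of them, the dimension of the algebra, so all the
independence statements follow at once from `linearIndependent_basisAll`. Scalar products of
generators reduce to the single formula `kf_tk`.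

Existence. Products `exp(ad X) exp(-ad Y) exp(ad X)` lift reflections. Seven orthogonal roots give a
lift `ω` of `-1`; root vectors normalised by `ω (E n) = -E (-n)` have structure constants `±1`
(`isChevalley_of_neg`). Moreover `λ₇` is the product of the reflections in three orthogonal roots
`orthB`. The product of suitably normalised lifts permutes a Chevalley basis up to signs, squares to
the identity, and has sign `+1` on every root with `λ₇ n = ±n`; so the signs can be absorbed into
the basis, orbit by orbit (`exists_chevalley_lift`).

Structure of `g₀`. Since `λ₇` is `-1` on the span of the roots `orthB`, Cayley transforms in these
roots carry the Cartan subalgebra into `g₀`. In the new position the involution acts on root spaces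
by a character of the root lattice with values `±1`. Its values on the roots fixed by `λ₇` and on
`orthB` determine it up to one reflection as `n ↦ (-1)^(n 6)` (`exists_conj`), whose fixed algebra
is `e₆` plus the line of `e₅ + e₆ + e₇`. -/

/-- The vector with integral coordinates `n` with respect to the simple roots. -/
def emb (n : Fin 7 → ℤ) : Fin 7 → ℝ := ∑ i, (n i : ℝ) • simple i

/-- The scalar product in coordinates with respect to the simple roots. -/
def dotZ (m n : Fin 7 → ℤ) : ℤ :=
  2 * (m 0 * n 0 + m 1 * n 1 + m 2 * n 2 + m 3 * n 3 + m 4 * n 4 + m 5 * n 5 + m 6 * n 6)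
    - (m 0 * n 1 + m 1 * n 0) - (m 1 * n 2 + m 2 * n 1) - (m 2 * n 3 + m 3 * n 2)
    - (m 3 * n 4 + m 4 * n 3) - (m 2 * n 5 + m 5 * n 2) - (m 4 * n 6 + m 6 * n 4)

/-- The map `λ₇` in coordinates with respect to the simple roots. -/
def lamZ (n : Fin 7 → ℤ) : Fin 7 → ℤ :=
  ![n 4 - 2 * n 6, n 3 - 3 * n 6, n 2 - 4 * n 6, n 1 - 3 * n 6, n 0 - 2 * n 6, n 5 - 2 * n 6, -n 6]

/-- The coordinates of the positive roots. -/
def posRoots : List (Fin 7 → ℤ) :=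
  [![0, 0, 0, 0, 0, 0, 1], ![0, 0, 0, 0, 0, 1, 0], ![0, 0, 0, 0, 1, 0, 0], ![0, 0, 0, 1, 0, 0, 0],
    ![0, 0, 1, 0, 0, 0, 0], ![0, 1, 0, 0, 0, 0, 0], ![1, 0, 0, 0, 0, 0, 0], ![0, 0, 0, 0, 1, 0, 1],
    ![0, 0, 0, 1, 1, 0, 0], ![0, 0, 1, 0, 0, 1, 0], ![0, 0, 1, 1, 0, 0, 0], ![0, 1, 1, 0, 0, 0, 0],
    ![1, 1, 0, 0, 0, 0, 0], ![0, 0, 0, 1, 1, 0, 1], ![0, 0, 1, 1, 0, 1, 0], ![0, 0, 1, 1, 1, 0, 0],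
    ![0, 1, 1, 0, 0, 1, 0], ![0, 1, 1, 1, 0, 0, 0], ![1, 1, 1, 0, 0, 0, 0], ![0, 0, 1, 1, 1, 0, 1],
    ![0, 0, 1, 1, 1, 1, 0], ![0, 1, 1, 1, 0, 1, 0], ![0, 1, 1, 1, 1, 0, 0], ![1, 1, 1, 0, 0, 1, 0],
    ![1, 1, 1, 1, 0, 0, 0], ![0, 0, 1, 1, 1, 1, 1], ![0, 1, 1, 1, 1, 0, 1], ![0, 1, 1, 1, 1, 1, 0],
    ![0, 1, 2, 1, 0, 1, 0], ![1, 1, 1, 1, 0, 1, 0], ![1, 1, 1, 1, 1, 0, 0], ![0, 1, 1, 1, 1, 1, 1],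
    ![0, 1, 2, 1, 1, 1, 0], ![1, 1, 1, 1, 1, 0, 1], ![1, 1, 1, 1, 1, 1, 0], ![1, 1, 2, 1, 0, 1, 0],
    ![0, 1, 2, 1, 1, 1, 1], ![0, 1, 2, 2, 1, 1, 0], ![1, 1, 1, 1, 1, 1, 1], ![1, 1, 2, 1, 1, 1, 0],
    ![1, 2, 2, 1, 0, 1, 0], ![0, 1, 2, 2, 1, 1, 1], ![1, 1, 2, 1, 1, 1, 1], ![1, 1, 2, 2, 1, 1, 0],
    ![1, 2, 2, 1, 1, 1, 0], ![0, 1, 2, 2, 2, 1, 1], ![1, 1, 2, 2, 1, 1, 1], ![1, 2, 2, 1, 1, 1, 1],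
    ![1, 2, 2, 2, 1, 1, 0], ![1, 1, 2, 2, 2, 1, 1], ![1, 2, 2, 2, 1, 1, 1], ![1, 2, 3, 2, 1, 1, 0],
    ![1, 2, 2, 2, 2, 1, 1], ![1, 2, 3, 2, 1, 1, 1], ![1, 2, 3, 2, 1, 2, 0], ![1, 2, 3, 2, 1, 2, 1],
    ![1, 2, 3, 2, 2, 1, 1], ![1, 2, 3, 2, 2, 2, 1], ![1, 2, 3, 3, 2, 1, 1], ![1, 2, 3, 3, 2, 2, 1],
    ![1, 2, 4, 3, 2, 2, 1], ![1, 3, 4, 3, 2, 2, 1], ![2, 3, 4, 3, 2, 2, 1]]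

/-- The coordinates of the roots of `e₇`. -/
def C7 : List (Fin 7 → ℤ) := posRoots ++ posRoots.map (fun n => -n)

/-- The coordinates of the roots of `e₆`. -/
def C6 : List (Fin 7 → ℤ) := C7.filter (fun n => n 6 = 0)

/-- The coordinates of the roots of `so(8)`. -/
def C8 : List (Fin 7 → ℤ) := C7.filter (fun n => n 0 = 0 ∧ n 4 = 0 ∧ n 6 = 0)

/-- The vector with entries `m i / 2` for `i < 4` and `m i / √2` for `i ≥ 4`. -/
def embM (m : Fin 7 → ℤ) : Fin 7 → ℝ :=
  ![m 0 / 2, m 1 / 2, m 2 / 2, m 3 / 2, m 4 * c, m 5 * c, m 6 * c]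

/-- From coordinates with respect to the simple roots to rescaled standard coordinates. -/
def toM (n : Fin 7 → ℤ) : Fin 7 → ℤ :=
  ![-n 0 + 2 * n 3 - 2 * n 4, -n 0 + 2 * n 2 - 2 * n 3, -n 0 + 2 * n 1 - 2 * n 2 + 2 * n 5,
    n 0 - 2 * n 1 + 2 * n 5, n 0, -n 0 + n 4, -n 4 + 2 * n 6]

/-- From rescaled standard coordinates to coordinates with respect to the simple roots. -/
def toN (m : Fin 7 → ℤ) : Fin 7 → ℤ :=
  ![m 4, (m 0 + m 1 + m 2 - m 3 + 6 * m 4 + 2 * m 5) / 4, (m 0 + m 1 + 4 * m 4 + 2 * m 5) / 2,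
    (m 0 + 3 * m 4 + 2 * m 5) / 2, m 4 + m 5, (m 0 + m 1 + m 2 + m 3 + 4 * m 4 + 2 * m 5) / 4,
    (m 4 + m 5 + m 6) / 2]

lemma c_sq : c * c = 1 / 2 := by
  unfold c
  rw [← mul_inv, Real.mul_self_sqrt (by norm_num)]; norm_num

lemma c_pos : 0 < c := by unfold c; positivity

lemma sqrt_two_eq : √2 = 2 * c := by
  have h : √2 * √2 = 2 := Real.mul_self_sqrt (by norm_num)
  have h0 : √2 ≠ 0 := by positivity
  unfold c
  field_simp
  linarith

lemma emb_eq_embM (n : Fin 7 → ℤ) : emb n = embM (toM n) := by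
  ext i
  fin_cases i <;>
    simp [emb, embM, toM, simple, Fin.sum_univ_seven, sqrt_two_eq] <;> ring

lemma emb_zero : emb 0 = 0 := by simp [emb]

lemma emb_add (m n : Fin 7 → ℤ) : emb (m + n) = emb m + emb n := by
  simp [emb, add_smul, Finset.sum_add_distrib]

lemma emb_neg (n : Fin 7 → ℤ) : emb (-n) = -emb n := by
  simp [emb, neg_smul, Finset.sum_neg_distrib]

lemma emb_sub (m n : Fin 7 → ℤ) : emb (m - n) = emb m - emb n := by
  rw [sub_eq_add_neg, emb_add, emb_neg, ← sub_eq_add_neg]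

lemma emb_single (i : Fin 7) : emb (Pi.single i 1) = simple i := by
  simp [emb, Pi.single_apply]

lemma simple_dot (i j : Fin 7) :
    simple i ⬝ᵥ simple j = (CartanMatrix.E₇ (sigma7 i) (sigma7 j) : ℝ) := by
  have h := c_sq
  fin_cases i <;> fin_cases j <;>
    simp [simple, dotProduct, Fin.sum_univ_seven, CartanMatrix.E₇, sigma7, sqrt_two_eq] <;>
    nlinarith [h]

lemma emb_dot (m n : Fin 7 → ℤ) : emb m ⬝ᵥ emb n = (dotZ m n : ℝ) := by
  have h := c_sq
  rw [emb_eq_embM, emb_eq_embM]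
  simp [embM, toM, dotProduct, Fin.sum_univ_seven, dotZ]
  ring_nf
  rw [show c ^ 2 = 1 / 2 by rw [sq, h]]
  ring

/-- After the denominators `2` and the factors `c` are cancelled, this is an equality of integer
vectors `toM m = toM n`, a unimodular-looking triangular system that `omega` solves. -/
lemma emb_injective : Function.Injective emb := by
  intro m n h
  rw [emb_eq_embM, emb_eq_embM] at h
  have hc := c_pos.ne'
  have h' (i : Fin 7) := congrFun h i
  have h0 := h' 0; have h1 := h' 1; have h2 := h' 2; have h3 := h' 3
  have h4 := h' 4; have h5 := h' 5; have h6 := h' 6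
  simp [embM, hc, div_left_inj'] at h0 h1 h2 h3 h4 h5 h6
  norm_cast at *
  simp [toM] at h0 h1 h2 h3 h4 h5 h6
  ext i
  fin_cases i <;> simp <;> omega

lemma lam_apply (v : Fin 7 → ℝ) : lam ℝ v =
    ![(v 0 + v 1 + v 2 - v 3) / 2, (v 0 + v 1 - v 2 + v 3) / 2, (v 0 - v 1 + v 2 + v 3) / 2,
      (-v 0 + v 1 + v 2 + v 3) / 2, -v 6, -v 5, -v 4] := by
  ext i
  fin_cases i <;>
    simp [lam, lamMatrix, Matrix.toLin'_apply, Matrix.mulVec, dotProduct, Fin.sum_univ_seven] <;>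
    ring

lemma lam_emb (n : Fin 7 → ℤ) : lam ℝ (emb n) = emb (lamZ n) := by
  rw [emb_eq_embM, emb_eq_embM, lam_apply]
  ext i
  fin_cases i <;> simp [embM, toM, lamZ] <;> ring

lemma lam_lam (v : Fin 7 → ℝ) : lam ℝ (lam ℝ v) = v := by
  rw [lam_apply, lam_apply]
  ext i
  fin_cases i <;> simp <;> ring

/-! ### Coordinates of the labelled roots -/

/-- Twice the weights `wL`. -/
def zL : Fin 8 → Fin 7 → ℤ :=
  ![![1, 1, 1, 1, 0, 0, 0], ![1, 1, -1, -1, 0, 0, 0], ![1, -1, 1, -1, 0, 0, 0],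
    ![1, -1, -1, 1, 0, 0, 0], ![-1, -1, -1, -1, 0, 0, 0], ![-1, -1, 1, 1, 0, 0, 0],
    ![-1, 1, -1, 1, 0, 0, 0], ![-1, 1, 1, -1, 0, 0, 0]]

/-- Twice the weights `wR`. -/
def zR : Fin 8 → Fin 7 → ℤ :=
  ![![1, 1, 1, -1, 0, 0, 0], ![1, 1, -1, 1, 0, 0, 0], ![1, -1, 1, 1, 0, 0, 0],
    ![-1, 1, 1, 1, 0, 0, 0], ![-1, -1, -1, 1, 0, 0, 0], ![-1, -1, 1, -1, 0, 0, 0],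
    ![-1, 1, -1, -1, 0, 0, 0], ![1, -1, -1, -1, 0, 0, 0]]

/-- Twice the weights `wV`. -/
def zV : Fin 8 → Fin 7 → ℤ :=
  ![![2, 0, 0, 0, 0, 0, 0], ![0, 2, 0, 0, 0, 0, 0], ![0, 0, 2, 0, 0, 0, 0], ![0, 0, 0, 2, 0, 0, 0],
    ![-2, 0, 0, 0, 0, 0, 0], ![0, -2, 0, 0, 0, 0, 0], ![0, 0, -2, 0, 0, 0, 0],
    ![0, 0, 0, -2, 0, 0, 0]]

/-- The coordinates of `aL a s`. -/
def cL (a : Fin 8) (s : ℤˣ) : Fin 7 → ℤ := toN (zL a + ![0, 0, 0, 0, (s : ℤ), 0, -s])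
/-- The coordinates of `aR a s`. -/
def cR (a : Fin 8) (s : ℤˣ) : Fin 7 → ℤ := toN (zR a + ![0, 0, 0, 0, (s : ℤ), -s, 0])
/-- The coordinates of `aV a s`. -/
def cV (a : Fin 8) (s : ℤˣ) : Fin 7 → ℤ := toN (zV a + ![0, 0, 0, 0, 0, (s : ℤ), -s])
/-- The coordinates of `aLp a s`. -/
def cLp (a : Fin 8) (s : ℤˣ) : Fin 7 → ℤ := toN (zL a + ![0, 0, 0, 0, (s : ℤ), 0, s])
/-- The coordinates of `aRp a s`. -/
def cRp (a : Fin 8) (s : ℤˣ) : Fin 7 → ℤ := toN (zR a + ![0, 0, 0, 0, (s : ℤ), s, 0])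
/-- The coordinates of `aVp a s`. -/
def cVp (a : Fin 8) (s : ℤˣ) : Fin 7 → ℤ := toN (zV a + ![0, 0, 0, 0, 0, (s : ℤ), s])
/-- Twice the vectors `e 0`, …, `e 6` in rescaled standard coordinates. -/
def zE (i : Fin 7) : Fin 7 → ℤ := fun k => if k = i then 2 else 0

/-- The coordinates of `aE j s`. -/
def cE (j : Fin 3) (s : ℤˣ) : Fin 7 → ℤ := toN ((s : ℤ) • zE (![4, 5, 6] j))

/-- The coordinates of `s • e i + t • e j`. -/
def cD (i j : Fin 4) (s t : ℤˣ) : Fin 7 → ℤ :=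
  toN ((s : ℤ) • zE (i.castLE (by decide)) + (t : ℤ) • zE (j.castLE (by decide)))

/-- The coordinates of `fix8 j`. -/
def cFix (j : Fin 6) : Fin 7 → ℤ :=
  toN (![zE 1 - zE 2, zE 0 - zE 3, zE 2 + zE 3, zE 1 + zE 3, zE 0 + zE 2, zE 0 + zE 1] j)

/-- The coordinates of `mov8 j`. -/
def cMov (j : Fin 3) : Fin 7 → ℤ := toN (![zE 0 - zE 1, zE 0 - zE 2, zE 0 + zE 3] j)

/-- The divisions in `toN` are integer divisions and are exact only on the root lattice. The
hypothesis expresses this exactness and is decided for each family of labels. -/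
lemma emb_toN {m : Fin 7 → ℤ} (h : toM (toN m) = m) : emb (toN m) = embM m := by
  rw [emb_eq_embM, h]

lemma emb_units_smul (s : ℤˣ) (n : Fin 7 → ℤ) : emb ((s : ℤ) • n) = s • emb n := by
  rcases Int.units_eq_one_or s with rfl | rfl <;> simp [emb_neg]

lemma aL_eq (a : Fin 8) (s : ℤˣ) : aL a s = emb (cL a s) := by
  rw [cL, emb_toN (by revert a s; decide)]
  ext i
  fin_cases a <;> fin_cases i <;> simp [aL, wL, zL, embM, e, Units.smul_def, mul_comm]

lemma aR_eq (a : Fin 8) (s : ℤˣ) : aR a s = emb (cR a s) := by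
  rw [cR, emb_toN (by revert a s; decide)]
  ext i
  fin_cases a <;> fin_cases i <;> simp [aR, wR, zR, embM, e, Units.smul_def, mul_comm]

lemma aV_eq (a : Fin 8) (s : ℤˣ) : aV a s = emb (cV a s) := by
  rw [cV, emb_toN (by revert a s; decide)]
  ext i
  fin_cases a <;> fin_cases i <;> simp [aV, wV, zV, embM, e, Units.smul_def, mul_comm]

lemma aLp_eq (a : Fin 8) (s : ℤˣ) : aLp a s = emb (cLp a s) := by
  rw [cLp, emb_toN (by revert a s; decide)]
  ext i
  fin_cases a <;> fin_cases i <;> simp [aLp, wL, zL, embM, e, Units.smul_def, mul_comm]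

lemma aRp_eq (a : Fin 8) (s : ℤˣ) : aRp a s = emb (cRp a s) := by
  rw [cRp, emb_toN (by revert a s; decide)]
  ext i
  fin_cases a <;> fin_cases i <;> simp [aRp, wR, zR, embM, e, Units.smul_def, mul_comm]

lemma aVp_eq (a : Fin 8) (s : ℤˣ) : aVp a s = emb (cVp a s) := by
  rw [cVp, emb_toN (by revert a s; decide)]
  ext i
  fin_cases a <;> fin_cases i <;> simp [aVp, wV, zV, embM, e, Units.smul_def, mul_comm]

lemma aE_eq (j : Fin 3) (s : ℤˣ) : aE j s = emb (cE j s) := by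
  rw [cE, emb_toN (by revert j s; decide)]
  ext i
  fin_cases j <;> fin_cases i <;>
    simp [aE, zE, embM, e, Units.smul_def, sqrt_two_eq] <;> ring

lemma cD_eq {i j : Fin 4} (hij : i ≠ j) (s t : ℤˣ) :
    s • e (i.castLE (by decide)) + t • e (j.castLE (by decide)) = emb (cD i j s t) := by
  rw [cD, emb_toN (by revert i j s t; decide)]
  ext k
  fin_cases k <;> fin_cases i <;> fin_cases j <;> simp [zE, embM, e, Units.smul_def] <;> ring

lemma fix8_eq (j : Fin 6) : fix8 j = emb (cFix j) := by
  rw [cFix, emb_toN (by revert j; decide)]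
  ext i
  fin_cases j <;> fin_cases i <;> simp [fix8, zE, embM, e]

lemma mov8_eq (j : Fin 3) : mov8 j = emb (cMov j) := by
  rw [cMov, emb_toN (by revert j; decide)]
  ext i
  fin_cases j <;> fin_cases i <;> simp [mov8, zE, embM, e]

lemma mov8'_eq (j : Fin 3) : mov8' j = emb (lamZ (cMov j)) := by
  rw [← lam_emb, ← mov8_eq, lam_apply]
  fin_cases j <;> ext i <;> fin_cases i <;> simp [mov8, mov8', e]

end

end E7

namespace E7

noncomputable section

/-! ### Finite verifications -/

lemma C7_facts : ∀ n ∈ C7, dotZ n n = 2 ∧ -n ∈ C7 ∧ lamZ n ∈ C7 := by decide +kernel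

lemma mem_C6 {n : Fin 7 → ℤ} : n ∈ C6 ↔ n ∈ C7 ∧ n 6 = 0 := by simp [C6]

lemma mem_C8 {n : Fin 7 → ℤ} : n ∈ C8 ↔ n ∈ C7 ∧ n 0 = 0 ∧ n 4 = 0 ∧ n 6 = 0 := by simp [C8]

lemma C8_labels : ∀ n ∈ C8, ∃ i j s t, i ≠ j ∧ n = cD i j s t := by decide +kernel

lemma C6_labels : ∀ n ∈ C6, n ∈ C8 ∨ ∃ a s, n = cL a s ∨ n = cR a s ∨ n = cV a s := by
  decide +kernel

lemma C7_labels : ∀ n ∈ C7, (n ∈ C6 ∨ ∃ j s, n = cE j s) ∨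
    ∃ a s, n = cLp a s ∨ n = cRp a s ∨ n = cVp a s := by
  decide +kernel

lemma cD_mem : ∀ i j s t, i ≠ j → cD i j s t ∈ C8 := by decide +kernel

lemma cLRV_mem : ∀ a s, cL a s ∈ C6 ∧ cR a s ∈ C6 ∧ cV a s ∈ C6 := by decide +kernel

lemma cLRVp_mem : ∀ a s, cLp a s ∈ C7 ∧ cRp a s ∈ C7 ∧ cVp a s ∈ C7 := by decide +kernel

lemma cE_mem : ∀ j s, cE j s ∈ C7 := by decide +kernel

lemma R8_eq : R8 = emb '' {n | n ∈ C8} := by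
  ext v
  constructor
  · rintro ⟨i, j, s, t, hij, rfl⟩
    exact ⟨_, cD_mem i j s t hij, (cD_eq hij s t).symm⟩
  · rintro ⟨n, hn, rfl⟩
    obtain ⟨i, j, s, t, hij, rfl⟩ := C8_labels n hn
    exact ⟨i, j, s, t, hij, (cD_eq hij s t).symm⟩

lemma R6_eq : R6 = emb '' {n | n ∈ C6} := by
  ext v
  constructor
  · rintro (hv | ⟨a, s, rfl | rfl | rfl⟩)
    · rw [R8_eq] at hv
      obtain ⟨n, hn, rfl⟩ := hv
      exact ⟨n, mem_C6.2 ⟨(mem_C8.1 hn).1, (mem_C8.1 hn).2.2.2⟩, rfl⟩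
    · exact ⟨_, (cLRV_mem a s).1, (aL_eq a s).symm⟩
    · exact ⟨_, (cLRV_mem a s).2.1, (aR_eq a s).symm⟩
    · exact ⟨_, (cLRV_mem a s).2.2, (aV_eq a s).symm⟩
  · rintro ⟨n, hn, rfl⟩
    rcases C6_labels n hn with h | ⟨a, s, rfl | rfl | rfl⟩
    · exact Or.inl (R8_eq ▸ ⟨n, h, rfl⟩)
    · exact Or.inr ⟨a, s, Or.inl (aL_eq a s).symm⟩
    · exact Or.inr ⟨a, s, Or.inr (Or.inl (aR_eq a s).symm)⟩
    · exact Or.inr ⟨a, s, Or.inr (Or.inr (aV_eq a s).symm)⟩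

lemma R7_eq : R7 = emb '' {n | n ∈ C7} := by
  ext v
  constructor
  · rintro ((hv | ⟨j, s, rfl⟩) | ⟨a, s, rfl | rfl | rfl⟩)
    · rw [R6_eq] at hv
      obtain ⟨n, hn, rfl⟩ := hv
      exact ⟨n, (mem_C6.1 hn).1, rfl⟩
    · exact ⟨_, cE_mem j s, (aE_eq j s).symm⟩
    · exact ⟨_, (cLRVp_mem a s).1, (aLp_eq a s).symm⟩
    · exact ⟨_, (cLRVp_mem a s).2.1, (aRp_eq a s).symm⟩
    · exact ⟨_, (cLRVp_mem a s).2.2, (aVp_eq a s).symm⟩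
  · rintro ⟨n, hn, rfl⟩
    rcases C7_labels n hn with (h | ⟨j, s, rfl⟩) | ⟨a, s, rfl | rfl | rfl⟩
    · exact Or.inl (Or.inl (R6_eq ▸ ⟨n, h, rfl⟩))
    · exact Or.inl (Or.inr ⟨j, s, (aE_eq j s).symm⟩)
    · exact Or.inr ⟨a, s, Or.inl (aLp_eq a s).symm⟩
    · exact Or.inr ⟨a, s, Or.inr (Or.inl (aRp_eq a s).symm)⟩
    · exact Or.inr ⟨a, s, Or.inr (Or.inr (aVp_eq a s).symm)⟩

lemma emb_mem_R7 {n : Fin 7 → ℤ} : emb n ∈ R7 ↔ n ∈ C7 := by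
  rw [R7_eq]; exact emb_injective.mem_set_image

lemma emb_mem_R6 {n : Fin 7 → ℤ} : emb n ∈ R6 ↔ n ∈ C6 := by
  rw [R6_eq]; exact emb_injective.mem_set_image

lemma emb_mem_R8 {n : Fin 7 → ℤ} : emb n ∈ R8 ↔ n ∈ C8 := by
  rw [R8_eq]; exact emb_injective.mem_set_image

lemma dotZ_self (n : Fin 7 → ℤ) : 4 * dotZ n n = toM n 0 ^ 2 + toM n 1 ^ 2 + toM n 2 ^ 2 +
    toM n 3 ^ 2 + 2 * (toM n 4 ^ 2 + toM n 5 ^ 2 + toM n 6 ^ 2) := by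
  simp [toM, dotZ]; ring

lemma toN_toM (n : Fin 7 → ℤ) : toN (toM n) = n := by
  ext i
  fin_cases i <;> simp [toN, toM] <;> omega

/-- An exhaustive search for lattice vectors of norm `2`. In rescaled coordinates the norm is
multiplied by `4`, hence the `8` and the range `-2..2`. The partial bounds between the quantifiers
cut branches early, and the last condition selects the vectors that lie in the root lattice. -/
lemma mem_C7_of_toM : ∀ m₄ ∈ Finset.Icc (-2 : ℤ) 2, ∀ m₅ ∈ Finset.Icc (-2 : ℤ) 2,
    ∀ m₆ ∈ Finset.Icc (-2 : ℤ) 2, 2 * (m₄ ^ 2 + m₅ ^ 2 + m₆ ^ 2) ≤ 8 →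
    ∀ m₀ ∈ Finset.Icc (-2 : ℤ) 2, ∀ m₁ ∈ Finset.Icc (-2 : ℤ) 2,
    m₀ ^ 2 + m₁ ^ 2 + 2 * (m₄ ^ 2 + m₅ ^ 2 + m₆ ^ 2) ≤ 8 →
    ∀ m₂ ∈ Finset.Icc (-2 : ℤ) 2,
    m₀ ^ 2 + m₁ ^ 2 + m₂ ^ 2 + 2 * (m₄ ^ 2 + m₅ ^ 2 + m₆ ^ 2) ≤ 8 →
    ∀ m₃ ∈ Finset.Icc (-2 : ℤ) 2,
    m₀ ^ 2 + m₁ ^ 2 + m₂ ^ 2 + m₃ ^ 2 + 2 * (m₄ ^ 2 + m₅ ^ 2 + m₆ ^ 2) = 8 →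
    toM (toN ![m₀, m₁, m₂, m₃, m₄, m₅, m₆]) = ![m₀, m₁, m₂, m₃, m₄, m₅, m₆] →
    toN ![m₀, m₁, m₂, m₃, m₄, m₅, m₆] ∈ C7 := by
  decide +kernel

lemma mem_C7_of_dotZ {n : Fin 7 → ℤ} (h : dotZ n n = 2) : n ∈ C7 := by
  have h1 := dotZ_self n
  rw [h] at h1
  have hm : ![toM n 0, toM n 1, toM n 2, toM n 3, toM n 4, toM n 5, toM n 6] = toM n := by
    ext i; fin_cases i <;> rfl
  have key := mem_C7_of_toM (toM n 4) ?_ (toM n 5) ?_ (toM n 6) ?_ ?_ (toM n 0) ?_ (toM n 1) ?_ ?_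
    (toM n 2) ?_ ?_ (toM n 3) ?_ ?_ ?_
  · rwa [hm, toN_toM] at key
  all_goals try rw [hm, toN_toM]
  all_goals try rw [Finset.mem_Icc]
  all_goals generalize toM n 0 = a at *; generalize toM n 1 = b at *
  all_goals generalize toM n 2 = a' at *; generalize toM n 3 = b' at *
  all_goals generalize toM n 4 = x at *; generalize toM n 5 = y at *; generalize toM n 6 = z at *
  all_goals try constructor
  all_goals nlinarith [sq_nonneg a, sq_nonneg b, sq_nonneg a', sq_nonneg b', sq_nonneg x,
    sq_nonneg y, sq_nonneg z]

/-- From here on membership in the explicit list is tested by a norm, so that sums and reflections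
of roots are handled by bilinearity alone. -/
lemma mem_C7 {n : Fin 7 → ℤ} : n ∈ C7 ↔ dotZ n n = 2 :=
  ⟨fun h => (C7_facts n h).1, mem_C7_of_dotZ⟩

/-! ### The lattice of integral coordinates -/

lemma dotZ_comm (m n : Fin 7 → ℤ) : dotZ m n = dotZ n m := by simp [dotZ]; ring
lemma dotZ_add_left (m n k : Fin 7 → ℤ) : dotZ (m + n) k = dotZ m k + dotZ n k := by
  simp [dotZ]; ring
lemma dotZ_add_right (m n k : Fin 7 → ℤ) : dotZ k (m + n) = dotZ k m + dotZ k n := by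
  simp [dotZ]; ring
lemma dotZ_neg_left (m n : Fin 7 → ℤ) : dotZ (-m) n = -dotZ m n := by simp [dotZ]; ring
lemma dotZ_neg_right (m n : Fin 7 → ℤ) : dotZ m (-n) = -dotZ m n := by simp [dotZ]; ring
lemma dotZ_sub_left (m n k : Fin 7 → ℤ) : dotZ (m - n) k = dotZ m k - dotZ n k := by
  simp [dotZ]; ring
lemma dotZ_sub_right (m n k : Fin 7 → ℤ) : dotZ k (m - n) = dotZ k m - dotZ k n := by
  simp [dotZ]; ring

lemma lamZ_add (m n : Fin 7 → ℤ) : lamZ (m + n) = lamZ m + lamZ n := by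
  ext i; fin_cases i <;> simp [lamZ] <;> ring
lemma lamZ_neg (n : Fin 7 → ℤ) : lamZ (-n) = -lamZ n := by
  ext i; fin_cases i <;> simp [lamZ] <;> ring
lemma lamZ_sub (m n : Fin 7 → ℤ) : lamZ (m - n) = lamZ m - lamZ n := by
  rw [sub_eq_add_neg, lamZ_add, lamZ_neg, ← sub_eq_add_neg]
lemma lamZ_lamZ (n : Fin 7 → ℤ) : lamZ (lamZ n) = n := by
  ext i; fin_cases i <;> simp [lamZ]
lemma dotZ_lamZ (m n : Fin 7 → ℤ) : dotZ (lamZ m) (lamZ n) = dotZ m n := by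
  simp [dotZ, lamZ]; ring

lemma dotZ_self_nonneg (n : Fin 7 → ℤ) : 0 ≤ dotZ n n := by
  have := dotZ_self n; nlinarith [sq_nonneg (toM n 0), sq_nonneg (toM n 1), sq_nonneg (toM n 2),
    sq_nonneg (toM n 3), sq_nonneg (toM n 4), sq_nonneg (toM n 5), sq_nonneg (toM n 6)]

lemma eq_zero_of_dotZ_self {n : Fin 7 → ℤ} (h : dotZ n n = 0) : n = 0 := by
  apply emb_injective
  have h1 := emb_dot n n
  rw [h, Int.cast_zero, dotProduct_self_eq_zero] at h1
  rw [h1, emb_zero]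

lemma C7_ne_zero {n : Fin 7 → ℤ} (h : n ∈ C7) : n ≠ 0 := by
  rintro rfl
  rw [mem_C7] at h
  simp [dotZ] at h

lemma C7_neg {n : Fin 7 → ℤ} (h : n ∈ C7) : -n ∈ C7 := (C7_facts n h).2.1
lemma C7_lam {n : Fin 7 → ℤ} (h : n ∈ C7) : lamZ n ∈ C7 := (C7_facts n h).2.2

lemma C7_add {m n : Fin 7 → ℤ} (hm : m ∈ C7) (hn : n ∈ C7) (h : dotZ m n = -1) : m + n ∈ C7 := by
  rw [mem_C7] at *
  rw [dotZ_add_left, dotZ_add_right, dotZ_add_right, dotZ_comm n m]; omega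

lemma C7_add_not {m n : Fin 7 → ℤ} (hm : m ∈ C7) (hn : n ∈ C7) (h : 0 ≤ dotZ m n) :
    m + n ∉ C7 ∧ m + n ≠ 0 := by
  rw [mem_C7] at *
  have h1 : dotZ (m + n) (m + n) = 4 + 2 * dotZ m n := by
    rw [dotZ_add_left, dotZ_add_right, dotZ_add_right, dotZ_comm n m]; omega
  refine ⟨by omega, fun h0 => ?_⟩
  rw [h0, show dotZ 0 0 = 0 by simp [dotZ]] at h1
  omega

lemma C7_dot_le {m n : Fin 7 → ℤ} (hm : m ∈ C7) (hn : n ∈ C7) : dotZ m n ≤ 2 := by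
  rw [mem_C7] at *
  have := dotZ_self_nonneg (m - n)
  rw [dotZ_sub_left, dotZ_sub_right, dotZ_sub_right, dotZ_comm n m] at this; omega

lemma C7_le_dot {m n : Fin 7 → ℤ} (hm : m ∈ C7) (hn : n ∈ C7) : -2 ≤ dotZ m n := by
  have := C7_dot_le hm (C7_neg hn)
  rw [dotZ_neg_right] at this; omega

lemma C7_eq_of_dot {m n : Fin 7 → ℤ} (hm : m ∈ C7) (hn : n ∈ C7) (h : dotZ m n = 2) : m = n := by
  rw [mem_C7] at *
  apply sub_eq_zero.1
  apply eq_zero_of_dotZ_self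
  rw [dotZ_sub_left, dotZ_sub_right, dotZ_sub_right, dotZ_comm n m]; omega

lemma C7_eq_neg_of_dot {m n : Fin 7 → ℤ} (hm : m ∈ C7) (hn : n ∈ C7) (h : dotZ m n = -2) :
    n = -m := by
  rw [C7_eq_of_dot hm (C7_neg hn) (by rw [dotZ_neg_right]; omega), neg_neg]

/-- The possible values of the scalar product of two roots. -/
lemma C7_cases {m n : Fin 7 → ℤ} (hm : m ∈ C7) (hn : n ∈ C7) :
    0 ≤ dotZ m n ∨ dotZ m n = -1 ∨ n = -m := by
  have h := C7_le_dot hm hn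
  by_cases h2 : dotZ m n = -2
  · exact Or.inr (Or.inr (C7_eq_neg_of_dot hm hn h2))
  · omega

end

end E7

namespace E7

noncomputable section

/-! ### The Weyl group element `λ₇` and the fundamental alcove -/

lemma simple_mem_R7 (i : Fin 7) : simple i ∈ R7 := by
  rw [← emb_single, emb_mem_R7]
  revert i; decide +kernel

lemma simple_dot_varpi7 (i : Fin 7) : simple i ⬝ᵥ varpi7 = if i = 6 then 1 else 0 := by
  have h := c_sq
  fin_cases i <;> simp [simple, varpi7, dotProduct, Fin.sum_univ_seven, sqrt_two_eq]
  linarith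

lemma dot_lam (v w : Fin 7 → ℝ) : v ⬝ᵥ lam ℝ w = lam ℝ v ⬝ᵥ w := by
  simp [lam_apply, dotProduct, Fin.sum_univ_seven]; ring

lemma refl_apply (β v : Fin 7 → ℝ) : refl β v = v - (β ⬝ᵥ v) • β := by
  simp [refl]

lemma refl_refl_refl {x y z : Fin 7 → ℝ} (hxy : x ⬝ᵥ y = 0) (hxz : x ⬝ᵥ z = 0)
    (hyz : y ⬝ᵥ z = 0) (v : Fin 7 → ℝ) : (refl x * refl y * refl z) v =
      v - (x ⬝ᵥ v) • x - (y ⬝ᵥ v) • y - (z ⬝ᵥ v) • z := by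
  rw [Module.End.mul_apply, Module.End.mul_apply, refl_apply, refl_apply, refl_apply]
  simp only [dotProduct_sub, dotProduct_smul, hxy, hxz, hyz, smul_zero, sub_zero]
  abel

lemma aE_one : aE 1 1 = ![0, 0, 0, 0, 0, 2 * c, 0] := by
  ext i; fin_cases i <;> simp [aE, e, sqrt_two_eq]

lemma aLp_three : aLp 3 1 = ![1/2, -1/2, -1/2, 1/2, c, 0, c] := by
  ext i; fin_cases i <;> simp [aLp, wL, e]

lemma aLp_three_neg : aLp 3 (-1) = ![1/2, -1/2, -1/2, 1/2, -c, 0, -c] := by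
  ext i; fin_cases i <;> simp [aLp, wL, e]

/-- The eigenspace of `λ₇` for `-1` is three-dimensional and has these three roots as an orthogonal
basis; on its orthogonal complement `λ₇` is the identity. -/
lemma lam_eq_refl : lam ℝ = refl (aE 1 1) * refl (aLp 3 1) * refl (aLp 3 (-1)) := by
  have h := c_sq
  refine LinearMap.ext fun v => ?_
  rw [refl_refl_refl, lam_apply, aE_one, aLp_three, aLp_three_neg]
  · ext i
    fin_cases i <;> simp [dotProduct, Fin.sum_univ_seven, vecHead, vecTail]
    · ring
    · ring
    · ring
    · ring
    · linear_combination (2 * v 4 + 2 * v 6) * h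
    · linear_combination (4 * v 5) * h
    · linear_combination (2 * v 4 + 2 * v 6) * h
  all_goals simp only [aE_one, aLp_three, aLp_three_neg]
  all_goals simp [dotProduct, Fin.sum_univ_seven]
  linear_combination (-2) * h

lemma lam_mem_weyl : lam ℝ ∈ Submonoid.closure (refl '' R7) := by
  rw [lam_eq_refl]
  refine mul_mem (mul_mem ?_ ?_) ?_ <;> apply Submonoid.subset_closure <;>
    apply Set.mem_image_of_mem
  · exact Or.inl (Or.inr ⟨_, _, rfl⟩)
  · exact Or.inr ⟨_, _, Or.inl rfl⟩
  · exact Or.inr ⟨_, _, Or.inl rfl⟩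

lemma lam_simple (i : Fin 7) : lam ℝ (simple i) =
    ![simple 4, simple 3, simple 2, simple 1, simple 0, simple 5, alpha0] i := by
  rw [lam_apply]
  fin_cases i <;> ext j <;> fin_cases j <;> simp [simple, alpha0] <;> norm_num

lemma lam_alpha0 : lam ℝ alpha0 = simple 6 := by
  rw [lam_apply]
  ext j; fin_cases j <;> simp [simple, alpha0]

lemma lam_varpi7 : lam ℝ varpi7 = -varpi7 := by
  rw [lam_apply]
  ext j; fin_cases j <;> simp [varpi7]

lemma alpha0_dot_varpi7 : alpha0 ⬝ᵥ varpi7 = -1 := by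
  have h := c_sq
  simp [alpha0, varpi7, dotProduct, Fin.sum_univ_seven, sqrt_two_eq]; linarith

lemma forall_pos_permuted {V : Type*} (s : Fin 7 → V) (a : V) (f : V → ℝ) (hs : ∀ i, 0 < f (s i))
    (ha : 0 < f a + 1) (i : Fin 7) :
    0 < f (![s 4, s 3, s 2, s 1, s 0, s 5, a] i) + if i = 6 then 1 else 0 := by
  fin_cases i <;> simp [hs, ha]

/-- As `λ₇` is symmetric, it can be moved onto the simple roots, where it permutes the walls. The
translation by `ϖ₇` adds `1` to the value of `α₇` only, and this turns the inequality for `α₀` into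
the one for `α₇` and conversely. -/
lemma alcove_mapsTo {x : Fin 7 → ℝ} (hx : x ∈ alcove) : lam ℝ x + varpi7 ∈ alcove := by
  obtain ⟨h1, h2⟩ := hx
  constructor
  · intro i
    rw [dotProduct_add, dot_lam, lam_simple, simple_dot_varpi7]
    exact forall_pos_permuted simple alpha0 (· ⬝ᵥ x) h1 (by linarith) i
  · rw [dotProduct_add, dot_lam, lam_alpha0, alpha0_dot_varpi7]
    linarith [h1 6]

/-- The affine map is an involution because `λ₇ ϖ₇ = -ϖ₇`, so stability of the alcove already gives
equality. -/
lemma image_alcove : (fun x => lam ℝ x + varpi7) '' alcove = alcove := by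
  refine Set.Subset.antisymm ?_ fun x hx => ⟨lam ℝ x + varpi7, alcove_mapsTo hx, ?_⟩
  · rintro _ ⟨x, hx, rfl⟩
    exact alcove_mapsTo hx
  · simp only [map_add, lam_lam, lam_varpi7]; abel

end

end E7

namespace E7

noncomputable section

/-! ### The sum of squares of the roots -/

/-- A strictly monotone key on the list of positive roots. -/
def key (n : Fin 7 → ℤ) : ℤ :=
  (n 0 + n 1 + n 2 + n 3 + n 4 + n 5 + n 6) * 10 ^ 7 + n 0 * 10 ^ 6 + n 1 * 10 ^ 5 + n 2 * 10 ^ 4 +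
    n 3 * 10 ^ 3 + n 4 * 10 ^ 2 + n 5 * 10 + n 6

lemma key_neg (n : Fin 7 → ℤ) : key (-n) = -key n := by simp [key]; ring

/-- Strict growth of the key along the list excludes repetitions after comparing only neighbours. -/
lemma isChain_key : (posRoots.map key).IsChain (· < ·) := by decide +kernel

lemma key_pos : ∀ n ∈ posRoots, 0 < key n := by decide +kernel

lemma nodup_posRoots : posRoots.Nodup :=
  List.Nodup.of_map key (isChain_key.pairwise.imp fun h => h.ne)

lemma nodup_C7 : C7.Nodup := by
  refine List.nodup_append'.2 ⟨nodup_posRoots, nodup_posRoots.map neg_injective, ?_⟩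
  intro n h1 h2
  obtain ⟨m, hm, rfl⟩ := List.mem_map.1 h2
  have h3 := key_pos _ h1
  have h4 := key_pos _ hm
  rw [key_neg] at h3
  omega

lemma length_C7 : C7.length = 126 := by decide +kernel

/-- The sum of `α ⊗ α` over the roots is `36`, twice the Coxeter number, times the identity. Entries
scaled by `1/2` turn `36` into `144`, entries scaled by `1/√2` turn it into `72`. -/
lemma sum_toM_mul_toM : ∀ i j, (C7.map fun n => toM n i * toM n j).sum =
    if i = j then (if (i : ℕ) < 4 then 144 else 72) else 0 := by
  decide +kernel

lemma toC_emb_apply (n : Fin 7 → ℤ) (i : Fin 7) :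
    toC (emb n) i = (if (i : ℕ) < 4 then 1 / 2 else (c : ℂ)) * (toM n i : ℂ) := by
  rw [toC, emb_eq_embM]
  fin_cases i <;> simp [embM] <;> ring

lemma list_sum_mul_mul {ι : Type*} (l : List ι) (f g : ι → ℤ) (a b : ℂ) :
    (l.map fun n => (a * (f n : ℂ)) * (b * (g n : ℂ))).sum =
      a * b * ((l.map fun n => f n * g n).sum : ℤ) := by
  induction l with
  | nil => simp
  | cons x l ih => simp only [List.map_cons, List.sum_cons, ih]; push_cast; ring

lemma cc_sq : (c : ℂ) * c = 1 / 2 := by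
  have := c_sq
  rw [← Complex.ofReal_mul, this]; simp

lemma sum_dot_mul_dot (u v : Fin 7 → ℂ) :
    ∑ n ∈ C7.toFinset, (toC (emb n) ⬝ᵥ u) * (toC (emb n) ⬝ᵥ v) = 36 * (u ⬝ᵥ v) := by
  have h (i j : Fin 7) : ∑ n ∈ C7.toFinset, toC (emb n) i * toC (emb n) j =
      if i = j then 36 else 0 := by
    rw [List.sum_toFinset _ nodup_C7]
    simp_rw [toC_emb_apply]
    rw [list_sum_mul_mul, sum_toM_mul_toM]
    split_ifs with hij h2 <;> subst_vars <;> simp_all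
    · norm_num
    · rw [cc_sq]; norm_num
  simp_rw [dotProduct, Finset.sum_mul_sum]
  rw [Finset.sum_comm]
  simp_rw [Finset.sum_comm (s := C7.toFinset)]
  rw [Finset.mul_sum]
  refine Finset.sum_congr rfl fun i _ => ?_
  have (j : Fin 7) : ∑ n ∈ C7.toFinset, toC (emb n) i * u i * (toC (emb n) j * v j) =
      (if i = j then 36 else 0) * (u i * v j) := by
    rw [← h i j, Finset.sum_mul]
    exact Finset.sum_congr rfl fun n _ => by ring
  simp [this]

lemma toC_dot (v w : Fin 7 → ℝ) : toC v ⬝ᵥ toC w = ((v ⬝ᵥ w : ℝ) : ℂ) := by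
  simp [toC, dotProduct]

lemma toC_emb_dot (m n : Fin 7 → ℤ) : toC (emb m) ⬝ᵥ toC (emb n) = (dotZ m n : ℂ) := by
  rw [toC_dot, emb_dot]; simp

lemma toC_add (v w : Fin 7 → ℝ) : toC (v + w) = toC v + toC w := by ext; simp [toC]
lemma toC_neg (v : Fin 7 → ℝ) : toC (-v) = -toC v := by ext; simp [toC]
lemma toC_sub (v w : Fin 7 → ℝ) : toC (v - w) = toC v - toC w := by ext; simp [toC]
lemma toC_smul (a : ℝ) (v : Fin 7 → ℝ) : toC (a • v) = (a : ℂ) • toC v := by ext; simp [toC]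
@[simp] lemma toC_zero : toC 0 = 0 := by ext; simp [toC]
lemma toC_injective : Function.Injective toC := fun v w h => by
  ext i; simpa [toC] using congrFun h i

lemma lam_toC (v : Fin 7 → ℝ) : lam ℂ (toC v) = toC (lam ℝ v) := by
  ext i
  fin_cases i <;>
    simp [lam, lamMatrix, toC, Matrix.toLin'_apply, Matrix.mulVec, dotProduct, Fin.sum_univ_seven]

section Lie

variable {L : Type*} [LieRing L] [LieAlgebra ℂ L] {H : LieSubalgebra ℂ L}
  (φ : H ≃ₗ[ℂ] (Fin 7 → ℂ))

/-! ### Root vectors -/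

lemma hh_mem (u : Fin 7 → ℂ) : hh φ u ∈ H := (φ.symm u).2

lemma exists_hh {x : L} (hx : x ∈ H) : ∃ u, x = hh φ u := ⟨φ ⟨x, hx⟩, by simp [hh]⟩

@[simp] lemma hh_add (u v : Fin 7 → ℂ) : hh φ (u + v) = hh φ u + hh φ v := by simp [hh]
@[simp] lemma hh_smul (a : ℂ) (u : Fin 7 → ℂ) : hh φ (a • u) = a • hh φ u := by simp [hh]
@[simp] lemma hh_zero : hh φ 0 = 0 := by simp [hh]
@[simp] lemma hh_neg (u : Fin 7 → ℂ) : hh φ (-u) = -hh φ u := by simp [hh]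
@[simp] lemma hh_sub (u v : Fin 7 → ℂ) : hh φ (u - v) = hh φ u - hh φ v := by simp [hh]

lemma hh_injective : Function.Injective (hh φ) := fun u v h => by
  simpa [hh] using h

/-- The parametrization of the Cartan subalgebra as a linear map. -/
def hhₗ : (Fin 7 → ℂ) →ₗ[ℂ] L := H.toSubmodule.subtype ∘ₗ φ.symm.toLinearMap

lemma hhₗ_apply (u : Fin 7 → ℂ) : hhₗ φ u = hh φ u := rfl

lemma form_apply (α : Fin 7 → ℝ) (h : H) : form φ α h = toC α ⬝ᵥ φ h := rfl

lemma form_injective : Function.Injective (form φ) := fun α β h => by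
  apply toC_injective
  ext i
  have := LinearMap.congr_fun h (φ.symm (Pi.single i 1))
  simpa [form_apply] using this

variable {φ}

lemma IsRootVector.lie_mem {α : Fin 7 → ℝ} {x : L} (hx : IsRootVector φ α x) (h : H) :
    ⁅(h : L), x⁆ = form φ α h • x := by
  have := hx (φ h)
  rwa [hh, φ.symm_apply_apply] at this

lemma IsRootVector.lie {α β : Fin 7 → ℝ} {x y : L} (hx : IsRootVector φ α x)
    (hy : IsRootVector φ β y) : IsRootVector φ (α + β) ⁅x, y⁆ := fun u => by
  rw [leibniz_lie, hx u, hy u, toC_add, add_dotProduct, add_smul, smul_lie, lie_smul]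

lemma IsRootVector.smul {α : Fin 7 → ℝ} {x : L} (a : ℂ) (hx : IsRootVector φ α x) :
    IsRootVector φ α (a • x) := fun u => by rw [lie_smul, hx u, smul_comm]

variable [FiniteDimensional ℂ L] [LieAlgebra.IsKilling ℂ L] [H.IsCartanSubalgebra]

variable (φ) in
lemma lie_hh_hh (u v : Fin 7 → ℂ) : ⁅hh φ u, hh φ v⁆ = 0 := by
  have := LieModule.IsTrivial.trivial (φ.symm u) (φ.symm v)
  simpa [hh] using congrArg (Subtype.val) this

/-- The Cartan subalgebra of a Killing Lie algebra acts diagonalisably, so generalised weight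
vectors are genuine ones. -/
lemma isRootVector_iff {α : Fin 7 → ℝ} {x : L} :
    IsRootVector φ α x ↔ x ∈ LieAlgebra.rootSpace H (form φ α) := by
  constructor
  · intro hx
    apply LieModule.weightSpace_le_genWeightSpace
    rw [LieModule.mem_weightSpace]
    exact fun h => hx.lie_mem h
  · intro hx u
    exact (LieAlgebra.IsKilling.lie_eq_smul_of_mem_rootSpace hx (φ.symm u)).trans (by
      rw [form_apply, φ.apply_symm_apply])

variable (hR : Set.range (LieAlgebra.IsKilling.rootSystem H).root = form φ '' R7)
include hR

lemma exists_weight {n : Fin 7 → ℤ} (hn : n ∈ C7) :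
    ∃ χ : LieModule.Weight ℂ H L, χ.IsNonZero ∧ χ.toLinear = form φ (emb n) := by
  have : form φ (emb n) ∈ Set.range (LieAlgebra.IsKilling.rootSystem H).root := by
    rw [hR]; exact Set.mem_image_of_mem _ (emb_mem_R7.2 hn)
  obtain ⟨χ, hχ⟩ := this
  exact ⟨χ, H.isNonZero_coe_root χ, hχ⟩

lemma exists_code (χ : LieModule.Weight ℂ H L) (hχ : χ.IsNonZero) :
    ∃ n ∈ C7, χ.toLinear = form φ (emb n) := by
  have : χ.toLinear ∈ form φ '' R7 := by
    rw [← hR]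
    exact ⟨⟨χ, by simpa using hχ⟩, rfl⟩
  obtain ⟨α, hα, h⟩ := this
  rw [R7_eq] at hα
  obtain ⟨n, hn, rfl⟩ := hα
  exact ⟨n, hn, h.symm⟩

lemma IsRootVector.eq_zero {n : Fin 7 → ℤ} (h1 : n ∉ C7) (h2 : n ≠ 0) {x : L}
    (hx : IsRootVector φ (emb n) x) : x = 0 := by
  rw [isRootVector_iff] at hx
  by_contra hx0
  have hne : LieAlgebra.rootSpace H (form φ (emb n)) ≠ ⊥ := fun h => hx0 (by
    rw [h] at hx; simpa using hx)
  let χ : LieModule.Weight ℂ H L := ⟨_, hne⟩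
  have hχ : χ.IsNonZero := by
    intro h0
    apply h2
    apply emb_injective
    apply form_injective φ
    apply DFunLike.coe_injective
    rw [emb_zero, show ((form φ (emb n) : Dual ℂ H) : H → ℂ) = 0 from h0]
    ext h
    simp [form_apply]
  obtain ⟨m, hm, hmn⟩ := exists_code hR χ hχ
  have : emb n = emb m := form_injective φ (DFunLike.coe_injective (by
    rw [← hmn]; rfl))
  rw [emb_injective this] at h1
  exact h1 hm

lemma IsRootVector.exists_smul {n : Fin 7 → ℤ} (hn : n ∈ C7) {x y : L}
    (hx : IsRootVector φ (emb n) x) (hx0 : x ≠ 0) (hy : IsRootVector φ (emb n) y) :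
    ∃ a : ℂ, y = a • x := by
  obtain ⟨χ, hχ, h⟩ := exists_weight hR hn
  rw [isRootVector_iff, ← h] at hx hy
  have h1 := LieAlgebra.IsKilling.finrank_rootSpace_eq_one χ hχ
  obtain ⟨a, ha⟩ := (finrank_eq_one_iff_of_nonzero' (⟨x, hx⟩ : LieAlgebra.rootSpace H χ)
    (fun h => hx0 (congrArg Subtype.val h))).1 h1 ⟨y, hy⟩
  exact ⟨a, (congrArg Subtype.val ha).symm⟩

omit hR in
lemma killing_hh_eq_sum (u v : Fin 7 → ℂ) : killingForm ℂ L (hh φ u) (hh φ v) =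
    ∑ α ∈ H.root, (α.toLinear : Dual ℂ H) (φ.symm u) * (α.toLinear : Dual ℂ H) (φ.symm v) := by
  have := LieAlgebra.IsKilling.restrict_killingForm_eq_sum (K := ℂ) (H := H)
  have := LinearMap.congr_fun (LinearMap.congr_fun this (φ.symm u)) (φ.symm v)
  exact this.trans (by simp [LinearMap.sum_apply]; rfl)

/-- On the Cartan subalgebra the Killing form is the sum over the roots of the products of their
values. The hypothesis `hR` lets the sum run over `C7`, where `sum_dot_mul_dot` evaluates it. -/
theorem kf_hh_hh (u v : Fin 7 → ℂ) : kf (hh φ u) (hh φ v) = u ⬝ᵥ v := by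
  classical
  have himage : H.root.image (fun α => α.toLinear) =
      C7.toFinset.image (fun n => form φ (emb n)) := by
    ext f
    simp only [Finset.mem_image, List.mem_toFinset]
    constructor
    · rintro ⟨χ, hχ, rfl⟩
      obtain ⟨n, hn, h⟩ := exists_code hR χ (by simpa using hχ)
      exact ⟨n, hn, h.symm⟩
    · rintro ⟨n, hn, rfl⟩
      obtain ⟨χ, hχ, h⟩ := exists_weight hR hn
      exact ⟨χ, by simpa using hχ, h⟩
  have h1 := Finset.sum_image (s := H.root) (g := fun α => α.toLinear)
    (f := fun f : Dual ℂ H => f (φ.symm u) * f (φ.symm v)) (by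
      intro α _ β _ h
      ext x
      exact LinearMap.congr_fun h x)
  have h2 := Finset.sum_image (s := C7.toFinset) (g := fun n => form φ (emb n))
    (f := fun f : Dual ℂ H => f (φ.symm u) * f (φ.symm v)) (by
      intro m _ n _ h
      exact emb_injective (form_injective φ h))
  rw [kf, killing_hh_eq_sum, ← h1, himage, h2]
  simp only [form_apply, LinearEquiv.apply_symm_apply]
  rw [sum_dot_mul_dot]
  ring

/-- Killing duality makes the coroot proportional to the root, and the value `2` of the root on its
coroot fixes the factor, since roots have norm `2`. -/
lemma coroot_eq (χ : LieModule.Weight ℂ H L) (hχ : χ.IsNonZero) {n : Fin 7 → ℤ} (hn : n ∈ C7)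
    (h : χ.toLinear = form φ (emb n)) :
    (LieAlgebra.IsKilling.coroot χ : L) = hh φ (toC (emb n)) := by
  obtain ⟨u, hu⟩ := exists_hh φ (LieAlgebra.IsKilling.coroot χ).2
  have hφ : LieAlgebra.IsKilling.coroot χ = φ.symm u := Subtype.ext hu
  have hχn (x : H) : χ x = toC (emb n) ⬝ᵥ φ x := by
    rw [← form_apply, ← h]; rfl
  have h1 (v : Fin 7 → ℂ) := LieAlgebra.IsKilling.traceForm_coroot χ (φ.symm v)
  -- The dual vector `t` enters only through the scalar `χ t`, which need not be computed: the
  -- proportionality factor is determined at the end.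
  generalize (LieAlgebra.IsKilling.cartanEquivDual H).symm χ.toLinear = t at h1
  set k : ℂ := 2 * (χ t)⁻¹ with hk
  have h2 (v : Fin 7 → ℂ) : 36 * (u ⬝ᵥ v) = k * (toC (emb n) ⬝ᵥ v) := by
    have h3 := h1 v
    rw [hφ, hχn (φ.symm v), φ.apply_symm_apply] at h3
    rw [← kf_hh_hh hR, kf]
    change 36 * (LieModule.traceForm ℂ H L (φ.symm u) (φ.symm v) / 36) = _
    rw [h3, hk]
    simp
    ring
  have h3 : u = (k / 36) • toC (emb n) := by
    ext i
    have := h2 (Pi.single i 1)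
    simp at this
    simp; linear_combination this / 36
  have h4 := LieAlgebra.IsKilling.root_apply_coroot hχ
  rw [hφ, hχn, φ.apply_symm_apply, h3,
    dotProduct_smul, toC_emb_dot, mem_C7.1 hn, smul_eq_mul] at h4
  have h5 : k / 36 = 1 := by push_cast at h4; linear_combination h4 / 2
  rw [hu, h3, h5, one_smul]

lemma exists_rootVector_pair {n : Fin 7 → ℤ} (hn : n ∈ C7) :
    ∃ x y : L, IsRootVector φ (emb n) x ∧ IsRootVector φ (emb (-n)) y ∧
      ⁅x, y⁆ = hh φ (toC (emb n)) := by
  obtain ⟨χ, hχ, h⟩ := exists_weight hR hn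
  obtain ⟨a, x, y, t, hx, hy⟩ := LieAlgebra.IsKilling.exists_isSl2Triple_of_weight_isNonZero hχ
  refine ⟨x, y, isRootVector_iff.2 (by rw [← h]; exact hx), isRootVector_iff.2 ?_, ?_⟩
  · rw [emb_neg, show form φ (-emb n) = -χ.toLinear by
      rw [h]; ext; simp [form_apply, toC_neg]]
    exact hy
  · rw [t.lie_e_f, t.h_eq_coroot hχ hx hy, coroot_eq hR χ hχ hn h]

end Lie

end

end E7

namespace E7

noncomputable section

section Lie

variable {L : Type*} [LieRing L] [LieAlgebra ℂ L] {H : LieSubalgebra ℂ L}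
  {φ : H ≃ₗ[ℂ] (Fin 7 → ℂ)}

/-! ### The invariant form and its values on root vectors -/

section Killing

lemma kf_comm (x y : L) : kf x y = kf y x := by
  rw [kf, kf, LieModule.traceForm_comm]

lemma kf_lie (x y z : L) : kf ⁅x, y⁆ z = kf x ⁅y, z⁆ := by
  rw [kf, kf, LieModule.traceForm_apply_lie_apply]

@[simp] lemma kf_add_left (x y z : L) : kf (x + y) z = kf x z + kf y z := by
  simp [kf, add_div]
@[simp] lemma kf_add_right (x y z : L) : kf x (y + z) = kf x y + kf x z := by
  simp [kf, add_div]
@[simp] lemma kf_smul_left (a : ℂ) (x y : L) : kf (a • x) y = a * kf x y := by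
  simp [kf, mul_div_assoc]
@[simp] lemma kf_smul_right (a : ℂ) (x y : L) : kf x (a • y) = a * kf x y := by
  simp [kf, mul_div_assoc]

variable [FiniteDimensional ℂ L] [LieAlgebra.IsKilling ℂ L] [H.IsCartanSubalgebra]

lemma IsRootVector.kf_eq_zero {α β : Fin 7 → ℝ} {x y : L} (hx : IsRootVector φ α x)
    (hy : IsRootVector φ β y) (h : α + β ≠ 0) : kf x y = 0 := by
  rw [isRootVector_iff] at hx hy
  rw [kf, LieAlgebra.killingForm_apply_eq_zero_of_mem_rootSpace_of_add_ne_zero ℂ L H hx hy,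
    zero_div]
  intro h0
  apply h
  apply form_injective φ
  ext z
  have := congrFun h0 z
  simp only [Pi.add_apply, Pi.zero_apply, form_apply] at this
  rw [form_apply, toC_add, add_dotProduct, this]
  simp [form_apply]

lemma isRootVector_hh (u : Fin 7 → ℂ) : IsRootVector φ 0 (hh φ u) := fun v => by
  rw [lie_hh_hh]; simp

end Killing

variable {E : (Fin 7 → ℝ) → L}

/-! ### Brackets and scalar products in a Chevalley basis -/

namespace IsChevalley

variable (hE : IsChevalley φ E)
include hE

lemma root {n : Fin 7 → ℤ} (hn : n ∈ C7) : IsRootVector φ (emb n) (E (emb n)) :=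
  hE.rootVector _ (emb_mem_R7.2 hn)

lemma lie_hh {n : Fin 7 → ℤ} (hn : n ∈ C7) (u : Fin 7 → ℂ) :
    ⁅hh φ u, E (emb n)⁆ = (toC (emb n) ⬝ᵥ u) • E (emb n) := hE.root hn u

lemma lie_hh_emb {n : Fin 7 → ℤ} (hn : n ∈ C7) (m : Fin 7 → ℤ) :
    ⁅hh φ (toC (emb m)), E (emb n)⁆ = (dotZ m n : ℂ) • E (emb n) := by
  rw [hE.lie_hh hn, toC_emb_dot, dotZ_comm]

lemma lie_neg {n : Fin 7 → ℤ} (hn : n ∈ C7) :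
    ⁅E (emb n), E (emb (-n))⁆ = hh φ (toC (emb n)) := by
  rw [emb_neg]; exact hE.coroot _ (emb_mem_R7.2 hn)

lemma ne_zero {n : Fin 7 → ℤ} (hn : n ∈ C7) : E (emb n) ≠ 0 := by
  intro h
  have h1 := hE.lie_neg hn
  rw [h, zero_lie] at h1
  have h2 : toC (emb n) = 0 := hh_injective φ (by rw [← h1, hh_zero])
  have h3 := toC_emb_dot n n
  rw [h2, mem_C7.1 hn] at h3
  simp at h3

lemma lie_of_dot_neg {m n : Fin 7 → ℤ} (hm : m ∈ C7) (hn : n ∈ C7) (h : dotZ m n = -1) :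
    ∃ s : ℤˣ, ⁅E (emb m), E (emb n)⁆ = (s : ℂ) • E (emb (m + n)) := by
  have h1 := hE.lie _ (emb_mem_R7.2 hm) _ (emb_mem_R7.2 hn)
    (by rw [← emb_add]; exact emb_mem_R7.2 (C7_add hm hn h))
  rw [← emb_add] at h1
  rcases h1 with h1 | h1
  · exact ⟨1, by simp [h1]⟩
  · exact ⟨-1, by simp [h1]⟩

variable [FiniteDimensional ℂ L] [LieAlgebra.IsKilling ℂ L] [H.IsCartanSubalgebra]
variable (hR : Set.range (LieAlgebra.IsKilling.rootSystem H).root = form φ '' R7)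

include hR in
lemma lie_of_dot_nonneg {m n : Fin 7 → ℤ} (hm : m ∈ C7) (hn : n ∈ C7) (h : 0 ≤ dotZ m n) :
    ⁅E (emb m), E (emb n)⁆ = 0 := by
  have h1 := (hE.root hm).lie (hE.root hn)
  rw [← emb_add] at h1
  obtain ⟨h2, h3⟩ := C7_add_not hm hn h
  exact h1.eq_zero hR h2 h3

lemma kf_hh_eq_zero {n : Fin 7 → ℤ} (hn : n ∈ C7) (u : Fin 7 → ℂ) :
    kf (hh φ u) (E (emb n)) = 0 :=
  (isRootVector_hh u).kf_eq_zero (hE.root hn) (by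
    rw [zero_add, ← emb_zero]
    exact fun h => C7_ne_zero hn (emb_injective h))

lemma kf_eq_zero {m n : Fin 7 → ℤ} (hm : m ∈ C7) (hn : n ∈ C7) (h : n ≠ -m) :
    kf (E (emb m)) (E (emb n)) = 0 :=
  (hE.root hm).kf_eq_zero (hE.root hn) (by
    rw [← emb_add, ← emb_zero]
    intro h0
    apply h
    rw [eq_neg_iff_add_eq_zero, add_comm]
    exact emb_injective h0)

include hR in
-- Invariance applied to `([h, E n], E (-n))`, with `h` the coroot, gives twice the product on one
-- side and `(h, h) = 2` on the other.
lemma kf_neg {n : Fin 7 → ℤ} (hn : n ∈ C7) : kf (E (emb n)) (E (emb (-n))) = 1 := by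
  have h1 := kf_lie (hh φ (toC (emb n))) (E (emb n)) (E (emb (-n)))
  rw [hE.lie_neg hn, kf_hh_hh hR, hE.lie_hh_emb hn, kf_smul_left, toC_emb_dot, mem_C7.1 hn] at h1
  push_cast at h1
  linear_combination h1 / 2

include hR in
lemma kf_eq {m n : Fin 7 → ℤ} (hm : m ∈ C7) (hn : n ∈ C7) :
    kf (E (emb m)) (E (emb n)) = if n = -m then 1 else 0 := by
  split_ifs with h
  · rw [h, hE.kf_neg hR hm]
  · exact hE.kf_eq_zero hm hn h

/-! ### The Chevalley basis as a basis of the vector space -/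

/-- The linear map that sends a family of coordinates to the vector with these coordinates. -/
def ofCoord (_ : IsChevalley φ E) : (Fin 7 → ℂ) × (C7.toFinset → ℂ) →ₗ[ℂ] L :=
  (hhₗ φ).coprod (Fintype.linearCombination ℂ fun n : C7.toFinset => E (emb n))

lemma ofCoord_apply (u : Fin 7 → ℂ) (a : C7.toFinset → ℂ) :
    ofCoord hE (u, a) = hh φ u + ∑ n : C7.toFinset, a n • E (emb n) := by
  simp [ofCoord, Fintype.linearCombination_apply, hhₗ_apply]

include hR

/-- Pairing a vanishing combination with `E (-m)` isolates the coefficient of `E m`; the Cartan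
component is then zero as well. -/
lemma ofCoord_injective : Function.Injective (ofCoord hE) := by
  rw [injective_iff_map_eq_zero]
  rintro ⟨u, a⟩ h
  rw [ofCoord_apply] at h
  have ha (m : C7.toFinset) : a m = 0 := by
    have hm : m.1 ∈ C7 := List.mem_toFinset.1 m.2
    have h1 : kf (E (emb (-m.1))) (hh φ u + ∑ n : C7.toFinset, a n • E (emb n)) = 0 := by
      rw [h]; simp [kf]
    rw [kf_add_right, kf_comm _ (hh φ u), hE.kf_hh_eq_zero (C7_neg hm), zero_add, kf, map_sum,
      Finset.sum_div] at h1
    have h2 (n : C7.toFinset) : killingForm ℂ L (E (emb (-m.1))) (a n • E (emb n)) / 36 =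
        if n = m then a n else 0 := by
      change kf _ _ = _
      rw [kf_smul_right, hE.kf_eq hR (C7_neg hm) (List.mem_toFinset.1 n.2), neg_neg]
      by_cases h : n = m
      · rw [if_pos h, if_pos (congrArg Subtype.val h), mul_one]
      · rw [if_neg h, if_neg (fun h' => h (Subtype.ext h')), mul_zero]
    rw [Finset.sum_congr rfl fun n _ => h2 n, Finset.sum_ite_eq' Finset.univ m a,
      if_pos (Finset.mem_univ m)] at h1
    exact h1
  have ha' : a = 0 := funext ha
  subst ha'
  simp only [Pi.zero_apply, zero_smul, Finset.sum_const_zero, add_zero] at h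
  rw [hh_injective φ (h.trans (hh_zero φ).symm)]
  rfl

/-- The algebra is the sum of its weight spaces: the one of weight zero is `H`, the others are the
lines spanned by the `E n`. -/
lemma ofCoord_surjective : Function.Surjective (ofCoord hE) := by
  rw [← LinearMap.range_eq_top, eq_top_iff]
  have htop := LieModule.iSup_genWeightSpace_eq_top' (K := ℂ) (L := H) (M := L)
  rw [← LieSubmodule.toSubmodule_inj, LieSubmodule.iSup_toSubmodule] at htop
  rw [← LieSubmodule.top_toSubmodule (R := ℂ) (L := H), ← htop, iSup_le_iff]
  intro χ x hx
  by_cases hχ : χ.IsZero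
  · rw [LieSubmodule.mem_toSubmodule, hχ.eq] at hx
    change x ∈ LieAlgebra.rootSpace H 0 at hx
    rw [LieAlgebra.rootSpace_zero_eq] at hx
    obtain ⟨u, rfl⟩ := exists_hh φ hx
    exact ⟨(u, 0), by simp [ofCoord_apply]⟩
  · obtain ⟨n, hn, h⟩ := exists_code hR χ hχ
    have hx' : IsRootVector φ (emb n) x := by
      rw [isRootVector_iff, ← h]; exact hx
    obtain ⟨a, rfl⟩ := (hE.root hn).exists_smul hR hn (hE.ne_zero hn) hx'
    refine ⟨(0, Pi.single ⟨n, List.mem_toFinset.2 hn⟩ a), ?_⟩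
    rw [ofCoord_apply, hh_zero, zero_add, Finset.sum_eq_single ⟨n, List.mem_toFinset.2 hn⟩]
    · simp
    · intro m _ hm
      simp [hm]
    · simp

lemma finrank_eq : finrank ℂ L = 133 := by
  rw [← (LinearEquiv.ofBijective (ofCoord hE)
    ⟨hE.ofCoord_injective hR, hE.ofCoord_surjective hR⟩).finrank_eq]
  rw [finrank_prod, finrank_fintype_fun_eq_card, finrank_fintype_fun_eq_card, Fintype.card_coe,
    List.toFinset_card_of_nodup nodup_C7, length_C7]
  rfl

lemma exists_coord (x : L) : ∃ (u : Fin 7 → ℂ) (a : (Fin 7 → ℤ) → ℂ),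
    x = hh φ u + ∑ n ∈ C7.toFinset, a n • E (emb n) := by
  classical
  obtain ⟨⟨u, a⟩, rfl⟩ := hE.ofCoord_surjective hR x
  refine ⟨u, fun n => if h : n ∈ C7.toFinset then a ⟨n, h⟩ else 0, ?_⟩
  rw [ofCoord_apply, ← Finset.sum_coe_sort C7.toFinset]
  simp

lemma coord_unique {u v : Fin 7 → ℂ} {a b : (Fin 7 → ℤ) → ℂ}
    (h : hh φ u + ∑ n ∈ C7.toFinset, a n • E (emb n) =
      hh φ v + ∑ n ∈ C7.toFinset, b n • E (emb n)) : u = v ∧ ∀ n ∈ C7, a n = b n := by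
  have h1 : ofCoord hE (u, fun n => a n) = ofCoord hE (v, fun n => b n) := by
    rw [ofCoord_apply, ofCoord_apply, Finset.sum_coe_sort C7.toFinset (fun n => a n • E (emb n)),
      Finset.sum_coe_sort C7.toFinset (fun n => b n • E (emb n)), h]
  have h2 := hE.ofCoord_injective hR h1
  rw [Prod.mk.injEq] at h2
  exact ⟨h2.1, fun n hn => congrFun h2.2 ⟨n, List.mem_toFinset.2 hn⟩⟩

end IsChevalley

/-! ### Subalgebras generated by root spaces -/

/-- A set of roots that is stable under negation and closed under addition of roots. -/
structure IsClosedSet (S : List (Fin 7 → ℤ)) : Prop where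
  subset : S ⊆ C7
  neg : ∀ n ∈ S, -n ∈ S
  add : ∀ m ∈ S, ∀ n ∈ S, m + n ∈ C7 → m + n ∈ S

lemma isClosedSet_C6 : IsClosedSet C6 where
  subset n hn := (mem_C6.1 hn).1
  neg n hn := mem_C6.2 ⟨C7_neg (mem_C6.1 hn).1, by simp [(mem_C6.1 hn).2]⟩
  add m hm n hn h := mem_C6.2 ⟨h, by simp [(mem_C6.1 hm).2, (mem_C6.1 hn).2]⟩

lemma isClosedSet_C8 : IsClosedSet C8 where
  subset n hn := (mem_C8.1 hn).1
  neg n hn := by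
    obtain ⟨h, h0, h4, h6⟩ := mem_C8.1 hn
    exact mem_C8.2 ⟨C7_neg h, by simp [h0], by simp [h4], by simp [h6]⟩
  add m hm n hn h := by
    obtain ⟨_, h0, h4, h6⟩ := mem_C8.1 hm
    obtain ⟨_, g0, g4, g6⟩ := mem_C8.1 hn
    exact mem_C8.2 ⟨h, by simp [h0, g0], by simp [h4, g4], by simp [h6, g6]⟩

variable (φ E) in
/-- The subspace spanned by root vectors and the corresponding coroots. -/
def rootSpan (S : List (Fin 7 → ℤ)) : Submodule ℂ L :=
  Submodule.span ℂ {x | ∃ n ∈ S, x = E (emb n) ∨ x = hh φ (toC (emb n))}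

lemma E_mem_rootSpan {S : List (Fin 7 → ℤ)} {n : Fin 7 → ℤ} (hn : n ∈ S) :
    E (emb n) ∈ rootSpan φ E S := Submodule.subset_span ⟨n, hn, Or.inl rfl⟩

lemma hh_mem_rootSpan {S : List (Fin 7 → ℤ)} {n : Fin 7 → ℤ} (hn : n ∈ S) :
    hh φ (toC (emb n)) ∈ rootSpan φ E S := Submodule.subset_span ⟨n, hn, Or.inr rfl⟩

variable [FiniteDimensional ℂ L] [LieAlgebra.IsKilling ℂ L] [H.IsCartanSubalgebra]
variable (hE : IsChevalley φ E)
  (hR : Set.range (LieAlgebra.IsKilling.rootSystem H).root = form φ '' R7)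
include hE hR

/-- By `C7_cases` a bracket of two root vectors vanishes, is a multiple of a root vector whose root
stays in the closed set, or is a coroot. -/
lemma rootSpan_lie_mem {S : List (Fin 7 → ℤ)} (hS : IsClosedSet S) {x y : L}
    (hx : x ∈ rootSpan φ E S) (hy : y ∈ rootSpan φ E S) : ⁅x, y⁆ ∈ rootSpan φ E S := by
  induction hx, hy using Submodule.span_induction₂ with
  | mem_mem x y hx hy =>
    obtain ⟨m, hm, rfl | rfl⟩ := hx <;> obtain ⟨n, hn, rfl | rfl⟩ := hy
    · rcases C7_cases (hS.subset hm) (hS.subset hn) with h | h | rfl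
      · rw [hE.lie_of_dot_nonneg hR (hS.subset hm) (hS.subset hn) h]; exact zero_mem _
      · obtain ⟨s, hs⟩ := hE.lie_of_dot_neg (hS.subset hm) (hS.subset hn) h
        rw [hs]
        exact Submodule.smul_mem _ _ (E_mem_rootSpan
          (hS.add m hm n hn (C7_add (hS.subset hm) (hS.subset hn) h)))
      · rw [hE.lie_neg (hS.subset hm)]; exact hh_mem_rootSpan hm
    · rw [← lie_skew, hE.lie_hh (hS.subset hm)]
      exact neg_mem (Submodule.smul_mem _ _ (E_mem_rootSpan hm))
    · rw [hE.lie_hh (hS.subset hn)]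
      exact Submodule.smul_mem _ _ (E_mem_rootSpan hn)
    · rw [lie_hh_hh]; exact zero_mem _
  | zero_left y hy => rw [zero_lie]; exact zero_mem _
  | zero_right x hx => rw [lie_zero]; exact zero_mem _
  | add_left x y z _ _ _ h1 h2 => rw [add_lie]; exact add_mem h1 h2
  | add_right x y z _ _ _ h1 h2 => rw [lie_add]; exact add_mem h1 h2
  | smul_left r x y _ _ h => rw [smul_lie]; exact Submodule.smul_mem _ _ h
  | smul_right r x y _ _ h => rw [lie_smul]; exact Submodule.smul_mem _ _ h

/-- The span is already a subalgebra, and conversely its coroots are brackets of opposite root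
vectors. -/
theorem rootSubalgebra_toSubmodule {S : List (Fin 7 → ℤ)} (hS : IsClosedSet S) :
    (rootSubalgebra φ (emb '' {n | n ∈ S})).toSubmodule = rootSpan φ E S := by
  apply le_antisymm
  · let K : LieSubalgebra ℂ L :=
      { rootSpan φ E S with lie_mem' := rootSpan_lie_mem hE hR hS }
    change rootSubalgebra φ (emb '' {n | n ∈ S}) ≤ K
    rw [rootSubalgebra, LieSubalgebra.lieSpan_le]
    rintro x ⟨_, ⟨n, hn, rfl⟩, hx⟩
    obtain ⟨a, rfl⟩ := (hE.root (hS.subset hn)).exists_smul hR (hS.subset hn)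
      (hE.ne_zero (hS.subset hn)) hx
    exact Submodule.smul_mem _ _ (E_mem_rootSpan hn)
  · have h1 {n : Fin 7 → ℤ} (hn : n ∈ S) : E (emb n) ∈ rootSubalgebra φ (emb '' {n | n ∈ S}) :=
      LieSubalgebra.subset_lieSpan ⟨_, Set.mem_image_of_mem _ hn, hE.root (hS.subset hn)⟩
    rw [rootSpan, Submodule.span_le]
    rintro x ⟨n, hn, rfl | rfl⟩
    · exact h1 hn
    · rw [← hE.lie_neg (hS.subset hn)]
      exact LieSubalgebra.lie_mem _ (h1 hn) (h1 (hS.neg n hn))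

end Lie

end

end E7

namespace E7

noncomputable section

section Lie

variable {L : Type*} [LieRing L] [LieAlgebra ℂ L] {H : LieSubalgebra ℂ L}
  {φ : H ≃ₗ[ℂ] (Fin 7 → ℂ)} {E : (Fin 7 → ℝ) → L}

/-! ### Fixed points of an involution that permutes the Chevalley basis -/

/-- The automorphism `Θ` permutes the vectors of the Chevalley basis that belong to the closed set
of roots `S` as the isometric involution `θ` permutes the roots; roots moved by `θ` are orthogonal
to their images. -/
structure IsFolding (φ : H ≃ₗ[ℂ] (Fin 7 → ℂ)) (E : (Fin 7 → ℝ) → L) (S : List (Fin 7 → ℤ))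
    (Θ : L ≃ₗ⁅ℂ⁆ L) (θ : (Fin 7 → ℤ) →+ (Fin 7 → ℤ)) : Prop where
  closed : IsClosedSet S
  map_mem : ∀ n ∈ S, θ n ∈ S
  invol : ∀ n, θ (θ n) = n
  dot : ∀ m n, dotZ (θ m) (θ n) = dotZ m n
  orth : ∀ n ∈ S, θ n = n ∨ dotZ n (θ n) = 0
  root : ∀ n ∈ S, Θ (E (emb n)) = E (emb (θ n))
  cartan : ∀ n, Θ (hh φ (toC (emb n))) = hh φ (toC (emb (θ n)))

/-- The invariant vector `E n` or `E n + E (θ n)`. -/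
def yv (E : (Fin 7 → ℝ) → L) (θ : (Fin 7 → ℤ) →+ (Fin 7 → ℤ)) (n : Fin 7 → ℤ) : L :=
  if θ n = n then E (emb n) else E (emb n) + E (emb (θ n))

/-- The anti-invariant vector `E n - E (θ n)`. -/
def tv (E : (Fin 7 → ℝ) → L) (θ : (Fin 7 → ℤ) →+ (Fin 7 → ℤ)) (n : Fin 7 → ℤ) : L :=
  E (emb n) - E (emb (θ n))

/-- The coordinates of the coroot that corresponds to the root vector `yv E θ n`. -/
def cv (θ : (Fin 7 → ℤ) →+ (Fin 7 → ℤ)) (n : Fin 7 → ℤ) : Fin 7 → ℤ :=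
  if θ n = n then n else n + θ n

/-- The subspace of `ℂ⁷` spanned by the roots in `S`. -/
def codeSpan (S : List (Fin 7 → ℤ)) : Submodule ℂ (Fin 7 → ℂ) :=
  Submodule.span ℂ {u | ∃ n ∈ S, u = toC (emb n)}

lemma mem_codeSpan {S : List (Fin 7 → ℤ)} {n : Fin 7 → ℤ} (hn : n ∈ S) :
    toC (emb n) ∈ codeSpan S := Submodule.subset_span ⟨n, hn, rfl⟩

open scoped ComplexOrder in
/-- A vector in the span of `S` that is orthogonal to `S` vanishes. -/
lemma eq_zero_of_mem_codeSpan {S : List (Fin 7 → ℤ)} {u : Fin 7 → ℂ} (hu : u ∈ codeSpan S)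
    (h : ∀ n ∈ S, toC (emb n) ⬝ᵥ u = 0) : u = 0 := by
  -- The bilinear form has isotropic complex vectors, the Hermitian one does not. The roots are
  -- real, so orthogonality to them is the same for both forms.
  have key : ∀ v ∈ codeSpan S, star v ⬝ᵥ u = 0 := by
    intro v hv
    induction hv using Submodule.span_induction with
    | mem v hv =>
      obtain ⟨n, hn, rfl⟩ := hv
      rw [← h n hn]
      congr 1
      ext i
      simp [toC]
    | zero => simp
    | add v w _ _ hv hw => rw [star_add, add_dotProduct, hv, hw, add_zero]
    | smul a v _ hv => rw [star_smul, smul_dotProduct, hv, smul_zero]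
  exact dotProduct_star_self_eq_zero.1 (key u hu)

/-- Coordinates of the elements of `rootSpan φ E S`. -/
lemma exists_coord_of_mem {S : List (Fin 7 → ℤ)} (hS : S ⊆ C7) {x : L} (hx : x ∈ rootSpan φ E S) :
    ∃ (u : Fin 7 → ℂ) (a : (Fin 7 → ℤ) → ℂ), u ∈ codeSpan S ∧
      (∀ n ∈ C7, n ∉ S → a n = 0) ∧ x = hh φ u + ∑ n ∈ C7.toFinset, a n • E (emb n) := by
  induction hx using Submodule.span_induction with
  | mem x hx =>
    obtain ⟨n, hn, rfl | rfl⟩ := hx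
    · refine ⟨0, Pi.single n 1, zero_mem _, ?_, ?_⟩
      · intro m _ hm
        rw [Pi.single_eq_of_ne]; rintro rfl; exact hm hn
      · rw [Finset.sum_eq_single n]
        · simp
        · intro m _ hm
          rw [Pi.single_eq_of_ne hm, zero_smul]
        · intro h
          exact absurd (List.mem_toFinset.2 (hS hn)) h
    · exact ⟨toC (emb n), 0, mem_codeSpan hn, fun _ _ _ => rfl, by simp⟩
  | zero => exact ⟨0, 0, zero_mem _, fun _ _ _ => rfl, by simp⟩
  | add x y _ _ hx hy =>
    obtain ⟨u, a, hu, ha, rfl⟩ := hx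
    obtain ⟨v, b, hv, hb, rfl⟩ := hy
    refine ⟨u + v, a + b, add_mem hu hv, ?_, ?_⟩
    · intro n h1 h2
      simp [ha n h1 h2, hb n h1 h2]
    · simp only [hh_add, Pi.add_apply, add_smul, Finset.sum_add_distrib]; abel
  | smul r x _ hx =>
    obtain ⟨u, a, hu, ha, rfl⟩ := hx
    refine ⟨r • u, r • a, Submodule.smul_mem _ _ hu, ?_, ?_⟩
    · intro n h1 h2
      simp [ha n h1 h2]
    · simp only [hh_smul, Pi.smul_apply, smul_add, Finset.smul_sum, smul_smul, smul_eq_mul]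

namespace IsFolding

variable {S : List (Fin 7 → ℤ)} {Θ : L ≃ₗ⁅ℂ⁆ L} {θ : (Fin 7 → ℤ) →+ (Fin 7 → ℤ)}
  (hF : IsFolding φ E S Θ θ)
include hF

lemma mem_C7 {n : Fin 7 → ℤ} (hn : n ∈ S) : n ∈ C7 := hF.closed.subset hn

lemma dot_right (m n : Fin 7 → ℤ) : dotZ m (θ n) = dotZ (θ m) n := by
  rw [← hF.dot, hF.invol]

omit hF in
-- The factor `2` absorbs the case distinction in `yv`, so that symmetrising a root vector can be
-- treated uniformly.
lemma add_theta_eq (n : Fin 7 → ℤ) : E (emb n) + E (emb (θ n)) =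
    (if θ n = n then 2 else 1 : ℂ) • yv E θ n := by
  rw [yv]
  split_ifs with h
  · rw [h, two_smul]
  · rw [one_smul]

lemma yv_theta (n : Fin 7 → ℤ) : yv E θ (θ n) = yv E θ n := by
  simp only [yv, hF.invol, eq_comm (a := n)]
  split_ifs with h
  · rw [h]
  · rw [add_comm]

lemma tv_theta (n : Fin 7 → ℤ) : tv E θ (θ n) = -tv E θ n := by
  simp only [tv, hF.invol, neg_sub]

lemma map_yv {n : Fin 7 → ℤ} (hn : n ∈ S) : Θ (yv E θ n) = yv E θ n := by
  rw [yv]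
  split_ifs with h
  · rw [hF.root n hn, h]
  · rw [map_add, hF.root n hn, hF.root _ (hF.map_mem n hn), hF.invol, add_comm]

lemma map_tv {n : Fin 7 → ℤ} (hn : n ∈ S) : Θ (tv E θ n) = -tv E θ n := by
  rw [tv, map_sub, hF.root n hn, hF.root _ (hF.map_mem n hn), hF.invol, neg_sub]

lemma yv_mem {n : Fin 7 → ℤ} (hn : n ∈ S) : yv E θ n ∈ rootSpan φ E S := by
  rw [yv]
  split_ifs
  · exact E_mem_rootSpan hn
  · exact add_mem (E_mem_rootSpan hn) (E_mem_rootSpan (hF.map_mem n hn))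

lemma tv_mem {n : Fin 7 → ℤ} (hn : n ∈ S) : tv E θ n ∈ rootSpan φ E S :=
  sub_mem (E_mem_rootSpan hn) (E_mem_rootSpan (hF.map_mem n hn))

lemma hh_cv_mem {n : Fin 7 → ℤ} (hn : n ∈ S) : hh φ (toC (emb (cv θ n))) ∈ rootSpan φ E S := by
  rw [cv]
  split_ifs
  · exact hh_mem_rootSpan hn
  · rw [emb_add, toC_add, hh_add]
    exact add_mem (hh_mem_rootSpan hn) (hh_mem_rootSpan (hF.map_mem n hn))

lemma theta_cv (n : Fin 7 → ℤ) : θ (cv θ n) = cv θ n := by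
  rw [cv]
  split_ifs with h
  · exact h
  · rw [map_add, hF.invol, add_comm]

/-- The map `1 + Θ` doubles fixed vectors, so they lie in the image of the spanning set under it. -/
lemma fixed_mem_span {x : L} (hx : x ∈ rootSpan φ E S) (h : Θ x = x) :
    x ∈ Submodule.span ℂ {x | ∃ n ∈ S, x = yv E θ n ∨ x = hh φ (toC (emb (n + θ n)))} := by
  let P : L →ₗ[ℂ] L := LinearMap.id + (Θ : L →ₗ[ℂ] L)
  have h1 : (rootSpan φ E S).map P ≤
      Submodule.span ℂ {x | ∃ n ∈ S, x = yv E θ n ∨ x = hh φ (toC (emb (n + θ n)))} := by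
    rw [rootSpan, Submodule.map_span, Submodule.span_le]
    rintro _ ⟨_, ⟨n, hn, rfl | rfl⟩, rfl⟩
    · change E (emb n) + Θ (E (emb n)) ∈ _
      rw [hF.root n hn, add_theta_eq]
      exact Submodule.smul_mem _ _ (Submodule.subset_span ⟨n, hn, Or.inl rfl⟩)
    · change hh φ (toC (emb n)) + Θ (hh φ (toC (emb n))) ∈ _
      rw [hF.cartan, ← hh_add, ← toC_add, ← emb_add]
      exact Submodule.subset_span ⟨n, hn, Or.inr rfl⟩
  have h2 : P x = (2 : ℂ) • x := by
    change x + Θ x = _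
    rw [h, two_smul]
  have h3 := Submodule.smul_mem _ (2⁻¹ : ℂ) (h1 ⟨x, hx, h2⟩)
  rwa [smul_smul, inv_mul_cancel₀ two_ne_zero, one_smul] at h3

lemma antifixed_mem_span {x : L} (hx : x ∈ rootSpan φ E S) (h : Θ x = -x) :
    x ∈ Submodule.span ℂ {x | ∃ n ∈ S, x = tv E θ n ∨ x = hh φ (toC (emb (n - θ n)))} := by
  let P : L →ₗ[ℂ] L := LinearMap.id - (Θ : L →ₗ[ℂ] L)
  have h1 : (rootSpan φ E S).map P ≤
      Submodule.span ℂ {x | ∃ n ∈ S, x = tv E θ n ∨ x = hh φ (toC (emb (n - θ n)))} := by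
    rw [rootSpan, Submodule.map_span, Submodule.span_le]
    rintro _ ⟨_, ⟨n, hn, rfl | rfl⟩, rfl⟩
    · change E (emb n) - Θ (E (emb n)) ∈ _
      rw [hF.root n hn]
      exact Submodule.subset_span ⟨n, hn, Or.inl rfl⟩
    · change hh φ (toC (emb n)) - Θ (hh φ (toC (emb n))) ∈ _
      rw [hF.cartan, ← hh_sub, ← toC_sub, ← emb_sub]
      exact Submodule.subset_span ⟨n, hn, Or.inr rfl⟩
  have h2 : P x = (2 : ℂ) • x := by
    change x - Θ x = _
    rw [h, two_smul, sub_neg_eq_add]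
  have h3 := Submodule.smul_mem _ (2⁻¹ : ℂ) (h1 ⟨x, hx, h2⟩)
  rwa [smul_smul, inv_mul_cancel₀ two_ne_zero, one_smul] at h3

variable [FiniteDimensional ℂ L] [LieAlgebra.IsKilling ℂ L] [H.IsCartanSubalgebra]
  (hE : IsChevalley φ E)
  (hR : Set.range (LieAlgebra.IsKilling.rootSystem H).root = form φ '' R7)
include hE

/-- A Cartan element fixed by `Θ` takes the same values at `n` and `θ n`. -/
lemma dot_theta {n : Fin 7 → ℤ} (hn : n ∈ S) {u : Fin 7 → ℂ} (hu : Θ (hh φ u) = hh φ u) :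
    toC (emb (θ n)) ⬝ᵥ u = toC (emb n) ⬝ᵥ u := by
  have h1 := congrArg Θ (hE.lie_hh (hF.mem_C7 hn) u)
  rw [LieEquiv.map_lie, hu, map_smul, hF.root n hn, hE.lie_hh (hF.mem_C7 (hF.map_mem n hn))] at h1
  have h2 := hE.ne_zero (hF.mem_C7 (hF.map_mem n hn))
  exact smul_left_injective ℂ h2 h1

lemma dot_theta_neg {n : Fin 7 → ℤ} (hn : n ∈ S) {u : Fin 7 → ℂ} (hu : Θ (hh φ u) = -hh φ u) :
    toC (emb (θ n)) ⬝ᵥ u = -(toC (emb n) ⬝ᵥ u) := by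
  have h1 := congrArg Θ (hE.lie_hh (hF.mem_C7 hn) u)
  rw [LieEquiv.map_lie, hu, map_smul, hF.root n hn, neg_lie,
    hE.lie_hh (hF.mem_C7 (hF.map_mem n hn)), ← neg_smul] at h1
  have h2 := hE.ne_zero (hF.mem_C7 (hF.map_mem n hn))
  rw [← smul_left_injective ℂ h2 h1, neg_neg]

lemma lie_hh_yv {n : Fin 7 → ℤ} (hn : n ∈ S) {u : Fin 7 → ℂ} (hu : Θ (hh φ u) = hh φ u) :
    ⁅hh φ u, yv E θ n⁆ = (toC (emb n) ⬝ᵥ u) • yv E θ n := by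
  rw [yv]
  split_ifs with h
  · exact hE.lie_hh (hF.mem_C7 hn) u
  · rw [lie_add, hE.lie_hh (hF.mem_C7 hn), hE.lie_hh (hF.mem_C7 (hF.map_mem n hn)),
      hF.dot_theta hE hn hu, smul_add]

lemma lie_hh_tv {n : Fin 7 → ℤ} (hn : n ∈ S) {u : Fin 7 → ℂ} (hu : Θ (hh φ u) = hh φ u) :
    ⁅hh φ u, tv E θ n⁆ = (toC (emb n) ⬝ᵥ u) • tv E θ n := by
  rw [tv, lie_sub, hE.lie_hh (hF.mem_C7 hn), hE.lie_hh (hF.mem_C7 (hF.map_mem n hn)),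
      hF.dot_theta hE hn hu, smul_sub]

omit hE in
-- A moved root is orthogonal to its image, so the second summand of `cv` contributes nothing. This
-- is the normalisation needed for an `sl₂`-triple.
lemma dot_cv {n : Fin 7 → ℤ} (hn : n ∈ S) : dotZ n (cv θ n) = 2 := by
  have h0 := E7.mem_C7.1 (hF.mem_C7 hn)
  rw [cv]
  split_ifs with h
  · exact h0
  · rw [dotZ_add_right, h0, (hF.orth n hn).resolve_left h]; rfl

include hR

/-- The cross brackets between `n` and `-θ n` vanish by orthogonality; only the two coroots remain.
-/
lemma lie_yv_neg {n : Fin 7 → ℤ} (hn : n ∈ S) :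
    ⁅yv E θ n, yv E θ (-n)⁆ = hh φ (toC (emb (cv θ n))) := by
  have hn' := hF.mem_C7 hn
  have ht := hF.mem_C7 (hF.map_mem n hn)
  rw [yv, yv, cv, map_neg]
  by_cases h : θ n = n
  · simp only [h, if_true]
    exact hE.lie_neg hn'
  · have h1 : -θ n ≠ -n := fun h' => h (neg_injective h')
    have h2 := (hF.orth n hn).resolve_left h
    simp only [h, h1, if_false]
    rw [add_lie, lie_add, lie_add, hE.lie_neg hn', hE.lie_neg ht,
      hE.lie_of_dot_nonneg hR hn' (C7_neg ht) (by rw [dotZ_neg_right, h2]; rfl),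
      hE.lie_of_dot_nonneg hR ht (C7_neg hn') (by rw [dotZ_neg_right, dotZ_comm, h2]; rfl),
      add_zero, zero_add, ← hh_add, ← toC_add, ← emb_add]

/-- Brackets of invariant vectors. -/
lemma lie_yv_yv {m n : Fin 7 → ℤ} (hm : m ∈ S) (hn : n ∈ S) (h : dotZ m n = -1)
    (h' : θ m = m ∨ θ n = n ∨ 0 ≤ dotZ (θ m) n) :
    ∃ a : ℂ, a ≠ 0 ∧ ⁅yv E θ m, yv E θ n⁆ = a • yv E θ (m + n) := by
  have hm7 := hF.mem_C7 hm
  have hn7 := hF.mem_C7 hn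
  obtain ⟨s, hs⟩ := hE.lie_of_dot_neg hm7 hn7 h
  have hs0 : (s : ℂ) ≠ 0 := by
    rcases Int.units_eq_one_or s with rfl | rfl <;> simp
  have hmn : m + n ∈ S := hF.closed.add m hm n hn (C7_add hm7 hn7 h)
  have hs' := congrArg Θ hs
  rw [LieEquiv.map_lie, map_smul, hF.root m hm, hF.root n hn, hF.root _ hmn] at hs'
  by_cases hθm : θ m = m
  · by_cases hθn : θ n = n
    · refine ⟨s, hs0, ?_⟩
      rw [yv, yv, yv, map_add, hθm, hθn]
      simpa using hs
    · refine ⟨s, hs0, ?_⟩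
      have h1 : θ (m + n) ≠ m + n := by rw [map_add, hθm]; simpa using hθn
      rw [hθm] at hs'
      rw [yv, yv, yv, if_pos hθm, if_neg hθn, if_neg h1, lie_add, hs, hs', smul_add]
  · by_cases hθn : θ n = n
    · refine ⟨s, hs0, ?_⟩
      have h1 : θ (m + n) ≠ m + n := by rw [map_add, hθn]; simpa using hθm
      rw [hθn] at hs'
      rw [yv, yv, yv, if_neg hθm, if_pos hθn, if_neg h1, add_lie, hs, hs', smul_add]
    · have h2 : 0 ≤ dotZ (θ m) n := (h'.resolve_left hθm).resolve_left hθn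
      -- With both roots moved, the bracket is `s` times `E (m + n) + E (θ (m + n))`; the two terms
      -- coincide when `m + n` is fixed, whence the factor `2`.
      refine ⟨(s : ℂ) * (if θ (m + n) = m + n then 2 else 1), ?_, ?_⟩
      · apply mul_ne_zero hs0
        split_ifs <;> simp
      · rw [mul_smul, ← add_theta_eq, yv, yv, if_neg hθm, if_neg hθn, add_lie, lie_add, lie_add, hs,
          hs', hE.lie_of_dot_nonneg hR hm7 (hF.mem_C7 (hF.map_mem n hn))
          (by rw [hF.dot_right]; exact h2),
          hE.lie_of_dot_nonneg hR (hF.mem_C7 (hF.map_mem m hm)) hn7 h2, add_zero, zero_add,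
          smul_add]

/-- Brackets of an invariant and an anti-invariant vector. -/
lemma lie_yv_tv {m n : Fin 7 → ℤ} (hm : m ∈ S) (hn : n ∈ S) (h : dotZ m n = -1)
    (h' : θ m = m ∨ 0 ≤ dotZ (θ m) n) :
    ∃ a : ℂ, a ≠ 0 ∧ ⁅yv E θ m, tv E θ n⁆ = a • tv E θ (m + n) := by
  have hm7 := hF.mem_C7 hm
  have hn7 := hF.mem_C7 hn
  obtain ⟨s, hs⟩ := hE.lie_of_dot_neg hm7 hn7 h
  have hs0 : (s : ℂ) ≠ 0 := by
    rcases Int.units_eq_one_or s with rfl | rfl <;> simp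
  have hmn : m + n ∈ S := hF.closed.add m hm n hn (C7_add hm7 hn7 h)
  have hs' := congrArg Θ hs
  rw [LieEquiv.map_lie, map_smul, hF.root m hm, hF.root n hn, hF.root _ hmn] at hs'
  refine ⟨s, hs0, ?_⟩
  by_cases hθm : θ m = m
  · rw [hθm] at hs'
    rw [yv, tv, tv, if_pos hθm, lie_sub, hs, hs', smul_sub]
  · have h2 := h'.resolve_left hθm
    rw [yv, tv, tv, if_neg hθm, add_lie, lie_sub, lie_sub, hs,
      hs', hE.lie_of_dot_nonneg hR hm7 (hF.mem_C7 (hF.map_mem n hn))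
      (by rw [hF.dot_right]; exact h2),
      hE.lie_of_dot_nonneg hR (hF.mem_C7 (hF.map_mem m hm)) hn7 h2, sub_zero, zero_sub,
      smul_sub, sub_eq_add_neg]

/-- Again only opposite roots contribute. This is how the anti-invariant part of the Cartan
subalgebra is reached from root vectors. -/
lemma lie_yv_neg_tv {n : Fin 7 → ℤ} (hn : n ∈ S) (h : θ n ≠ n) :
    ⁅yv E θ (-n), tv E θ n⁆ = hh φ (toC (emb (θ n - n))) := by
  have hn7 := hF.mem_C7 hn
  have ht := hF.mem_C7 (hF.map_mem n hn)
  have h1 : -θ n ≠ -n := fun h' => h (neg_injective h')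
  have h2 := (hF.orth n hn).resolve_left h
  rw [yv, tv, map_neg, if_neg h1, add_lie, lie_sub, lie_sub, ← lie_skew, hE.lie_neg hn7,
    ← lie_skew (E (emb (-θ n))) (E (emb (θ n))), hE.lie_neg ht,
    hE.lie_of_dot_nonneg hR (C7_neg hn7) ht (by rw [dotZ_neg_left, h2]; rfl),
    hE.lie_of_dot_nonneg hR (C7_neg ht) hn7 (by rw [dotZ_neg_left, dotZ_comm, h2]; rfl),
    emb_sub, toC_sub, hh_sub]
  abel

lemma lie_yv_eq_zero {m n : Fin 7 → ℤ} (hm : m ∈ S) (hn : n ∈ S) (h : 0 ≤ dotZ m n)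
    (h' : 0 ≤ dotZ (θ m) n) : ⁅yv E θ m, yv E θ n⁆ = 0 := by
  have hm7 := hF.mem_C7 hm
  have hn7 := hF.mem_C7 hn
  have hm' := hF.mem_C7 (hF.map_mem m hm)
  have hn' := hF.mem_C7 (hF.map_mem n hn)
  have e1 := hE.lie_of_dot_nonneg hR hm7 hn7 h
  have e2 := hE.lie_of_dot_nonneg hR hm' hn7 h'
  have e3 := hE.lie_of_dot_nonneg hR hm7 hn' (by rw [hF.dot_right]; exact h')
  have e4 := hE.lie_of_dot_nonneg hR hm' hn' (by rw [hF.dot]; exact h)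
  rw [yv, yv]
  split_ifs <;> simp [e1, e2, e3, e4]

omit hF in
lemma _root_.E7.hh_mem_rootSpan_iff (hS : S ⊆ C7) {u : Fin 7 → ℂ} :
    hh φ u ∈ rootSpan φ E S ↔ u ∈ codeSpan S := by
  constructor
  · intro h
    obtain ⟨v, a, hv, ha, he⟩ := exists_coord_of_mem hS h
    have h1 : hh φ u + ∑ n ∈ C7.toFinset, (0 : (Fin 7 → ℤ) → ℂ) n • E (emb n) =
        hh φ v + ∑ n ∈ C7.toFinset, a n • E (emb n) := by
      rw [← he]; simp
    rwa [(hE.coord_unique hR h1).1]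
  · intro h
    have h1 : (codeSpan S).map (hhₗ φ) ≤ rootSpan φ E S := by
      rw [codeSpan, Submodule.map_span, Submodule.span_le]
      rintro _ ⟨_, ⟨n, hn, rfl⟩, rfl⟩
      exact hh_mem_rootSpan hn
    exact h1 ⟨u, h, hhₗ_apply φ u⟩

omit hF in
/-- An eigenvector of a Cartan element on `rootSpan φ E S`. -/
lemma _root_.E7.eigenvector_cases (hS : S ⊆ C7) {x : L} (hx : x ∈ rootSpan φ E S) (hx0 : x ≠ 0)
    {v : Fin 7 → ℂ} {μ : ℂ} (hμ : ⁅hh φ v, x⁆ = μ • x)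
    (hreg : ∀ m ∈ S, toC (emb m) ⬝ᵥ v ≠ 0 ∧ ∀ n ∈ S, toC (emb m) ⬝ᵥ v = toC (emb n) ⬝ᵥ v →
      n = m ∨ n = θ m) :
    (∃ u, u ≠ 0 ∧ x = hh φ u) ∨ ∃ m ∈ S, ∃ a b : ℂ, x = a • E (emb m) + b • E (emb (θ m)) := by
  obtain ⟨u, a, hu, ha, hxe⟩ := exists_coord_of_mem hS hx
  have h1 : hh φ 0 + ∑ n ∈ C7.toFinset, ((toC (emb n) ⬝ᵥ v) * a n) • E (emb n) =
      hh φ (μ • u) + ∑ n ∈ C7.toFinset, (μ * a n) • E (emb n) := by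
    rw [hxe] at hμ
    rw [lie_add, lie_hh_hh, lie_sum, smul_add, Finset.smul_sum] at hμ
    rw [hh_zero, hh_smul]
    convert hμ using 2
    · refine Finset.sum_congr rfl fun n hn => ?_
      rw [lie_smul, hE.lie_hh (List.mem_toFinset.1 hn), smul_smul, mul_comm]
    · refine Finset.sum_congr rfl fun n hn => ?_
      rw [smul_smul]
  obtain ⟨h2, h3⟩ := hE.coord_unique hR h1
  by_cases ha0 : ∀ n ∈ C7, a n = 0
  · left
    have hx' : x = hh φ u := by
      rw [hxe, Finset.sum_eq_zero, add_zero]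
      intro n hn
      rw [ha0 n (List.mem_toFinset.1 hn), zero_smul]
    exact ⟨u, fun h => hx0 (by rw [hx', h, hh_zero]), hx'⟩
  · right
    push Not at ha0
    obtain ⟨m, hm7, hm0⟩ := ha0
    have hm : m ∈ S := by
      by_contra h; exact hm0 (ha m hm7 h)
    have hμm : toC (emb m) ⬝ᵥ v = μ := mul_right_cancel₀ hm0 (h3 m hm7)
    -- The eigenvalue is the value of a root at the regular element, hence nonzero, whereas a Cartan
    -- component would have eigenvalue zero.
    have hu0 : u = 0 := by
      rcases smul_eq_zero.1 h2.symm with h | h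
      · exact absurd (hμm.trans h) (hreg m hm).1
      · exact h
    have hzero : ∀ n ∈ C7, n ≠ m → n ≠ θ m → a n = 0 := by
      intro n hn h4 h5
      by_cases hnS : n ∈ S
      · by_contra h6
        have h7 : toC (emb n) ⬝ᵥ v = μ := mul_right_cancel₀ h6 (h3 n hn)
        rcases (hreg m hm).2 n hnS (hμm.trans h7.symm) with h8 | h8
        · exact h4 h8
        · exact h5 h8
      · exact ha n hn hnS
    -- The second coefficient is set to zero when `θ m = m`, since the coefficient of `E m` would
    -- otherwise be counted twice.
    refine ⟨m, hm, a m, if θ m ∈ C7 ∧ θ m ≠ m then a (θ m) else 0, ?_⟩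
    rw [hxe, hu0, hh_zero, zero_add]
    split_ifs with h
    · rw [← Finset.sum_pair (f := fun n => a n • E (emb n)) h.2.symm]
      symm
      apply Finset.sum_subset
      · intro n hn
        simp only [Finset.mem_insert, Finset.mem_singleton] at hn
        rcases hn with rfl | rfl
        · exact List.mem_toFinset.2 hm7
        · exact List.mem_toFinset.2 h.1
      · intro n hn hn'
        simp only [Finset.mem_insert, Finset.mem_singleton, not_or] at hn'
        rw [hzero n (List.mem_toFinset.1 hn) hn'.1 hn'.2, zero_smul]
    · rw [zero_smul, add_zero, Finset.sum_eq_single m]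
      · intro n hn hnm
        have hn7 := List.mem_toFinset.1 hn
        rw [hzero n hn7 hnm ?_, zero_smul]
        rintro rfl
        exact h ⟨hn7, hnm⟩
      · intro h'
        exact absurd (List.mem_toFinset.2 hm7) h'

end IsFolding

end Lie

end

end E7

namespace E7

noncomputable section

section Lie

variable {L : Type*} [LieRing L] [LieAlgebra ℂ L] {H : LieSubalgebra ℂ L}
  {φ : H ≃ₗ[ℂ] (Fin 7 → ℂ)} {E : (Fin 7 → ℝ) → L}

/-! ### Simple roots of fixed subalgebras -/

/-- The height of a vector in coordinates with respect to the simple roots. -/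
def ht (n : Fin 7 → ℤ) : ℤ := ∑ i, n i

/-- The integral vector `ρ` separates the `θ`-orbits on `S`. -/
structure IsRegularFor (S : List (Fin 7 → ℤ)) (θ : (Fin 7 → ℤ) →+ (Fin 7 → ℤ))
    (ρ : Fin 7 → ℤ) : Prop where
  fixed : θ ρ = ρ
  mem : toC (emb ρ) ∈ codeSpan S
  ne_zero : ∀ n ∈ S, dotZ n ρ ≠ 0
  eq_or : ∀ m ∈ S, ∀ n ∈ S, dotZ m ρ = dotZ n ρ → n = m ∨ n = θ m

/-- The vectors `r i` represent the `θ`-orbits of simple roots of `S`. -/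
structure IsSimpleSystem {ι : Type} (S : List (Fin 7 → ℤ)) (θ : (Fin 7 → ℤ) →+ (Fin 7 → ℤ))
    (r : ι → Fin 7 → ℤ) : Prop where
  mem : ∀ i, r i ∈ S
  nonpos : ∀ i j, i ≠ j → dotZ (r i) (r j) ≤ 0 ∧ dotZ (θ (r i)) (r j) ≤ 0
  ht_ne_zero : ∀ n ∈ S, ht n ≠ 0
  step : ∀ n ∈ S, 0 < ht n → (∃ i, n = r i ∨ n = θ (r i)) ∨ ∃ m ∈ S, ∃ k ∈ S, 0 < ht m ∧ 0 < ht k ∧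
    n = m + k ∧ dotZ m k = -1 ∧ (θ m = m ∨ θ k = k ∨ 0 ≤ dotZ (θ m) k)

lemma ht_add (m n : Fin 7 → ℤ) : ht (m + n) = ht m + ht n := by
  simp [ht, Finset.sum_add_distrib]

lemma ht_neg (n : Fin 7 → ℤ) : ht (-n) = -ht n := by
  simp [ht, Finset.sum_neg_distrib]

/-- Induction along the decompositions of roots into simple roots. -/
lemma IsSimpleSystem.induction {ι : Type} {S : List (Fin 7 → ℤ)}
    {θ : (Fin 7 → ℤ) →+ (Fin 7 → ℤ)} {r : ι → Fin 7 → ℤ} (hr : IsSimpleSystem S θ r)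
    {P : (Fin 7 → ℤ) → Prop} (h1 : ∀ i, P (r i)) (h2 : ∀ i, P (θ (r i)))
    (h3 : ∀ m ∈ S, ∀ k ∈ S, m + k ∈ S → dotZ m k = -1 →
      (θ m = m ∨ θ k = k ∨ 0 ≤ dotZ (θ m) k) → P m → P k → P (m + k)) :
    ∀ n ∈ S, 0 < ht n → P n := by
  -- Induction on an upper bound for the height: both summands of a decomposable positive root have
  -- smaller positive height.
  suffices h : ∀ N : ℕ, ∀ n ∈ S, 0 < ht n → ht n < N → P n from
    fun n hn h0 => h (ht n + 1).toNat n hn h0 (by omega)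
  intro N
  induction N with
  | zero => intro n _ h0 h; omega
  | succ N ih =>
    intro n hn h0 hN
    rcases hr.step n hn h0 with ⟨i, rfl | rfl⟩ | ⟨m, hm, k, hk, hm0, hk0, rfl, hd, hθ⟩
    · exact h1 i
    · exact h2 i
    · rw [ht_add] at hN
      exact h3 m hm k hk hn hd hθ (ih m hm hm0 (by push_cast at hN; omega))
        (ih k hk hk0 (by push_cast at hN; omega))

namespace IsFolding

variable {S : List (Fin 7 → ℤ)} {Θ : L ≃ₗ⁅ℂ⁆ L} {θ : (Fin 7 → ℤ) →+ (Fin 7 → ℤ)}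
  (hF : IsFolding φ E S Θ θ)
include hF

lemma map_hh_of_fixed {ρ : Fin 7 → ℤ} (h : θ ρ = ρ) :
    Θ (hh φ (toC (emb ρ))) = hh φ (toC (emb ρ)) := by rw [hF.cartan, h]

variable [FiniteDimensional ℂ L] [LieAlgebra.IsKilling ℂ L] [H.IsCartanSubalgebra]
  (hE : IsChevalley φ E)
  (hR : Set.range (LieAlgebra.IsKilling.rootSystem H).root = form φ '' R7)
include hE hR

omit hF hR hE in
lemma _root_.E7.exists_dot_ne_zero {u : Fin 7 → ℂ} (hu : u ∈ codeSpan S)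
    (hu0 : u ≠ 0) : ∃ n ∈ S, toC (emb n) ⬝ᵥ u ≠ 0 := by
  by_contra h
  push Not at h
  exact hu0 (eq_zero_of_mem_codeSpan hu h)

/-- A nonzero subspace that is stable under a regular Cartan element contains a nonzero Cartan
element or a combination of the root vectors of an orbit. -/
lemma exists_mem_cases {ρ : Fin 7 → ℤ} (hρ : IsRegularFor S θ ρ) {V : Submodule ℂ L}
    (hV : V ≤ rootSpan φ E S) (hV0 : V ≠ ⊥)
    (hst : ∀ x ∈ V, ⁅hh φ (toC (emb ρ)), x⁆ ∈ V) :
    (∃ u, u ≠ 0 ∧ u ∈ codeSpan S ∧ hh φ u ∈ V) ∨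
      ∃ m ∈ S, ∃ a b : ℂ, a • E (emb m) + b • E (emb (θ m)) ∈ V ∧
        a • E (emb m) + b • E (emb (θ m)) ≠ 0 := by
  -- Over `ℂ` the restriction of `ad ρ` to the nonzero space `V` has an eigenvector, and regularity
  -- of `ρ` limits its support to one orbit.
  let f : V →ₗ[ℂ] V := (LieAlgebra.ad ℂ L (hh φ (toC (emb ρ)))).restrict hst
  have : Nontrivial V := Submodule.nontrivial_iff_ne_bot.2 hV0
  obtain ⟨μ, hμ⟩ := Module.End.exists_eigenvalue f
  obtain ⟨x, hx⟩ := hμ.exists_hasEigenvector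
  have hx0 : (x : L) ≠ 0 := fun h => hx.2 (Subtype.ext h)
  have hxμ : ⁅hh φ (toC (emb ρ)), (x : L)⁆ = μ • (x : L) :=
    congrArg Subtype.val (Module.End.mem_eigenspace_iff.1 hx.1)
  have hreg : ∀ m ∈ S, toC (emb m) ⬝ᵥ toC (emb ρ) ≠ 0 ∧ ∀ n ∈ S,
      toC (emb m) ⬝ᵥ toC (emb ρ) = toC (emb n) ⬝ᵥ toC (emb ρ) → n = m ∨ n = θ m := by
    intro m hm
    simp only [toC_emb_dot]
    refine ⟨by exact_mod_cast hρ.ne_zero m hm, fun n hn h => hρ.eq_or m hm n hn ?_⟩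
    exact_mod_cast h
  rcases eigenvector_cases hE hR (θ := θ) hF.closed.subset (hV x.2) hx0 hxμ hreg with
    ⟨u, hu, hxu⟩ | ⟨m, hm, a, b, hab⟩
  · refine Or.inl ⟨u, hu, ?_, hxu ▸ x.2⟩
    rw [← hh_mem_rootSpan_iff hE hR hF.closed.subset, ← hxu]
    exact hV x.2
  · exact Or.inr ⟨m, hm, a, b, hab ▸ x.2, hab ▸ hx0⟩

omit hR in
-- A fixed vector is the average of itself and its image, in which both coefficients become `(a + b)
-- / 2`.
lemma eq_smul_yv {m : Fin 7 → ℤ} (hm : m ∈ S) {a b : ℂ}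
    (h0 : a • E (emb m) + b • E (emb (θ m)) ≠ 0)
    (h : Θ (a • E (emb m) + b • E (emb (θ m))) = a • E (emb m) + b • E (emb (θ m))) :
    ∃ t : ℂ, t ≠ 0 ∧ a • E (emb m) + b • E (emb (θ m)) = t • yv E θ m := by
  have key : a • E (emb m) + b • E (emb (θ m)) =
      ((a + b) / 2 * (if θ m = m then 2 else 1)) • yv E θ m := by
    rw [map_add, map_smul, map_smul, hF.root m hm, hF.root _ (hF.map_mem m hm), hF.invol] at h
    rw [mul_smul, ← add_theta_eq]
    have : (2 : ℂ) • (a • E (emb m) + b • E (emb (θ m))) =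
        (a + b) • (E (emb m) + E (emb (θ m))) := by
      nth_rw 1 [two_smul, ← h]
      module
    rw [div_eq_inv_mul, mul_smul, ← this, smul_smul, inv_mul_cancel₀ two_ne_zero, one_smul]
  refine ⟨_, ?_, key⟩
  intro ht
  rw [key, ht, zero_smul] at h0
  exact h0 rfl

omit hR in
lemma eq_smul_tv {m : Fin 7 → ℤ} (hm : m ∈ S) {a b : ℂ}
    (h0 : a • E (emb m) + b • E (emb (θ m)) ≠ 0)
    (h : Θ (a • E (emb m) + b • E (emb (θ m))) = -(a • E (emb m) + b • E (emb (θ m)))) :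
    ∃ t : ℂ, t ≠ 0 ∧ θ m ≠ m ∧ a • E (emb m) + b • E (emb (θ m)) = t • tv E θ m := by
  have key : a • E (emb m) + b • E (emb (θ m)) = ((a - b) / 2) • tv E θ m := by
    rw [map_add, map_smul, map_smul, hF.root m hm, hF.root _ (hF.map_mem m hm), hF.invol] at h
    have : (2 : ℂ) • (a • E (emb m) + b • E (emb (θ m))) = (a - b) • tv E θ m := by
      nth_rw 1 [two_smul, ← neg_neg (a • E (emb m) + b • E (emb (θ m))), ← h, tv]
      module
    rw [div_eq_inv_mul, mul_smul, ← this, smul_smul, inv_mul_cancel₀ two_ne_zero, one_smul]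
  refine ⟨_, ?_, ?_, key⟩
  · intro ht
    rw [key, ht, zero_smul] at h0
    exact h0 rfl
  · intro ht
    rw [key, tv, ht, sub_self, smul_zero] at h0
    exact h0 rfl

/-! ### Semisimplicity of the fixed subalgebra -/

variable {K : LieSubalgebra ℂ L} (hK : ∀ x, x ∈ K ↔ x ∈ rootSpan φ E S ∧ Θ x = x)
include hK

omit hE hR in
lemma yv_mem_of {n : Fin 7 → ℤ} (hn : n ∈ S) : yv E θ n ∈ K :=
  (hK _).2 ⟨hF.yv_mem hn, hF.map_yv hn⟩

omit hE hR in
lemma hh_cv_mem_of {n : Fin 7 → ℤ} (hn : n ∈ S) : hh φ (toC (emb (cv θ n))) ∈ K :=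
  (hK _).2 ⟨hF.hh_cv_mem hn, hF.map_hh_of_fixed (hF.theta_cv n)⟩

omit hR hK in
-- For a moved root, the coroot of `n` acts by `2` on `E n` and by `0` on `E (θ n)`, so the two
-- terms cannot cancel.
lemma yv_ne_zero {n : Fin 7 → ℤ} (hn : n ∈ S) : yv E θ n ≠ 0 := by
  intro h
  have h1 := hE.lie_hh_emb (hF.mem_C7 hn) n
  have h2 := kf_lie (hh φ (toC (emb n))) (yv E θ n) (E (emb (-n)))
  have h3 : ⁅yv E θ n, E (emb (-n))⁆ = 0 := by rw [h, zero_lie]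
  rw [yv] at h3
  split_ifs at h3 with hθ
  · have h4 := hE.lie_neg (hF.mem_C7 hn)
    rw [h3] at h4
    have h5 : toC (emb n) = 0 := hh_injective φ (by rw [← h4, hh_zero])
    exact C7_ne_zero (hF.mem_C7 hn) (emb_injective (toC_injective (by rw [h5, emb_zero, toC_zero])))
  · rw [yv, if_neg hθ] at h
    have h4 := congrArg (fun x => ⁅hh φ (toC (emb n)), x⁆) h
    simp only [lie_add, lie_zero] at h4
    rw [h1, hE.lie_hh_emb (hF.mem_C7 (hF.map_mem n hn)), (hF.orth n hn).resolve_left hθ,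
      E7.mem_C7.1 (hF.mem_C7 hn)] at h4
    have := hE.ne_zero (hF.mem_C7 hn)
    simp [this] at h4

/-- In characteristic zero it suffices to exclude nonzero abelian ideals. By `exists_mem_cases` such
an ideal contains a Cartan element or a multiple of some `yv E θ n`; bracketing a nonzero Cartan
element with a suitable `yv` leads to the second case, which `key` excludes. -/
theorem isKilling {ρ : Fin 7 → ℤ} (hρ : IsRegularFor S θ ρ) : LieAlgebra.IsKilling ℂ K := by
  suffices h : LieAlgebra.HasTrivialRadical ℂ K from inferInstance
  rw [LieAlgebra.hasTrivialRadical_iff_no_abelian_ideals]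
  intro I hI
  by_contra hI0
  let V : Submodule ℂ L := I.toSubmodule.map (K.incl : K →ₗ[ℂ] L)
  have hVK {x : L} (hx : x ∈ V) : x ∈ K := by
    obtain ⟨y, _, rfl⟩ := hx
    exact y.2
  have hVlie {x y : L} (hx : x ∈ K) (hy : y ∈ V) : ⁅x, y⁆ ∈ V := by
    obtain ⟨y, hy, rfl⟩ := hy
    exact ⟨⁅(⟨x, hx⟩ : K), y⁆, lie_mem_right ℂ K I _ _ hy, rfl⟩
  have hVab {x y : L} (hx : x ∈ V) (hy : y ∈ V) : ⁅x, y⁆ = 0 := by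
    obtain ⟨x, hx, rfl⟩ := hx
    obtain ⟨y, hy, rfl⟩ := hy
    have h1 : ⁅(⟨x, hx⟩ : I), (⟨y, hy⟩ : I)⁆ = 0 := trivial_lie_zero I I _ _
    have h2 := congrArg (fun z : I => ((z : K) : L)) h1
    exact h2
  have hV0 : V ≠ ⊥ := by
    intro h
    apply hI0
    rw [← LieSubmodule.toSubmodule_eq_bot]
    rw [Submodule.eq_bot_iff] at h ⊢
    exact fun x hx => Subtype.ext (h _ ⟨x, hx, rfl⟩)
  have hρK : hh φ (toC (emb ρ)) ∈ K :=
    (hK _).2 ⟨(hh_mem_rootSpan_iff hE hR hF.closed.subset).2 hρ.mem, hF.map_hh_of_fixed hρ.fixed⟩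
  -- Bracketing with the opposite vector puts the coroot into the ideal, and the coroot acts on `yv
  -- E θ n` by `2`, so the ideal is not abelian.
  have key {n : Fin 7 → ℤ} (hn : n ∈ S) : yv E θ n ∉ V := by
    intro h
    have h1 := hVlie (hF.yv_mem_of hK (hF.closed.neg n hn)) h
    rw [← lie_skew, hF.lie_yv_neg hE hR hn] at h1
    have h2 := hVab h1 h
    rw [neg_lie, hF.lie_hh_yv hE hn (hF.map_hh_of_fixed (hF.theta_cv n)), toC_emb_dot,
      hF.dot_cv hn] at h2
    have := hF.yv_ne_zero hE hn
    simp [this] at h2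
  rcases hF.exists_mem_cases hE hR hρ (V := V) (fun x hx => ((hK x).1 (hVK hx)).1) hV0
    (fun x hx => hVlie hρK hx) with ⟨u, hu0, hu, hV⟩ | ⟨m, hm, a, b, h1, h2⟩
  · obtain ⟨n, hn, h⟩ := exists_dot_ne_zero hu hu0
    apply key hn
    have h1 := hVlie (hF.yv_mem_of hK hn) hV
    rw [← lie_skew, hF.lie_hh_yv hE hn ((hK _).1 (hVK hV)).2] at h1
    have h2 := V.smul_mem (-(toC (emb n) ⬝ᵥ u)⁻¹) h1
    rwa [smul_neg, neg_smul, neg_neg, smul_smul, inv_mul_cancel₀ h, one_smul] at h2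
  · obtain ⟨t, ht, h3⟩ := hF.eq_smul_yv hE hm h2 ((hK _).1 (hVK h1)).2
    apply key hm
    rw [h3] at h1
    have h4 := V.smul_mem t⁻¹ h1
    rwa [smul_smul, inv_mul_cancel₀ ht, one_smul] at h4

/-! ### Generators and base of the fixed subalgebra -/

section Simple

variable {ι : Type} [Fintype ι] [DecidableEq ι] {r : ι → Fin 7 → ℤ} (hr : IsSimpleSystem S θ r)
include hr

omit hK hE hR in
/-- The invariant part of the Cartan subalgebra is spanned by the simple coroots. -/
lemma hh_add_theta_mem {n : Fin 7 → ℤ} (hn : n ∈ S) : hh φ (toC (emb (n + θ n))) ∈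
    Submodule.span ℂ (Set.range fun i => hh φ (toC (emb (cv θ (r i))))) := by
  have h0 (i : ι) : hh φ (toC (emb (r i + θ (r i)))) ∈
      Submodule.span ℂ (Set.range fun i => hh φ (toC (emb (cv θ (r i))))) := by
    have h1 : hh φ (toC (emb (cv θ (r i)))) ∈
      Submodule.span ℂ (Set.range fun i => hh φ (toC (emb (cv θ (r i))))) :=
      Submodule.subset_span ⟨i, rfl⟩
    rw [cv] at h1
    split_ifs at h1 with h
    · rw [h, emb_add, toC_add, hh_add]
      exact add_mem h1 h1
    · exact h1
  have hpos := hr.induction (P := fun n => hh φ (toC (emb (n + θ n))) ∈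
      Submodule.span ℂ (Set.range fun i => hh φ (toC (emb (cv θ (r i)))))) h0
    (fun i => by rw [hF.invol, add_comm]; exact h0 i)
    (fun m _ k _ _ _ _ h1 h2 => by
      rw [map_add, add_add_add_comm, emb_add, toC_add, hh_add]
      exact add_mem h1 h2)
  rcases lt_or_gt_of_ne (hr.ht_ne_zero n hn) with h | h
  · have h1 := hpos _ (hF.closed.neg n hn) (by rw [ht_neg]; omega)
    rw [map_neg, ← neg_add, emb_neg, toC_neg, hh_neg] at h1
    exact neg_mem_iff.1 h1
  · exact hpos n hn h

omit hE in
lemma hh_mem_span_of_mem (hE : IsChevalley φ E) {u : Fin 7 → ℂ} (hu : hh φ u ∈ K) : hh φ u ∈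
    Submodule.span ℂ (Set.range fun i => hh φ (toC (emb (cv θ (r i))))) := by
  obtain ⟨h1, h2⟩ := (hK _).1 hu
  rw [hh_mem_rootSpan_iff hE hR hF.closed.subset] at h1
  have h3 : hh φ u + Θ (hh φ u) ∈
      Submodule.span ℂ (Set.range fun i => hh φ (toC (emb (cv θ (r i))))) := by
    clear h2 hu
    induction h1 using Submodule.span_induction with
    | mem u hu =>
      obtain ⟨n, hn, rfl⟩ := hu
      rw [hF.cartan, ← hh_add, ← toC_add, ← emb_add]
      exact hF.hh_add_theta_mem hr hn
    | zero => simp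
    | add u v _ _ hu hv =>
      rw [hh_add, map_add, add_add_add_comm]
      exact add_mem hu hv
    | smul a u _ hu =>
      rw [hh_smul, map_smul, ← smul_add]
      exact Submodule.smul_mem _ _ hu
  rw [h2, ← two_smul ℂ] at h3
  have h4 := Submodule.smul_mem _ (2⁻¹ : ℂ) h3
  rwa [smul_smul, inv_mul_cancel₀ two_ne_zero, one_smul] at h4

/-- The vectors attached to the simple roots and their opposites generate `K`. -/
lemma lieSpan_eq_top : LieSubalgebra.lieSpan ℂ K
    (Set.range (fun i => (⟨yv E θ (r i), hF.yv_mem_of hK (hr.mem i)⟩ : K)) ∪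
      Set.range (fun i => (⟨yv E θ (-r i), hF.yv_mem_of hK (hF.closed.neg _ (hr.mem i))⟩ : K))) =
      ⊤ := by
  set G := LieSubalgebra.lieSpan ℂ K
    (Set.range (fun i => (⟨yv E θ (r i), hF.yv_mem_of hK (hr.mem i)⟩ : K)) ∪
      Set.range (fun i => (⟨yv E θ (-r i), hF.yv_mem_of hK (hF.closed.neg _ (hr.mem i))⟩ : K)))
    with hG
  let M : LieSubalgebra ℂ L := G.map K.incl
  have hpos := hr.induction (P := fun n => yv E θ n ∈ M ∧ yv E θ (-n) ∈ M)
    (fun i => ⟨⟨_, LieSubalgebra.subset_lieSpan (Or.inl ⟨i, rfl⟩), rfl⟩,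
      ⟨_, LieSubalgebra.subset_lieSpan (Or.inr ⟨i, rfl⟩), rfl⟩⟩)
    (fun i => by
      rw [← map_neg, hF.yv_theta, hF.yv_theta]
      exact ⟨⟨_, LieSubalgebra.subset_lieSpan (Or.inl ⟨i, rfl⟩), rfl⟩,
        ⟨_, LieSubalgebra.subset_lieSpan (Or.inr ⟨i, rfl⟩), rfl⟩⟩)
    (fun m hm k hk hmk hd hθ ⟨hm1, hm2⟩ ⟨hk1, hk2⟩ => by
      constructor
      · obtain ⟨a, ha, h⟩ := hF.lie_yv_yv hE hR hm hk hd hθ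
        have h1 := M.smul_mem a⁻¹ (M.lie_mem hm1 hk1)
        rwa [h, smul_smul, inv_mul_cancel₀ ha, one_smul] at h1
      · obtain ⟨a, ha, h⟩ := hF.lie_yv_yv hE hR (hF.closed.neg m hm) (hF.closed.neg k hk)
          (by rw [dotZ_neg_left, dotZ_neg_right, neg_neg, hd])
          (by
            rw [map_neg, map_neg, neg_inj, neg_inj, dotZ_neg_left, dotZ_neg_right, neg_neg]
            exact hθ)
        have h1 := M.smul_mem a⁻¹ (M.lie_mem hm2 hk2)
        rwa [h, smul_smul, inv_mul_cancel₀ ha, one_smul, ← neg_add] at h1)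
  have hall : ∀ n ∈ S, yv E θ n ∈ M := by
    intro n hn
    rcases lt_or_gt_of_ne (hr.ht_ne_zero n hn) with h | h
    · have h1 := (hpos _ (hF.closed.neg n hn) (by rw [ht_neg]; omega)).2
      rwa [neg_neg] at h1
    · exact (hpos n hn h).1
  rw [eq_top_iff]
  rintro ⟨x, hx⟩ -
  obtain ⟨h1, h2⟩ := (hK x).1 hx
  have h3 : Submodule.span ℂ {x | ∃ n ∈ S, x = yv E θ n ∨ x = hh φ (toC (emb (n + θ n)))} ≤
      M.toSubmodule := by
    rw [Submodule.span_le]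
    rintro _ ⟨n, hn, rfl | rfl⟩
    · exact hall n hn
    · have h4 := M.lie_mem (hall n hn) (hall _ (hF.closed.neg n hn))
      rw [hF.lie_yv_neg hE hR hn, cv] at h4
      split_ifs at h4 with h
      · rw [h, emb_add, toC_add, hh_add]
        exact add_mem h4 h4
      · exact h4
  obtain ⟨y, hy, hyx⟩ := h3 (hF.fixed_mem_span h1 h2)
  have : y = ⟨x, hx⟩ := Subtype.ext hyx
  rwa [← this]

/-- The vectors `yv` of the simple representatives, those of their opposites and the elements `cv`
satisfy the Chevalley relations and generate; this is the data of a `LieAlgebra.Basis`, which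
supplies the Cartan subalgebra and the base. A simple root of `K` is the restriction of `r i` to the
fixed part of `H`, represented by the mean of `r i` and its image. -/
theorem hasSimpleRoots {ρ : Fin 7 → ℤ} (hρ : IsRegularFor S θ ρ) {A : Matrix ι ι ℤ}
    (hA : ∀ i j, dotZ (r i) (cv θ (r j)) = A i j) (hdet : A.det ≠ 0) {α αv : ι → Fin 7 → ℝ}
    (hα : ∀ i, (2 : ℝ) • α i = emb (r i + θ (r i))) (hαv : ∀ i, αv i = emb (cv θ (r i))) :
    HasSimpleRoots φ K A α αv := by
  have hKill := hF.isKilling hE hR hK hρ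
  have hfix (n : Fin 7 → ℤ) := hF.map_hh_of_fixed (hF.theta_cv n)
  have hAe (i j : ι) : ⁅hh φ (toC (emb (cv θ (r j)))), yv E θ (r i)⁆ = A i j • yv E θ (r i) := by
    rw [hF.lie_hh_yv hE (hr.mem i) (hfix _), toC_emb_dot, hA, Int.cast_smul_eq_zsmul]
  have hAf (i j : ι) : ⁅hh φ (toC (emb (cv θ (r j)))), yv E θ (-r i)⁆ =
      -A i j • yv E θ (-r i) := by
    rw [hF.lie_hh_yv hE (hF.closed.neg _ (hr.mem i)) (hfix _), toC_emb_dot, dotZ_neg_left, hA,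
      Int.cast_smul_eq_zsmul]
  have hdiag (i : ι) : A i i = 2 := by rw [← hA, hF.dot_cv (hr.mem i)]
  have hne (i : ι) : hh φ (toC (emb (cv θ (r i)))) ≠ 0 := by
    intro h
    have h1 := hAe i i
    rw [h, zero_lie, hdiag] at h1
    have := hF.yv_ne_zero hE (hr.mem i)
    have h2 : (2 : ℂ) • yv E θ (r i) = 0 := by
      rw [h1, ← Int.cast_smul_eq_zsmul ℂ]; norm_num
    simp [this] at h2
  let b : LieAlgebra.Basis ι (cartanIn H K) :=
    { A := A
      h := fun i => ⟨_, hF.hh_cv_mem_of hK (hr.mem i)⟩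
      e := fun i => ⟨_, hF.yv_mem_of hK (hr.mem i)⟩
      f := fun i => ⟨_, hF.yv_mem_of hK (hF.closed.neg _ (hr.mem i))⟩
      cartan_eq_lieSpan := by
        apply le_antisymm
        · rintro ⟨x, hx⟩ hxH
          obtain ⟨u, rfl⟩ := exists_hh φ (show x ∈ H from hxH)
          have h1 := hF.hh_mem_span_of_mem hR hK hr hE hx
          have h2 : Submodule.span ℂ (Set.range fun i => hh φ (toC (emb (cv θ (r i))))) ≤
              ((LieSubalgebra.lieSpan ℂ K (Set.range fun i =>
                (⟨_, hF.hh_cv_mem_of hK (hr.mem i)⟩ : K))).map K.incl).toSubmodule := by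
            rw [Submodule.span_le]
            rintro _ ⟨i, rfl⟩
            exact ⟨_, LieSubalgebra.subset_lieSpan ⟨i, rfl⟩, rfl⟩
          obtain ⟨y, hy, hyx⟩ := h2 h1
          have : y = ⟨_, hx⟩ := Subtype.ext hyx
          rwa [← this]
        · rw [LieSubalgebra.lieSpan_le]
          rintro _ ⟨i, rfl⟩
          exact hh_mem φ _
      span_ef := hF.lieSpan_eq_top hE hR hK hr
      -- Applying a relation between the coroots to each simple root vector gives `A *ᵥ g = 0`, and
      -- the determinant of `A` is nonzero.
      linInd := by
        rw [Fintype.linearIndependent_iff]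
        intro g hg
        have h1 : ∑ i, g i • hh φ (toC (emb (cv θ (r i)))) = 0 := by
          have := congrArg (Subtype.val : K → L) hg
          simpa using this
        have h2 : (A.map (Int.cast : ℤ → ℂ)) *ᵥ g = 0 := by
          ext j
          have h3 := congrArg (fun x => ⁅x, yv E θ (r j)⁆) h1
          simp only [sum_lie, smul_lie, hAe, zero_lie] at h3
          simp only [← Int.cast_smul_eq_zsmul ℂ, smul_smul, ← Finset.sum_smul] at h3
          rcases smul_eq_zero.1 h3 with h4 | h4
          · simp only [mulVec, dotProduct, Matrix.map_apply, Pi.zero_apply]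
            rw [← h4]
            exact Finset.sum_congr rfl fun i _ => mul_comm _ _
          · exact absurd h4 (hF.yv_ne_zero hE (hr.mem j))
        have h3 : (A.map (Int.cast : ℤ → ℂ)).det ≠ 0 := by
          have := Int.cast_det (R := ℂ) A
          rw [show A.map (Int.cast : ℤ → ℂ) = A.map (fun x => (x : ℂ)) from rfl, ← this]
          exact_mod_cast hdet
        exact fun i => congrFun (Matrix.eq_zero_of_mulVec_eq_zero h3 h2) i
      nondegen := Matrix.nondegenerate_of_det_ne_zero hdet
      sl2 := fun i =>
        { h_ne_zero := fun h => hne i (congrArg Subtype.val h)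
          lie_e_f := Subtype.ext (hF.lie_yv_neg hE hR (hr.mem i))
          lie_h_e_nsmul := Subtype.ext (by
            change ⁅hh φ (toC (emb (cv θ (r i)))), yv E θ (r i)⁆ = 2 • yv E θ (r i)
            rw [hAe, hdiag]; norm_num [two_smul])
          lie_h_f_nsmul := Subtype.ext (by
            change ⁅hh φ (toC (emb (cv θ (r i)))), yv E θ (-r i)⁆ = -(2 • yv E θ (-r i))
            rw [hAf, hdiag]; norm_num [two_smul]) }
      lie_h_h := fun i j => Subtype.ext (lie_hh_hh φ _ _)
      lie_h_e := fun i j => Subtype.ext (hAe i j)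
      lie_h_f := fun i j => Subtype.ext (hAf i j)
      lie_e_f_ne := fun i j hij => Subtype.ext (hF.lie_yv_eq_zero hE hR (hr.mem i)
        (hF.closed.neg _ (hr.mem j))
        (by rw [dotZ_neg_right]; have := (hr.nonpos i j hij).1; omega)
        (by rw [dotZ_neg_right]; have := (hr.nonpos i j hij).2; omega)) }
  have hC := b.isCartanSubalgebra
  refine ⟨hKill, hC, b.base, b.baseSupportEquiv, fun i => ⟨fun x => ?_, ?_, fun j => ?_⟩⟩
  · have h1 : b.baseSupp i x • yv E θ (r i) = ⁅((x : K) : L), yv E θ (r i)⁆ :=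
      congrArg Subtype.val (b.baseSupp_apply_smul_e i x)
    have hx : ((x : K) : L) = hh φ (coord φ K x) := by simp [hh, coord]
    have hfx : Θ (hh φ (coord φ K x)) = hh φ (coord φ K x) := by
      rw [← hx]; exact ((hK _).1 (x : K).2).2
    rw [hx, hF.lie_hh_yv hE (hr.mem i) hfx] at h1
    have h2 : b.baseSupp i x = toC (emb (r i)) ⬝ᵥ coord φ K x :=
      smul_left_injective ℂ (hF.yv_ne_zero hE (hr.mem i)) h1
    -- On fixed Cartan elements `r i` and its image take the same value, so their mean `α i` does
    -- too.
    have h3 : (2 : ℂ) * (toC (α i) ⬝ᵥ coord φ K x) = 2 * (toC (emb (r i)) ⬝ᵥ coord φ K x) := by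
      have h4 := congrArg toC (hα i)
      rw [toC_smul, emb_add, toC_add] at h4
      have h5 := congrArg (fun v => v ⬝ᵥ coord φ K x) h4
      simp only [smul_dotProduct, add_dotProduct, hF.dot_theta hE (hr.mem i) hfx] at h5
      rw [← two_mul] at h5
      simpa using h5
    rw [mul_left_cancel₀ two_ne_zero h3, ← h2]
    rfl
  · have h1 : (LieAlgebra.IsKilling.rootSystem (cartanIn H K)).coroot (b.baseSupportEquiv i) =
        b.h' i := b.coroot_eq_h' i
    rw [h1]
    change φ ⟨hh φ (toC (emb (cv θ (r i)))), _⟩ = _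
    rw [hαv]
    simp [hh]
  · rw [b.cartanMatrix_base_eq]
    simp [b]

end Simple

end IsFolding

end Lie

end

end E7

namespace E7

noncomputable section

/-- The map `lamZ` as a homomorphism. -/
def lamHom : (Fin 7 → ℤ) →+ (Fin 7 → ℤ) where
  toFun := lamZ
  map_zero' := by ext i; fin_cases i <;> simp [lamZ]
  map_add' := lamZ_add

@[simp] lemma lamHom_apply (n : Fin 7 → ℤ) : lamHom n = lamZ n := rfl

/-! ### Simple systems in `e₆` and `so(8)` -/

/-- The bounds make decimal encodings of the coordinates injective; the last clause is the
orthogonality on which the folding rests. -/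
lemma C6_bounds : ∀ n ∈ C6, n 6 = 0 ∧ ht n ≠ 0 ∧
    (-1 ≤ n 0 ∧ n 0 ≤ 1) ∧ (-2 ≤ n 1 ∧ n 1 ≤ 2) ∧ (-3 ≤ n 2 ∧ n 2 ≤ 3) ∧
    (-2 ≤ n 3 ∧ n 3 ≤ 2) ∧ (-1 ≤ n 4 ∧ n 4 ≤ 1) ∧ (-2 ≤ n 5 ∧ n 5 ≤ 2) ∧
    (lamZ n = n ∨ dotZ n (lamZ n) = 0) := by
  decide +kernel

lemma C8_subset_C6 : C8 ⊆ C6 := fun _ hn =>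
  mem_C6.2 ⟨(mem_C8.1 hn).1, (mem_C8.1 hn).2.2.2⟩

lemma lamZ_mem_C6 {n : Fin 7 → ℤ} (hn : n ∈ C6) : lamZ n ∈ C6 :=
  mem_C6.2 ⟨C7_lam (mem_C6.1 hn).1, by simp [lamZ, (mem_C6.1 hn).2]⟩

lemma lamZ_mem_C8 {n : Fin 7 → ℤ} (hn : n ∈ C8) : lamZ n ∈ C8 := by
  obtain ⟨h, h0, h4, h6⟩ := mem_C8.1 hn
  exact mem_C8.2 ⟨C7_lam h, by simp [lamZ, h4, h6], by simp [lamZ, h0, h6], by simp [lamZ, h6]⟩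

/-- Orbits of `λ₇` on the roots of `e₆` are determined by their sums. -/
lemma eq_or_of_add_lamZ_eq {m n : Fin 7 → ℤ} (hm : m ∈ C6) (hn : n ∈ C6)
    (h : n + lamZ n = m + lamZ m) : n = m ∨ n = lamZ m := by
  have hm7 := (mem_C6.1 hm).1
  have hn7 := (mem_C6.1 hn).1
  have hl7 := C7_lam hm7
  have h2 := mem_C7.1 hn7
  have h1 := congrArg (dotZ n) h
  rw [dotZ_add_right, dotZ_add_right, h2] at h1
  have b1 := C7_dot_le hn7 hm7
  have b2 := C7_dot_le hn7 hl7
  by_cases e1 : dotZ n m = 2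
  · exact Or.inl (C7_eq_of_dot hn7 hm7 e1)
  by_cases e2 : dotZ n (lamZ m) = 2
  · exact Or.inr (C7_eq_of_dot hn7 hl7 e2)
  -- Otherwise both products of `n` with the orbit of `m` are at most `1`. Pairing the equality of
  -- sums with `n` forces `n` to be moved and `dotZ n m = 1`. Then `n - m` is a root sent to its
  -- opposite, which is neither fixed nor orthogonal to its image.
  exfalso
  rcases (C6_bounds n hn).2.2.2.2.2.2.2.2 with h3 | h3
  · rw [h3, h2] at h1; omega
  · have e3 : dotZ n m = 1 := by omega
    have hd : n - m ∈ C7 := by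
      rw [sub_eq_add_neg]
      exact C7_add hn7 (C7_neg hm7) (by rw [dotZ_neg_right, e3])
    have hd6 : n - m ∈ C6 := mem_C6.2 ⟨hd, by simp [(mem_C6.1 hn).2, (mem_C6.1 hm).2]⟩
    have h4 : lamZ (n - m) = -(n - m) := by
      rw [lamZ_sub]
      linear_combination h
    rcases (C6_bounds _ hd6).2.2.2.2.2.2.2.2 with h5 | h5
    · rw [h5] at h4
      have := congrArg (dotZ (n - m)) h4
      rw [dotZ_neg_right, mem_C7.1 hd] at this
      omega
    · rw [h4, dotZ_neg_right, mem_C7.1 hd] at h5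
      omega

/-- The coordinates of representatives of the simple roots of `f₄`. -/
def simpleFZ : Fin 4 → Fin 7 → ℤ := fun i => Pi.single (![5, 2, 1, 0] i) 1

lemma C6_steps : ∀ n ∈ C6, 0 < ht n → (∃ i : Fin 6, n = Pi.single i.castSucc 1) ∨
    ∃ i : Fin 6, n - Pi.single i.castSucc 1 ∈ C6 ∧ 0 < ht (n - Pi.single i.castSucc 1) ∧
      dotZ (Pi.single i.castSucc 1) (n - Pi.single i.castSucc 1) = -1 := by
  decide +kernel

/-- A simple root can be removed so that mixed brackets between orbits do not interfere: the final
alternative is the hypothesis of `lie_yv_yv`. -/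
lemma C6_lam_steps : ∀ n ∈ C6, 0 < ht n → (∃ i, n = simpleFZ i ∨ n = lamZ (simpleFZ i)) ∨
    ∃ i : Fin 6, n - Pi.single i.castSucc 1 ∈ C6 ∧ 0 < ht (n - Pi.single i.castSucc 1) ∧
      dotZ (Pi.single i.castSucc 1) (n - Pi.single i.castSucc 1) = -1 ∧
      (lamZ (Pi.single i.castSucc 1) = Pi.single i.castSucc 1 ∨
        lamZ (n - Pi.single i.castSucc 1) = n - Pi.single i.castSucc 1 ∨
        0 ≤ dotZ (lamZ (Pi.single i.castSucc 1)) (n - Pi.single i.castSucc 1)) := by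
  decide +kernel

/-- Positions of the simple roots of `so(8)` among those of `e₇`. -/
def pos8 : Fin 4 → Fin 7 := ![1, 2, 3, 5]

lemma C8_lam_steps : ∀ n ∈ C8, 0 < ht n →
    (∃ i : Fin 3, n = simpleFZ i.castSucc ∨ n = lamZ (simpleFZ i.castSucc)) ∨
    ∃ i, n - Pi.single (pos8 i) 1 ∈ C8 ∧ 0 < ht (n - Pi.single (pos8 i) 1) ∧
      dotZ (Pi.single (pos8 i) 1) (n - Pi.single (pos8 i) 1) = -1 ∧
      (lamZ (Pi.single (pos8 i) 1) = Pi.single (pos8 i) 1 ∨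
        lamZ (n - Pi.single (pos8 i) 1) = n - Pi.single (pos8 i) 1 ∨
        0 ≤ dotZ (lamZ (Pi.single (pos8 i) 1)) (n - Pi.single (pos8 i) 1)) := by
  decide +kernel

lemma single_facts : (∀ i : Fin 6, (Pi.single i.castSucc 1 : Fin 7 → ℤ) ∈ C6) ∧
    (∀ i, (Pi.single (pos8 i) 1 : Fin 7 → ℤ) ∈ C8) ∧ (∀ i, simpleFZ i ∈ C6) ∧
    (∀ i : Fin 3, simpleFZ i.castSucc ∈ C8) ∧
    (∀ i : Fin 7, 0 < ht (Pi.single i 1)) ∧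
    (∀ i j, i ≠ j → dotZ (simpleFZ i) (simpleFZ j) ≤ 0 ∧
      dotZ (lamZ (simpleFZ i)) (simpleFZ j) ≤ 0) ∧
    (∀ i j : Fin 7, i ≠ j → dotZ (Pi.single i 1) (Pi.single j 1) ≤ 0) := by
  decide +kernel

/-- With the trivial involution the folding results describe `e₆` itself. -/
lemma isSimpleSystem_C6_id : IsSimpleSystem C6 (AddMonoidHom.id _)
    (fun i : Fin 6 => Pi.single i.castSucc 1) where
  mem := single_facts.1
  nonpos i j hij := by
    have := single_facts.2.2.2.2.2.2 i.castSucc j.castSucc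
      (fun h => hij (Fin.castSucc_injective _ h))
    exact ⟨this, this⟩
  ht_ne_zero n hn := (C6_bounds n hn).2.1
  step n hn h := by
    rcases C6_steps n hn h with ⟨i, rfl⟩ | ⟨i, h1, h2, h3⟩
    · exact Or.inl ⟨i, Or.inl rfl⟩
    · exact Or.inr ⟨_, single_facts.1 i, _, h1, single_facts.2.2.2.2.1 _, h2,
        (add_sub_cancel _ _).symm, h3, Or.inl rfl⟩

lemma isSimpleSystem_C6 : IsSimpleSystem C6 lamHom simpleFZ where
  mem := single_facts.2.2.1
  nonpos := single_facts.2.2.2.2.2.1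
  ht_ne_zero n hn := (C6_bounds n hn).2.1
  step n hn h := by
    rcases C6_lam_steps n hn h with ⟨i, hi⟩ | ⟨i, h1, h2, h3, h4⟩
    · exact Or.inl ⟨i, hi⟩
    · exact Or.inr ⟨_, single_facts.1 i, _, h1, single_facts.2.2.2.2.1 _, h2,
        (add_sub_cancel _ _).symm, h3, h4⟩

lemma isSimpleSystem_C8 : IsSimpleSystem C8 lamHom (fun i : Fin 3 => simpleFZ i.castSucc) where
  mem := single_facts.2.2.2.1
  nonpos i j hij := single_facts.2.2.2.2.2.1 _ _ (fun h => hij (Fin.castSucc_injective _ h))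
  ht_ne_zero n hn := (C6_bounds n (C8_subset_C6 hn)).2.1
  step n hn h := by
    rcases C8_lam_steps n hn h with ⟨i, hi⟩ | ⟨i, h1, h2, h3, h4⟩
    · exact Or.inl ⟨i, hi⟩
    · exact Or.inr ⟨_, single_facts.2.1 i, _, h1, single_facts.2.2.2.2.1 _, h2,
        (add_sub_cancel _ _).symm, h3, h4⟩

/-! ### Regular elements -/

lemma mem_codeSpan_of_single {S : List (Fin 7 → ℤ)} {ρ : Fin 7 → ℤ}
    (h : ∀ i, ρ i = 0 ∨ Pi.single i 1 ∈ S) : toC (emb ρ) ∈ codeSpan S := by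
  have h1 : toC (emb ρ) = ∑ i, (ρ i : ℂ) • toC (emb (Pi.single i 1)) := by
    simp only [emb_single]
    ext j
    simp [toC, emb]
  rw [h1]
  refine Submodule.sum_mem _ fun i _ => ?_
  rcases h i with h | h
  · rw [h]; simp
  · exact Submodule.smul_mem _ _ (mem_codeSpan h)

/-- Sums over the `λ₇`-orbits of simple roots of `f₄`, weighted by powers of `10`. -/
def wt (n : Fin 7 → ℤ) : ℤ := (n 0 + n 4) + 10 * (n 1 + n 3) + 100 * n 2 + 1000 * n 5

lemma wt_ne_zero : ∀ n ∈ C6, wt n ≠ 0 := by decide +kernel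

/-- By `C6_bounds` the four decimal digits of two weights differ by less than `10`, so equal weights
have equal digits; these determine the sum over the orbit. -/
lemma eq_or_of_wt_eq {m n : Fin 7 → ℤ} (hm : m ∈ C6) (hn : n ∈ C6) (h : wt m = wt n) :
    n = m ∨ n = lamZ m := by
  apply eq_or_of_add_lamZ_eq hm hn
  obtain ⟨e6, -, e0, e1, e2, e3, e4, e5, -⟩ := C6_bounds m hm
  obtain ⟨f6, -, f0, f1, f2, f3, f4, f5, -⟩ := C6_bounds n hn
  simp only [wt] at h
  ext i
  fin_cases i <;> simp [lamZ, e6, f6] <;> omega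

/-- A regular element for the action of `λ₇` on `e₆`. -/
def rhoF : Fin 7 → ℤ := ![1232, 2463, 3684, 2463, 1232, 2342, 0]
/-- A regular element for the action of `λ₇` on `so(8)`. -/
def rhoB : Fin 7 → ℤ := ![0, 615, 1220, 615, 0, 1110, 0]
/-- A regular element of `e₆`. -/
def rhoE : Fin 7 → ℤ := ![324654, 649305, 973926, 661284, 345642, 636963, 0]

/-- `rhoF` solves the linear system prescribing the values `1, 10, 100, 1000` on the orbits of
simple roots. -/
lemma dotZ_rhoF {n : Fin 7 → ℤ} (hn : n ∈ C6) : dotZ n rhoF = wt n := by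
  simp [dotZ, rhoF, wt, (mem_C6.1 hn).2]; ring

lemma dotZ_rhoB {n : Fin 7 → ℤ} (hn : n ∈ C8) : dotZ n rhoB = wt n := by
  obtain ⟨-, h0, h4, h6⟩ := mem_C8.1 hn
  simp [dotZ, rhoB, wt, h0, h4, h6]; ring

lemma isRegularFor_C6 : IsRegularFor C6 lamHom rhoF where
  fixed := by ext i; fin_cases i <;> simp [lamZ, rhoF]
  mem := mem_codeSpan_of_single (by decide +kernel)
  ne_zero n hn := by rw [dotZ_rhoF hn]; exact wt_ne_zero n hn
  eq_or m hm n hn h := by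
    rw [dotZ_rhoF hm, dotZ_rhoF hn] at h
    exact eq_or_of_wt_eq hm hn h

lemma isRegularFor_C8 : IsRegularFor C8 lamHom rhoB where
  fixed := by ext i; fin_cases i <;> simp [lamZ, rhoB]
  mem := mem_codeSpan_of_single (by decide +kernel)
  ne_zero n hn := by rw [dotZ_rhoB hn]; exact wt_ne_zero n (C8_subset_C6 hn)
  eq_or m hm n hn h := by
    rw [dotZ_rhoB hm, dotZ_rhoB hn] at h
    exact eq_or_of_wt_eq (C8_subset_C6 hm) (C8_subset_C6 hn) h

lemma isRegularFor_C6_id : IsRegularFor C6 (AddMonoidHom.id _) rhoE where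
  fixed := rfl
  mem := mem_codeSpan_of_single (by decide +kernel)
  ne_zero := by decide +kernel
  eq_or m hm n hn h := by
    -- The factor `3`, the determinant of the Cartan matrix `E₆`, makes the solution with these
    -- values integral.
    have key {k : Fin 7 → ℤ} (hk : k ∈ C6) : dotZ k rhoE = 3 * (k 0 + 10 * k 1 + 100 * k 2 +
        1000 * k 3 + 10000 * k 4 + 100000 * k 5) := by
      simp [dotZ, rhoE, (mem_C6.1 hk).2]; ring
    rw [key hm, key hn] at h
    obtain ⟨e6, -, e0, e1, e2, e3, e4, e5, -⟩ := C6_bounds m hm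
    obtain ⟨f6, -, f0, f1, f2, f3, f4, f5, -⟩ := C6_bounds n hn
    left
    ext i
    fin_cases i <;> simp [e6, f6] <;> omega

/-- The coordinates of the simple coroots of `f₄`. -/
def simpleCoFZ : Fin 4 → Fin 7 → ℤ :=
  ![![0, 0, 0, 0, 0, 1, 0], ![0, 0, 1, 0, 0, 0, 0], ![0, 1, 0, 1, 0, 0, 0], ![1, 0, 0, 0, 1, 0, 0]]

lemma cv_simpleFZ (i : Fin 4) : cv lamHom (simpleFZ i) = simpleCoFZ i := by
  simp only [cv, lamHom_apply]; revert i; decide +kernel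

lemma dotZ_simpleFZ : ∀ i j, dotZ (simpleFZ i) (simpleCoFZ j) = CartanMatrix.F₄ i j := by
  intro i j; fin_cases i <;> fin_cases j <;> rfl

lemma dotZ_simpleFZ_castSucc : ∀ i j : Fin 3,
    dotZ (simpleFZ i.castSucc) (simpleCoFZ j.castSucc) = CartanMatrix.B 3 i j := by
  intro i j; fin_cases i <;> fin_cases j <;> rfl

lemma dotZ_single : ∀ i j : Fin 6, dotZ (Pi.single i.castSucc 1) (Pi.single j.castSucc 1) =
    CartanMatrix.E₆ (sigma6 i) (sigma6 j) := by
  decide +kernel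

lemma two_smul_simpleF (i : Fin 4) :
    (2 : ℝ) • simpleF i = emb (simpleFZ i + lamZ (simpleFZ i)) := by
  rw [emb_eq_embM]
  ext j
  fin_cases i <;> fin_cases j <;> simp [simpleF, embM, toM, simpleFZ, lamZ] <;> ring

lemma simpleCoF_eq (i : Fin 4) : simpleCoF i = emb (simpleCoFZ i) := by
  rw [emb_eq_embM]
  ext j
  fin_cases i <;> fin_cases j <;> simp [simpleCoF, embM, toM, simpleCoFZ]

/-! ### The foldings of `e₆` and `so(8)` -/

section Lie

variable {L : Type*} [LieRing L] [LieAlgebra ℂ L] {H : LieSubalgebra ℂ L}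
  {φ : H ≃ₗ[ℂ] (Fin 7 → ℂ)} {E : (Fin 7 → ℝ) → L} {Λ : L ≃ₗ⁅ℂ⁆ L}

lemma IsLift.map_E (hΛ : IsLift φ E Λ) {n : Fin 7 → ℤ} (hn : n ∈ C7) :
    Λ (E (emb n)) = E (emb (lamZ n)) := by
  rw [hΛ.root _ (emb_mem_R7.2 hn), lam_emb]

lemma IsLift.map_hh (hΛ : IsLift φ E Λ) (v : Fin 7 → ℝ) :
    Λ (hh φ (toC v)) = hh φ (toC (lam ℝ v)) := by
  rw [hΛ.cartan, lam_toC]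

lemma IsLift.isFolding_C6 (hΛ : IsLift φ E Λ) : IsFolding φ E C6 Λ lamHom where
  closed := isClosedSet_C6
  map_mem _ hn := lamZ_mem_C6 hn
  invol := lamZ_lamZ
  dot := dotZ_lamZ
  orth n hn := (C6_bounds n hn).2.2.2.2.2.2.2.2
  root n hn := hΛ.map_E (mem_C6.1 hn).1
  cartan n := by rw [hΛ.map_hh, lam_emb]; rfl

lemma IsLift.isFolding_C8 (hΛ : IsLift φ E Λ) : IsFolding φ E C8 Λ lamHom where
  closed := isClosedSet_C8
  map_mem _ hn := lamZ_mem_C8 hn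
  invol := lamZ_lamZ
  dot := dotZ_lamZ
  orth n hn := (C6_bounds n (C8_subset_C6 hn)).2.2.2.2.2.2.2.2
  root n hn := hΛ.map_E (mem_C8.1 hn).1
  cartan n := by rw [hΛ.map_hh, lam_emb]; rfl

variable (φ E) in
lemma isFolding_id : IsFolding φ E C6 LieEquiv.refl (AddMonoidHom.id _) where
  closed := isClosedSet_C6
  map_mem _ hn := hn
  invol _ := rfl
  dot _ _ := rfl
  orth _ _ := Or.inl rfl
  root _ _ := rfl
  cartan _ := rfl

variable [FiniteDimensional ℂ L] [LieAlgebra.IsKilling ℂ L] [H.IsCartanSubalgebra]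
  (hE : IsChevalley φ E)
  (hR : Set.range (LieAlgebra.IsKilling.rootSystem H).root = form φ '' R7)
include hE hR

lemma e6_toSubmodule : (e6 φ).toSubmodule = rootSpan φ E C6 := by
  rw [e6, R6_eq]; exact rootSubalgebra_toSubmodule hE hR isClosedSet_C6

lemma so8_toSubmodule : (so8 φ).toSubmodule = rootSpan φ E C8 := by
  rw [so8, R8_eq]; exact rootSubalgebra_toSubmodule hE hR isClosedSet_C8

lemma mem_e6 {x : L} : x ∈ e6 φ ↔ x ∈ rootSpan φ E C6 := by
  rw [← LieSubalgebra.mem_toSubmodule, e6_toSubmodule hE hR]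

lemma mem_so8 {x : L} : x ∈ so8 φ ↔ x ∈ rootSpan φ E C8 := by
  rw [← LieSubalgebra.mem_toSubmodule, so8_toSubmodule hE hR]

lemma mem_f4 {x : L} : x ∈ f4 φ Λ ↔ x ∈ rootSpan φ E C6 ∧ Λ x = x := by
  rw [← mem_e6 hE hR]; rfl

lemma mem_so7 {x : L} : x ∈ so7 φ Λ ↔ x ∈ rootSpan φ E C8 ∧ Λ x = x := by
  rw [← mem_so8 hE hR]; rfl

lemma mem_rep26 {x : L} : x ∈ rep26 φ Λ ↔ x ∈ rootSpan φ E C6 ∧ Λ x = -x := by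
  rw [← mem_e6 hE hR]; rfl

lemma mem_rep7 {x : L} : x ∈ rep7 φ Λ ↔ x ∈ rootSpan φ E C8 ∧ Λ x = -x := by
  rw [← mem_so8 hE hR]; rfl

theorem f4_hasSimpleRoots (hΛ : IsLift φ E Λ) :
    HasSimpleRoots φ (f4 φ Λ) CartanMatrix.F₄ simpleF simpleCoF :=
  hΛ.isFolding_C6.hasSimpleRoots hE hR (fun _ => mem_f4 hE hR) isSimpleSystem_C6 isRegularFor_C6
    (fun i j => by rw [cv_simpleFZ, dotZ_simpleFZ])
    (by rw [CartanMatrix.F₄_det]; norm_num) two_smul_simpleF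
    (fun i => by rw [cv_simpleFZ, simpleCoF_eq])

theorem so7_hasSimpleRoots (hΛ : IsLift φ E Λ) :
    HasSimpleRoots φ (so7 φ Λ) (CartanMatrix.B 3)
      (fun i => simpleF i.castSucc) (fun i => simpleCoF i.castSucc) :=
  hΛ.isFolding_C8.hasSimpleRoots hE hR (fun _ => mem_so7 hE hR) isSimpleSystem_C8 isRegularFor_C8
    (fun i j => by rw [cv_simpleFZ, dotZ_simpleFZ_castSucc])
    (by decide +kernel) (fun i => two_smul_simpleF i.castSucc)
    (fun i => by rw [cv_simpleFZ, simpleCoF_eq])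

theorem e6_hasSimpleRoots :
    HasSimpleRoots φ (e6 φ) (CartanMatrix.E₆.submatrix sigma6 sigma6)
      (fun i => simple i.castSucc) (fun i => simple i.castSucc) :=
  (isFolding_id φ E).hasSimpleRoots hE hR
    (fun x => by rw [mem_e6 hE hR]; exact (and_iff_left rfl).symm)
    isSimpleSystem_C6_id isRegularFor_C6_id
    (fun i j => by
      simp only [cv, AddMonoidHom.id_apply, if_true]
      exact dotZ_single i j)
    (by
      have h : sigma6 = ⇑(Equiv.ofBijective sigma6 (by decide)) := rfl
      rw [h, Matrix.det_submatrix_equiv_self, CartanMatrix.E₆_det]; norm_num)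
    (fun i => by
      rw [AddMonoidHom.id_apply, emb_add, emb_single, two_smul])
    (fun i => by rw [cv, AddMonoidHom.id_apply, if_pos rfl, emb_single])

end Lie

end

end E7

namespace E7

noncomputable section

section Lie

variable {L : Type*} [LieRing L] [LieAlgebra ℂ L] {H : LieSubalgebra ℂ L}
  {φ : H ≃ₗ[ℂ] (Fin 7 → ℂ)} {E : (Fin 7 → ℝ) → L}

/-! ### Irreducibility of the anti-invariant parts -/

/-- The roots of `S` that are moved by `θ` are connected to the root `top` by chains along which
the height increases. -/
structure IsTop (S : List (Fin 7 → ℤ)) (θ : (Fin 7 → ℤ) →+ (Fin 7 → ℤ)) (top : Fin 7 → ℤ) :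
    Prop where
  mem : top ∈ S
  moved : θ top ≠ top
  ht_lt : ∀ n ∈ S, ht n < 20
  ht_ne_zero : ∀ n ∈ S, ht n ≠ 0
  step : ∀ n ∈ S, 0 < ht n → θ n ≠ n → n = top ∨ n = θ top ∨ ∃ m ∈ S, 0 < ht m ∧
    dotZ m n = -1 ∧ (θ m = m ∨ dotZ (θ m) n = 0) ∧ θ (m + n) ≠ m + n

namespace IsFolding

variable {S : List (Fin 7 → ℤ)} {Θ : L ≃ₗ⁅ℂ⁆ L} {θ : (Fin 7 → ℤ) →+ (Fin 7 → ℤ)}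
  (hF : IsFolding φ E S Θ θ)
include hF
variable [FiniteDimensional ℂ L] [LieAlgebra.IsKilling ℂ L] [H.IsCartanSubalgebra]
  (hE : IsChevalley φ E)
  (hR : Set.range (LieAlgebra.IsKilling.rootSystem H).root = form φ '' R7)
  {K : LieSubalgebra ℂ L} (hK : ∀ x, x ∈ K ↔ x ∈ rootSpan φ E S ∧ Θ x = x)
include hE

lemma lie_yv_hh {n : Fin 7 → ℤ} (hn : n ∈ S) (hθ : θ n ≠ n) {u : Fin 7 → ℂ}
    (hu : Θ (hh φ u) = -hh φ u) :
    ⁅yv E θ n, hh φ u⁆ = -(toC (emb n) ⬝ᵥ u) • tv E θ n := by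
  rw [yv, if_neg hθ, tv, add_lie, ← lie_skew, hE.lie_hh (hF.mem_C7 hn), ← lie_skew (E (emb (θ n))),
    hE.lie_hh (hF.mem_C7 (hF.map_mem n hn)), hF.dot_theta_neg hE hn hu]
  module

lemma tv_ne_zero {n : Fin 7 → ℤ} (hn : n ∈ S) (hθ : θ n ≠ n) : tv E θ n ≠ 0 := by
  intro h
  have h1 := congrArg (fun x => ⁅hh φ (toC (emb n)), x⁆) h
  simp only [tv, lie_sub, lie_zero] at h1
  rw [hE.lie_hh_emb (hF.mem_C7 hn), hE.lie_hh_emb (hF.mem_C7 (hF.map_mem n hn)),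
    (hF.orth n hn).resolve_left hθ, E7.mem_C7.1 (hF.mem_C7 hn)] at h1
  have := hE.ne_zero (hF.mem_C7 hn)
  simp [this] at h1

include hR

/-- In the second alternative the two mixed brackets are nonzero, but `Θ` exchanges them and fixes
their common root vector; being equal, they cancel in the difference `tv`. -/
lemma lie_yv_tv_eq_zero {m n : Fin 7 → ℤ} (hm : m ∈ S) (hn : n ∈ S) (h : 0 ≤ dotZ m n)
    (h' : 0 ≤ dotZ (θ m) n ∨ θ m ≠ m ∧ dotZ (θ m) n = -1 ∧ θ (θ m + n) = θ m + n) :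
    ⁅yv E θ m, tv E θ n⁆ = 0 := by
  have hm7 := hF.mem_C7 hm
  have hn7 := hF.mem_C7 hn
  have hm' := hF.mem_C7 (hF.map_mem m hm)
  have hn' := hF.mem_C7 (hF.map_mem n hn)
  have e1 := hE.lie_of_dot_nonneg hR hm7 hn7 h
  have e4 := hE.lie_of_dot_nonneg hR hm' hn' (by rw [hF.dot]; exact h)
  rcases h' with h' | ⟨hθ, hd, hf⟩
  · have e2 := hE.lie_of_dot_nonneg hR hm' hn7 h'
    have e3 := hE.lie_of_dot_nonneg hR hm7 hn' (by rw [hF.dot_right]; exact h')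
    rw [yv, tv]
    split_ifs <;> simp [e1, e2, e3, e4]
  · obtain ⟨s, hs⟩ := hE.lie_of_dot_neg hm' hn7 hd
    have hs' := congrArg Θ hs
    have hmn : θ m + n ∈ S := hF.closed.add _ (hF.map_mem m hm) n hn (C7_add hm' hn7 hd)
    rw [LieEquiv.map_lie, map_smul, hF.root _ (hF.map_mem m hm), hF.root n hn, hF.root _ hmn,
      hf, hF.invol, ← hs] at hs'
    rw [yv, tv, if_neg hθ]
    simp [e1, e4, hs']

include hK

/-- A nonzero subspace of the anti-invariant part that is stable under `K` is the whole
anti-invariant part. -/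
lemma mem_of_stable {top ρ : Fin 7 → ℤ} (htop : IsTop S θ top) (hρ : IsRegularFor S θ ρ)
    {V : Submodule ℂ L} (hV : ∀ x ∈ V, x ∈ rootSpan φ E S ∧ Θ x = -x) (hV0 : V ≠ ⊥)
    (hst : ∀ x ∈ K, ∀ y ∈ V, ⁅x, y⁆ ∈ V) {x : L} (hx : x ∈ rootSpan φ E S) (hΘ : Θ x = -x) :
    x ∈ V := by
  have hsm {a : ℂ} {y : L} (ha : a ≠ 0) (h : a • y ∈ V) : y ∈ V := by
    have h2 := V.smul_mem a⁻¹ h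
    rwa [smul_smul, inv_mul_cancel₀ ha, one_smul] at h2
  have hyK {n : Fin 7 → ℤ} (hn : n ∈ S) : yv E θ n ∈ K := hF.yv_mem_of hK hn
  have hhv {n : Fin 7 → ℤ} (hn : n ∈ S) (hθ : θ n ≠ n) (h : tv E θ n ∈ V) :
      hh φ (toC (emb (n - θ n))) ∈ V := by
    have h1 := hst _ (hyK (hF.closed.neg n hn)) _ h
    rw [hF.lie_yv_neg_tv hE hR hn hθ] at h1
    have h2 := neg_mem h1
    rwa [← hh_neg, ← toC_neg, ← emb_neg, neg_sub] at h2
  -- The passage from `n` to `-n` goes through the Cartan element `n - θ n`, on which `n` takes the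
  -- value `2`.
  have hneg {n : Fin 7 → ℤ} (hn : n ∈ S) (hθ : θ n ≠ n) (h : tv E θ n ∈ V) :
      tv E θ (-n) ∈ V := by
    have hθ' : θ (-n) ≠ -n := by rwa [map_neg, ne_eq, neg_inj]
    have h1 := hhv hn hθ h
    have h2 := hst _ (hyK (hF.closed.neg n hn)) _ h1
    rw [hF.lie_yv_hh hE (hF.closed.neg n hn) hθ' (hV _ h1).2, toC_emb_dot, dotZ_neg_left,
      dotZ_sub_right, (hF.orth n hn).resolve_left hθ, E7.mem_C7.1 (hF.mem_C7 hn)] at h2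
    exact hsm (by norm_num) h2
  -- Upward induction on the height, with `20` above all heights. Each step is reversible: `yv` of
  -- `m` raises, `yv` of `-m` lowers, both with a nonzero coefficient.
  have key : ∀ N : ℕ, ∀ n ∈ S, 0 < ht n → θ n ≠ n → 20 - ht n < N →
      (tv E θ n ∈ V ↔ tv E θ top ∈ V) := by
    intro N
    induction N with
    | zero => intro n hn _ _ h; have := htop.ht_lt n hn; omega
    | succ N ih =>
      intro n hn h0 hθ hN
      rcases htop.step n hn h0 hθ with rfl | rfl | ⟨m, hm, hm0, hd, hθm, hθmn⟩
      · rfl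
      · rw [hF.tv_theta, neg_mem_iff]
      · have hmn : m + n ∈ S :=
          hF.closed.add m hm n hn (C7_add (hF.mem_C7 hm) (hF.mem_C7 hn) hd)
        rw [← ih (m + n) hmn (by rw [ht_add]; omega) hθmn (by rw [ht_add]; push_cast at hN; omega)]
        constructor
        · intro h
          obtain ⟨a, ha, h1⟩ := hF.lie_yv_tv hE hR hm hn hd (hθm.imp_right fun h => h.ge)
          have h2 := hst _ (hyK hm) _ h
          rw [h1] at h2
          exact hsm ha h2
        · intro h
          have hm2 := E7.mem_C7.1 (hF.mem_C7 hm)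
          obtain ⟨a, ha, h1⟩ := hF.lie_yv_tv hE hR (m := -m) (n := m + n) (hF.closed.neg m hm) hmn
            (by rw [dotZ_neg_left, dotZ_add_right, hd, hm2]; rfl)
            (by
              rw [map_neg, neg_inj, dotZ_neg_left, dotZ_add_right]
              rcases hF.orth m hm with h | h
              · exact Or.inl h
              · rw [dotZ_comm m] at h
                exact hθm.imp_right fun h' => by rw [h, h']; rfl)
          have h2 := hst _ (hyK (hF.closed.neg m hm)) _ h
          rw [h1, neg_add_cancel_left] at h2
          exact hsm ha h2
  have key' {n : Fin 7 → ℤ} (hn : n ∈ S) (h0 : 0 < ht n) (hθ : θ n ≠ n) :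
      tv E θ n ∈ V ↔ tv E θ top ∈ V := key (20 - ht n + 1).toNat n hn h0 hθ (by
        have := htop.ht_lt n hn; omega)
  -- An eigenvector of `ad ρ` in `V` is an anti-invariant Cartan element, which some moved root
  -- turns into a vector `tv`, or is itself a multiple of one.
  have hexists : ∃ m ∈ S, θ m ≠ m ∧ tv E θ m ∈ V := by
    have hρK : hh φ (toC (emb ρ)) ∈ K :=
      (hK _).2 ⟨(hh_mem_rootSpan_iff hE hR hF.closed.subset).2 hρ.mem,
        hF.map_hh_of_fixed hρ.fixed⟩
    rcases hF.exists_mem_cases hE hR hρ (V := V) (fun x hx => (hV x hx).1) hV0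
      (fun x hx => hst _ hρK x hx) with ⟨u, hu0, hu, huV⟩ | ⟨m, hm, a, b, h1, h2⟩
    · obtain ⟨n, hn, h⟩ := exists_dot_ne_zero hu hu0
      have hθ : θ n ≠ n := by
        intro hθ
        have h1 := hF.dot_theta_neg hE hn (hV _ huV).2
        rw [hθ] at h1
        exact h (self_eq_neg.1 h1)
      have h1 := hst _ (hyK hn) _ huV
      rw [hF.lie_yv_hh hE hn hθ (hV _ huV).2] at h1
      exact ⟨n, hn, hθ, hsm (neg_ne_zero.2 h) h1⟩
    · obtain ⟨t, ht, hθ, h3⟩ := hF.eq_smul_tv hE hm h2 (hV _ h1).2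
      rw [h3] at h1
      exact ⟨m, hm, hθ, hsm ht h1⟩
  have htopV : tv E θ top ∈ V := by
    obtain ⟨m, hm, hθ, h⟩ := hexists
    rcases lt_or_gt_of_ne (htop.ht_ne_zero m hm) with h0 | h0
    · exact (key' (hF.closed.neg m hm) (by rw [ht_neg]; omega)
        (by rwa [map_neg, ne_eq, neg_inj])).1 (hneg hm hθ h)
    · exact (key' hm h0 hθ).1 h
  have hall {n : Fin 7 → ℤ} (hn : n ∈ S) (hθ : θ n ≠ n) : tv E θ n ∈ V := by
    rcases lt_or_gt_of_ne (htop.ht_ne_zero n hn) with h0 | h0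
    · have hθ' : θ (-n) ≠ -n := by rwa [map_neg, ne_eq, neg_inj]
      have h1 := (key' (hF.closed.neg n hn) (by rw [ht_neg]; omega) hθ').2 htopV
      have h2 := hneg (hF.closed.neg n hn) hθ' h1
      rwa [neg_neg] at h2
    · exact (key' hn h0 hθ).2 htopV
  have hspan : Submodule.span ℂ {x | ∃ n ∈ S, x = tv E θ n ∨ x = hh φ (toC (emb (n - θ n)))} ≤
      V := by
    rw [Submodule.span_le]
    rintro _ ⟨n, hn, h⟩
    by_cases hθ : θ n = n
    · rcases h with rfl | rfl
      · rw [tv, hθ, sub_self]; exact zero_mem _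
      · rw [hθ, sub_self, emb_zero, toC_zero, hh_zero]; exact zero_mem _
    · rcases h with rfl | rfl
      · exact hall hn hθ
      · exact hhv hn hθ (hall hn hθ)
  exact hspan (hF.antifixed_mem_span hx hΘ)

/-- Irreducibility is `mem_of_stable`, and `tv E θ top` is the highest weight vector. To see that
every vector of a simple root space annihilates it, the root condition is used at `ρ` alone:
regularity already forces such a vector to be a multiple of `yv E θ (r j)`. -/
theorem isFundamental {ι : Type} [DecidableEq ι] {r : ι → Fin 7 → ℤ} (hr : ∀ i, r i ∈ S)
    {top ρ : Fin 7 → ℤ} (htop : IsTop S θ top) (hρ : IsRegularFor S θ ρ)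
    {W : LieSubmodule ℂ K L} (hW : ∀ x, x ∈ W ↔ x ∈ rootSpan φ E S ∧ Θ x = -x)
    {α αv : ι → Fin 7 → ℝ} (hα : ∀ i, (2 : ℝ) • α i = emb (r i + θ (r i)))
    (hαv : ∀ i, αv i = emb (cv θ (r i))) {i : ι}
    (hdom : ∀ j, 0 ≤ dotZ (r j) top ∧ (0 ≤ dotZ (θ (r j)) top ∨ θ (r j) ≠ r j ∧
      dotZ (θ (r j)) top = -1 ∧ θ (θ (r j) + top) = θ (r j) + top))
    (hwt : ∀ j, dotZ top (cv θ (r j)) = if j = i then 1 else 0) :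
    IsFundamental φ α αv i W := by
  have htop0 : tv E θ top ≠ 0 := hF.tv_ne_zero hE htop.mem htop.moved
  have htopW : tv E θ top ∈ W := (hW _).2 ⟨hF.tv_mem htop.mem, hF.map_tv htop.mem⟩
  refine ⟨?_, tv E θ top, htopW, htop0, ?_, ?_⟩
  · have : Nontrivial W := ⟨⟨⟨_, htopW⟩, 0, fun h => htop0 (congrArg Subtype.val h)⟩⟩
    apply LieModule.IsIrreducible.mk
    intro N hN
    let V : Submodule ℂ L := N.toSubmodule.map W.toSubmodule.subtype
    have hVW {x : L} (hx : x ∈ V) : x ∈ W := by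
      obtain ⟨y, _, rfl⟩ := hx
      exact y.2
    have hV0 : V ≠ ⊥ := by
      intro h
      apply hN
      rw [← LieSubmodule.toSubmodule_eq_bot]
      rw [Submodule.eq_bot_iff] at h ⊢
      exact fun x hx => Subtype.ext (h _ ⟨x, hx, rfl⟩)
    rw [eq_top_iff]
    rintro ⟨x, hx⟩ -
    obtain ⟨h1, h2⟩ := (hW x).1 hx
    obtain ⟨y, hy, hyx⟩ := hF.mem_of_stable hE hR hK htop hρ (V := V)
      (fun x hx => (hW x).1 (hVW hx)) hV0 (by
        rintro x hx _ ⟨y, hy, rfl⟩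
        exact ⟨(⁅(⟨x, hx⟩ : K), (show W from y)⁆ : W), N.lie_mem hy, rfl⟩) h1 h2
    have : y = ⟨x, hx⟩ := Subtype.ext hyx
    rwa [← this]
  · intro j
    rw [hαv, hF.lie_hh_tv hE htop.mem (hF.map_hh_of_fixed (hF.theta_cv _)), toC_emb_dot, hwt]
    norm_cast
  · intro j x hx hxα
    by_cases hx0 : x = 0
    · rw [hx0, zero_lie]
    obtain ⟨h1, h2⟩ := (hK x).1 hx
    have hρf := hF.map_hh_of_fixed hρ.fixed
    have hρK : hh φ (toC (emb ρ)) ∈ K :=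
      (hK _).2 ⟨(hh_mem_rootSpan_iff hE hR hF.closed.subset).2 hρ.mem, hρf⟩
    have hval : toC (α j) ⬝ᵥ toC (emb ρ) = (dotZ (r j) ρ : ℂ) := by
      have h4 := congrArg toC (hα j)
      rw [toC_smul, emb_add, toC_add] at h4
      have h5 := congrArg (fun v => v ⬝ᵥ toC (emb ρ)) h4
      simp only [smul_dotProduct, add_dotProduct, hF.dot_theta hE (hr j) hρf, toC_emb_dot] at h5
      rw [← two_mul] at h5
      exact mul_left_cancel₀ two_ne_zero (by simpa using h5)
    have hμ := hxα _ hρK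
    rw [hval] at hμ
    have hreg : ∀ m ∈ S, toC (emb m) ⬝ᵥ toC (emb ρ) ≠ 0 ∧ ∀ n ∈ S,
        toC (emb m) ⬝ᵥ toC (emb ρ) = toC (emb n) ⬝ᵥ toC (emb ρ) → n = m ∨ n = θ m := by
      intro m hm
      simp only [toC_emb_dot]
      refine ⟨by exact_mod_cast hρ.ne_zero m hm, fun n hn h => hρ.eq_or m hm n hn ?_⟩
      exact_mod_cast h
    have hx0' := hx0
    rcases eigenvector_cases hE hR (θ := θ) hF.closed.subset h1 hx0 hμ hreg with
      ⟨u, hu, rfl⟩ | ⟨m, hm, a, b, rfl⟩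
    · rw [lie_hh_hh] at hμ
      rcases smul_eq_zero.1 hμ.symm with h | h
      · exact absurd (by exact_mod_cast h) (hρ.ne_zero _ (hr j))
      · exact absurd h hx0
    · obtain ⟨t, ht, h3⟩ := hF.eq_smul_yv hE hm hx0 h2
      rw [h3] at hμ ⊢
      rw [lie_smul, hF.lie_hh_yv hE hm hρf, smul_comm, toC_emb_dot] at hμ
      have h4 : (dotZ m ρ : ℂ) = dotZ (r j) ρ :=
        smul_left_injective ℂ (by rw [← h3]; exact hx0) hμ
      have h5 : yv E θ m = yv E θ (r j) := by
        rcases hρ.eq_or _ (hr j) m hm (by exact_mod_cast h4.symm) with rfl | rfl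
        · rfl
        · rw [hF.yv_theta]
      rw [smul_lie, h5, hF.lie_yv_tv_eq_zero hE hR (hr j) htop.mem (hdom j).1 (hdom j).2,
        smul_zero]

end IsFolding

/-! ### The representations of dimensions `26` and `7` -/

/-- A representative of the highest weight of the representation of dimension `26`. -/
def top26 : Fin 7 → ℤ := ![1, 2, 2, 1, 1, 1, 0]
/-- A representative of the highest weight of the representation of dimension `7`. -/
def top7 : Fin 7 → ℤ := ![0, 1, 1, 0, 0, 1, 0]

lemma top26_steps : ∀ n ∈ C6, ht n < 20 ∧ (0 < ht n → lamZ n = n ∨ n = top26 ∨ n = lamZ top26 ∨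
    ∃ i : Fin 6, dotZ (Pi.single i.castSucc 1) n = -1 ∧
      (lamZ (Pi.single i.castSucc 1) = Pi.single i.castSucc 1 ∨
        dotZ (lamZ (Pi.single i.castSucc 1)) n = 0) ∧
      lamZ (Pi.single i.castSucc 1 + n) ≠ Pi.single i.castSucc 1 + n) := by
  decide +kernel

lemma top7_steps : ∀ n ∈ C8, 0 < ht n → lamZ n = n ∨ n = top7 ∨ n = lamZ top7 ∨
    ∃ i, dotZ (Pi.single (pos8 i) 1) n = -1 ∧
      (lamZ (Pi.single (pos8 i) 1) = Pi.single (pos8 i) 1 ∨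
        dotZ (lamZ (Pi.single (pos8 i) 1)) n = 0) ∧
      lamZ (Pi.single (pos8 i) 1 + n) ≠ Pi.single (pos8 i) 1 + n := by
  decide +kernel

lemma isTop_top26 : IsTop C6 lamHom top26 where
  mem := by decide +kernel
  moved := by decide +kernel
  ht_lt n hn := (top26_steps n hn).1
  ht_ne_zero n hn := (C6_bounds n hn).2.1
  step n hn h hθ := by
    rcases ((top26_steps n hn).2 h).resolve_left hθ with h | h | ⟨i, h1, h2, h3⟩
    · exact Or.inl h
    · exact Or.inr (Or.inl h)
    · exact Or.inr (Or.inr ⟨_, single_facts.1 i, single_facts.2.2.2.2.1 _, h1, h2, h3⟩)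

lemma isTop_top7 : IsTop C8 lamHom top7 where
  mem := by decide +kernel
  moved := by decide +kernel
  ht_lt n hn := (top26_steps n (C8_subset_C6 hn)).1
  ht_ne_zero n hn := (C6_bounds n (C8_subset_C6 hn)).2.1
  step n hn h hθ := by
    rcases (top7_steps n hn h).resolve_left hθ with h | h | ⟨i, h1, h2, h3⟩
    · exact Or.inl h
    · exact Or.inr (Or.inl h)
    · exact Or.inr (Or.inr ⟨_, single_facts.2.1 i, single_facts.2.2.2.2.1 _, h1, h2, h3⟩)

lemma top26_weights : ∀ j, (0 ≤ dotZ (simpleFZ j) top26 ∧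
    (0 ≤ dotZ (lamZ (simpleFZ j)) top26 ∨ lamZ (simpleFZ j) ≠ simpleFZ j ∧
      dotZ (lamZ (simpleFZ j)) top26 = -1 ∧
      lamZ (lamZ (simpleFZ j) + top26) = lamZ (simpleFZ j) + top26)) ∧
    dotZ top26 (simpleCoFZ j) = if j = 3 then 1 else 0 := by
  decide +kernel

lemma top7_weights : ∀ j : Fin 3, (0 ≤ dotZ (simpleFZ j.castSucc) top7 ∧
    (0 ≤ dotZ (lamZ (simpleFZ j.castSucc)) top7 ∨
      lamZ (simpleFZ j.castSucc) ≠ simpleFZ j.castSucc ∧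
      dotZ (lamZ (simpleFZ j.castSucc)) top7 = -1 ∧
      lamZ (lamZ (simpleFZ j.castSucc) + top7) = lamZ (simpleFZ j.castSucc) + top7)) ∧
    dotZ top7 (simpleCoFZ j.castSucc) = if j = 0 then 1 else 0 := by
  decide +kernel

variable {Λ : L ≃ₗ⁅ℂ⁆ L} [FiniteDimensional ℂ L] [LieAlgebra.IsKilling ℂ L]
  [H.IsCartanSubalgebra] (hE : IsChevalley φ E)
  (hR : Set.range (LieAlgebra.IsKilling.rootSystem H).root = form φ '' R7)
include hE hR

theorem rep26_isFundamental (hΛ : IsLift φ E Λ) :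
    IsFundamental φ simpleF simpleCoF 3 (rep26 φ Λ) :=
  hΛ.isFolding_C6.isFundamental hE hR (fun _ => mem_f4 hE hR) single_facts.2.2.1 isTop_top26
    isRegularFor_C6 (fun _ => mem_rep26 hE hR) two_smul_simpleF
    (fun i => by rw [cv_simpleFZ, simpleCoF_eq]) (fun j => (top26_weights j).1)
    (fun j => by rw [cv_simpleFZ, (top26_weights j).2])

theorem rep7_isFundamental (hΛ : IsLift φ E Λ) :
    IsFundamental φ (fun i : Fin 3 => simpleF i.castSucc) (fun i => simpleCoF i.castSucc) 0
      (rep7 φ Λ) :=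
  hΛ.isFolding_C8.isFundamental hE hR (fun _ => mem_so7 hE hR) single_facts.2.2.2.1 isTop_top7
    isRegularFor_C8 (fun _ => mem_rep7 hE hR) (fun i => two_smul_simpleF i.castSucc)
    (fun i => by rw [cv_simpleFZ, simpleCoF_eq]) (fun j => (top7_weights j).1)
    (fun j => by rw [cv_simpleFZ, (top7_weights j).2])

end Lie

end

end E7

namespace E7

noncomputable section

/-! ### Orbits of `λ₇` on the roots, with labels -/

lemma C8_orbits : ∀ n ∈ C8, (∃ j, ∃ s : ℤˣ, n = (s : ℤ) • cFix j) ∨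
    ∃ j, ∃ s : ℤˣ, n = (s : ℤ) • cMov j ∨ n = lamZ ((s : ℤ) • cMov j) := by
  decide +kernel

lemma cFix_facts : ∀ j, ∀ s : ℤˣ, (s : ℤ) • cFix j ∈ C8 ∧ lamZ ((s : ℤ) • cFix j) =
    (s : ℤ) • cFix j := by
  decide +kernel

lemma cMov_mem : ∀ j, ∀ s : ℤˣ, (s : ℤ) • cMov j ∈ C8 := by decide +kernel

lemma C6_orbits : ∀ n ∈ C6, n ∈ C8 ∨ (∃ a s, n = cR a s ∨ n = lamZ (cR a s)) ∨
    (∃ a s, (a ≠ 3 ∧ a ≠ 7) ∧ n = cL a s) ∨ ∃ s, n = cL 3 s ∨ n = lamZ (cL 3 s) := by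
  decide +kernel

lemma C7_orbits : ∀ n ∈ C7, n ∈ C6 ∨ (∃ a s, n = cRp a s ∨ n = lamZ (cRp a s)) ∨
    (∃ a, (a ≠ 3 ∧ a ≠ 7) ∧ (n = cLp a 1 ∨ n = lamZ (cLp a 1))) ∨
    (∃ s, n = cLp 3 s ∨ n = lamZ (cLp 3 s)) ∨ (∃ s, n = cE 0 s ∨ n = lamZ (cE 0 s)) ∨
    (n = cE 1 1 ∨ n = lamZ (cE 1 1)) := by
  decide +kernel

lemma not_mem_labels : (∀ a s, cR a s ∉ C8) ∧ (∀ a s, cL a s ∉ C8) ∧ (∀ a s, cRp a s ∉ C6) ∧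
    (∀ a s, cLp a s ∉ C6) ∧ (∀ j s, cE j s ∉ C6) := by
  decide +kernel

lemma lamZ_cR : ∀ a s, lamZ (cR a s) = cV a s := by decide +kernel
lemma lamZ_cRp : ∀ a s, lamZ (cRp a s) = cVp a (-s) := by decide +kernel
lemma lamZ_cL : ∀ a s, a ≠ 3 ∧ a ≠ 7 → lamZ (cL a s) = cL a s := by decide +kernel
lemma lamZ_cL_three : ∀ s, lamZ (cL 3 s) = cL 7 s := by decide +kernel
lemma lamZ_cLp : ∀ a s, a ≠ 3 ∧ a ≠ 7 → lamZ (cLp a s) = cLp a (-s) := by decide +kernel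
lemma lamZ_cLp_three : ∀ s, lamZ (cLp 3 s) = cLp 7 (-s) := by decide +kernel
lemma lamZ_cE_zero : ∀ s, lamZ (cE 0 s) = cE 2 (-s) := by decide +kernel
lemma lamZ_cE_one : ∀ s, lamZ (cE 1 s) = cE 1 (-s) := by decide +kernel

/-! ### Homogeneous components -/

/-- The sign `(-1)^k`. -/
def eps (k : ZMod 2) : ℂ := (-1 : ℂ) ^ k.val

@[simp] lemma eps_zero : eps 0 = 1 := by simp [eps]
@[simp] lemma eps_one : eps 1 = -1 := by simp [eps, ZMod.val_one]
lemma eps_cases (k : ZMod 2) : k = 0 ∧ eps k = 1 ∨ k = 1 ∧ eps k = -1 := by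
  fin_cases k
  · exact Or.inl ⟨rfl, eps_zero⟩
  · exact Or.inr ⟨rfl, eps_one⟩
lemma eps_mul_self (k : ZMod 2) : eps k * eps k = 1 := by
  rcases eps_cases k with ⟨-, h⟩ | ⟨-, h⟩ <;> rw [h] <;> norm_num
lemma eps_add (k l : ZMod 2) : eps (k + l) = eps k * eps l := by
  rcases eps_cases k with ⟨rfl, h⟩ | ⟨rfl, h⟩ <;> rcases eps_cases l with ⟨rfl, h'⟩ | ⟨rfl, h'⟩
  · simp
  · simp
  · simp
  · rw [show (1 : ZMod 2) + 1 = 0 from rfl]; simp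

lemma lam_complex_apply (v : Fin 7 → ℂ) : lam ℂ v =
    ![(v 0 + v 1 + v 2 - v 3) / 2, (v 0 + v 1 - v 2 + v 3) / 2, (v 0 - v 1 + v 2 + v 3) / 2,
      (-v 0 + v 1 + v 2 + v 3) / 2, -v 6, -v 5, -v 4] := by
  ext i
  fin_cases i <;>
    simp [lam, lamMatrix, Matrix.toLin'_apply, Matrix.mulVec, dotProduct, Fin.sum_univ_seven] <;>
    ring

lemma lam_complex_lam_complex (v : Fin 7 → ℂ) : lam ℂ (lam ℂ v) = v := by
  rw [lam_complex_apply, lam_complex_apply]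
  ext i
  fin_cases i <;> simp <;> ring

section Lie

variable {L : Type*} [LieRing L] [LieAlgebra ℂ L] {H : LieSubalgebra ℂ L}
  {φ : H ≃ₗ[ℂ] (Fin 7 → ℂ)} {E : (Fin 7 → ℝ) → L} {Λ : L ≃ₗ⁅ℂ⁆ L}

/-- The vector `E n + (-1)^k E (λ₇ n)`. -/
def tk (E : (Fin 7 → ℝ) → L) (k : ZMod 2) (n : Fin 7 → ℤ) : L :=
  E (emb n) + eps k • E (emb (lamZ n))

lemma tk_lamZ (k : ZMod 2) (n : Fin 7 → ℤ) : tk E k (lamZ n) = eps k • tk E k n := by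
  rw [tk, tk, lamZ_lamZ, smul_add, smul_smul, eps_mul_self, one_smul, add_comm]

/-- Here and below, each generator is brought to the common form `tk` at an orbit representative, so
that degree, span and scalar products are computed once for all kinds. -/
lemma tR_eq (k : ZMod 2) (a : Fin 8) (s : ℤˣ) : tR E k a s = (c : ℂ) • tk E k (cR a s) := by
  rw [tR, tk, aR_eq, aV_eq, lamZ_cR]; rfl

lemma tL4_eq (k : ZMod 2) (s : ℤˣ) : tL4 E k s = (c : ℂ) • tk E k (cL 3 s) := by
  rw [tL4, tk, aL_eq, aL_eq, lamZ_cL_three]; rfl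

lemma tM_eq (j : Fin 3) (s : ℤˣ) : tM E j s = (c : ℂ) • tk E 1 ((s : ℤ) • cMov j) := by
  rw [tM, tk, eps_one, emb_units_smul, ← mov8_eq, ← lam_emb, emb_units_smul, mov8'_eq, ← lam_emb,
    neg_one_smul, sub_eq_add_neg]
  congr 4
  rcases Int.units_eq_one_or s with rfl | rfl <;> simp

lemma tRp_eq (k : ZMod 2) (a : Fin 8) (s : ℤˣ) : tRp E k a s = (c : ℂ) • tk E k (cRp a s) := by
  rw [tRp, tk, aRp_eq, aVp_eq, lamZ_cRp]; rfl

lemma tLp_eq (k : ZMod 2) (a : Fin 8) (ha : a ≠ 3 ∧ a ≠ 7) :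
    tLp E k a = (c : ℂ) • tk E k (cLp a 1) := by
  rw [tLp, tk, aLp_eq, aLp_eq, lamZ_cLp a 1 ha]; rfl

lemma tLp4_eq (k : ZMod 2) (s : ℤˣ) : tLp4 E k s = (c : ℂ) • tk E k (cLp 3 s) := by
  rw [tLp4, tk, aLp_eq, aLp_eq, lamZ_cLp_three]; rfl

lemma t5_eq (k : ZMod 2) (s : ℤˣ) : t5 E k s = (c : ℂ) • tk E k (cE 0 s) := by
  rw [t5, tk, aE_eq, aE_eq, lamZ_cE_zero]; rfl

lemma t6_eq (k : ZMod 2) (s : ℤˣ) : t6 E k s = (c : ℂ) • tk E k (cE 1 s) := by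
  rw [t6, tk, aE_eq, aE_eq, lamZ_cE_one]; rfl

lemma basisSo7_fix (j : Fin 6) (s : ℤˣ) :
    basisSo7 φ E (.fix j s) = E (emb ((s : ℤ) • cFix j)) := by
  rw [basisSo7, fix8_eq, emb_units_smul]

lemma basisSo7_mov (j : Fin 3) (s : ℤˣ) :
    basisSo7 φ E (.mov j s) = tk E 0 ((s : ℤ) • cMov j) := by
  rw [basisSo7, tk, eps_zero, one_smul, emb_units_smul, ← mov8_eq, ← lam_emb, emb_units_smul,
    mov8'_eq, ← lam_emb]
  congr 2
  rcases Int.units_eq_one_or s with rfl | rfl <;> simp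

lemma basisSo7_cartan (j : Fin 3) :
    basisSo7 φ E (.cartan j) = hh φ (toC (emb (simpleCoFZ j.castSucc))) := by
  rw [basisSo7, simpleCoF_eq]

lemma basisJ0_R (a : Fin 8) (s : ℤˣ) : basisJ0 φ E (.R a s) = tk E 0 (cR a s) := by
  rw [basisJ0, tR_eq, smul_smul, ← Complex.ofReal_mul, sqrt_two_eq, mul_assoc, c_sq]; simp

lemma basisJ0_L4 (s : ℤˣ) : basisJ0 φ E (.L4 s) = tk E 0 (cL 3 s) := by
  rw [basisJ0, tL4_eq, smul_smul, ← Complex.ofReal_mul, sqrt_two_eq, mul_assoc, c_sq]; simp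

lemma basisJ0_L (a : Fin 8) (ha : a ≠ 3 ∧ a ≠ 7) (s : ℤˣ) :
    basisJ0 φ E (.L a ha s) = E (emb (cL a s)) := by
  rw [basisJ0, aL_eq]

/-- Twice the projection to the homogeneous component of degree `k`. -/
def proj (Λ : L ≃ₗ⁅ℂ⁆ L) (k : ZMod 2) : L →ₗ[ℂ] L :=
  LinearMap.id + eps k • (Λ : L →ₗ[ℂ] L)

lemma proj_apply (k : ZMod 2) (x : L) : proj Λ k x = x + eps k • Λ x := rfl

lemma mem_grade {k : ZMod 2} {x : L} : x ∈ grade Λ k ↔ Λ x = eps k • x :=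
  Module.End.mem_eigenspace_iff

lemma mem_grade_zero {x : L} : x ∈ grade Λ 0 ↔ Λ x = x := by
  rw [mem_grade, eps_zero, one_smul]

lemma mem_grade_one {x : L} : x ∈ grade Λ 1 ↔ Λ x = -x := by
  rw [mem_grade, eps_one, neg_one_smul]

lemma proj_of_mem_grade {k : ZMod 2} {x : L} (hx : x ∈ grade Λ k) : proj Λ k x = (2 : ℂ) • x := by
  rw [proj_apply, mem_grade.1 hx, smul_smul, eps_mul_self, one_smul, two_smul]

/-- `proj Λ k` multiplies vectors of degree `k` by `2`, so the homogeneous part of `V` is contained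
in its image. -/
lemma inf_grade_le {k : ZMod 2} {V W : Submodule ℂ L} (h : V.map (proj Λ k) ≤ W) :
    V ⊓ grade Λ k ≤ W := by
  rintro x ⟨hx, hk⟩
  have h1 := W.smul_mem (2⁻¹ : ℂ) (h ⟨x, hx, proj_of_mem_grade hk⟩)
  rwa [smul_smul, inv_mul_cancel₀ two_ne_zero, one_smul] at h1

lemma map_span_proj_le {k : ZMod 2} {X : Set L} {W : Submodule ℂ L}
    (h : ∀ x ∈ X, proj Λ k x ∈ W) : (Submodule.span ℂ X).map (proj Λ k) ≤ W := by
  rw [Submodule.map_span, Submodule.span_le]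
  rintro _ ⟨x, hx, rfl⟩
  exact h x hx

lemma proj_mem_grade (hinv : ∀ x, Λ (Λ x) = x) (k : ZMod 2) (x : L) : proj Λ k x ∈ grade Λ k := by
  rw [mem_grade, proj_apply, map_add, map_smul, hinv, smul_add, smul_smul, eps_mul_self, one_smul,
    add_comm]

/-- Intersections do not distribute over sums in general; here they do because the projection
preserves both stable subspaces. -/
lemma sup_inf_grade (hinv : ∀ x, Λ (Λ x) = x) {V W : Submodule ℂ L} (hV : ∀ x ∈ V, Λ x ∈ V)
    (hW : ∀ x ∈ W, Λ x ∈ W) (k : ZMod 2) :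
    (V ⊔ W) ⊓ grade Λ k = (V ⊓ grade Λ k) ⊔ (W ⊓ grade Λ k) := by
  apply le_antisymm
  · apply inf_grade_le
    rw [Submodule.map_sup]
    apply sup_le_sup
    · rintro _ ⟨x, hx, rfl⟩
      exact ⟨add_mem hx (V.smul_mem _ (hV x hx)), proj_mem_grade hinv k x⟩
    · rintro _ ⟨x, hx, rfl⟩
      exact ⟨add_mem hx (W.smul_mem _ (hW x hx)), proj_mem_grade hinv k x⟩
  · rw [sup_le_iff]
    exact ⟨inf_le_inf_right _ le_sup_left, inf_le_inf_right _ le_sup_right⟩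

lemma disjoint_grade : Disjoint (grade Λ 0) (grade Λ 1) := by
  rw [Submodule.disjoint_def]
  intro x h0 h1
  rw [mem_grade_zero] at h0
  rw [mem_grade_one, h0] at h1
  have h2 : (2 : ℂ) • x = 0 := by
    rw [two_smul]; nth_rw 1 [h1]; exact neg_add_cancel x
  exact (smul_eq_zero.1 h2).resolve_left two_ne_zero

lemma grade_sup_grade (hinv : ∀ x, Λ (Λ x) = x) : grade Λ 0 ⊔ grade Λ 1 = ⊤ := by
  rw [eq_top_iff]
  intro x _
  have h : x = (2⁻¹ : ℂ) • proj Λ 0 x + (2⁻¹ : ℂ) • proj Λ 1 x := by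
    rw [proj_apply, proj_apply, eps_zero, eps_one]; module
  rw [h]
  exact add_mem (Submodule.mem_sup_left (Submodule.smul_mem _ _ (proj_mem_grade hinv 0 x)))
    (Submodule.mem_sup_right (Submodule.smul_mem _ _ (proj_mem_grade hinv 1 x)))

/-- A stable subspace is the sum of its homogeneous components. -/
lemma isSum_grade (hinv : ∀ x, Λ (Λ x) = x) {V : Submodule ℂ L} (hV : ∀ x ∈ V, Λ x ∈ V) :
    IsSum V (V ⊓ grade Λ 0) (V ⊓ grade Λ 1) := by
  refine ⟨disjoint_grade.mono inf_le_right inf_le_right, le_antisymm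
    (sup_le inf_le_left inf_le_left) fun x hx => ?_⟩
  have h : x = (2⁻¹ : ℂ) • proj Λ 0 x + (2⁻¹ : ℂ) • proj Λ 1 x := by
    rw [proj_apply, proj_apply, eps_zero, eps_one]; module
  rw [h]
  exact add_mem (Submodule.mem_sup_left (Submodule.smul_mem _ _
    ⟨add_mem hx (V.smul_mem _ (hV x hx)), proj_mem_grade hinv 0 x⟩))
    (Submodule.mem_sup_right (Submodule.smul_mem _ _
    ⟨add_mem hx (V.smul_mem _ (hV x hx)), proj_mem_grade hinv 1 x⟩))

lemma lie_mem_grade {k l : ZMod 2} {x y : L} (hx : x ∈ grade Λ k) (hy : y ∈ grade Λ l) :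
    ⁅x, y⁆ ∈ grade Λ (k + l) := by
  rw [mem_grade] at *
  rw [LieEquiv.map_lie, hx, hy, smul_lie, lie_smul, smul_smul, eps_add]

lemma isInternal_grade (hinv : ∀ x, Λ (Λ x) = x) : DirectSum.IsInternal (grade Λ) := by
  rw [DirectSum.isInternal_submodule_iff_isCompl (grade Λ) (i := 0) (j := 1) (by decide)
    (by symm; rw [Set.eq_univ_iff_forall]; decide)]
  exact ⟨disjoint_grade, codisjoint_iff.2 (grade_sup_grade hinv)⟩

lemma IsLift.proj_E (hΛ : IsLift φ E Λ) {n : Fin 7 → ℤ} (hn : n ∈ C7) (k : ZMod 2) :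
    proj Λ k (E (emb n)) = tk E k n := by
  rw [proj_apply, hΛ.map_E hn, tk]

lemma IsLift.map_hh_emb (hΛ : IsLift φ E Λ) (n : Fin 7 → ℤ) :
    Λ (hh φ (toC (emb n))) = hh φ (toC (emb (lamZ n))) := by
  rw [hΛ.map_hh, lam_emb]

variable [FiniteDimensional ℂ L] [LieAlgebra.IsKilling ℂ L] [H.IsCartanSubalgebra]
  (hE : IsChevalley φ E)
  (hR : Set.range (LieAlgebra.IsKilling.rootSystem H).root = form φ '' R7)

include hE hR in
theorem IsLift.involutive (hΛ : IsLift φ E Λ) (x : L) : Λ (Λ x) = x := by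
  obtain ⟨u, a, rfl⟩ := hE.exists_coord hR x
  rw [map_add, map_add, map_sum, map_sum, hΛ.cartan, hΛ.cartan, lam_complex_lam_complex]
  refine congrArg _ (Finset.sum_congr rfl fun n hn => ?_)
  have hn' := List.mem_toFinset.1 hn
  rw [map_smul, map_smul, hΛ.map_E hn', hΛ.map_E (C7_lam hn'), lamZ_lamZ]

lemma IsLift.tk_mem_grade (hΛ : IsLift φ E Λ) {n : Fin 7 → ℤ} (hn : n ∈ C7) (k : ZMod 2) :
    tk E k n ∈ grade Λ k := by
  rw [mem_grade, tk, map_add, map_smul, hΛ.map_E hn, hΛ.map_E (C7_lam hn), lamZ_lamZ, smul_add,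
    smul_smul, eps_mul_self, one_smul, add_comm]

end Lie

end

end E7

namespace E7

noncomputable section

section Lie

variable {L : Type*} [LieRing L] [LieAlgebra ℂ L] {H : LieSubalgebra ℂ L}
  {φ : H ≃ₗ[ℂ] (Fin 7 → ℂ)} {E : (Fin 7 → ℝ) → L} {Λ : L ≃ₗ⁅ℂ⁆ L}

/-! ### The spaces spanned by the GS generators -/

lemma span_eq_inf_grade {ι : Type} {v : ι → L} {V : Submodule ℂ L} {k : ZMod 2}
    (h1 : ∀ i, v i ∈ V ∧ v i ∈ grade Λ k)
    (h2 : V.map (proj Λ k) ≤ Submodule.span ℂ (Set.range v)) :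
    Submodule.span ℂ (Set.range v) = V ⊓ grade Λ k := by
  apply le_antisymm _ (inf_grade_le h2)
  rw [Submodule.span_le]
  rintro _ ⟨i, rfl⟩
  exact h1 i

lemma mem_of_c_smul_mem {V : Submodule ℂ L} {x : L} (h : (c : ℂ) • x ∈ V) : x ∈ V := by
  have h1 := V.smul_mem ((2 : ℂ) * c) h
  rw [smul_smul, mul_assoc, ← Complex.ofReal_mul, c_sq] at h1
  simpa using h1

lemma mem_span_range {ι : Type} {v : ι → L} (i : ι) : v i ∈ Submodule.span ℂ (Set.range v) :=
  Submodule.subset_span ⟨i, rfl⟩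

/-- The two roots of an orbit define the same vector up to sign, so one representative per orbit is
enough. -/
lemma tk_mem_of {V : Submodule ℂ L} {k : ZMod 2} {n m : Fin 7 → ℤ} (h : tk E k m ∈ V)
    (hn : n = m ∨ n = lamZ m) : tk E k n ∈ V := by
  rcases hn with rfl | rfl
  · exact h
  · rw [tk_lamZ]; exact V.smul_mem _ h

lemma IsLift.map_hA1 (hΛ : IsLift φ E Λ) : Λ (hh φ (toC hA1)) = -hh φ (toC hA1) := by
  rw [hΛ.map_hh, hA1, map_smul, map_sub, lam_simple, lam_simple]
  rw [← hh_neg, ← toC_neg, ← smul_neg, neg_sub]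
  rfl

lemma IsLift.map_hA2 (hΛ : IsLift φ E Λ) : Λ (hh φ (toC hA2)) = -hh φ (toC hA2) := by
  rw [hΛ.map_hh, hA2, map_smul, map_sub, lam_simple, lam_simple]
  rw [← hh_neg, ← toC_neg, ← smul_neg, neg_sub]
  rfl

lemma IsLift.map_sum_e (hΛ : IsLift φ E Λ) :
    Λ (hh φ (toC (e 4 + e 5 + e 6))) = -hh φ (toC (e 4 + e 5 + e 6)) := by
  rw [hΛ.map_hh, ← hh_neg, ← toC_neg]
  congr 2
  rw [lam_apply]
  ext i
  fin_cases i <;> simp [e]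

lemma hh_hE5 : hh φ (toC hE5) = (((√3)⁻¹ : ℝ) : ℂ) • hh φ (toC (e 4 + e 5 + e 6)) := by
  rw [hE5, toC_smul, hh_smul]

lemma IsLift.map_hE5 (hΛ : IsLift φ E Λ) : Λ (hh φ (toC hE5)) = -hh φ (toC hE5) := by
  rw [hh_hE5, map_smul, hΛ.map_sum_e, smul_neg]

lemma lamZ_simpleCoFZ : ∀ j, lamZ (simpleCoFZ j) = simpleCoFZ j := by decide +kernel

lemma IsLift.map_simpleCoF (hΛ : IsLift φ E Λ) (j : Fin 4) :
    Λ (hh φ (toC (simpleCoF j))) = hh φ (toC (simpleCoF j)) := by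
  rw [simpleCoF_eq, hΛ.map_hh_emb, lamZ_simpleCoFZ]

variable [FiniteDimensional ℂ L] [LieAlgebra.IsKilling ℂ L] [H.IsCartanSubalgebra]
  (hE : IsChevalley φ E)
  (hR : Set.range (LieAlgebra.IsKilling.rootSystem H).root = form φ '' R7)

include hE hR

lemma spJ_eq : spJ φ = Submodule.span ℂ ({x | ∃ n, (n ∈ C6 ∧ n ∉ C8) ∧ x = E (emb n)} ∪
    {hh φ (toC hA1), hh φ (toC (simpleCoF 3))}) := by
  apply le_antisymm
  · rw [spJ, Submodule.span_le]
    rintro x (⟨α, ⟨h6, h8⟩, hx⟩ | hx)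
    · rw [R6_eq] at h6
      obtain ⟨n, hn, rfl⟩ := h6
      rw [emb_mem_R8] at h8
      have hn7 := (mem_C6.1 hn).1
      obtain ⟨a, rfl⟩ := (hE.root hn7).exists_smul hR hn7 (hE.ne_zero hn7) hx
      exact Submodule.smul_mem _ _ (Submodule.subset_span (Or.inl ⟨n, ⟨hn, h8⟩, rfl⟩))
    · exact Submodule.subset_span (Or.inr hx)
  · rw [spJ]
    apply Submodule.span_mono
    apply Set.union_subset_union_left
    rintro _ ⟨n, ⟨hn, h8⟩, rfl⟩
    exact ⟨emb n, ⟨emb_mem_R6.2 hn, fun h => h8 (emb_mem_R8.1 h)⟩, hE.root (mem_C6.1 hn).1⟩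

lemma spI_eq : spI φ = Submodule.span ℂ ({x | ∃ n, (n ∈ C7 ∧ n ∉ C6) ∧ x = E (emb n)} ∪
    {hh φ (toC (e 4 + e 5 + e 6))}) := by
  apply le_antisymm
  · rw [spI, Submodule.span_le]
    rintro x (⟨α, ⟨h6, h8⟩, hx⟩ | hx)
    · rw [R7_eq] at h6
      obtain ⟨n, hn, rfl⟩ := h6
      rw [emb_mem_R6] at h8
      obtain ⟨a, rfl⟩ := (hE.root hn).exists_smul hR hn (hE.ne_zero hn) hx
      exact Submodule.smul_mem _ _ (Submodule.subset_span (Or.inl ⟨n, ⟨hn, h8⟩, rfl⟩))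
    · exact Submodule.subset_span (Or.inr hx)
  · rw [spI]
    apply Submodule.span_mono
    apply Set.union_subset_union_left
    rintro _ ⟨n, ⟨hn, h8⟩, rfl⟩
    exact ⟨emb n, ⟨emb_mem_R7.2 hn, fun h => h8 (emb_mem_R6.1 h)⟩, hE.root hn⟩

lemma E_mem_spJ {n : Fin 7 → ℤ} (hn : n ∈ C6) (h8 : n ∉ C8) : E (emb n) ∈ spJ φ := by
  rw [spJ_eq hE hR]; exact Submodule.subset_span (Or.inl ⟨n, ⟨hn, h8⟩, rfl⟩)

lemma E_mem_spI {n : Fin 7 → ℤ} (hn : n ∈ C7) (h6 : n ∉ C6) : E (emb n) ∈ spI φ := by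
  rw [spI_eq hE hR]; exact Submodule.subset_span (Or.inl ⟨n, ⟨hn, h6⟩, rfl⟩)

omit hE hR [FiniteDimensional ℂ L] [LieAlgebra.IsKilling ℂ L] [H.IsCartanSubalgebra] in
lemma lamZ_not_mem_C8 {n : Fin 7 → ℤ} (h : n ∉ C8) : lamZ n ∉ C8 := fun h' =>
  h (by have := lamZ_mem_C8 h'; rwa [lamZ_lamZ] at this)

omit hE hR [FiniteDimensional ℂ L] [LieAlgebra.IsKilling ℂ L] [H.IsCartanSubalgebra] in
lemma lamZ_not_mem_C6 {n : Fin 7 → ℤ} (h : n ∉ C6) : lamZ n ∉ C6 := fun h' =>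
  h (by have := lamZ_mem_C6 h'; rwa [lamZ_lamZ] at this)

lemma tk_mem_spJ {n : Fin 7 → ℤ} (hn : n ∈ C6) (h8 : n ∉ C8) (k : ZMod 2) :
    tk E k n ∈ spJ φ :=
  add_mem (E_mem_spJ hE hR hn h8)
    (Submodule.smul_mem _ _ (E_mem_spJ hE hR (lamZ_mem_C6 hn) (lamZ_not_mem_C8 h8)))

lemma tk_mem_spI {n : Fin 7 → ℤ} (hn : n ∈ C7) (h6 : n ∉ C6) (k : ZMod 2) :
    tk E k n ∈ spI φ :=
  add_mem (E_mem_spI hE hR hn h6)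
    (Submodule.smul_mem _ _ (E_mem_spI hE hR (C7_lam hn) (lamZ_not_mem_C6 h6)))

omit hE hR [FiniteDimensional ℂ L] [LieAlgebra.IsKilling ℂ L] [H.IsCartanSubalgebra] in
lemma tk_mem_rootSpan {n : Fin 7 → ℤ} (hn : n ∈ C8) (k : ZMod 2) :
    tk E k n ∈ rootSpan φ E C8 :=
  add_mem (E_mem_rootSpan hn) (Submodule.smul_mem _ _ (E_mem_rootSpan (lamZ_mem_C8 hn)))

variable (hΛ : IsLift φ E Λ)
include hΛ

/-! ### Stability under `λ₇` -/

lemma map_mem_e6 {x : L} (hx : x ∈ (e6 φ).toSubmodule) : Λ x ∈ (e6 φ).toSubmodule := by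
  rw [e6_toSubmodule hE hR] at *
  have h : (rootSpan φ E C6).map (Λ : L →ₗ[ℂ] L) ≤ rootSpan φ E C6 := by
    rw [rootSpan, Submodule.map_span, Submodule.span_le]
    rintro _ ⟨_, ⟨n, hn, rfl | rfl⟩, rfl⟩
    · change Λ (E (emb n)) ∈ _
      rw [hΛ.map_E (mem_C6.1 hn).1]
      exact E_mem_rootSpan (lamZ_mem_C6 hn)
    · change Λ (hh φ (toC (emb n))) ∈ _
      rw [hΛ.map_hh_emb]
      exact hh_mem_rootSpan (lamZ_mem_C6 hn)
  exact h ⟨x, hx, rfl⟩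

lemma map_mem_so8 {x : L} (hx : x ∈ (so8 φ).toSubmodule) : Λ x ∈ (so8 φ).toSubmodule := by
  rw [so8_toSubmodule hE hR] at *
  have h : (rootSpan φ E C8).map (Λ : L →ₗ[ℂ] L) ≤ rootSpan φ E C8 := by
    rw [rootSpan, Submodule.map_span, Submodule.span_le]
    rintro _ ⟨_, ⟨n, hn, rfl | rfl⟩, rfl⟩
    · change Λ (E (emb n)) ∈ _
      rw [hΛ.map_E (mem_C8.1 hn).1]
      exact E_mem_rootSpan (lamZ_mem_C8 hn)
    · change Λ (hh φ (toC (emb n))) ∈ _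
      rw [hΛ.map_hh_emb]
      exact hh_mem_rootSpan (lamZ_mem_C8 hn)
  exact h ⟨x, hx, rfl⟩

lemma map_mem_spJ {x : L} (hx : x ∈ spJ φ) : Λ x ∈ spJ φ := by
  have h : (spJ φ).map (Λ : L →ₗ[ℂ] L) ≤ spJ φ := by
    nth_rw 1 [spJ_eq hE hR]
    rw [Submodule.map_span, Submodule.span_le]
    rintro _ ⟨_, (⟨n, ⟨hn, h8⟩, rfl⟩ | rfl | rfl), rfl⟩
    · change Λ (E (emb n)) ∈ _
      rw [hΛ.map_E (mem_C6.1 hn).1]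
      exact E_mem_spJ hE hR (lamZ_mem_C6 hn) (lamZ_not_mem_C8 h8)
    · change Λ (hh φ (toC hA1)) ∈ _
      rw [hΛ.map_hA1]
      exact neg_mem (Submodule.subset_span (Or.inr (Or.inl rfl)))
    · change Λ (hh φ (toC (simpleCoF 3))) ∈ _
      rw [hΛ.map_simpleCoF]
      exact Submodule.subset_span (Or.inr (Or.inr rfl))
  exact h ⟨x, hx, rfl⟩

lemma map_mem_spI {x : L} (hx : x ∈ spI φ) : Λ x ∈ spI φ := by
  have h : (spI φ).map (Λ : L →ₗ[ℂ] L) ≤ spI φ := by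
    nth_rw 1 [spI_eq hE hR]
    rw [Submodule.map_span, Submodule.span_le]
    rintro _ ⟨_, (⟨n, ⟨hn, h6⟩, rfl⟩ | rfl), rfl⟩
    · change Λ (E (emb n)) ∈ _
      rw [hΛ.map_E hn]
      exact E_mem_spI hE hR (C7_lam hn) (lamZ_not_mem_C6 h6)
    · change Λ (hh φ (toC (e 4 + e 5 + e 6))) ∈ _
      rw [hΛ.map_sum_e]
      exact neg_mem (Submodule.subset_span (Or.inr rfl))
  exact h ⟨x, hx, rfl⟩

/-! ### Spanning sets of the homogeneous components -/

lemma span_basisSo7 : Submodule.span ℂ (Set.range (basisSo7 φ E)) =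
    (so8 φ).toSubmodule ⊓ grade Λ 0 := by
  rw [so8_toSubmodule hE hR]
  apply span_eq_inf_grade
  · rintro (⟨j, s⟩ | ⟨j, s⟩ | j)
    · rw [basisSo7_fix, mem_grade_zero]
      obtain ⟨h1, h2⟩ := cFix_facts j s
      exact ⟨E_mem_rootSpan h1, by rw [hΛ.map_E (mem_C8.1 h1).1, h2]⟩
    · rw [basisSo7_mov]
      have h1 := cMov_mem j s
      exact ⟨tk_mem_rootSpan h1 0, hΛ.tk_mem_grade (mem_C8.1 h1).1 0⟩
    · rw [basisSo7_cartan, mem_grade_zero, hΛ.map_hh_emb, lamZ_simpleCoFZ, ← cv_simpleFZ]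
      exact ⟨hΛ.isFolding_C8.hh_cv_mem (single_facts.2.2.2.1 j), rfl⟩
  · rw [rootSpan]
    apply map_span_proj_le
    rintro _ ⟨n, hn, rfl | rfl⟩
    · rw [hΛ.proj_E (mem_C8.1 hn).1]
      rcases C8_orbits n hn with ⟨j, s, rfl⟩ | ⟨j, s, h⟩
      · rw [tk, (cFix_facts j s).2, ← basisSo7_fix (φ := φ) (E := E)]
        exact add_mem (mem_span_range _) (Submodule.smul_mem _ _ (mem_span_range _))
      · refine tk_mem_of ?_ h
        rw [← basisSo7_mov (φ := φ)]
        exact mem_span_range _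
    · rw [proj_apply, eps_zero, one_smul, hΛ.map_hh_emb, ← hh_add, ← toC_add, ← emb_add]
      have h1 := hΛ.isFolding_C8.hh_add_theta_mem isSimpleSystem_C8 hn
      refine Submodule.span_mono ?_ h1
      rintro _ ⟨i, rfl⟩
      refine ⟨.cartan i, ?_⟩
      rw [basisSo7_cartan, ← cv_simpleFZ]

lemma span_basis7 : Submodule.span ℂ (Set.range (basis7 φ E)) =
    (so8 φ).toSubmodule ⊓ grade Λ 1 := by
  -- The anti-invariant part of the Cartan subalgebra of `so(8)` is the line through `α₂ - α₄`.
  have hsub : ∀ n ∈ C8, n - lamZ n = (n 1 - n 3) • (Pi.single 1 1 - Pi.single 3 1) := by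
    decide +kernel
  have hA : (c : ℂ) • hh φ (toC (emb (Pi.single 1 1 - Pi.single 3 1))) = hh φ (toC hA2) := by
    rw [hA2, toC_smul, hh_smul, emb_sub, emb_single, emb_single]
  rw [so8_toSubmodule hE hR]
  apply span_eq_inf_grade
  · rintro (⟨j, s⟩ | -)
    · have h1 := cMov_mem j s
      change tM E j s ∈ _ ∧ tM E j s ∈ _
      rw [tM_eq]
      exact ⟨Submodule.smul_mem _ _ (tk_mem_rootSpan h1 1),
        Submodule.smul_mem _ _ (hΛ.tk_mem_grade (mem_C8.1 h1).1 1)⟩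
    · refine ⟨?_, mem_grade_one.2 hΛ.map_hA2⟩
      change hh φ (toC hA2) ∈ _
      rw [← hA, emb_sub, toC_sub, hh_sub]
      exact Submodule.smul_mem _ _ (sub_mem (hh_mem_rootSpan (single_facts.2.1 0))
        (hh_mem_rootSpan (single_facts.2.1 2)))
  · rw [rootSpan]
    apply map_span_proj_le
    rintro _ ⟨n, hn, rfl | rfl⟩
    · rw [hΛ.proj_E (mem_C8.1 hn).1]
      rcases C8_orbits n hn with ⟨j, s, rfl⟩ | ⟨j, s, h⟩
      · rw [tk, (cFix_facts j s).2, eps_one, neg_one_smul, add_neg_cancel]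
        exact zero_mem _
      · refine tk_mem_of (mem_of_c_smul_mem ?_) h
        rw [← tM_eq]
        exact mem_span_range (v := basis7 φ E) (.mov j s)
    · rw [proj_apply, eps_one, neg_one_smul, hΛ.map_hh_emb, ← sub_eq_add_neg, ← hh_sub, ← toC_sub,
        ← emb_sub, hsub n hn]
      have h1 : emb ((n 1 - n 3) • (Pi.single 1 1 - Pi.single 3 1)) =
          ((n 1 - n 3 : ℤ) : ℝ) • emb (Pi.single 1 1 - Pi.single 3 1) := by
        simp only [emb, Pi.smul_apply, smul_eq_mul, Int.cast_mul, mul_smul, Finset.smul_sum]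
      rw [h1, toC_smul, hh_smul]
      apply Submodule.smul_mem
      apply mem_of_c_smul_mem
      rw [hA]
      exact mem_span_range (v := basis7 φ E) .cartan

lemma span_basisJ0 : Submodule.span ℂ (Set.range (basisJ0 φ E)) = spJk φ Λ 0 := by
  rw [spJk]
  apply span_eq_inf_grade
  · rintro (⟨a, s⟩ | ⟨a, ha, s⟩ | s | -)
    · rw [basisJ0_R]
      have h := (cLRV_mem a s).2.1
      exact ⟨tk_mem_spJ hE hR h (not_mem_labels.1 a s) 0, hΛ.tk_mem_grade (mem_C6.1 h).1 0⟩
    · rw [basisJ0_L, mem_grade_zero]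
      have h := (cLRV_mem a s).1
      exact ⟨E_mem_spJ hE hR h (not_mem_labels.2.1 a s),
        by rw [hΛ.map_E (mem_C6.1 h).1, lamZ_cL a s ha]⟩
    · rw [basisJ0_L4]
      have h := (cLRV_mem 3 s).1
      exact ⟨tk_mem_spJ hE hR h (not_mem_labels.2.1 3 s) 0, hΛ.tk_mem_grade (mem_C6.1 h).1 0⟩
    · exact ⟨Submodule.subset_span (Or.inr (Or.inr rfl)), mem_grade_zero.2 (hΛ.map_simpleCoF 3)⟩
  · rw [spJ_eq hE hR]
    apply map_span_proj_le
    rintro _ (⟨n, ⟨hn, h8⟩, rfl⟩ | rfl | rfl)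
    · rw [hΛ.proj_E (mem_C6.1 hn).1]
      rcases (C6_orbits n hn).resolve_left h8 with ⟨a, s, h⟩ | ⟨a, s, ha, rfl⟩ | ⟨s, h⟩
      · refine tk_mem_of ?_ h
        rw [← basisJ0_R (φ := φ)]
        exact mem_span_range _
      · rw [tk, lamZ_cL a s ha, ← basisJ0_L (φ := φ) (E := E) a ha]
        exact add_mem (mem_span_range _) (Submodule.smul_mem _ _ (mem_span_range _))
      · refine tk_mem_of ?_ h
        rw [← basisJ0_L4 (φ := φ)]
        exact mem_span_range _
    · rw [proj_apply, eps_zero, one_smul, hΛ.map_hA1, add_neg_cancel]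
      exact zero_mem _
    · rw [proj_apply, hΛ.map_simpleCoF]
      have := mem_span_range (v := basisJ0 φ E) .cartan
      exact add_mem this (Submodule.smul_mem _ _ this)

lemma span_basisJ1 : Submodule.span ℂ (Set.range (basisJ1 φ E)) = spJk φ Λ 1 := by
  rw [spJk]
  apply span_eq_inf_grade
  · rintro (⟨a, s⟩ | s | -)
    · change tR E 1 a s ∈ _ ∧ tR E 1 a s ∈ _
      rw [tR_eq]
      have h := (cLRV_mem a s).2.1
      exact ⟨Submodule.smul_mem _ _ (tk_mem_spJ hE hR h (not_mem_labels.1 a s) 1),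
        Submodule.smul_mem _ _ (hΛ.tk_mem_grade (mem_C6.1 h).1 1)⟩
    · change tL4 E 1 s ∈ _ ∧ tL4 E 1 s ∈ _
      rw [tL4_eq]
      have h := (cLRV_mem 3 s).1
      exact ⟨Submodule.smul_mem _ _ (tk_mem_spJ hE hR h (not_mem_labels.2.1 3 s) 1),
        Submodule.smul_mem _ _ (hΛ.tk_mem_grade (mem_C6.1 h).1 1)⟩
    · exact ⟨Submodule.subset_span (Or.inr (Or.inl rfl)), mem_grade_one.2 hΛ.map_hA1⟩
  · rw [spJ_eq hE hR]
    apply map_span_proj_le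
    rintro _ (⟨n, ⟨hn, h8⟩, rfl⟩ | rfl | rfl)
    · rw [hΛ.proj_E (mem_C6.1 hn).1]
      rcases (C6_orbits n hn).resolve_left h8 with ⟨a, s, h⟩ | ⟨a, s, ha, rfl⟩ | ⟨s, h⟩
      · refine tk_mem_of (mem_of_c_smul_mem ?_) h
        rw [← tR_eq]
        exact mem_span_range (v := basisJ1 φ E) (.R a s)
      · rw [tk, lamZ_cL a s ha, eps_one, neg_one_smul, add_neg_cancel]
        exact zero_mem _
      · refine tk_mem_of (mem_of_c_smul_mem ?_) h
        rw [← tL4_eq]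
        exact mem_span_range (v := basisJ1 φ E) (.L4 s)
    · rw [proj_apply, hΛ.map_hA1]
      have := mem_span_range (v := basisJ1 φ E) .cartan
      exact add_mem this (Submodule.smul_mem _ _ (neg_mem this))
    · rw [proj_apply, hΛ.map_simpleCoF, eps_one, neg_one_smul, add_neg_cancel]
      exact zero_mem _

lemma basisI_mem (k : ZMod 2) (i : LabelI) : basisI E k i ∈ spI φ ∧ basisI E k i ∈ grade Λ k := by
  have key {n : Fin 7 → ℤ} (hn : n ∈ C7) (h6 : n ∉ C6) : (c : ℂ) • tk E k n ∈ spI φ ∧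
      (c : ℂ) • tk E k n ∈ grade Λ k :=
    ⟨Submodule.smul_mem _ _ (tk_mem_spI hE hR hn h6 k),
      Submodule.smul_mem _ _ (hΛ.tk_mem_grade hn k)⟩
  rcases i with ⟨a, s⟩ | ⟨a, ha⟩ | s | s | -
  · change tRp E k a s ∈ _ ∧ tRp E k a s ∈ _
    rw [tRp_eq]
    exact key (cLRVp_mem a s).2.1 (not_mem_labels.2.2.1 a s)
  · change tLp E k a ∈ _ ∧ tLp E k a ∈ _
    rw [tLp_eq k a ha]
    exact key (cLRVp_mem a 1).1 (not_mem_labels.2.2.2.1 a 1)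
  · change tLp4 E k s ∈ _ ∧ tLp4 E k s ∈ _
    rw [tLp4_eq]
    exact key (cLRVp_mem 3 s).1 (not_mem_labels.2.2.2.1 3 s)
  · change t5 E k s ∈ _ ∧ t5 E k s ∈ _
    rw [t5_eq]
    exact key (cE_mem 0 s) (not_mem_labels.2.2.2.2 0 s)
  · change t6 E k 1 ∈ _ ∧ t6 E k 1 ∈ _
    rw [t6_eq]
    exact key (cE_mem 1 1) (not_mem_labels.2.2.2.2 1 1)

omit hE hR hΛ [FiniteDimensional ℂ L] [LieAlgebra.IsKilling ℂ L] [H.IsCartanSubalgebra] in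
lemma tk_mem_span_basisI (k : ZMod 2) {n : Fin 7 → ℤ} (hn : n ∈ C7) (h6 : n ∉ C6) :
    tk E k n ∈ Submodule.span ℂ (Set.range (basisI E k)) := by
  rcases (C7_orbits n hn).resolve_left h6 with ⟨a, s, h⟩ | ⟨a, ha, h⟩ | ⟨s, h⟩ | ⟨s, h⟩ | h <;>
    refine tk_mem_of (mem_of_c_smul_mem ?_) h
  · rw [← tRp_eq]
    exact mem_span_range (v := basisI E k) (.R a s)
  · rw [← tLp_eq k a ha]
    exact mem_span_range (v := basisI E k) (.L a ha)
  · rw [← tLp4_eq]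
    exact mem_span_range (v := basisI E k) (.L4 s)
  · rw [← t5_eq]
    exact mem_span_range (v := basisI E k) (.five s)
  · rw [← t6_eq]
    exact mem_span_range (v := basisI E k) .six

lemma span_basisV : Submodule.span ℂ (Set.range (basisI E 0)) = spV φ Λ := by
  rw [spV]
  apply span_eq_inf_grade (basisI_mem hE hR hΛ 0)
  rw [spI_eq hE hR]
  apply map_span_proj_le
  rintro _ (⟨n, ⟨hn, h6⟩, rfl⟩ | rfl)
  · rw [hΛ.proj_E hn]
    exact tk_mem_span_basisI 0 hn h6
  · rw [proj_apply, eps_zero, one_smul, hΛ.map_sum_e, add_neg_cancel]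
    exact zero_mem _

lemma span_basisI1 : Submodule.span ℂ (Set.range
    (Sum.elim (basisI E 1) (fun _ : Unit => hh φ (toC hE5)))) = spI φ ⊓ grade Λ 1 := by
  apply span_eq_inf_grade
  · rintro (i | -)
    · exact basisI_mem hE hR hΛ 1 i
    · refine ⟨?_, mem_grade_one.2 hΛ.map_hE5⟩
      change hh φ (toC hE5) ∈ _
      rw [hh_hE5]
      exact Submodule.smul_mem _ _ (Submodule.subset_span (Or.inr rfl))
  · rw [spI_eq hE hR]
    apply map_span_proj_le
    rintro _ (⟨n, ⟨hn, h6⟩, rfl⟩ | rfl)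
    · rw [hΛ.proj_E hn, Set.Sum.elim_range, Submodule.span_union]
      exact Submodule.mem_sup_left (tk_mem_span_basisI 1 hn h6)
    · have h1 := mem_span_range (v := Sum.elim (basisI E 1) (fun _ : Unit => hh φ (toC hE5)))
        (Sum.inr ())
      change hh φ (toC hE5) ∈ _ at h1
      have h2 : hh φ (toC (e 4 + e 5 + e 6)) = ((√3 : ℝ) : ℂ) • hh φ (toC hE5) := by
        rw [hh_hE5, smul_smul, ← Complex.ofReal_mul, mul_inv_cancel₀ (by positivity),
          Complex.ofReal_one, one_smul]
      rw [proj_apply, hΛ.map_sum_e, h2]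
      exact add_mem (Submodule.smul_mem _ _ h1)
        (Submodule.smul_mem _ _ (neg_mem (Submodule.smul_mem _ _ h1)))

end Lie

end

end E7

namespace E7

noncomputable section

/-! ### Counting the labels -/

/-- The labels of the generators of `so(7)` as a sum type. -/
def LabelSo7.equiv : LabelSo7 ≃ (Fin 6 × ℤˣ) ⊕ (Fin 3 × ℤˣ) ⊕ Fin 3 where
  toFun
    | .fix j s => .inl (j, s)
    | .mov j s => .inr (.inl (j, s))
    | .cartan j => .inr (.inr j)
  invFun
    | .inl (j, s) => .fix j s
    | .inr (.inl (j, s)) => .mov j s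
    | .inr (.inr j) => .cartan j
  left_inv x := by cases x <;> rfl
  right_inv x := by rcases x with x | x | x <;> rfl

/-- The labels of the generators of the representation of dimension `7` as a sum type. -/
def Label7.equiv : Label7 ≃ (Fin 3 × ℤˣ) ⊕ Unit where
  toFun
    | .mov j s => .inl (j, s)
    | .cartan => .inr ()
  invFun
    | .inl (j, s) => .mov j s
    | .inr () => .cartan
  left_inv x := by cases x <;> rfl
  right_inv x := by rcases x with x | x <;> rfl

/-- The labels of the generators of `J₀` as a sum type. -/
def LabelJ0.equiv :
    LabelJ0 ≃ (Fin 8 × ℤˣ) ⊕ ({a : Fin 8 // a ≠ 3 ∧ a ≠ 7} × ℤˣ) ⊕ ℤˣ ⊕ Unit where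
  toFun
    | .R a s => .inl (a, s)
    | .L a ha s => .inr (.inl (⟨a, ha⟩, s))
    | .L4 s => .inr (.inr (.inl s))
    | .cartan => .inr (.inr (.inr ()))
  invFun
    | .inl (a, s) => .R a s
    | .inr (.inl (a, s)) => .L a.1 a.2 s
    | .inr (.inr (.inl s)) => .L4 s
    | .inr (.inr (.inr ())) => .cartan
  left_inv x := by cases x <;> rfl
  right_inv x := by rcases x with x | x | x | x <;> rfl

/-- The labels of the generators of `J₁` as a sum type. -/
def LabelJ1.equiv : LabelJ1 ≃ (Fin 8 × ℤˣ) ⊕ ℤˣ ⊕ Unit where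
  toFun
    | .R a s => .inl (a, s)
    | .L4 s => .inr (.inl s)
    | .cartan => .inr (.inr ())
  invFun
    | .inl (a, s) => .R a s
    | .inr (.inl s) => .L4 s
    | .inr (.inr ()) => .cartan
  left_inv x := by cases x <;> rfl
  right_inv x := by rcases x with x | x | x <;> rfl

/-- The labels of the generators outside `e₆` as a sum type. -/
def LabelI.equiv :
    LabelI ≃ (Fin 8 × ℤˣ) ⊕ {a : Fin 8 // a ≠ 3 ∧ a ≠ 7} ⊕ ℤˣ ⊕ ℤˣ ⊕ Unit where
  toFun
    | .R a s => .inl (a, s)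
    | .L a ha => .inr (.inl ⟨a, ha⟩)
    | .L4 s => .inr (.inr (.inl s))
    | .five s => .inr (.inr (.inr (.inl s)))
    | .six => .inr (.inr (.inr (.inr ())))
  invFun
    | .inl (a, s) => .R a s
    | .inr (.inl a) => .L a.1 a.2
    | .inr (.inr (.inl s)) => .L4 s
    | .inr (.inr (.inr (.inl s))) => .five s
    | .inr (.inr (.inr (.inr ()))) => .six
  left_inv x := by cases x <;> rfl
  right_inv x := by rcases x with x | x | x | x | x <;> rfl

instance : Fintype LabelSo7 := .ofEquiv _ LabelSo7.equiv.symm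
instance : Fintype Label7 := .ofEquiv _ Label7.equiv.symm
instance : Fintype LabelJ0 := .ofEquiv _ LabelJ0.equiv.symm
instance : Fintype LabelJ1 := .ofEquiv _ LabelJ1.equiv.symm
instance : Fintype LabelI := .ofEquiv _ LabelI.equiv.symm

lemma card_LabelSo7 : Fintype.card LabelSo7 = 21 := by
  rw [Fintype.card_congr LabelSo7.equiv]; decide
lemma card_Label7 : Fintype.card Label7 = 7 := by
  rw [Fintype.card_congr Label7.equiv]; decide
lemma card_LabelJ0 : Fintype.card LabelJ0 = 31 := by
  rw [Fintype.card_congr LabelJ0.equiv]; decide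
lemma card_LabelJ1 : Fintype.card LabelJ1 = 19 := by
  rw [Fintype.card_congr LabelJ1.equiv]; decide
lemma card_LabelI : Fintype.card LabelI = 27 := by
  rw [Fintype.card_congr LabelI.equiv]; decide

/-! ### Decompositions and independence of the generators -/

section Lie

variable {L : Type*} [LieRing L] [LieAlgebra ℂ L] {H : LieSubalgebra ℂ L}
  {φ : H ≃ₗ[ℂ] (Fin 7 → ℂ)} {E : (Fin 7 → ℝ) → L} {Λ : L ≃ₗ⁅ℂ⁆ L}

lemma f4_toSubmodule : (f4 φ Λ).toSubmodule = (e6 φ).toSubmodule ⊓ grade Λ 0 := by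
  ext x; exact and_congr Iff.rfl mem_grade_zero.symm

lemma so7_toSubmodule : (so7 φ Λ).toSubmodule = (so8 φ).toSubmodule ⊓ grade Λ 0 := by
  ext x; exact and_congr Iff.rfl mem_grade_zero.symm

lemma rep26_toSubmodule : (rep26 φ Λ).toSubmodule = (e6 φ).toSubmodule ⊓ grade Λ 1 := by
  ext x; exact and_congr Iff.rfl mem_grade_one.symm

lemma rep7_toSubmodule : (rep7 φ Λ).toSubmodule = (so8 φ).toSubmodule ⊓ grade Λ 1 := by
  ext x; exact and_congr Iff.rfl mem_grade_one.symm

variable (φ E) in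
/-- All generators. -/
def basisAll : ((LabelSo7 ⊕ LabelJ0) ⊕ LabelI) ⊕ LabelJ1 ⊕ Label7 ⊕ LabelI ⊕ Unit → L :=
  Sum.elim (Sum.elim (Sum.elim (basisSo7 φ E) (basisJ0 φ E)) (basisI E 0)) (basisG1 φ E)

variable [FiniteDimensional ℂ L] [LieAlgebra.IsKilling ℂ L] [H.IsCartanSubalgebra]
  (hE : IsChevalley φ E)
  (hR : Set.range (LieAlgebra.IsKilling.rootSystem H).root = form φ '' R7)

include hE hR

/-- Only the Cartan part needs an argument: `so(8)` contains the four simple roots other than `α₁`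
and `α₅`, while the two Cartan generators of `J` are multiples of `α₁ - α₅` and `α₁ + α₅`. -/
lemma so8_sup_spJ : (so8 φ).toSubmodule ⊔ spJ φ = (e6 φ).toSubmodule := by
  rw [so8_toSubmodule hE hR, e6_toSubmodule hE hR]
  have hA : hh φ (toC hA1) = (c : ℂ) • (hh φ (toC (simple 0)) - hh φ (toC (simple 4))) := by
    rw [hA1, toC_smul, toC_sub, hh_smul, hh_sub]
  have hC : hh φ (toC (simpleCoF 3)) = hh φ (toC (simple 0)) + hh φ (toC (simple 4)) := by
    rw [simpleCoF_eq, show simpleCoFZ 3 = Pi.single 0 1 + Pi.single 4 1 by decide +kernel, emb_add,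
      emb_single, emb_single, toC_add, hh_add]
  have hs (i : Fin 6) : hh φ (toC (simple i.castSucc)) ∈ rootSpan φ E C6 := by
    rw [← emb_single]; exact hh_mem_rootSpan (single_facts.1 i)
  apply le_antisymm
  · rw [sup_le_iff]
    constructor
    · rw [rootSpan, Submodule.span_le]
      rintro _ ⟨n, hn, rfl | rfl⟩
      · exact E_mem_rootSpan (C8_subset_C6 hn)
      · exact hh_mem_rootSpan (C8_subset_C6 hn)
    · rw [spJ_eq hE hR, Submodule.span_le]
      rintro _ (⟨n, ⟨hn, h8⟩, rfl⟩ | rfl | rfl)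
      · exact E_mem_rootSpan hn
      · rw [SetLike.mem_coe, hA]
        exact Submodule.smul_mem _ _ (sub_mem (hs 0) (hs 4))
      · rw [SetLike.mem_coe, hC]
        exact add_mem (hs 0) (hs 4)
  · set M := rootSpan φ E C8 ⊔ spJ φ with hM
    have hA' : hh φ (toC hA1) ∈ M :=
      Submodule.mem_sup_right (Submodule.subset_span (Or.inr (Or.inl rfl)))
    have hC' : hh φ (toC (simpleCoF 3)) ∈ M :=
      Submodule.mem_sup_right (Submodule.subset_span (Or.inr (Or.inr rfl)))
    rw [hA] at hA'
    rw [hC] at hC'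
    have hA'' := mem_of_c_smul_mem hA'
    have h0 : hh φ (toC (simple 0)) ∈ M := by
      have := M.smul_mem (2⁻¹ : ℂ) (add_mem hC' hA'')
      rwa [add_add_sub_cancel, ← two_smul ℂ, smul_smul, inv_mul_cancel₀ two_ne_zero,
        one_smul] at this
    have h4 : hh φ (toC (simple 4)) ∈ M := by
      have := sub_mem hC' h0
      rwa [add_sub_cancel_left] at this
    have h8 (i : Fin 4) : hh φ (toC (simple (pos8 i))) ∈ M := by
      rw [← emb_single]
      exact Submodule.mem_sup_left (hh_mem_rootSpan (single_facts.2.1 i))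
    rw [rootSpan, Submodule.span_le]
    rintro _ ⟨n, hn, rfl | rfl⟩
    · by_cases h : n ∈ C8
      · exact Submodule.mem_sup_left (E_mem_rootSpan h)
      · exact Submodule.mem_sup_right (E_mem_spJ hE hR hn h)
    · have h1 : hh φ (toC (emb n)) = ∑ i, (n i : ℂ) • hh φ (toC (simple i)) := by
        have h2 : toC (emb n) = ∑ i, (n i : ℂ) • toC (simple i) := by
          ext j; simp [toC, emb]
        rw [h2, ← hhₗ_apply, map_sum]
        exact Finset.sum_congr rfl fun i _ => by rw [map_smul]; rfl
      rw [SetLike.mem_coe, h1]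
      refine sum_mem fun i _ => ?_
      by_cases hi : i = 6
      · rw [hi, (mem_C6.1 hn).2, Int.cast_zero, zero_smul]
        exact zero_mem _
      · refine M.smul_mem _ ?_
        fin_cases i
        · exact h0
        · exact h8 0
        · exact h8 1
        · exact h8 2
        · exact h4
        · exact h8 3
        · exact absurd rfl hi

omit [FiniteDimensional ℂ L] [LieAlgebra.IsKilling ℂ L] [H.IsCartanSubalgebra] hE hR in
/-- The Cartan subalgebra is spanned by the roots of `e₆` and `e₅ + e₆ + e₇`. -/
lemma hh_mem_of_e6 {M : Submodule ℂ L} (hC : ∀ n ∈ C6, hh φ (toC (emb n)) ∈ M)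
    (hw : hh φ (toC (e 4 + e 5 + e 6)) ∈ M) (u : Fin 7 → ℂ) : hh φ u ∈ M := by
  replace hC {n : Fin 7 → ℤ} (hn : n ∈ C6) : hh φ (toC (emb n)) ∈ M := hC n hn
  have hD (i j : Fin 4) (hij : i ≠ j) : hh φ (toC (e (i.castLE (by decide)))) ∈ M := by
    have h1 := add_mem (hC (C8_subset_C6 (cD_mem i j 1 1 hij)))
      (hC (C8_subset_C6 (cD_mem i j 1 (-1) hij)))
    rw [← hh_add, ← toC_add, ← cD_eq hij, ← cD_eq hij] at h1
    have h2 := M.smul_mem (2⁻¹ : ℂ) h1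
    rw [← hh_smul] at h2
    convert h2 using 2
    ext k
    simp [toC]
    ring
  have hsub {v : ℕ → Fin 7 → ℝ} (h : hh φ (toC (v 0)) ∈ M ∧ hh φ (toC (v 1)) ∈ M) {w : Fin 7 → ℝ}
      (hv : v 0 - v 1 = (2 : ℝ) • c • w) : hh φ (toC w) ∈ M := by
    have h1 := sub_mem h.1 h.2
    rw [← hh_sub, ← toC_sub, hv, toC_smul, toC_smul, hh_smul, hh_smul] at h1
    have h2 := M.smul_mem (2⁻¹ : ℂ) h1
    rw [Complex.ofReal_ofNat, smul_smul, inv_mul_cancel₀ two_ne_zero, one_smul] at h2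
    exact mem_of_c_smul_mem h2
  have h45 : hh φ (toC (e 4 - e 5)) ∈ M := by
    refine hsub (v := fun i => aR 0 (if i = 0 then 1 else -1)) ⟨?_, ?_⟩ ?_
    · rw [aR_eq]; exact hC (cLRV_mem _ _).2.1
    · rw [aR_eq]; exact hC (cLRV_mem _ _).2.1
    · simp [aR, two_smul]
  have h46 : hh φ (toC (e 4 - e 6)) ∈ M := by
    refine hsub (v := fun i => aL 0 (if i = 0 then 1 else -1)) ⟨?_, ?_⟩ ?_
    · rw [aL_eq]; exact hC (cLRV_mem _ _).1
    · rw [aL_eq]; exact hC (cLRV_mem _ _).1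
    · simp [aL, two_smul]
  -- `3 e₅ = (e₅ + e₆ + e₇) + (e₅ - e₆) + (e₅ - e₇)`.
  have h4 : hh φ (toC (e 4)) ∈ M := by
    have h1 := M.smul_mem (3⁻¹ : ℂ) (add_mem (add_mem hw h45) h46)
    rw [← hh_add, ← toC_add, ← hh_add, ← toC_add, ← hh_smul] at h1
    convert h1 using 2
    ext k
    simp [toC]
    ring
  have h5 : hh φ (toC (e 5)) ∈ M := by
    have h1 := sub_mem h4 h45
    rwa [← hh_sub, ← toC_sub, sub_sub_cancel] at h1
  have h6 : hh φ (toC (e 6)) ∈ M := by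
    have h1 := sub_mem h4 h46
    rwa [← hh_sub, ← toC_sub, sub_sub_cancel] at h1
  have hu : hh φ u = ∑ i, u i • hh φ (toC (e i)) := by
    have h2 : u = ∑ i, u i • toC (e i) := by
      ext j; simp [toC, e, apply_ite Complex.ofReal]
    nth_rw 1 [h2]
    rw [← hhₗ_apply, map_sum]
    exact Finset.sum_congr rfl fun i _ => by rw [map_smul]; rfl
  rw [hu]
  refine sum_mem fun i _ => M.smul_mem _ ?_
  fin_cases i
  · exact hD 0 1 (by decide)
  · exact hD 1 0 (by decide)
  · exact hD 2 0 (by decide)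
  · exact hD 3 0 (by decide)
  · exact h4
  · exact h5
  · exact h6

lemma e6_sup_spI : (e6 φ).toSubmodule ⊔ spI φ = ⊤ := by
  rw [eq_top_iff]
  rintro x -
  rw [e6_toSubmodule hE hR]
  set M := rootSpan φ E C6 ⊔ spI φ with hM
  obtain ⟨u, a, rfl⟩ := hE.exists_coord hR x
  refine add_mem ?_ (sum_mem fun n hn => M.smul_mem _ ?_)
  · have hw : hh φ (toC (e 4 + e 5 + e 6)) ∈ M :=
      Submodule.mem_sup_right (Submodule.subset_span (Or.inr rfl))
    exact hh_mem_of_e6 (fun n hn => Submodule.mem_sup_left (hh_mem_rootSpan hn)) hw u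
  · by_cases h : n ∈ C6
    · exact Submodule.mem_sup_left (E_mem_rootSpan h)
    · exact Submodule.mem_sup_right (E_mem_spI hE hR (List.mem_toFinset.1 hn) h)

variable (hΛ : IsLift φ E Λ)
include hΛ

lemma f4_eq_sup : (f4 φ Λ).toSubmodule = (so7 φ Λ).toSubmodule ⊔ spJk φ Λ 0 := by
  rw [f4_toSubmodule, ← so8_sup_spJ hE hR, sup_inf_grade (hΛ.involutive hE hR)
    (fun _ => map_mem_so8 hE hR hΛ) (fun _ => map_mem_spJ hE hR hΛ), so7_toSubmodule, spJk]

lemma rep26_eq_sup : (rep26 φ Λ).toSubmodule = spJk φ Λ 1 ⊔ (rep7 φ Λ).toSubmodule := by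
  rw [rep26_toSubmodule, ← so8_sup_spJ hE hR, sup_inf_grade (hΛ.involutive hE hR)
    (fun _ => map_mem_so8 hE hR hΛ) (fun _ => map_mem_spJ hE hR hΛ), rep7_toSubmodule, spJk,
    sup_comm]

lemma grade_zero_eq_sup : grade Λ 0 = (f4 φ Λ).toSubmodule ⊔ spV φ Λ := by
  rw [← top_inf_eq (grade Λ 0), ← e6_sup_spI hE hR, sup_inf_grade (hΛ.involutive hE hR)
    (fun _ => map_mem_e6 hE hR hΛ) (fun _ => map_mem_spI hE hR hΛ), f4_toSubmodule, spV]

lemma grade_one_eq_sup : grade Λ 1 = (rep26 φ Λ).toSubmodule ⊔ spI φ ⊓ grade Λ 1 := by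
  rw [rep26_toSubmodule, ← sup_inf_grade (hΛ.involutive hE hR)
    (fun _ => map_mem_e6 hE hR hΛ) (fun _ => map_mem_spI hE hR hΛ), e6_sup_spI hE hR, top_inf_eq]

lemma span_basisF4 : Submodule.span ℂ (Set.range (Sum.elim (basisSo7 φ E) (basisJ0 φ E))) =
    (f4 φ Λ).toSubmodule := by
  rw [Set.Sum.elim_range, Submodule.span_union, span_basisSo7 hE hR hΛ, span_basisJ0 hE hR hΛ,
    f4_eq_sup hE hR hΛ, so7_toSubmodule]

lemma span_basisG1 : Submodule.span ℂ (Set.range (basisG1 φ E)) = grade Λ 1 := by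
  rw [basisG1, Set.Sum.elim_range, Submodule.span_union, Set.Sum.elim_range, Submodule.span_union,
    span_basisJ1 hE hR hΛ, span_basis7 hE hR hΛ, span_basisI1 hE hR hΛ, ← sup_assoc,
    ← rep7_toSubmodule, ← rep26_eq_sup hE hR hΛ, ← grade_one_eq_sup hE hR hΛ]

lemma span_basisG0 : Submodule.span ℂ (Set.range (Sum.elim (Sum.elim (basisSo7 φ E)
    (basisJ0 φ E)) (basisI E 0))) = grade Λ 0 := by
  rw [Set.Sum.elim_range, Submodule.span_union, span_basisF4 hE hR hΛ, span_basisV hE hR hΛ,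
    grade_zero_eq_sup hE hR hΛ]

/-- The family spans both homogeneous components, hence everything, and its cardinality is the
dimension `133`. -/
lemma linearIndependent_basisAll : LinearIndependent ℂ (basisAll φ E) := by
  apply linearIndependent_of_top_le_span_of_card_eq_finrank
  · rw [basisAll, Set.Sum.elim_range, Submodule.span_union, span_basisG0 hE hR hΛ,
      span_basisG1 hE hR hΛ, grade_sup_grade (hΛ.involutive hE hR)]
  · rw [hE.finrank_eq hR]
    simp only [Fintype.card_sum, card_LabelSo7, card_Label7, card_LabelJ0, card_LabelJ1,
      card_LabelI, Fintype.card_unit]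

/-- Independence of a family indexed by a sum type contains independence of the two parts and
disjointness of their spans; repeated splitting yields all the sums needed. -/
lemma independence : (LinearIndependent ℂ (basisSo7 φ E) ∧ LinearIndependent ℂ (basisJ0 φ E) ∧
      Disjoint (so7 φ Λ).toSubmodule (spJk φ Λ 0)) ∧
    (LinearIndependent ℂ (Sum.elim (basisSo7 φ E) (basisJ0 φ E)) ∧
      LinearIndependent ℂ (basisI E 0) ∧ Disjoint (f4 φ Λ).toSubmodule (spV φ Λ)) ∧
    (LinearIndependent ℂ (basisG1 φ E) ∧ Disjoint (grade Λ 0) (grade Λ 1)) ∧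
    (LinearIndependent ℂ (basisJ1 φ E) ∧ LinearIndependent ℂ (basis7 φ E) ∧
      LinearIndependent ℂ (Sum.elim (basisI E 1) (fun _ : Unit => hh φ (toC hE5))) ∧
      Disjoint (spJk φ Λ 1) (rep7 φ Λ).toSubmodule) := by
  have h := linearIndependent_sum.1 (linearIndependent_basisAll hE hR hΛ)
  have h0 : LinearIndependent ℂ (Sum.elim (Sum.elim (basisSo7 φ E) (basisJ0 φ E)) (basisI E 0)) :=
    h.1
  have h1 : LinearIndependent ℂ (basisG1 φ E) := h.2.1
  have h2 := linearIndependent_sum.1 h0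
  have h3 : LinearIndependent ℂ (Sum.elim (basisSo7 φ E) (basisJ0 φ E)) := h2.1
  have h4 := linearIndependent_sum.1 h3
  have h5 := linearIndependent_sum.1 h1
  have h6 : LinearIndependent ℂ (Sum.elim (basis7 φ E) (Sum.elim (basisI E 1)
    (fun _ : Unit => hh φ (toC hE5)))) := h5.2.1
  have h7 := linearIndependent_sum.1 h6
  have e1 := span_basisSo7 hE hR hΛ
  have e2 := span_basisJ0 hE hR hΛ
  have e3 := span_basisF4 hE hR hΛ
  have e4 := span_basisV hE hR hΛ
  have e5 := span_basisJ1 hE hR hΛ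
  have e6' := span_basis7 hE hR hΛ
  refine ⟨⟨h4.1, h4.2.1, ?_⟩, ⟨h3, h2.2.1, ?_⟩, ⟨h1, disjoint_grade⟩, h5.1, h7.1, h7.2.1, ?_⟩
  · rw [so7_toSubmodule, ← e1, ← e2]; exact h4.2.2
  · rw [← e3, ← e4]; exact h2.2.2
  · rw [rep7_toSubmodule, ← e5, ← e6']
    refine h5.2.2.mono_right (Submodule.span_mono ?_)
    rintro _ ⟨i, rfl⟩
    exact ⟨.inl i, rfl⟩

/-! ### Dimensions -/

omit hE hR hΛ [LieAlgebra.IsKilling ℂ L] [H.IsCartanSubalgebra] in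
lemma finrank_eq_add {W A B : Submodule ℂ L} (h : IsSum W A B) :
    finrank ℂ W = finrank ℂ A + finrank ℂ B := by
  have := Submodule.finrank_sup_add_finrank_inf_eq A B
  rw [h.2, disjoint_iff.1 h.1, finrank_bot, add_zero] at this
  exact this

omit hE hR hΛ [LieAlgebra.IsKilling ℂ L] [H.IsCartanSubalgebra] in
lemma disjoint_of_finrank {W A B : Submodule ℂ L} (h : A ⊔ B = W)
    (hd : finrank ℂ W = finrank ℂ A + finrank ℂ B) : Disjoint A B := by
  have := Submodule.finrank_sup_add_finrank_inf_eq A B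
  rw [h, hd] at this
  rw [disjoint_iff, ← Submodule.finrank_eq_zero (R := ℂ)]
  omega

lemma finrank_so7 : finrank ℂ (so7 φ Λ).toSubmodule = 21 := by
  rw [so7_toSubmodule, ← span_basisSo7 hE hR hΛ,
    finrank_span_eq_card (independence hE hR hΛ).1.1, card_LabelSo7]

lemma finrank_spJk_zero : finrank ℂ (spJk φ Λ 0) = 31 := by
  rw [← span_basisJ0 hE hR hΛ, finrank_span_eq_card (independence hE hR hΛ).1.2.1, card_LabelJ0]

lemma finrank_spV : finrank ℂ (spV φ Λ) = 27 := by
  rw [← span_basisV hE hR hΛ, finrank_span_eq_card (independence hE hR hΛ).2.1.2.1, card_LabelI]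

lemma finrank_grade_one : finrank ℂ (grade Λ 1) = 54 := by
  rw [← span_basisG1 hE hR hΛ, finrank_span_eq_card (independence hE hR hΛ).2.2.1.1]
  simp only [Fintype.card_sum, card_Label7, card_LabelJ1, card_LabelI, Fintype.card_unit]

lemma finrank_spJk_one : finrank ℂ (spJk φ Λ 1) = 19 := by
  rw [← span_basisJ1 hE hR hΛ, finrank_span_eq_card (independence hE hR hΛ).2.2.2.1, card_LabelJ1]

lemma finrank_rep7 : finrank ℂ (rep7 φ Λ).toSubmodule = 7 := by
  rw [rep7_toSubmodule, ← span_basis7 hE hR hΛ,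
    finrank_span_eq_card (independence hE hR hΛ).2.2.2.2.1, card_Label7]

lemma finrank_spI_inf_grade_one : finrank ℂ ↥(spI φ ⊓ grade Λ 1) = 28 := by
  rw [← span_basisI1 hE hR hΛ, finrank_span_eq_card (independence hE hR hΛ).2.2.2.2.2.1]
  simp only [Fintype.card_sum, card_LabelI, Fintype.card_unit]

lemma isSum_f4 : IsSum (f4 φ Λ).toSubmodule (so7 φ Λ).toSubmodule (spJk φ Λ 0) :=
  ⟨(independence hE hR hΛ).1.2.2, (f4_eq_sup hE hR hΛ).symm⟩

lemma isSum_rep26 : IsSum (rep26 φ Λ).toSubmodule (spJk φ Λ 1) (rep7 φ Λ).toSubmodule :=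
  ⟨(independence hE hR hΛ).2.2.2.2.2.2, (rep26_eq_sup hE hR hΛ).symm⟩

lemma isSum_spJ : IsSum (spJ φ) (spJk φ Λ 0) (spJk φ Λ 1) :=
  isSum_grade (hΛ.involutive hE hR) (fun _ => map_mem_spJ hE hR hΛ)

lemma isSum_so8 : IsSum (so8 φ).toSubmodule (so7 φ Λ).toSubmodule (rep7 φ Λ).toSubmodule := by
  rw [so7_toSubmodule, rep7_toSubmodule]
  exact isSum_grade (hΛ.involutive hE hR) (fun _ => map_mem_so8 hE hR hΛ)

lemma isSum_e6 : IsSum (e6 φ).toSubmodule (f4 φ Λ).toSubmodule (rep26 φ Λ).toSubmodule := by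
  rw [f4_toSubmodule, rep26_toSubmodule]
  exact isSum_grade (hΛ.involutive hE hR) (fun _ => map_mem_e6 hE hR hΛ)

lemma finrank_f4 : finrank ℂ (f4 φ Λ).toSubmodule = 52 := by
  rw [finrank_eq_add (isSum_f4 hE hR hΛ), finrank_so7 hE hR hΛ, finrank_spJk_zero hE hR hΛ]

lemma finrank_rep26 : finrank ℂ (rep26 φ Λ).toSubmodule = 26 := by
  rw [finrank_eq_add (isSum_rep26 hE hR hΛ), finrank_spJk_one hE hR hΛ, finrank_rep7 hE hR hΛ]

lemma finrank_e6 : finrank ℂ (e6 φ).toSubmodule = 78 := by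
  rw [finrank_eq_add (isSum_e6 hE hR hΛ), finrank_f4 hE hR hΛ, finrank_rep26 hE hR hΛ]

lemma finrank_so8 : finrank ℂ (so8 φ).toSubmodule = 28 := by
  rw [finrank_eq_add (isSum_so8 hE hR hΛ), finrank_so7 hE hR hΛ, finrank_rep7 hE hR hΛ]

lemma finrank_spJ : finrank ℂ (spJ φ) = 50 := by
  rw [finrank_eq_add (isSum_spJ hE hR hΛ), finrank_spJk_zero hE hR hΛ, finrank_spJk_one hE hR hΛ]

lemma isSum_e6_so8 : IsSum (e6 φ).toSubmodule (so8 φ).toSubmodule (spJ φ) :=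
  ⟨disjoint_of_finrank (so8_sup_spJ hE hR)
    (by rw [finrank_e6 hE hR hΛ, finrank_so8 hE hR hΛ, finrank_spJ hE hR hΛ]),
    so8_sup_spJ hE hR⟩

lemma isCompl_e6_spI : IsCompl (e6 φ).toSubmodule (spI φ) := by
  refine ⟨disjoint_of_finrank (e6_sup_spI hE hR) ?_, codisjoint_iff.2 (e6_sup_spI hE hR)⟩
  have h := isSum_grade (hΛ.involutive hE hR) (V := spI φ) (fun _ => map_mem_spI hE hR hΛ)
  have h1 := finrank_spV hE hR hΛ
  rw [spV] at h1
  rw [finrank_top, hE.finrank_eq hR, finrank_e6 hE hR hΛ, finrank_eq_add h, h1,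
    finrank_spI_inf_grade_one hE hR hΛ]

lemma isSum_grade_zero : IsSum (grade Λ 0) (f4 φ Λ).toSubmodule (spV φ Λ) :=
  ⟨(independence hE hR hΛ).2.1.2.2, (grade_zero_eq_sup hE hR hΛ).symm⟩

lemma isInternal_e7 :
    DirectSum.IsInternal ![(f4 φ Λ).toSubmodule, spV φ Λ, grade Λ 1] := by
  obtain ⟨h1, h2⟩ := isSum_grade_zero hE hR hΛ
  have h3 : Disjoint ((f4 φ Λ).toSubmodule ⊔ spV φ Λ) (grade Λ 1) := by
    rw [h2]; exact disjoint_grade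
  have h4 := h1.disjoint_sup_right_of_disjoint_sup_left h3
  have h5 : Disjoint (spV φ Λ) ((f4 φ Λ).toSubmodule ⊔ grade Λ 1) :=
    h1.symm.disjoint_sup_right_of_disjoint_sup_left (by rwa [sup_comm])
  rw [DirectSum.isInternal_submodule_iff_iSupIndep_and_iSup_eq_top]
  constructor
  · intro i
    fin_cases i
    · refine h4.mono_right (iSup₂_le fun j hj => ?_)
      fin_cases j
      · exact absurd rfl hj
      · exact le_sup_left
      · exact le_sup_right
    · refine h5.mono_right (iSup₂_le fun j hj => ?_)
      fin_cases j
      · exact le_sup_left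
      · exact absurd rfl hj
      · exact le_sup_right
    · refine h3.symm.mono_right (iSup₂_le fun j hj => ?_)
      fin_cases j
      · exact le_sup_left
      · exact le_sup_right
      · exact absurd rfl hj
  · rw [eq_top_iff, ← grade_sup_grade (hΛ.involutive hE hR), ← h2]
    refine sup_le (sup_le ?_ ?_) ?_
    · exact le_iSup (![(f4 φ Λ).toSubmodule, spV φ Λ, grade Λ 1]) 0
    · exact le_iSup (![(f4 φ Λ).toSubmodule, spV φ Λ, grade Λ 1]) 1
    · exact le_iSup (![(f4 φ Λ).toSubmodule, spV φ Λ, grade Λ 1]) 2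

theorem gs_bases :
    IsBasisOf (basisSo7 φ E) (so7 φ Λ).toSubmodule ∧
      IsBasisOf (basisJ0 φ E) (spJk φ Λ 0) ∧
      IsBasisOf (Sum.elim (basisSo7 φ E) (basisJ0 φ E)) (f4 φ Λ).toSubmodule ∧
      IsBasisOf (basis7 φ E) (rep7 φ Λ).toSubmodule ∧
      IsBasisOf (basisJ1 φ E) (spJk φ Λ 1) ∧
      IsBasisOf (basisI E 0) (spV φ Λ) ∧
      IsBasisOf (basisG1 φ E) (grade Λ 1) := by
  obtain ⟨⟨h1, h2, -⟩, ⟨h3, h4, -⟩, ⟨h5, -⟩, h6, h7, -, -⟩ := independence hE hR hΛ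
  exact ⟨⟨h1, by rw [span_basisSo7 hE hR hΛ, so7_toSubmodule]⟩,
    ⟨h2, span_basisJ0 hE hR hΛ⟩, ⟨h3, span_basisF4 hE hR hΛ⟩,
    ⟨h7, by rw [span_basis7 hE hR hΛ, rep7_toSubmodule]⟩, ⟨h6, span_basisJ1 hE hR hΛ⟩,
    ⟨h4, span_basisV hE hR hΛ⟩, ⟨h5, span_basisG1 hE hR hΛ⟩⟩

/-- The Cartan subalgebra of the invariant subalgebra of `e₆`. -/
lemma hh_mem_f4_iff (u : Fin 7 → ℂ) :
    hh φ u ∈ f4 φ Λ ↔ u 0 - u 1 - u 2 + u 3 = 0 ∧ u 5 = 0 ∧ u 6 = -u 4 := by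
  have hc : (c : ℂ) * c = 1 / 2 := by
    rw [← Complex.ofReal_mul, c_sq]; norm_num
  constructor
  · intro hu
    have h1 := hΛ.isFolding_C6.hh_mem_span_of_mem hR (fun _ => mem_f4 hE hR) isSimpleSystem_C6
      hE hu
    obtain ⟨a, ha⟩ := Submodule.mem_span_range_iff_exists_fun ℂ |>.1 h1
    have h2 : u = ∑ i, a i • toC (simpleCoF i) := by
      apply φ.symm.injective
      apply Subtype.coe_injective
      change hhₗ φ u = hhₗ φ _
      rw [map_sum, hhₗ_apply, ← ha]
      refine Finset.sum_congr rfl fun i _ => ?_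
      rw [map_smul, hhₗ_apply, cv_simpleFZ, ← simpleCoF_eq]
    rw [h2]
    simp only [Fin.sum_univ_four, Pi.add_apply, Pi.smul_apply, smul_eq_mul]
    simp [toC, simpleCoF]
    ring
  · rintro ⟨h1, h2, h3⟩
    have h4 : ∀ i, hh φ (toC (simpleCoF i)) ∈ f4 φ Λ := by
      intro i
      have h := (span_basisF4 hE hR hΛ).le
      rw [Submodule.span_le] at h
      induction i using Fin.lastCases with
      | last => exact h ⟨Sum.inr .cartan, rfl⟩
      | cast i => exact h ⟨Sum.inl (.cartan i), rfl⟩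
    -- The coefficients are found by elimination, starting from the fifth coordinate, where only the
    -- last coroot is nonzero: its entry is `c`, and `1 / c = 2 c`.
    have h5 : u = (u 2 + u 1 + 2 * c * u 4) • toC (simpleCoF 0) +
        (u 1 + u 0 + 4 * c * u 4) • toC (simpleCoF 1) +
        (u 0 + 3 * c * u 4) • toC (simpleCoF 2) + (2 * c * u 4) • toC (simpleCoF 3) := by
      ext j
      fin_cases j <;> simp [toC, simpleCoF]
      · ring
      · ring
      · ring
      · linear_combination h1
      · linear_combination (-2 * u 4) * hc
      · exact h2
      · linear_combination h3 + (2 * u 4) * hc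
    rw [h5, hh_add, hh_add, hh_add, hh_smul, hh_smul, hh_smul, hh_smul]
    have h6 := fun (t : ℂ) i => (f4 φ Λ).smul_mem t (h4 i)
    exact add_mem (add_mem (add_mem (h6 _ _) (h6 _ _)) (h6 _ _)) (h6 _ _)

end Lie

end

end E7

namespace E7

noncomputable section

/-! ### Values of the normalised Killing form -/

/-- The product of two generators depends only on whether one representative is opposite to the
other or to the image of the other; this and the following lemmas settle the question for each kind.
-/
lemma cR_eq_neg : ∀ a b s t, (cR b t = -cR a s ↔ b = a + 4 ∧ t = -s) ∧ cR b t ≠ -lamZ (cR a s) := by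
  decide +kernel
lemma cRp_eq_neg : ∀ a b s t,
    (cRp b t = -cRp a s ↔ b = a + 4 ∧ t = -s) ∧ cRp b t ≠ -lamZ (cRp a s) := by
  decide +kernel
lemma cL_eq_neg : ∀ a b s t, cL b t = -cL a s ↔ b = a + 4 ∧ t = -s := by decide +kernel
lemma cL_three_eq_neg : ∀ s t, cL 3 t ≠ -cL 3 s ∧ (cL 3 t = -lamZ (cL 3 s) ↔ t = -s) := by
  decide +kernel
lemma cLp_three_eq_neg : ∀ s t, cLp 3 t ≠ -cLp 3 s ∧ (cLp 3 t = -lamZ (cLp 3 s) ↔ t = s) := by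
  decide +kernel
lemma cLp_eq_neg : ∀ a b : Fin 8, a ≠ 3 ∧ a ≠ 7 →
    cLp b 1 ≠ -cLp a 1 ∧ (cLp b 1 = -lamZ (cLp a 1) ↔ b = a + 4) := by
  decide +kernel
lemma cMov_eq_neg : ∀ i j, ∀ s t : ℤˣ, ((t : ℤ) • cMov j = -((s : ℤ) • cMov i) ↔ i = j ∧ t = -s) ∧
    (t : ℤ) • cMov j ≠ -lamZ ((s : ℤ) • cMov i) := by
  decide +kernel
lemma cFix_eq_neg : ∀ i j, ∀ s t : ℤˣ,
    (t : ℤ) • cFix j = -((s : ℤ) • cFix i) ↔ i = j ∧ t = -s := by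
  decide +kernel
lemma cE_zero_eq_neg : ∀ s t, (cE 0 t = -cE 0 s ↔ t = -s) ∧ cE 0 t ≠ -lamZ (cE 0 s) := by
  decide +kernel
lemma cE_one_eq_neg : cE 1 (-1) = -cE 1 1 ∧ cE 1 (-1) ≠ -lamZ (cE 1 1) := by
  decide +kernel

lemma C6_subset {n : Fin 7 → ℤ} (h : n ∈ C6) : n ∈ C7 := (mem_C6.1 h).1
lemma C8_subset {n : Fin 7 → ℤ} (h : n ∈ C8) : n ∈ C7 := (mem_C8.1 h).1

lemma hA_dot : ∀ i j : Fin 2, ![hA1, hA2] i ⬝ᵥ ![hA1, hA2] j = (CartanMatrix.A 2 i j : ℝ) := by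
  have h : c ^ 2 = 1 / 2 := by rw [sq, c_sq]
  have h4 : c ^ 4 = 1 / 4 := by rw [show c ^ 4 = (c ^ 2) ^ 2 by ring, h]; norm_num
  intro i j
  fin_cases i <;> fin_cases j <;>
    simp [hA1, hA2, simple, dotProduct, Fin.sum_univ_succ, CartanMatrix.A] <;> ring_nf <;>
    simp only [h, h4] <;> norm_num

lemma hE5_dot : (∀ i : Fin 2, hE5 ⬝ᵥ ![hA1, hA2] i = 0) ∧ hE5 ⬝ᵥ hE5 = 1 := by
  have h : (√3)⁻¹ ^ 2 = (1 / 3 : ℝ) := by rw [inv_pow, Real.sq_sqrt (by norm_num)]; norm_num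
  constructor
  · intro i
    fin_cases i <;> simp [hE5, hA1, hA2, simple, dotProduct, Fin.sum_univ_succ, e] <;> ring
  · simp [hE5, dotProduct, Fin.sum_univ_succ, e]
    rw [← mul_inv]
    norm_num

section Lie

variable {L : Type*} [LieRing L] [LieAlgebra ℂ L] {H : LieSubalgebra ℂ L}
  {φ : H ≃ₗ[ℂ] (Fin 7 → ℂ)} {E : (Fin 7 → ℝ) → L}
variable [FiniteDimensional ℂ L] [LieAlgebra.IsKilling ℂ L] [H.IsCartanSubalgebra]
  (hE : IsChevalley φ E)
  (hR : Set.range (LieAlgebra.IsKilling.rootSystem H).root = form φ '' R7)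
include hE hR

/-- Of the four products, those exchanged by `λ₇` on both arguments are equal. This produces the
factor `1 + (-1)^(k+l)`, which is `2` or `0`. -/
lemma kf_tk (k l : ZMod 2) {m n : Fin 7 → ℤ} (hm : m ∈ C7) (hn : n ∈ C7) :
    kf (tk E k m) (tk E l n) = if k + l = 0 then
      2 * ((if n = -m then 1 else 0) + eps k * if n = -lamZ m then 1 else 0) else 0 := by
  have h1 : lamZ n = -m ↔ n = -lamZ m := by
    rw [← lamZ_neg]
    exact ⟨fun h => by rw [← h, lamZ_lamZ], fun h => by rw [h, lamZ_lamZ]⟩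
  have h2 : lamZ n = -lamZ m ↔ n = -m := by
    rw [← lamZ_neg]
    exact ⟨fun h => by rw [← lamZ_lamZ n, h, lamZ_lamZ], fun h => by rw [h]⟩
  rw [tk, tk]
  simp only [kf_add_left, kf_add_right, kf_smul_left, kf_smul_right, hE.kf_eq hR hm hn,
    hE.kf_eq hR hm (C7_lam hn), hE.kf_eq hR (C7_lam hm) hn,
    hE.kf_eq hR (C7_lam hm) (C7_lam hn), h1, h2]
  rcases eps_cases k with ⟨rfl, h⟩ | ⟨rfl, h⟩ <;> rcases eps_cases l with ⟨rfl, h'⟩ | ⟨rfl, h'⟩ <;>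
    simp only [eps_zero, eps_one]
  · rw [if_pos (show (0 : ZMod 2) + 0 = 0 by decide)]; ring
  · rw [if_neg (show ¬(0 : ZMod 2) + 1 = 0 by decide)]; ring
  · rw [if_neg (show ¬(1 : ZMod 2) + 0 = 0 by decide)]; ring
  · rw [if_pos (show (1 : ZMod 2) + 1 = 0 by decide)]; ring

lemma kf_c_smul_tk (k l : ZMod 2) {m n : Fin 7 → ℤ} (hm : m ∈ C7) (hn : n ∈ C7) :
    kf ((c : ℂ) • tk E k m) ((c : ℂ) • tk E l n) = if k + l = 0 then
      ((if n = -m then 1 else 0) + eps k * if n = -lamZ m then 1 else 0) else 0 := by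
  have hc : (c : ℂ) * c = 1 / 2 := by rw [← Complex.ofReal_mul, c_sq]; norm_num
  rw [kf_smul_left, kf_smul_right, ← mul_assoc, hc, kf_tk hE hR k l hm hn]
  split_ifs <;> ring

theorem kf_chevalley : (∀ u v, kf (hh φ u) (hh φ v) = u ⬝ᵥ v) ∧
    (∀ u, ∀ α ∈ R7, kf (hh φ u) (E α) = 0) ∧ (∀ α ∈ R7, kf (E α) (E (-α)) = 1) ∧
    (∀ α ∈ R7, ∀ β ∈ R7, β ≠ -α → kf (E α) (E β) = 0) := by
  refine ⟨kf_hh_hh hR, fun u α hα => ?_, fun α hα => ?_, fun α hα β hβ h => ?_⟩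
  · obtain ⟨n, hn, rfl⟩ := R7_eq ▸ hα
    exact hE.kf_hh_eq_zero hn u
  · obtain ⟨n, hn, rfl⟩ := R7_eq ▸ hα
    rw [← emb_neg, hE.kf_eq hR hn (C7_neg hn), if_pos rfl]
  · obtain ⟨n, hn, rfl⟩ := R7_eq ▸ hα
    obtain ⟨m, hm, rfl⟩ := R7_eq ▸ hβ
    rw [hE.kf_eq hR hn hm, if_neg]
    rintro rfl
    exact h (emb_neg n)

theorem kf_f4 : (∀ i j s t, kf (basisSo7 φ E (.fix i s)) (basisSo7 φ E (.fix j t)) =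
      if i = j ∧ t = -s then 1 else 0) ∧
    (∀ i j s t, kf (basisSo7 φ E (.mov i s)) (basisSo7 φ E (.mov j t)) =
      if i = j ∧ t = -s then 2 else 0) ∧
    (∀ a b s t, kf (basisJ0 φ E (.R a s)) (basisJ0 φ E (.R b t)) =
      if b = a + 4 ∧ t = -s then 2 else 0) ∧
    (∀ a b ha hb s t, kf (basisJ0 φ E (.L a ha s)) (basisJ0 φ E (.L b hb t)) =
      if b = a + 4 ∧ t = -s then 1 else 0) ∧
    (∀ s t, kf (basisJ0 φ E (.L4 s)) (basisJ0 φ E (.L4 t)) = if t = -s then 2 else 0) := by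
  refine ⟨fun i j s t => ?_, fun i j s t => ?_, fun a b s t => ?_, fun a b ha hb s t => ?_,
    fun s t => ?_⟩
  · rw [basisSo7_fix, basisSo7_fix, hE.kf_eq hR (C8_subset (cFix_facts i s).1)
      (C8_subset (cFix_facts j t).1)]
    simp only [cFix_eq_neg]
  · rw [basisSo7_mov, basisSo7_mov, kf_tk hE hR _ _ (C8_subset (cMov_mem i s))
      (C8_subset (cMov_mem j t)), if_pos (by decide), if_neg (cMov_eq_neg i j s t).2]
    simp only [(cMov_eq_neg i j s t).1]
    split_ifs <;> simp
  · rw [basisJ0_R, basisJ0_R, kf_tk hE hR _ _ (C6_subset (cLRV_mem a s).2.1)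
      (C6_subset (cLRV_mem b t).2.1), if_pos (by decide), if_neg (cR_eq_neg a b s t).2]
    simp only [(cR_eq_neg a b s t).1]
    split_ifs <;> simp
  · rw [basisJ0_L, basisJ0_L, hE.kf_eq hR (C6_subset (cLRV_mem a s).1)
      (C6_subset (cLRV_mem b t).1)]
    simp only [cL_eq_neg]
  · rw [basisJ0_L4, basisJ0_L4, kf_tk hE hR _ _ (C6_subset (cLRV_mem 3 s).1)
      (C6_subset (cLRV_mem 3 t).1), if_pos (by decide), if_neg (cL_three_eq_neg s t).1]
    simp only [(cL_three_eq_neg s t).2]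
    split_ifs <;> simp

theorem kf_generators : (∀ k l a b s t, kf (tRp E k a s) (tRp E l b t) =
      if b = a + 4 ∧ t = -s ∧ k + l = 0 then 1 else 0) ∧
    (∀ k l s t, kf (tLp4 E k s) (tLp4 E l t) =
      if t = s ∧ k + l = 0 then (-1) ^ k.val else 0) ∧
    (∀ k l s t, kf (tL4 E k s) (tL4 E l t) =
      if t = -s ∧ k + l = 0 then (-1) ^ k.val else 0) ∧
    (∀ k l a b s t, kf (tR E k a s) (tR E l b t) =
      if b = a + 4 ∧ t = -s ∧ k + l = 0 then 1 else 0) ∧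
    (∀ k l, ∀ a b : Fin 8, a ≠ 3 ∧ a ≠ 7 → b ≠ 3 ∧ b ≠ 7 → kf (tLp E k a) (tLp E l b) =
      if b = a + 4 ∧ k + l = 0 then (-1) ^ k.val else 0) ∧
    (∀ i j s t, kf (tM E i s) (tM E j t) = if i = j ∧ t = -s then 1 else 0) ∧
    (∀ k l s t, kf (t5 E k s) (t5 E l t) = if t = -s ∧ k + l = 0 then 1 else 0) ∧
    (∀ k l, kf (t6 E k 1) (t6 E l (-1)) = if k + l = 0 then 1 else 0) ∧
    (∀ i j, kf (hh φ (toC (![hA1, hA2] i))) (hh φ (toC (![hA1, hA2] j))) =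
      (CartanMatrix.A 2 i j : ℂ)) ∧
    (∀ i, kf (hh φ (toC hE5)) (hh φ (toC (![hA1, hA2] i))) = 0) ∧
    kf (hh φ (toC hE5)) (hh φ (toC hE5)) = 1 := by
  have key (P : Prop) [Decidable P] (k l : ZMod 2) (x : ℂ) :
      (if k + l = 0 then if P then x else 0 else 0) = if P ∧ k + l = 0 then x else 0 := by
    split_ifs <;> tauto
  refine ⟨fun k l a b s t => ?_, fun k l s t => ?_, fun k l s t => ?_, fun k l a b s t => ?_,
    fun k l a b ha hb => ?_, fun i j s t => ?_, fun k l s t => ?_, fun k l => ?_, fun i j => ?_,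
    fun i => ?_, ?_⟩
  · rw [tRp_eq, tRp_eq, kf_c_smul_tk hE hR _ _ (cLRVp_mem a s).2.1 (cLRVp_mem b t).2.1,
      if_neg (cRp_eq_neg a b s t).2, mul_zero, add_zero]
    simp only [(cRp_eq_neg a b s t).1, key, and_assoc]
  · rw [tLp4_eq, tLp4_eq, kf_c_smul_tk hE hR _ _ (cLRVp_mem 3 s).1 (cLRVp_mem 3 t).1,
      if_neg (cLp_three_eq_neg s t).1, zero_add]
    simp only [(cLp_three_eq_neg s t).2, mul_ite, mul_one, mul_zero, key]; rfl
  · rw [tL4_eq, tL4_eq, kf_c_smul_tk hE hR _ _ (C6_subset (cLRV_mem 3 s).1)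
      (C6_subset (cLRV_mem 3 t).1), if_neg (cL_three_eq_neg s t).1, zero_add]
    simp only [(cL_three_eq_neg s t).2, mul_ite, mul_one, mul_zero, key]; rfl
  · rw [tR_eq, tR_eq, kf_c_smul_tk hE hR _ _ (C6_subset (cLRV_mem a s).2.1)
      (C6_subset (cLRV_mem b t).2.1), if_neg (cR_eq_neg a b s t).2, mul_zero, add_zero]
    simp only [(cR_eq_neg a b s t).1, key, and_assoc]
  · rw [tLp_eq k a ha, tLp_eq l b hb, kf_c_smul_tk hE hR _ _ (cLRVp_mem a 1).1 (cLRVp_mem b 1).1,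
      if_neg (cLp_eq_neg a b ha).1, zero_add]
    simp only [(cLp_eq_neg a b ha).2, mul_ite, mul_one, mul_zero, key]; rfl
  · rw [tM_eq, tM_eq, kf_c_smul_tk hE hR _ _ (C8_subset (cMov_mem i s))
      (C8_subset (cMov_mem j t)), if_neg (cMov_eq_neg i j s t).2, mul_zero, add_zero,
      if_pos (by decide)]
    simp only [(cMov_eq_neg i j s t).1]
  · rw [t5_eq, t5_eq, kf_c_smul_tk hE hR _ _ (cE_mem 0 s) (cE_mem 0 t),
      if_neg (cE_zero_eq_neg s t).2, mul_zero, add_zero]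
    simp only [(cE_zero_eq_neg s t).1, key]
  · rw [t6_eq, t6_eq, kf_c_smul_tk hE hR _ _ (cE_mem 1 1) (cE_mem 1 (-1)),
      if_neg cE_one_eq_neg.2, mul_zero, add_zero, if_pos cE_one_eq_neg.1]
  · rw [kf_hh_hh hR, toC_dot, hA_dot, Complex.ofReal_intCast]
  · rw [kf_hh_hh hR, toC_dot, hE5_dot.1, Complex.ofReal_zero]
  · rw [kf_hh_hh hR, toC_dot, hE5_dot.2, Complex.ofReal_one]

end Lie

end

end E7

namespace E7

noncomputable section

/-! ### Exponentials and lifts of reflections -/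

/-- If `(ad x)^3 = 0`, then `exp (ad x)` is an automorphism of the Lie algebra. -/
lemma exists_lieExp {L : Type*} [LieRing L] [LieAlgebra ℂ L] {x : L}
    (hx : ∀ v : L, ⁅x, ⁅x, ⁅x, v⁆⁆⁆ = 0) :
    ∃ Φ : L ≃ₗ⁅ℂ⁆ L, ∀ v, Φ v = v + ⁅x, v⁆ + (2⁻¹ : ℂ) • ⁅x, ⁅x, v⁆⁆ := by
  obtain ⟨D, hD⟩ : ∃ D : L →ₗ[ℂ] L, ∀ v, ⁅x, v⁆ = D v := ⟨LieAlgebra.ad ℂ L x, fun _ => rfl⟩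
  have hl (a b : L) : D ⁅a, b⁆ = ⁅D a, b⁆ + ⁅a, D b⁆ := by
    rw [← hD, ← hD, ← hD, leibniz_lie]
  simp only [hD] at hx ⊢
  clear hD
  -- Leibniz' rule for `D³ = 0` on a bracket leaves three times the sum of these two terms. Together
  -- with `h4` it removes the terms of degree above two in the product of exponentials.
  have h3 (a b : L) : ⁅D (D a), D b⁆ = -⁅D a, D (D b)⁆ := by
    have h := hx ⁅a, b⁆
    simp only [hl, map_add, hx, zero_lie, lie_zero, zero_add, add_zero] at h
    have h' : (3 : ℂ) • (⁅D (D a), D b⁆ + ⁅D a, D (D b)⁆) = 0 := by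
      rw [← h]; module
    exact eq_neg_of_add_eq_zero_left ((smul_eq_zero.1 h').resolve_left (by norm_num))
  have h4 (a b : L) : ⁅D (D a), D (D b)⁆ = 0 := by
    have h := congrArg D (h3 a b)
    simp only [hl, map_neg, hx, zero_lie, lie_zero, zero_add, add_zero] at h
    have h' : (2 : ℂ) • ⁅D (D a), D (D b)⁆ = 0 := by
      rw [two_smul]; nth_rw 1 [h]; exact neg_add_cancel _
    exact (smul_eq_zero.1 h').resolve_left two_ne_zero
  -- The inverse is the exponential of `-D`.
  refine ⟨{ toLinearMap := LinearMap.id + D + (2⁻¹ : ℂ) • (D * D)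
            map_lie' := ?_
            invFun := fun v => v - D v + (2⁻¹ : ℂ) • D (D v)
            left_inv := ?_
            right_inv := ?_ }, fun v => rfl⟩
  · intro a b
    change ⁅a, b⁆ + D ⁅a, b⁆ + (2⁻¹ : ℂ) • D (D ⁅a, b⁆) =
      ⁅a + D a + (2⁻¹ : ℂ) • D (D a), b + D b + (2⁻¹ : ℂ) • D (D b)⁆
    simp only [hl, map_add, lie_add, add_lie, smul_lie, lie_smul, smul_add, h4, h3]
    module
  · intro v
    change (v + D v + (2⁻¹ : ℂ) • D (D v)) - D (v + D v + (2⁻¹ : ℂ) • D (D v)) +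
      (2⁻¹ : ℂ) • D (D (v + D v + (2⁻¹ : ℂ) • D (D v))) = v
    simp only [map_add, map_smul, hx, map_zero, smul_zero]
    module
  · intro v
    change (v - D v + (2⁻¹ : ℂ) • D (D v)) + D (v - D v + (2⁻¹ : ℂ) • D (D v)) +
      (2⁻¹ : ℂ) • D (D (v - D v + (2⁻¹ : ℂ) • D (D v))) = v
    simp only [map_add, map_sub, map_smul, hx, map_zero, smul_zero]
    module

/-- For a root `m` the norm of `3n + m` is `18 + 6 (n, m) + 2`, which is at least `8` as `(n, m) ≥
-2`. Hence the cube of `ad` of a root vector vanishes. -/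
lemma C7_three_add {n m : Fin 7 → ℤ} (hn : n ∈ C7) (hm : m ∈ C7 ∨ m = 0) :
    n + (n + (n + m)) ∉ C7 ∧ n + (n + (n + m)) ≠ 0 := by
  have h : 8 ≤ dotZ (n + (n + (n + m))) (n + (n + (n + m))) := by
    simp only [dotZ_add_left, dotZ_add_right, dotZ_comm m n, mem_C7.1 hn]
    rcases hm with hm | rfl
    · have := C7_le_dot hn hm
      rw [mem_C7.1 hm]
      omega
    · simp [dotZ]
  constructor
  · intro h1
    rw [mem_C7] at h1
    omega
  · intro h1
    rw [h1] at h
    simp [dotZ] at h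

/-- The reflection of `ℂ⁷` defined by a root. -/
def reflC (b : Fin 7 → ℤ) (u : Fin 7 → ℂ) : Fin 7 → ℂ :=
  u - (toC (emb b) ⬝ᵥ u) • toC (emb b)

section Lie

variable {L : Type*} [LieRing L] [LieAlgebra ℂ L] {H : LieSubalgebra ℂ L}
  {φ : H ≃ₗ[ℂ] (Fin 7 → ℂ)}

lemma IsRootVector.map {N : L ≃ₗ⁅ℂ⁆ L} {f g : (Fin 7 → ℂ) → Fin 7 → ℂ} {α β : Fin 7 → ℝ}
    (hN : ∀ u, N (hh φ u) = hh φ (f u)) (hfg : ∀ u, f (g u) = u)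
    (hg : ∀ u, toC α ⬝ᵥ g u = toC β ⬝ᵥ u) {x : L} (hx : IsRootVector φ α x) :
    IsRootVector φ β (N x) := fun u => by
  conv_lhs => rw [← hfg u, ← hN, ← LieEquiv.map_lie, hx, map_smul, hg]

variable [FiniteDimensional ℂ L] [LieAlgebra.IsKilling ℂ L] [H.IsCartanSubalgebra]
  (hR : Set.range (LieAlgebra.IsKilling.rootSystem H).root = form φ '' R7)
include hR

/-- The Lie algebra is spanned by the Cartan subalgebra and the root vectors. -/
lemma rootVector_induction {p : L → Prop} (hh0 : ∀ u, p (hh φ u))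
    (hr : ∀ n ∈ C7, ∀ x, IsRootVector φ (emb n) x → p x) (hadd : ∀ x y, p x → p y → p (x + y))
    (x : L) : p x := by
  have htop := LieModule.iSup_genWeightSpace_eq_top' (K := ℂ) (L := H) (M := L)
  rw [← LieSubmodule.toSubmodule_inj, LieSubmodule.iSup_toSubmodule] at htop
  have hx : x ∈ (⊤ : LieSubmodule ℂ H L).toSubmodule := Submodule.mem_top
  rw [← htop] at hx
  refine Submodule.iSup_induction _ (motive := p) hx (fun χ x hx => ?_) ?_ hadd
  · by_cases hχ : χ.IsZero
    · rw [LieSubmodule.mem_toSubmodule, hχ.eq] at hx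
      change x ∈ LieAlgebra.rootSpace H 0 at hx
      rw [LieAlgebra.rootSpace_zero_eq] at hx
      obtain ⟨u, rfl⟩ := exists_hh φ hx
      exact hh0 u
    · obtain ⟨n, hn, h⟩ := exists_code hR χ hχ
      exact hr n hn x (by rw [isRootVector_iff, ← h]; exact hx)
  · rw [← hh_zero φ]; exact hh0 0

lemma IsRootVector.lie_lie_lie {n : Fin 7 → ℤ} (hn : n ∈ C7) {x : L}
    (hx : IsRootVector φ (emb n) x) (v : L) : ⁅x, ⁅x, ⁅x, v⁆⁆⁆ = 0 := by
  have key {m : Fin 7 → ℤ} (hm : m ∈ C7 ∨ m = 0) {v : L} (hv : IsRootVector φ (emb m) v) :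
      ⁅x, ⁅x, ⁅x, v⁆⁆⁆ = 0 := by
    have h := hx.lie (hx.lie (hx.lie hv))
    rw [← emb_add, ← emb_add, ← emb_add] at h
    exact h.eq_zero hR (C7_three_add hn hm).1 (C7_three_add hn hm).2
  induction v using rootVector_induction (φ := φ) hR with
  | hh0 u => exact key (Or.inr rfl) (by rw [emb_zero]; exact isRootVector_hh u)
  | hr m hm v hv => exact key (Or.inl hm) hv
  | hadd v w hv hw => simp only [lie_add, hv, hw, add_zero]

lemma IsRootVector.exists_exp {n : Fin 7 → ℤ} (hn : n ∈ C7) {x : L}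
    (hx : IsRootVector φ (emb n) x) :
    ∃ Φ : L ≃ₗ⁅ℂ⁆ L, (∀ v, Φ v = v + ⁅x, v⁆ + (2⁻¹ : ℂ) • ⁅x, ⁅x, v⁆⁆) ∧
      (∀ v, ⁅x, v⁆ = 0 → Φ v = v) ∧ ∀ v, ⁅x, ⁅x, v⁆⁆ = 0 → Φ v = v + ⁅x, v⁆ := by
  obtain ⟨Φ, h⟩ := exists_lieExp (hx.lie_lie_lie hR hn)
  exact ⟨Φ, h, fun v hv => by simp [h, hv], fun v hv => by simp [h, hv]⟩

lemma IsRootVector.lie_eq_zero {m n : Fin 7 → ℤ} (hm : m ∈ C7) (hn : n ∈ C7)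
    (h : 0 ≤ dotZ m n) {x y : L} (hx : IsRootVector φ (emb m) x) (hy : IsRootVector φ (emb n) y) :
    ⁅x, y⁆ = 0 := by
  have h1 := hx.lie hy
  rw [← emb_add] at h1
  exact h1.eq_zero hR (C7_add_not hm hn h).1 (C7_add_not hm hn h).2

/-- The reflection in a root lifts to an automorphism of the Lie algebra. -/
lemma exists_reflection {b : Fin 7 → ℤ} (hb : b ∈ C7) {X Y : L} (hX : IsRootVector φ (emb b) X)
    (hY : IsRootVector φ (emb (-b)) Y) (hXY : ⁅X, Y⁆ = hh φ (toC (emb b))) :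
    ∃ N : L ≃ₗ⁅ℂ⁆ L, (∀ u, N (hh φ u) = hh φ (reflC b u)) ∧ N X = -Y ∧ N Y = -X ∧
      ∀ n ∈ C7, ∀ v, IsRootVector φ (emb n) v → (dotZ b n = 0 → N v = v) ∧
        (dotZ b n = -1 → N v = ⁅X, v⁆) ∧ (dotZ b n = 1 → N v = -⁅Y, v⁆) := by
  have hb' := C7_neg hb
  have hY' : IsRootVector φ (emb (-b)) (-Y) := by
    have := hY.smul (-1); rwa [neg_one_smul] at this
  obtain ⟨P, hP, hP0, hP1⟩ := hX.exists_exp hR hb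
  obtain ⟨Q, hQ, hQ0, hQ1⟩ := hY'.exists_exp hR hb'
  have hXh (u) : ⁅X, hh φ u⁆ = -(toC (emb b) ⬝ᵥ u) • X := by
    rw [← lie_skew, hX u, neg_smul]
  have hYh (u) : ⁅Y, hh φ u⁆ = (toC (emb b) ⬝ᵥ u) • Y := by
    rw [← lie_skew, hY u, emb_neg, toC_neg, neg_dotProduct, neg_smul, neg_neg]
  have hYX : ⁅Y, X⁆ = -hh φ (toC (emb b)) := by rw [← lie_skew, hXY]
  have hbb : toC (emb b) ⬝ᵥ toC (emb b) = 2 := by rw [toC_emb_dot, mem_C7.1 hb]; norm_num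
  have hPh (u) : P (hh φ u) = hh φ u - (toC (emb b) ⬝ᵥ u) • X := by
    rw [hP1 _ (by rw [hXh, lie_smul, lie_self, smul_zero]), hXh, neg_smul, sub_eq_add_neg]
  have hPX : P X = X := hP0 _ (lie_self X)
  have hQY : Q Y = Y := hQ0 _ (by rw [neg_lie, lie_self, neg_zero])
  have hPY : P Y = Y + hh φ (toC (emb b)) - X := by
    rw [hP, hXY, hXh, hbb]; module
  have hQX : Q X = X + hh φ (toC (emb b)) - Y := by
    rw [hQ, neg_lie, neg_lie, hYX, neg_neg, hYh, hbb]; module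
  have hQh (u) : Q (hh φ u) = hh φ u - (toC (emb b) ⬝ᵥ u) • Y := by
    rw [hQ1 _ (by rw [neg_lie, neg_lie, hYh, lie_neg, lie_smul, lie_self]; simp), neg_lie, hYh,
      sub_eq_add_neg]
  -- This is `exp(ad X) exp(-ad Y) exp(ad X)`, the usual representative in `SL₂` of the nontrivial
  -- Weyl group element.
  refine ⟨(P.trans Q).trans P, fun u => ?_, ?_, ?_, fun n hn v hv => ⟨fun h => ?_, fun h => ?_,
    fun h => ?_⟩⟩ <;> simp only [LieEquiv.trans_apply]
  · simp only [hPh, hQh, hQX, hPX, hPY, map_sub, map_add, map_smul, hbb, reflC, hh_sub, hh_smul]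
    module
  · simp only [hPh, hQX, hPX, hPY, map_sub, map_add, hbb]
    module
  · simp only [hPh, hPY, hPX, hQX, hQY, hQh, map_sub, map_add, hbb, map_smul]
    module
  · have h1 : ⁅X, v⁆ = 0 := hX.lie_eq_zero hR hb hn h.ge hv
    have h2 : ⁅Y, v⁆ = 0 := hY.lie_eq_zero hR hb' hn (by rw [dotZ_neg_left, h, neg_zero]) hv
    rw [hP0 v h1, hQ0 v (by rw [neg_lie, h2, neg_zero]), hP0 v h1]
  · have h2 : ⁅Y, v⁆ = 0 := hY.lie_eq_zero hR hb' hn (by rw [dotZ_neg_left, h]; norm_num) hv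
    have hbn := C7_add hb hn h
    have h3 : IsRootVector φ (emb (b + n)) ⁅X, v⁆ := by rw [emb_add]; exact hX.lie hv
    have h4 : ⁅X, ⁅X, v⁆⁆ = 0 := hX.lie_eq_zero hR hb hbn
      (by rw [dotZ_add_right, h, mem_C7.1 hb]; norm_num) h3
    have h5 : ⁅Y, ⁅X, v⁆⁆ = v := by
      rw [leibniz_lie, hYX, h2, lie_zero, add_zero, neg_lie, hv, dotProduct_comm, toC_emb_dot, h]
      simp
    rw [hP1 v h4, map_add, hQ0 v (by rw [neg_lie, h2, neg_zero]),
      hQ1 ⁅X, v⁆ (by rw [neg_lie, neg_lie, h5, lie_neg, h2]; simp), neg_lie, h5]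
    rw [add_neg_cancel_comm_assoc, hP0 _ h4]
  · have h1 : ⁅X, v⁆ = 0 := hX.lie_eq_zero hR hb hn (by rw [h]; norm_num) hv
    have hbn := C7_add hb' hn (by rw [dotZ_neg_left, h])
    have h3 : IsRootVector φ (emb (-b + n)) ⁅Y, v⁆ := by rw [emb_add]; exact hY.lie hv
    have h4 : ⁅Y, ⁅Y, v⁆⁆ = 0 := hY.lie_eq_zero hR hb' hbn
      (by rw [dotZ_add_right, dotZ_neg_left, dotZ_neg_right, dotZ_neg_left, h, mem_C7.1 hb]
          norm_num) h3
    have h5 : ⁅X, ⁅Y, v⁆⁆ = v := by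
      rw [leibniz_lie, hXY, h1, lie_zero, add_zero, hv, dotProduct_comm, toC_emb_dot, h]
      simp
    rw [hP0 v h1, hQ1 v (by rw [neg_lie, neg_lie, lie_neg, h4]; simp), map_add, hP0 v h1,
      hP1 ⁅-Y, v⁆ (by rw [neg_lie, lie_neg, h5, lie_neg, h1, neg_zero]), neg_lie, lie_neg, h5]
    abel

end Lie

end

end E7

namespace E7

noncomputable section

/-! ### Existence of Chevalley bases -/

/-- Seven pairwise orthogonal roots. -/
def orthoList : List (Fin 7 → ℤ) :=
  [cD 0 1 1 1, cD 0 1 1 (-1), cD 2 3 1 1, cD 2 3 1 (-1), cE 0 1, cE 1 1, cE 2 1]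

lemma orthoList_facts : (∀ b ∈ orthoList, b ∈ C7) ∧
    orthoList.Pairwise (fun a b => dotZ a b = 0) := by
  decide +kernel

/-- Seven orthogonal vectors of norm `2` form an orthogonal basis, so the expansion gives `2u`, and
the product of the seven reflections is `-1`. -/
lemma sum_orthoList (u : Fin 7 → ℂ) :
    (orthoList.map fun b => (toC (emb b) ⬝ᵥ u) • toC (emb b)).sum = u + u := by
  have hc : (c : ℂ) * c = 1 / 2 := by rw [← Complex.ofReal_mul, c_sq]; norm_num
  simp only [orthoList, List.map_cons, List.map_nil, List.sum_cons, List.sum_nil]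
  rw [← cD_eq (by decide), ← cD_eq (by decide), ← cD_eq (by decide), ← cD_eq (by decide), ← aE_eq,
    ← aE_eq, ← aE_eq]
  ext j
  fin_cases j <;>
    simp [toC, e, aE, dotProduct, Fin.sum_univ_seven, sqrt_two_eq] <;>
    first | linear_combination (4 * u 4) * hc | linear_combination (4 * u 5) * hc |
      linear_combination (4 * u 6) * hc | ring

lemma posRoots_facts : ∀ n ∈ C7, (n ∈ posRoots ∧ -n ∉ posRoots) ∨ n ∉ posRoots ∧ -n ∈ posRoots := by
  decide +kernel

lemma dotProduct_sum_map (b : Fin 7 → ℤ) (u : Fin 7 → ℂ) (l : List (Fin 7 → ℤ))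
    (h : ∀ a ∈ l, dotZ b a = 0) :
    toC (emb b) ⬝ᵥ (l.map fun b => (toC (emb b) ⬝ᵥ u) • toC (emb b)).sum = 0 := by
  induction l with
  | nil => simp
  | cons a l ih =>
    rw [List.map_cons, List.sum_cons, dotProduct_add, dotProduct_smul, toC_emb_dot,
      h a List.mem_cons_self, ih fun a' ha' => h a' (List.mem_cons_of_mem _ ha')]
    simp

section Lie

variable {L : Type*} [LieRing L] [LieAlgebra ℂ L] {H : LieSubalgebra ℂ L}
  {φ : H ≃ₗ[ℂ] (Fin 7 → ℂ)}
variable [FiniteDimensional ℂ L] [LieAlgebra.IsKilling ℂ L] [H.IsCartanSubalgebra]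
  (hR : Set.range (LieAlgebra.IsKilling.rootSystem H).root = form φ '' R7)

lemma hh_emb_ne_zero {n : Fin 7 → ℤ} (hn : n ∈ C7) : hh φ (toC (emb n)) ≠ 0 := by
  intro h
  have h1 : toC (emb n) = 0 := hh_injective φ (h.trans (hh_zero φ).symm)
  have h2 := toC_emb_dot n n
  rw [h1, mem_C7.1 hn] at h2
  simp at h2

include hR

lemma exists_product_reflection (l : List (Fin 7 → ℤ)) (hl : ∀ b ∈ l, b ∈ C7)
    (ho : l.Pairwise (fun a b => dotZ a b = 0)) : ∃ N : L ≃ₗ⁅ℂ⁆ L, ∀ u, N (hh φ u) =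
      hh φ (u - (l.map fun b => (toC (emb b) ⬝ᵥ u) • toC (emb b)).sum) := by
  induction l with
  | nil => exact ⟨LieEquiv.refl, fun u => by simp⟩
  | cons b l ih =>
    obtain ⟨N, hN⟩ := ih (fun a ha => hl a (List.mem_cons_of_mem _ ha)) ho.of_cons
    have hb := hl b List.mem_cons_self
    obtain ⟨X, Y, hX, hY, hXY⟩ := exists_rootVector_pair hR hb
    obtain ⟨M, hM, -⟩ := exists_reflection hR hb hX hY hXY
    refine ⟨N.trans M, fun u => ?_⟩
    rw [LieEquiv.trans_apply, hN, hM, reflC, dotProduct_sub,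
      dotProduct_sum_map b u l (List.pairwise_cons.1 ho).1, sub_zero, List.map_cons, List.sum_cons,
      sub_sub, add_comm]

/-- Multiplication by `-1` on the Cartan subalgebra lifts to an automorphism. -/
lemma exists_neg : ∃ ω : L ≃ₗ⁅ℂ⁆ L, ∀ u, ω (hh φ u) = -hh φ u := by
  obtain ⟨ω, h⟩ := exists_product_reflection hR orthoList orthoList_facts.1 orthoList_facts.2
  refine ⟨ω, fun u => ?_⟩
  rw [h, sum_orthoList, sub_add_cancel_left, hh_neg]

variable {ω : L ≃ₗ⁅ℂ⁆ L} (hω : ∀ u, ω (hh φ u) = -hh φ u)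
include hω

omit hR in
lemma IsRootVector.map_neg {n : Fin 7 → ℤ} {x : L} (hx : IsRootVector φ (emb n) x) :
    IsRootVector φ (emb (-n)) (ω x) :=
  hx.map (f := fun u => -u) (g := fun u => -u) (fun u => by rw [hω, hh_neg]) (fun u => neg_neg u)
    (fun u => by rw [emb_neg, toC_neg, neg_dotProduct, dotProduct_neg])

/-- Scaling a root vector by `t` multiplies its bracket with its `ω`-image by `t²`, and square roots
exist in `ℂ`. -/
lemma exists_normalised {n : Fin 7 → ℤ} (hn : n ∈ C7) : ∃ x, IsRootVector φ (emb n) x ∧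
    ⁅x, ω x⁆ = -hh φ (toC (emb n)) ∧ ω (ω x) = x := by
  obtain ⟨X, Y, hX, hY, hXY⟩ := exists_rootVector_pair hR hn
  have hh0 := hh_emb_ne_zero (φ := φ) hn
  have hY0 : Y ≠ 0 := fun h => hh0 (by rw [← hXY, h, lie_zero])
  have hX0 : X ≠ 0 := fun h => hh0 (by rw [← hXY, h, zero_lie])
  obtain ⟨a, ha⟩ := hY.exists_smul hR (C7_neg hn) hY0 (hX.map_neg hω)
  have ha0 : a ≠ 0 := fun h => hX0 ((map_eq_zero_iff ω ω.injective).1 (by rw [ha, h, zero_smul]))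
  obtain ⟨t, ht⟩ := IsAlgClosed.exists_pow_nat_eq (-a⁻¹) (n := 2) (by norm_num)
  have h1 : ⁅t • X, ω (t • X)⁆ = -hh φ (toC (emb n)) := by
    rw [map_smul, ha, smul_lie, lie_smul, lie_smul, hXY, smul_smul, smul_smul, ← sq,
      ht, neg_mul, inv_mul_cancel₀ ha0, neg_one_smul]
  have hx := hX.smul t
  have hx0 : t • X ≠ 0 := fun h => hh0 (by rw [h, zero_lie] at h1; exact neg_eq_zero.1 h1.symm)
  refine ⟨t • X, hx, h1, ?_⟩
  have h2 := (hx.map_neg hω).map_neg hω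
  rw [neg_neg] at h2
  obtain ⟨s, hs⟩ := hx.exists_smul hR hn hx0 h2
  -- Since `ω² x = s x`, applying `ω` to the normalised bracket compares `s` times the coroot with
  -- the coroot, so `s = 1`.
  have h3 := congrArg ω h1
  rw [LieEquiv.map_lie, hs, lie_smul, ← lie_skew, h1, neg_neg, map_neg, hω, neg_neg] at h3
  have h4 : (s - 1) • hh φ (toC (emb n)) = 0 := by rw [sub_smul, h3, one_smul, sub_self]
  rw [hs, sub_eq_zero.1 ((smul_eq_zero.1 h4).resolve_right hh0), one_smul]

/-- Root vectors that are compatible with a lift of `-1` form a Chevalley basis. -/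
lemma isChevalley_of_neg {E : (Fin 7 → ℝ) → L} (hr : ∀ n ∈ C7, IsRootVector φ (emb n) (E (emb n)))
    (hneg : ∀ n ∈ C7, ω (E (emb n)) = -E (emb (-n)))
    (hco : ∀ n ∈ C7, ⁅E (emb n), E (emb (-n))⁆ = hh φ (toC (emb n))) : IsChevalley φ E where
  rootVector α hα := by
    obtain ⟨n, hn, rfl⟩ := R7_eq ▸ hα
    exact hr n hn
  coroot α hα := by
    obtain ⟨n, hn, rfl⟩ := R7_eq ▸ hα
    rw [← emb_neg, hco n hn]
  lie α hα β hβ hαβ := by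
    obtain ⟨m, hm, rfl⟩ := R7_eq ▸ hα
    obtain ⟨n, hn, rfl⟩ := R7_eq ▸ hβ
    rw [← emb_add] at hαβ ⊢
    have hmn := emb_mem_R7.1 hαβ
    have hd : dotZ m n = -1 := by
      have h1 := mem_C7.1 hmn
      rw [dotZ_add_left, dotZ_add_right, dotZ_add_right, mem_C7.1 hm, mem_C7.1 hn,
        dotZ_comm n m] at h1
      omega
    have hne : E (emb (m + n)) ≠ 0 := fun h => hh_emb_ne_zero (φ := φ) hmn (by
      rw [← hco _ hmn, h, zero_lie])
    have h1 := (hr m hm).lie (hr n hn)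
    rw [← emb_add] at h1
    obtain ⟨t, ht⟩ := (hr _ hmn).exists_smul hR hmn hne h1
    have h2 := congrArg ω ht
    rw [LieEquiv.map_lie, hneg m hm, hneg n hn, map_smul, hneg _ hmn, neg_lie, lie_neg, neg_neg,
      smul_neg] at h2
    have h3 : ⁅⁅E (emb m), E (emb n)⁆, E (emb (-m))⁆ = -E (emb n) := by
      have h0 : ⁅E (emb n), E (emb (-m))⁆ = 0 := (hr n hn).lie_eq_zero hR hn (C7_neg hm)
        (by rw [dotZ_neg_right, dotZ_comm, hd]; norm_num) (hr _ (C7_neg hm))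
      rw [lie_lie, h0, lie_zero, zero_sub, hco m hm, lie_skew, hr n hn, toC_emb_dot, dotZ_comm, hd]
      simp
    have h4 : ⁅⁅E (emb m), E (emb n)⁆, E (emb (-n))⁆ = E (emb m) := by
      have h0 : ⁅E (emb m), E (emb (-n))⁆ = 0 := (hr m hm).lie_eq_zero hR hm (C7_neg hn)
        (by rw [dotZ_neg_right, hd]; norm_num) (hr _ (C7_neg hn))
      rw [lie_lie, h0, lie_zero, sub_zero, hco n hn, ← lie_skew, hr m hm, toC_emb_dot, hd]
      simp
    -- By compatibility with `ω`, the structure constant of the opposite pair is `-t`. Evaluating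
    -- this bracket in two ways therefore gives `t² = 1`.
    have h5 : ⁅⁅E (emb m), E (emb n)⁆, ⁅E (emb (-m)), E (emb (-n))⁆⁆ =
        -hh φ (toC (emb (m + n))) := by
      rw [leibniz_lie, h3, h4, neg_lie, hco n hn, emb_add, toC_add, hh_add,
        ← lie_skew, hco m hm]
      abel
    rw [ht, h2, smul_lie, lie_neg, lie_smul, hco _ hmn] at h5
    have h6 : ((t - 1) * (t + 1)) • hh φ (toC (emb (m + n))) = 0 := by
      rw [smul_neg, neg_inj, smul_smul] at h5
      rw [show (t - 1) * (t + 1) = t * t - 1 by ring, sub_smul, h5, one_smul, sub_self]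
    rcases mul_eq_zero.1 ((smul_eq_zero.1 h6).resolve_right (hh_emb_ne_zero hmn)) with h | h
    · left; rw [ht, sub_eq_zero.1 h, one_smul]
    · right; rw [ht, eq_neg_of_add_eq_zero_left h, neg_one_smul]

omit hω in
-- Normalised vectors are chosen for positive roots, and the negative ones are defined as minus
-- their images under `ω`. The extension by zero off the root lattice is irrelevant.
theorem exists_chevalley : ∃ E : (Fin 7 → ℝ) → L, IsChevalley φ E := by
  classical
  obtain ⟨ω, hω⟩ := exists_neg hR
  choose! x hx1 hx2 hx3 using fun n (hn : n ∈ C7) => exists_normalised hR hω hn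
  let F (n : Fin 7 → ℤ) : L := if n ∈ posRoots then x n else -ω (x (-n))
  have hF (n) : Function.extend emb F 0 (emb n) = F n := emb_injective.extend_apply F 0 n
  refine ⟨Function.extend emb F 0, isChevalley_of_neg hR hω (fun n hn => ?_) (fun n hn => ?_)
    (fun n hn => ?_)⟩ <;> simp only [hF, F]
  · split_ifs
    · exact hx1 n hn
    · have h := ((hx1 _ (C7_neg hn)).map_neg hω).smul (-1)
      rwa [neg_one_smul, neg_neg] at h
  · rcases posRoots_facts n hn with ⟨h1, h2⟩ | ⟨h1, h2⟩
    · rw [if_pos h1, if_neg h2, neg_neg, neg_neg]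
    · rw [if_neg h1, if_pos h2, _root_.map_neg, hx3 _ (C7_neg hn)]
  · rcases posRoots_facts n hn with ⟨h1, h2⟩ | ⟨h1, h2⟩
    · rw [if_pos h1, if_neg h2, neg_neg, lie_neg, hx2 n hn, neg_neg]
    · rw [if_neg h1, if_pos h2, neg_lie, lie_skew, hx2 _ (C7_neg hn), emb_neg, toC_neg, hh_neg,
        neg_neg]

end Lie

end

end E7

namespace E7

noncomputable section

/-! ### Existence of the lift of `λ₇` -/

/-- Three pairwise orthogonal roots such that `λ₇` is the product of their reflections. -/
def orthB : Fin 3 → Fin 7 → ℤ := ![cE 1 1, cLp 3 1, cLp 3 (-1)]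

lemma orthB_facts : (∀ k, orthB k ∈ C7) ∧ ∀ j k, j ≠ k → dotZ (orthB j) (orthB k) = 0 := by
  decide +kernel

lemma orthB_eq : orthB = ![![0, 1, 2, 2, 2, 1, 1], ![1, 1, 2, 2, 1, 1, 1],
    ![-1, -2, -2, -1, -1, -1, -1]] := by
  decide +kernel

lemma lamZ_eq_orthB (n : Fin 7 → ℤ) : lamZ n = n - dotZ (orthB 0) n • orthB 0 -
    dotZ (orthB 1) n • orthB 1 - dotZ (orthB 2) n • orthB 2 := by
  rw [orthB_eq]
  ext i
  fin_cases i <;> simp [dotZ, lamZ, Matrix.vecHead, Matrix.vecTail] <;> ring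

/-- In the last case exactly two of the three reflections move the root, so the factors `i` of their
lifts combine to a real sign. -/
lemma orthB_cases : ∀ n ∈ C7, (∀ k, dotZ (orthB k) n = 0) ∨
    (∃ k, ∃ s : ℤˣ, n = (s : ℤ) • orthB k) ∨
    ((lamZ n ≠ n ∧ lamZ n ≠ -n) ∧ ∃ i j k : Fin 3, (i < j ∧ k ≠ i ∧ k ≠ j) ∧
      ∃ s t : ℤˣ, dotZ (orthB i) n = s ∧ dotZ (orthB j) n = t ∧ dotZ (orthB k) n = 0) := by
  decide +kernel

lemma lam_eq_sub_orthB (u : Fin 7 → ℂ) : lam ℂ u =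
    u - (toC (emb (orthB 0)) ⬝ᵥ u) • toC (emb (orthB 0)) -
      (toC (emb (orthB 1)) ⬝ᵥ u) • toC (emb (orthB 1)) -
      (toC (emb (orthB 2)) ⬝ᵥ u) • toC (emb (orthB 2)) := by
  have hc : (c : ℂ) * c = 1 / 2 := by rw [← Complex.ofReal_mul, c_sq]; norm_num
  rw [show orthB 0 = cE 1 1 from rfl, show orthB 1 = cLp 3 1 from rfl,
    show orthB 2 = cLp 3 (-1) from rfl, ← aE_eq, ← aLp_eq, ← aLp_eq, lam_complex_apply]
  ext j
  fin_cases j <;>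
    simp [toC, e, aE, aLp, wL, dotProduct, Fin.sum_univ_seven, sqrt_two_eq, Matrix.vecHead,
      Matrix.vecTail] <;>
    first | linear_combination (4 * u 5) * hc | linear_combination (2 * u 4 + 2 * u 6) * hc | ring

lemma orthB_lam : ∀ k, ∀ s : ℤˣ, lamZ ((s : ℤ) • orthB k) = -((s : ℤ) • orthB k) := by
  decide +kernel

lemma dotZ_smul_left (k : ℤ) (m n : Fin 7 → ℤ) : dotZ (k • m) n = k * dotZ m n := by
  simp [dotZ]; ring
lemma dotZ_smul_right (k : ℤ) (m n : Fin 7 → ℤ) : dotZ m (k • n) = k * dotZ m n := by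
  simp [dotZ]; ring

lemma C7_units_smul {n : Fin 7 → ℤ} (hn : n ∈ C7) (s : ℤˣ) : (s : ℤ) • n ∈ C7 := by
  rcases Int.units_eq_one_or s with rfl | rfl
  · simpa using hn
  · simpa using C7_neg hn

lemma units_mul_self (s : ℤˣ) : (s : ℤ) * s = 1 := by
  rcases Int.units_eq_one_or s with rfl | rfl <;> rfl

/-- The reflection is an involution that permutes the roots. -/
lemma C7_reflect {b n : Fin 7 → ℤ} (hb : b ∈ C7) (hn : n ∈ C7) {s : ℤˣ} (h : dotZ b n = s) :
    -((s : ℤ) • b) + n ∈ C7 :=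
  C7_add (C7_neg (C7_units_smul hb s)) hn (by
    rw [dotZ_neg_left, dotZ_smul_left, h, units_mul_self])

section Lie

variable {L : Type*} [LieRing L] [LieAlgebra ℂ L] {H : LieSubalgebra ℂ L}
  {φ : H ≃ₗ[ℂ] (Fin 7 → ℂ)} {E : (Fin 7 → ℝ) → L}

/-- `N` lifts the reflection in the root `b`; on the root spaces it is given by the vectors
`i E_{± b}`. -/
structure IsReflection (φ : H ≃ₗ[ℂ] (Fin 7 → ℂ)) (E : (Fin 7 → ℝ) → L) (b : Fin 7 → ℤ)
    (N : L ≃ₗ⁅ℂ⁆ L) : Prop where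
  hh : ∀ u, N (hh φ u) = hh φ (reflC b u)
  self : ∀ s : ℤˣ, N (E (emb ((s : ℤ) • b))) = E (emb (-((s : ℤ) • b)))
  zero : ∀ n ∈ C7, dotZ b n = 0 → ∀ v, IsRootVector φ (emb n) v → N v = v
  one : ∀ n ∈ C7, ∀ s : ℤˣ, dotZ b n = s → ∀ v, IsRootVector φ (emb n) v →
    N v = Complex.I • ⁅E (emb (-((s : ℤ) • b))), v⁆

variable [FiniteDimensional ℂ L] [LieAlgebra.IsKilling ℂ L] [H.IsCartanSubalgebra]
  (hE : IsChevalley φ E)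
  (hR : Set.range (LieAlgebra.IsKilling.rootSystem H).root = form φ '' R7)
include hE hR

/-- Using `i E b` and `-i E (-b)` in place of `E b` and `E (-b)` keeps the coroot but makes the lift
exchange `E b` and `E (-b)` without a sign. -/
lemma exists_isReflection {b : Fin 7 → ℤ} (hb : b ∈ C7) : ∃ N, IsReflection φ E b N := by
  have hI := Complex.I_mul_I
  obtain ⟨N, h1, h2, h3, h4⟩ := exists_reflection hR hb ((hE.root hb).smul Complex.I)
    ((hE.root (C7_neg hb)).smul (-Complex.I))
    (by rw [smul_lie, lie_smul, hE.lie_neg hb, smul_smul, mul_neg, hI, neg_neg, one_smul])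
  have hN1 : N (E (emb b)) = E (emb (-b)) := by
    rw [map_smul, neg_smul, neg_neg] at h2
    exact smul_right_injective L Complex.I_ne_zero h2
  have hN2 : N (E (emb (-b))) = E (emb b) := by
    rw [map_smul, neg_smul, neg_inj] at h3
    exact smul_right_injective L Complex.I_ne_zero h3
  refine ⟨N, h1, fun s => ?_, fun n hn h v hv => (h4 n hn v hv).1 h, fun n hn s h v hv => ?_⟩
  · rcases Int.units_eq_one_or s with rfl | rfl
    · simpa using hN1
    · simpa using hN2
  · rcases Int.units_eq_one_or s with rfl | rfl
    · rw [(h4 n hn v hv).2.2 (by simpa using h)]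
      simp
    · rw [(h4 n hn v hv).2.1 (by simpa using h)]
      simp

omit hR in
lemma lie_units_smul {b : Fin 7 → ℤ} (hb : b ∈ C7) {n : Fin 7 → ℤ} {s : ℤˣ}
    (h : dotZ b n = s) {v : L} (hv : IsRootVector φ (emb n) v) :
    ⁅⁅E (emb ((s : ℤ) • b)), E (emb (-((s : ℤ) • b)))⁆, v⁆ = v := by
  rw [hE.lie_neg (C7_units_smul hb s), hv, toC_emb_dot, dotZ_comm, dotZ_smul_left, h,
    units_mul_self]
  simp

/-! ### Products of lifts of two orthogonal reflections -/

namespace IsReflection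

variable {b b' : Fin 7 → ℤ} {N N' : L ≃ₗ⁅ℂ⁆ L}

lemma map_map (hb : b ∈ C7) (hbb : dotZ b b' = 0) (hN : IsReflection φ E b N)
    (hN' : IsReflection φ E b' N') {n : Fin 7 → ℤ} (hn : n ∈ C7) {s t : ℤˣ}
    (hs : dotZ b n = s) (ht : dotZ b' n = t) {v : L} (hv : IsRootVector φ (emb n) v) :
    N' (N v) = -⁅E (emb (-((t : ℤ) • b'))), ⁅E (emb (-((s : ℤ) • b))), v⁆⁆ := by
  have h1 : IsRootVector φ (emb (-((s : ℤ) • b) + n)) ⁅E (emb (-((s : ℤ) • b))), v⁆ := by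
    rw [emb_add]; exact (hE.root (C7_neg (C7_units_smul hb s))).lie hv
  rw [hN.one n hn s hs v hv, map_smul, hN'.one _ (C7_reflect hb hn hs) t (by
    rw [dotZ_add_right, dotZ_neg_right, dotZ_smul_right, dotZ_comm b' b, hbb, ht]; simp) _ h1,
    smul_smul, Complex.I_mul_I, neg_one_smul]

/-- After one application both scalar products change sign, so the second application brackets with
the opposite root vectors. Vectors attached to `b` and `b'` commute, and the two coroots then act by
`1`; the two signs `-1` cancel. -/
lemma map_map_E (hb : b ∈ C7) (hb' : b' ∈ C7) (hbb : dotZ b b' = 0) (hN : IsReflection φ E b N)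
    (hN' : IsReflection φ E b' N') {n : Fin 7 → ℤ} (hn : n ∈ C7) {s t : ℤˣ}
    (hs : dotZ b n = s) (ht : dotZ b' n = t) :
    (∃ x : ℤˣ, N' (N (E (emb n))) =
        (x : ℂ) • E (emb (-((t : ℤ) • b') + (-((s : ℤ) • b) + n)))) ∧
      N' (N (N' (N (E (emb n))))) = E (emb n) := by
  have hbs := C7_units_smul hb s
  have hbt := C7_units_smul hb' t
  have hst : dotZ b' (-((s : ℤ) • b) + n) = t := by
    rw [dotZ_add_right, dotZ_neg_right, dotZ_smul_right, dotZ_comm b' b, hbb, ht]; simp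
  have h1 := map_map hE hR hb hbb hN hN' hn hs ht (hE.root hn)
  have h2 := C7_reflect hb hn hs
  have h3 := C7_reflect hb' h2 hst
  obtain ⟨x, hx⟩ := hE.lie_of_dot_neg (C7_neg hbs) hn
    (by rw [dotZ_neg_left, dotZ_smul_left, hs, units_mul_self])
  obtain ⟨y, hy⟩ := hE.lie_of_dot_neg (C7_neg hbt) h2
    (by rw [dotZ_neg_left, dotZ_smul_left, hst, units_mul_self])
  refine ⟨⟨-(x * y), by rw [h1, hx, lie_smul, hy, smul_smul, ← neg_smul]; simp⟩, ?_⟩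
  have hw : IsRootVector φ (emb (-((t : ℤ) • b') + (-((s : ℤ) • b) + n))) (N' (N (E (emb n)))) := by
    have h4 := (hE.root h3).smul (-((x : ℂ) * (y : ℂ)))
    rwa [neg_smul, ← smul_smul, ← hy, ← lie_smul, ← hx, ← h1] at h4
  have hs' : dotZ b (-((t : ℤ) • b') + (-((s : ℤ) • b) + n)) = ((-s : ℤˣ) : ℤ) := by
    simp only [dotZ_add_right, dotZ_neg_right, dotZ_smul_right, hbb, hs, mem_C7.1 hb]
    push_cast; ring
  have ht' : dotZ b' (-((t : ℤ) • b') + (-((s : ℤ) • b) + n)) = ((-t : ℤˣ) : ℤ) := by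
    rw [dotZ_add_right, hst, dotZ_neg_right, dotZ_smul_right, mem_C7.1 hb']
    push_cast; ring
  rw [map_map hE hR hb hbb hN hN' h3 hs' ht' hw, h1]
  simp only [Units.val_neg, neg_smul, neg_neg, lie_neg]
  have hcomm : ⁅E (emb ((s : ℤ) • b)), E (emb (-((t : ℤ) • b')))⁆ = 0 :=
    hE.lie_of_dot_nonneg hR hbs (C7_neg hbt) (by
      rw [dotZ_neg_right, dotZ_smul_left, dotZ_smul_right, hbb]; simp)
  have h0 : ⁅E (emb ((s : ℤ) • b)), E (emb n)⁆ = 0 := hE.lie_of_dot_nonneg hR hbs hn (by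
    rw [dotZ_smul_left, hs, units_mul_self]; norm_num)
  have h0' : ⁅E (emb ((t : ℤ) • b')), E (emb n)⁆ = 0 := hE.lie_of_dot_nonneg hR hbt hn (by
    rw [dotZ_smul_left, ht, units_mul_self]; norm_num)
  rw [leibniz_lie (E (emb ((s : ℤ) • b))) (E (emb (-((t : ℤ) • b')))), hcomm, zero_lie, zero_add,
    leibniz_lie (E (emb ((s : ℤ) • b))), h0, lie_zero, add_zero,
    lie_units_smul hE hb hs (hE.root hn), leibniz_lie (E (emb ((t : ℤ) • b'))), h0', lie_zero,
    add_zero, lie_units_smul hE hb' ht (hE.root hn)]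

omit hR in
lemma map_fixed (hb : b ∈ C7) (hbb : dotZ b b' = 0) (hN : IsReflection φ E b N)
    (hN' : IsReflection φ E b' N') {n : Fin 7 → ℤ} (hn : n ∈ C7) {s : ℤˣ} (hs : dotZ b n = s)
    (h0 : dotZ b' n = 0) : N' (N (E (emb n))) = N (E (emb n)) := by
  refine hN'.zero _ (C7_reflect hb hn hs) (by
    rw [dotZ_add_right, dotZ_neg_right, dotZ_smul_right, dotZ_comm, hbb, h0]; simp) _ ?_
  rw [hN.one n hn s hs _ (hE.root hn), emb_add]
  exact ((hE.root (C7_neg (C7_units_smul hb s))).lie (hE.root hn)).smul _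

end IsReflection

/-- An automorphism that acts on the Cartan subalgebra through `λ₇` and permutes the vectors of a
Chevalley basis up to signs. -/
lemma exists_lam_up_to_sign : ∃ Λ : L ≃ₗ⁅ℂ⁆ L, (∀ u, Λ (hh φ u) = hh φ (lam ℂ u)) ∧
    ∀ n ∈ C7, (∃ x : ℤˣ, Λ (E (emb n)) = (x : ℂ) • E (emb (lamZ n))) ∧
      Λ (Λ (E (emb n))) = E (emb n) ∧
      (lamZ n = n ∨ lamZ n = -n → Λ (E (emb n)) = E (emb (lamZ n))) := by
  choose N hN using fun k => exists_isReflection hE hR (orthB_facts.1 k)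
  have hperm (n : Fin 7 → ℤ) (hn : n ∈ C7) (k : Fin 3) (h : dotZ (orthB k) n = 0) :
      N k (E (emb n)) = E (emb n) := (hN k).zero n hn h _ (hE.root hn)
  refine ⟨((N 0).trans (N 1)).trans (N 2), fun u => ?_, fun n hn => ?_⟩
  · have ho : ∀ j k, j ≠ k → toC (emb (orthB j)) ⬝ᵥ toC (emb (orthB k)) = 0 := fun j k hjk => by
      rw [toC_emb_dot, orthB_facts.2 j k hjk, Int.cast_zero]
    simp only [LieEquiv.trans_apply, (hN _).hh, reflC, dotProduct_sub, dotProduct_smul,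
      ho 1 0 (by decide), ho 2 0 (by decide), ho 2 1 (by decide), smul_zero, sub_zero,
      lam_eq_sub_orthB]
  simp only [LieEquiv.trans_apply]
  rcases orthB_cases n hn with h | ⟨k, s, rfl⟩ | ⟨⟨hl1, hl2⟩, i, j, k, ⟨hij, hki, hkj⟩, s, t, hi, hj, hk⟩
  · have hl : lamZ n = n := by rw [lamZ_eq_orthB, h, h, h]; simp
    have h1 := fun k => hperm n hn k (h k)
    simp only [h1, hl, implies_true, and_true]
    exact ⟨1, by simp⟩
  · have ho (j) (hj : j ≠ k) : N j (E (emb ((s : ℤ) • orthB k))) = E (emb ((s : ℤ) • orthB k)) :=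
      hperm _ hn j (by rw [dotZ_smul_right, orthB_facts.2 j k hj, mul_zero])
    have ho' (j) (hj : j ≠ k) : N j (E (emb (-((s : ℤ) • orthB k)))) =
        E (emb (-((s : ℤ) • orthB k))) :=
      hperm _ (C7_neg hn) j (by
        rw [dotZ_neg_right, dotZ_smul_right, orthB_facts.2 j k hj, mul_zero, neg_zero])
    have hs := (hN k).self s
    have hs' := (hN k).self (-s)
    rw [Units.val_neg, neg_smul, neg_neg] at hs'
    have key : N 2 (N 1 (N 0 (E (emb ((s : ℤ) • orthB k))))) = E (emb (-((s : ℤ) • orthB k))) ∧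
        N 2 (N 1 (N 0 (E (emb (-((s : ℤ) • orthB k)))))) = E (emb ((s : ℤ) • orthB k)) := by
      fin_cases k
      · simp only [Fin.mk_zero] at *
        rw [hs, hs', ho 1 (by decide), ho' 1 (by decide), ho 2 (by decide), ho' 2 (by decide)]
        exact ⟨rfl, rfl⟩
      · simp only [Fin.mk_one] at *
        rw [ho 0 (by decide), ho' 0 (by decide), hs, hs', ho 2 (by decide), ho' 2 (by decide)]
        exact ⟨rfl, rfl⟩
      · simp only [Fin.reduceFinMk] at *
        rw [ho 0 (by decide), ho' 0 (by decide), ho 1 (by decide), ho' 1 (by decide), hs, hs']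
        exact ⟨rfl, rfl⟩
    rw [orthB_lam, key.1, key.2]
    exact ⟨⟨1, by simp⟩, rfl, fun _ => rfl⟩
  -- The third lift acts trivially on every vector involved, wherever it stands in the product, so
  -- only the pair `i, j` matters.
  · have hl : -((t : ℤ) • orthB j) + (-((s : ℤ) • orthB i) + n) = lamZ n := by
      rw [lamZ_eq_orthB, ← hi, ← hj]
      fin_cases i <;> fin_cases j <;> fin_cases k <;> simp at hij hki hkj hk ⊢ <;> rw [hk] <;>
        simp <;> abel
    have hki' := orthB_facts.2 i k hki.symm
    have hkj' := orthB_facts.2 k j hkj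
    obtain ⟨⟨x, hx⟩, h2⟩ := (hN i).map_map_E hE hR (orthB_facts.1 i) (orthB_facts.1 j)
      (orthB_facts.2 i j hij.ne) (hN j) hn hi hj
    rw [hl] at hx
    have hlk : dotZ (orthB k) (lamZ n) = 0 := by
      rw [← hl, dotZ_add_right, dotZ_add_right, hk, dotZ_neg_right, dotZ_neg_right,
        dotZ_smul_right, dotZ_smul_right, hkj', dotZ_comm, hki']
      simp
    have hli : dotZ (orthB i) (lamZ n) = ((-s : ℤˣ) : ℤ) := by
      rw [← hl, dotZ_add_right, dotZ_add_right, hi, dotZ_neg_right, dotZ_neg_right,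
        dotZ_smul_right, dotZ_smul_right, orthB_facts.2 i j hij.ne, mem_C7.1 (orthB_facts.1 i)]
      push_cast; ring
    have f1 := hperm n hn k hk
    have f2 := hperm _ (C7_lam hn) k hlk
    have f3 := (hN i).map_fixed hE (orthB_facts.1 i) hki' (hN k) hn hi hk
    have f4 := (hN i).map_fixed hE (orthB_facts.1 i) hki' (hN k) (C7_lam hn) hli hlk
    refine ⟨⟨x, ?_⟩, ?_, fun h => absurd h (not_or.2 ⟨hl1, hl2⟩)⟩
    · fin_cases i <;> fin_cases j <;> fin_cases k <;> simp at hij hki hkj f1 f2 f3 f4 hx ⊢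
      · rw [hx, map_smul, f2]
      · rw [f3, hx]
      · rw [f1, hx]
    · fin_cases i <;> fin_cases j <;> fin_cases k <;> simp at hij hki hkj f1 f2 f3 f4 hx h2 ⊢
      · rw [show N 2 (N 1 (N 0 (E (emb n)))) = N 1 (N 0 (E (emb n))) by rw [hx, map_smul, f2],
          h2, f1]
      · rw [f3, show N 1 (N 0 (N 2 (N 0 (E (emb n))))) = N 0 (N 2 (N 0 (E (emb n)))) by
          rw [hx, map_smul, map_smul, f4], h2]
      · rw [f1, show N 0 (N 2 (N 1 (E (emb n)))) = N 2 (N 1 (E (emb n))) by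
          rw [hx, map_smul, f2], h2]

end Lie

end

end E7

/-! ### Absorbing the signs into the Chevalley basis -/

namespace E7

noncomputable section

/-- A function that takes different values on roots that are not equal up to sign. -/
def orbitKey (n : Fin 7 → ℤ) : ℤ :=
  (n 0 + 10 * n 1 + 100 * n 2 + 1000 * n 3 + 10000 * n 4 + 100000 * n 5 + 1000000 * n 6) ^ 2

lemma orbitKey_neg (n : Fin 7 → ℤ) : orbitKey (-n) = orbitKey n := by simp [orbitKey]; ring

lemma orbitKey_lamZ : ∀ n ∈ C7, orbitKey n = orbitKey (lamZ n) → lamZ n = n ∨ lamZ n = -n := by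
  decide +kernel

section Lie

variable {L : Type*} [LieRing L] [LieAlgebra ℂ L] {H : LieSubalgebra ℂ L}
  {φ : H ≃ₗ[ℂ] (Fin 7 → ℂ)} {E : (Fin 7 → ℝ) → L}

/-- A change of signs transforms a Chevalley basis into another one. -/
lemma IsChevalley.change_signs (hE : IsChevalley φ E) {E' : (Fin 7 → ℝ) → L}
    {s : (Fin 7 → ℤ) → ℤˣ} (h : ∀ n ∈ C7, E' (emb n) = (s n : ℂ) • E (emb n))
    (hs : ∀ n ∈ C7, s (-n) = s n) : IsChevalley φ E' where
  rootVector α hα := by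
    obtain ⟨n, hn, rfl⟩ := R7_eq ▸ hα
    rw [h n hn]
    exact (hE.root hn).smul _
  coroot α hα := by
    obtain ⟨n, hn, rfl⟩ := R7_eq ▸ hα
    rw [← emb_neg, h n hn, h _ (C7_neg hn), hs n hn, smul_lie, lie_smul, hE.lie_neg hn]
    rcases Int.units_eq_one_or (s n) with h | h <;> simp [h]
  lie α hα β hβ hαβ := by
    have h1 := hE.lie α hα β hβ hαβ
    obtain ⟨m, hm, rfl⟩ := R7_eq ▸ hα
    obtain ⟨n, hn, rfl⟩ := R7_eq ▸ hβ
    rw [← emb_add] at hαβ h1 ⊢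
    rw [h m hm, h n hn, h _ (emb_mem_R7.1 hαβ), smul_lie, lie_smul]
    rcases Int.units_eq_one_or (s m) with h2 | h2 <;>
      rcases Int.units_eq_one_or (s n) with h3 | h3 <;>
      rcases Int.units_eq_one_or (s (m + n)) with h4 | h4 <;> rcases h1 with h1 | h1 <;>
      simp [h1, h2, h3, h4]

lemma units_eq_of_smul_eq {x y : ℤˣ} {v : L} (hv : v ≠ 0) (h : (x : ℂ) • v = (y : ℂ) • v) :
    x = y := by
  have h1 := smul_left_injective ℂ hv h
  exact Units.ext (by exact_mod_cast h1)

variable [FiniteDimensional ℂ L] [LieAlgebra.IsKilling ℂ L] [H.IsCartanSubalgebra]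
  (hR : Set.range (LieAlgebra.IsKilling.rootSystem H).root = form φ '' R7)
include hR

/-- The sign of `Λ` at a root is unchanged under `λ₇`, because `Λ` squares to the identity on root
vectors, and under negation, because `Λ` respects coroots. It can thus be removed by rescaling one
root in each orbit of two. -/
theorem exists_chevalley_lift : ∃ (E : (Fin 7 → ℝ) → L) (Λ : L ≃ₗ⁅ℂ⁆ L), IsChevalley φ E ∧
    IsLift φ E Λ := by
  obtain ⟨E, hE⟩ := exists_chevalley hR
  obtain ⟨Λ, h1, h2⟩ := exists_lam_up_to_sign hE hR
  choose! σ hσ using fun n hn => (h2 n hn).1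
  have hσ1 (n) (hn : n ∈ C7) (h : lamZ n = n ∨ lamZ n = -n) : σ n = 1 :=
    units_eq_of_smul_eq (hE.ne_zero (C7_lam hn)) (by
      rw [← hσ n hn, (h2 n hn).2.2 h]; simp)
  have hσlam (n) (hn : n ∈ C7) : σ (lamZ n) = σ n := by
    have h3 := (h2 n hn).2.1
    rw [hσ n hn, map_smul, hσ _ (C7_lam hn), lamZ_lamZ, smul_smul] at h3
    have h4 : σ n * σ (lamZ n) = 1 := units_eq_of_smul_eq (hE.ne_zero hn) (by
      rw [Units.val_mul, Int.cast_mul, h3]; simp)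
    rw [← inv_eq_of_mul_eq_one_right h4, Int.units_inv_eq_self]
  have hσneg (n) (hn : n ∈ C7) : σ (-n) = σ n := by
    have h3 := congrArg Λ (hE.lie_neg hn)
    rw [LieEquiv.map_lie, hσ n hn, hσ _ (C7_neg hn), h1, lam_toC, lam_emb, smul_lie, lie_smul,
      lamZ_neg, hE.lie_neg (C7_lam hn), smul_smul] at h3
    have h4 : σ n * σ (-n) = 1 := units_eq_of_smul_eq (hh_emb_ne_zero (φ := φ) (C7_lam hn)) (by
      rw [Units.val_mul, Int.cast_mul, h3]; simp)
    rw [← inv_eq_of_mul_eq_one_right h4, Int.units_inv_eq_self]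
  -- The key selects a root of the orbit and is even, so `s (-n) = s n` and coroots are preserved. A
  -- tie occurs only for `λ₇ n = ±n`, where the sign is already `1`.
  let s (n : Fin 7 → ℤ) : ℤˣ := if orbitKey n < orbitKey (lamZ n) then σ n else 1
  have hs (n) (hn : n ∈ C7) : s n * σ n = s (lamZ n) := by
    simp only [s, lamZ_lamZ, hσlam n hn]
    rcases lt_trichotomy (orbitKey n) (orbitKey (lamZ n)) with h | h | h
    · rw [if_pos h, if_neg h.not_gt, Int.units_mul_self]
    · rw [if_neg h.not_lt, if_neg h.not_gt, hσ1 n hn (orbitKey_lamZ n hn h), one_mul]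
    · rw [if_neg h.not_gt, if_pos h, one_mul]
  let E' : (Fin 7 → ℝ) → L := Function.extend emb (fun n => (s n : ℂ) • E (emb n)) 0
  have hE' (n) : E' (emb n) = (s n : ℂ) • E (emb n) := emb_injective.extend_apply _ 0 n
  refine ⟨E', Λ, hE.change_signs (fun n _ => hE' n) (fun n hn => ?_), ⟨h1, fun α hα => ?_⟩⟩
  · simp only [s, lamZ_neg, orbitKey_neg, hσneg n hn]
  · obtain ⟨n, hn, rfl⟩ := R7_eq ▸ hα
    rw [lam_emb, hE', hE', map_smul, hσ n hn, ← hs n hn, smul_smul]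
    simp

end Lie

end

end E7

namespace E7

noncomputable section

/-! ### Characters of the root lattice with values `± 1` -/

/-- The value at `n` of the character of the root lattice with given values at the simple roots. -/
def signChar (p : Fin 7 → ℤˣ) (n : Fin 7 → ℤ) : ℤˣ := ∏ i, p i ^ n i

lemma signChar_add (p : Fin 7 → ℤˣ) (m n : Fin 7 → ℤ) :
    signChar p (m + n) = signChar p m * signChar p n := by
  simp [signChar, _root_.zpow_add, Finset.prod_mul_distrib]

lemma signChar_single (p : Fin 7 → ℤˣ) (i : Fin 7) : signChar p (Pi.single i 1) = p i := by
  rw [signChar, Finset.prod_eq_single i]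
  · simp
  · intro j _ hj
    simp [Pi.single_eq_of_ne hj]
  · simp

lemma signChar_neg (p : Fin 7 → ℤˣ) (n : Fin 7 → ℤ) : signChar p (-n) = signChar p n := by
  simp [signChar]

lemma posRoots_step : ∀ n ∈ posRoots, (∃ i, n = Pi.single i 1) ∨
    ∃ i, n - Pi.single i 1 ∈ posRoots ∧ dotZ (n - Pi.single i 1) (Pi.single i 1) = -1 := by
  decide +kernel

lemma posRoots_ht : ∀ n ∈ posRoots, 0 < ht n := by decide +kernel

lemma posRoots_subset {n : Fin 7 → ℤ} (hn : n ∈ posRoots) : n ∈ C7 := List.mem_append_left _ hn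

lemma single_mem_posRoots : ∀ i : Fin 7, Pi.single i 1 ∈ posRoots := by decide +kernel

/-- A multiplicative function on the roots is the restriction of a character. -/
lemma eq_signChar {χ : (Fin 7 → ℤ) → ℤˣ}
    (hadd : ∀ m ∈ C7, ∀ n ∈ C7, dotZ m n = -1 → χ (m + n) = χ m * χ n)
    (hneg : ∀ n ∈ C7, χ (-n) = χ n) {n : Fin 7 → ℤ} (hn : n ∈ C7) :
    χ n = signChar (fun i => χ (Pi.single i 1)) n := by
  have key (k : ℕ) : ∀ n ∈ posRoots, ht n ≤ k → χ n = signChar (fun i => χ (Pi.single i 1)) n := by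
    induction k with
    | zero => exact fun n hn h => absurd (posRoots_ht n hn) (by exact_mod_cast h.not_gt)
    | succ k ih =>
      intro n hn h
      rcases posRoots_step n hn with ⟨i, rfl⟩ | ⟨i, h1, h2⟩
      · rw [signChar_single]
      · have h3 : ht (n - Pi.single i 1) ≤ k := by
          have : ht (n - Pi.single i 1) = ht n - 1 := by simp [ht, Finset.sum_sub_distrib]
          push_cast at h; omega
        rw [← sub_add_cancel n (Pi.single i 1), hadd _ (posRoots_subset h1) _
          (posRoots_subset (single_mem_posRoots i)) h2, ih _ h1 h3, signChar_add,
          signChar_single]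
  rcases posRoots_facts n hn with ⟨h, -⟩ | ⟨-, h⟩
  · exact key (ht n).toNat n h (Int.self_le_toNat _)
  · rw [← hneg n hn, ← signChar_neg]
    exact key (ht (-n)).toNat (-n) h (Int.self_le_toNat _)

lemma C7_six : ∀ n ∈ C7, n 6 = 0 ∨ n 6 = 1 ∨ n 6 = -1 := by decide +kernel

/-- The coefficient of `α₇` in a root is `0` or `±1`, and it is `0` exactly on `e₆`. -/
lemma signChar_six {p : Fin 7 → ℤˣ} (hp : ∀ i, p i = if i = 6 then -1 else 1) {n : Fin 7 → ℤ}
    (hn : n ∈ C7) : signChar p n = if n ∈ C6 then 1 else -1 := by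
  have h : signChar p n = (-1) ^ n 6 := by
    rw [signChar, Finset.prod_eq_single 6]
    · rw [hp, if_pos rfl]
    · intro i _ hi
      rw [hp, if_neg hi, _root_.one_zpow]
    · simp
  rw [h]
  simp only [mem_C6, hn, true_and]
  rcases C7_six n hn with h | h | h <;> simp [h]

lemma fixed_dot : ∀ n ∈ C7, lamZ n = n → ∀ k, dotZ (orthB k) n = 0 := by decide +kernel

lemma fixed_roots : ∀ n ∈ [![0, 0, 0, 0, 0, 1, 0], ![0, 0, 1, 0, 0, 0, 0], ![0, 1, 1, 1, 0, 0, 0],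
    ![1, 1, 1, 1, 1, 0, 0]], n ∈ C7 ∧ lamZ n = n := by
  decide +kernel

/-- A character that is trivial on the roots fixed by `λ₇` and equal to `-1` on the three roots
`orthB k` becomes the character `n ↦ (-1)^(n 6)` after at most one reflection. -/
lemma exists_orthB_of_signChar {p : Fin 7 → ℤˣ} (hf : ∀ n ∈ C7, lamZ n = n → signChar p n = 1)
    (hb : ∀ k, signChar p (orthB k) = -1) : (∀ i, p i = if i = 6 then -1 else 1) ∨
      ∃ k, ∀ i, p i * (-1) ^ dotZ (orthB k) (Pi.single i 1) = if i = 6 then -1 else 1 := by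
  -- The four roots of `fixed_roots` and the root `orthB 0` leave two free signs, and the four
  -- possibilities are checked.
  have key : ∀ a b : ℤˣ, (∀ i, ![a, b, 1, b, a, 1, -b] i = if i = 6 then -1 else 1) ∨
      ∃ k, ∀ i, ![a, b, 1, b, a, 1, -b] i * (-1) ^ dotZ (orthB k) (Pi.single i 1) =
        if i = 6 then -1 else 1 := by
    decide +kernel
  have hf' := fun n hn => hf n (fixed_roots n hn).1 (fixed_roots n hn).2
  have h0 := hb 0
  simp only [List.forall_mem_cons, List.not_mem_nil, signChar, Fin.prod_univ_seven, orthB_eq] at hf' h0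
  simp at hf' h0
  obtain ⟨h5, h2, h13, h04⟩ := hf'
  rw [h2] at h13 h04
  rw [h5] at h0
  have h3 : p 3 = p 1 := by
    rcases Int.units_eq_one_or (p 1) with h | h <;> rcases Int.units_eq_one_or (p 3) with h' | h' <;>
      simp_all
  have h4 : p 4 = p 0 := by
    rcases Int.units_eq_one_or (p 1) with h | h <;> rcases Int.units_eq_one_or (p 0) with h' | h' <;>
      rcases Int.units_eq_one_or (p 4) with h'' | h'' <;> simp_all
  have h6 : p 6 = -p 1 := by
    rcases Int.units_eq_one_or (p 1) with h | h <;> rcases Int.units_eq_one_or (p 6) with h' | h' <;>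
      rcases Int.units_eq_one_or (p 0) with h'' | h'' <;> simp_all
  have hp : p = ![p 0, p 1, 1, p 1, p 0, 1, -p 1] := by
    ext i; fin_cases i <;> simp [h2, h3, h4, h5, h6]
  rw [hp]
  exact key (p 0) (p 1)

/-! ### Cayley transforms -/

section Lie

variable {L : Type*} [LieRing L] [LieAlgebra ℂ L] {H : LieSubalgebra ℂ L}
  {φ : H ≃ₗ[ℂ] (Fin 7 → ℂ)} {E : (Fin 7 → ℝ) → L} {Λ : L ≃ₗ⁅ℂ⁆ L}
variable [FiniteDimensional ℂ L] [LieAlgebra.IsKilling ℂ L] [H.IsCartanSubalgebra]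
  (hE : IsChevalley φ E)
  (hR : Set.range (LieAlgebra.IsKilling.rootSystem H).root = form φ '' R7)
include hE hR

/-- The Cayley transform defined by a root. -/
lemma exists_cayley {b : Fin 7 → ℤ} (hb : b ∈ C7) : ∃ G : L ≃ₗ⁅ℂ⁆ L,
    (∀ u, G (hh φ u) = hh φ (u - (2⁻¹ * (toC (emb b) ⬝ᵥ u)) • toC (emb b)) +
      (2⁻¹ * (toC (emb b) ⬝ᵥ u)) • (E (emb b) + E (emb (-b)))) ∧
    G (E (emb b)) = (4⁻¹ : ℂ) • (E (emb b) - hh φ (toC (emb b)) - E (emb (-b))) ∧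
    ∀ n ∈ C7, dotZ b n = 0 → G (E (emb n)) = E (emb n) := by
  have hb' := C7_neg hb
  obtain ⟨P, hP, hP0, hP1⟩ := ((hE.root hb').smul (2⁻¹ : ℂ)).exists_exp hR hb'
  obtain ⟨Q, hQ, hQ0, hQ1⟩ := ((hE.root hb).smul (-1 : ℂ)).exists_exp hR hb
  have hbb : toC (emb b) ⬝ᵥ toC (emb b) = 2 := by rw [toC_emb_dot, mem_C7.1 hb]; norm_num
  have hXY := hE.lie_neg hb
  have hXh (u) : ⁅E (emb b), hh φ u⁆ = -(toC (emb b) ⬝ᵥ u) • E (emb b) := by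
    rw [← lie_skew, hE.lie_hh hb, neg_smul]
  have hYh (u) : ⁅E (emb (-b)), hh φ u⁆ = (toC (emb b) ⬝ᵥ u) • E (emb (-b)) := by
    rw [← lie_skew, hE.lie_hh hb', emb_neg, toC_neg, neg_dotProduct, neg_smul, neg_neg]
  have hYX : ⁅E (emb (-b)), E (emb b)⁆ = -hh φ (toC (emb b)) := by rw [← lie_skew, hXY]
  have hPh (u) : P (hh φ u) = hh φ u + (2⁻¹ * (toC (emb b) ⬝ᵥ u)) • E (emb (-b)) := by
    rw [hP1 _ (by simp only [smul_lie, lie_smul, hYh, lie_self, smul_zero]), smul_lie, hYh,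
      smul_smul]
  have hPX : P (E (emb b)) =
      E (emb b) - (2⁻¹ : ℂ) • hh φ (toC (emb b)) - (4⁻¹ : ℂ) • E (emb (-b)) := by
    simp only [hP, smul_lie, lie_smul, hYX, lie_neg, hYh, hbb]
    module
  have hQh (u) : Q (hh φ u) = hh φ u + (toC (emb b) ⬝ᵥ u) • E (emb b) := by
    rw [hQ1 _ (by simp only [smul_lie, lie_smul, hXh, lie_self, smul_zero]), smul_lie, hXh,
      smul_smul, neg_mul_neg, one_mul]
  have hQX : Q (E (emb b)) = E (emb b) := hQ0 _ (by rw [smul_lie, lie_self, smul_zero])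
  have hQY : Q (E (emb (-b))) = E (emb (-b)) - hh φ (toC (emb b)) - E (emb b) := by
    simp only [hQ, smul_lie, lie_smul, hXY, hXh, hbb]
    module
  refine ⟨P.trans Q, fun u => ?_, ?_, fun n hn h => ?_⟩ <;> rw [LieEquiv.trans_apply]
  · simp only [hPh, hQh, hQY, map_add, map_smul, hh_sub, hh_smul]
    module
  · simp only [hPX, hQX, hQh, hQY, map_sub, map_smul, hbb]
    module
  · rw [hP0 _ (by rw [smul_lie, hE.lie_of_dot_nonneg hR hb' hn (by rw [dotZ_neg_left, h, neg_zero]),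
      smul_zero]), hQ0 _ (by rw [smul_lie, hE.lie_of_dot_nonneg hR hb hn h.ge, smul_zero])]

/-- An automorphism that maps the Cartan subalgebra into the invariant subalgebra. -/
lemma exists_cayley_lam (hΛ : IsLift φ E Λ) : ∃ G : L ≃ₗ⁅ℂ⁆ L,
    (∀ u, Λ (G (hh φ u)) = G (hh φ u)) ∧
    (∀ k, Λ (G (E (emb (orthB k)))) = -G (E (emb (orthB k)))) ∧
    ∀ n ∈ C7, lamZ n = n → Λ (G (E (emb n))) = G (E (emb n)) := by
  choose G hG1 hG2 hG3 using fun k => exists_cayley hE hR (orthB_facts.1 k)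
  have ho (j k) (h : j ≠ k) := orthB_facts.2 j k h
  have hd : ∀ j k, j ≠ k → toC (emb (orthB j)) ⬝ᵥ toC (emb (orthB k)) = 0 := fun j k hjk => by
    rw [toC_emb_dot, ho j k hjk, Int.cast_zero]
  have hd2 (k) : toC (emb (orthB k)) ⬝ᵥ toC (emb (orthB k)) = 2 := by
    rw [toC_emb_dot, mem_C7.1 (orthB_facts.1 k)]; norm_num
  have hX (j k) (h : j ≠ k) : G j (E (emb (orthB k))) = E (emb (orthB k)) :=
    hG3 j _ (orthB_facts.1 k) (ho j k h)
  have hY (j k) (h : j ≠ k) : G j (E (emb (-orthB k))) = E (emb (-orthB k)) :=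
    hG3 j _ (C7_neg (orthB_facts.1 k)) (by rw [dotZ_neg_right, ho j k h, neg_zero])
  have hh0 (j k) (h : j ≠ k) : G j (hh φ (toC (emb (orthB k)))) = hh φ (toC (emb (orthB k))) := by
    rw [hG1, hd j k h]; simp
  have hl (k) : lamZ (orthB k) = -orthB k := by simpa using orthB_lam k 1
  have hΛX (k) : Λ (E (emb (orthB k))) = E (emb (-orthB k)) := by
    rw [hΛ.map_E (orthB_facts.1 k), hl]
  have hΛY (k) : Λ (E (emb (-orthB k))) = E (emb (orthB k)) := by
    rw [hΛ.map_E (C7_neg (orthB_facts.1 k)), lamZ_neg, hl, neg_neg]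
  have hΛh (k) : Λ (hh φ (toC (emb (orthB k)))) = -hh φ (toC (emb (orthB k))) := by
    rw [hΛ.map_hh_emb, hl, emb_neg, toC_neg, hh_neg]
  refine ⟨((G 0).trans (G 1)).trans (G 2), fun u => ?_, fun k => ?_, fun n hn h => ?_⟩ <;>
    simp only [LieEquiv.trans_apply]
  -- The transforms replace the components along `orthB k`, which `Λ` negates, by multiples of `E
  -- (orthB k) + E (-orthB k)`, which `Λ` fixes.
  · simp only [hG1, map_add, map_smul, hX 1 0 (by decide), hX 2 0 (by decide), hX 2 1 (by decide),
      hY 1 0 (by decide), hY 2 0 (by decide), hY 2 1 (by decide), hΛX, hΛY, hΛ.cartan,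
      dotProduct_sub, dotProduct_smul, hd 1 0 (by decide), hd 2 0 (by decide), hd 2 1 (by decide),
      smul_zero, sub_zero]
    rw [lam_eq_sub_orthB]
    simp only [dotProduct_sub, dotProduct_smul, hd 0 1 (by decide), hd 0 2 (by decide),
      hd 1 2 (by decide), hd 1 0 (by decide), hd 2 0 (by decide), hd 2 1 (by decide), hd2,
      smul_eq_mul, mul_zero, sub_zero]
    have h0 (x : ℂ) : x - 2⁻¹ * x * 2 = 0 := by ring
    simp only [h0, zero_smul, sub_zero]
    module
  · have key : G 2 (G 1 (G 0 (E (emb (orthB k))))) =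
        (4⁻¹ : ℂ) • (E (emb (orthB k)) - hh φ (toC (emb (orthB k))) - E (emb (-orthB k))) := by
      fin_cases k
      · simp only [Fin.mk_zero]
        rw [hG2]
        simp only [map_smul, map_sub, hX 1 0 (by decide), hX 2 0 (by decide), hY 1 0 (by decide),
          hY 2 0 (by decide), hh0 1 0 (by decide), hh0 2 0 (by decide)]
      · simp only [Fin.mk_one]
        rw [hX 0 1 (by decide), hG2]
        simp only [map_smul, map_sub, hX 2 1 (by decide), hY 2 1 (by decide), hh0 2 1 (by decide)]
      · simp only [Fin.reduceFinMk]
        rw [hX 0 2 (by decide), hX 1 2 (by decide), hG2]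
    rw [key]
    simp only [map_smul, map_sub, hΛX, hΛY, hΛh]
    module
  · have h1 := fixed_dot n hn h
    rw [hG3 0 n hn (h1 0), hG3 1 n hn (h1 1), hG3 2 n hn (h1 2), hΛ.map_E hn, h]

end Lie

end

end E7

namespace E7

noncomputable section

/-! ### The invariant subalgebra is the sum of a copy of `e₆` and a one-dimensional centre -/

lemma C7_reflZ {b n : Fin 7 → ℤ} (hb : b ∈ C7) (hn : n ∈ C7) : n - dotZ b n • b ∈ C7 := by
  rw [mem_C7] at *
  simp only [dotZ_sub_left, dotZ_sub_right, dotZ_smul_left, dotZ_smul_right, dotZ_comm n b, hb, hn]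
  ring

lemma toC_emb_reflC (b n : Fin 7 → ℤ) (u : Fin 7 → ℂ) :
    toC (emb n) ⬝ᵥ reflC b u = toC (emb (n - dotZ b n • b)) ⬝ᵥ u := by
  have h : toC (emb (n - dotZ b n • b)) = toC (emb n) - (dotZ b n : ℂ) • toC (emb b) := by
    ext j
    simp [toC, emb, Finset.sum_sub_distrib, sub_mul, Finset.mul_sum, mul_assoc]
  rw [h, reflC, dotProduct_sub, dotProduct_smul, toC_emb_dot, sub_dotProduct, smul_dotProduct,
    dotZ_comm n b, smul_eq_mul, smul_eq_mul, mul_comm]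

lemma reflC_reflC {b : Fin 7 → ℤ} (hb : b ∈ C7) (u : Fin 7 → ℂ) : reflC b (reflC b u) = u := by
  have h : toC (emb b) ⬝ᵥ toC (emb b) = 2 := by rw [toC_emb_dot, mem_C7.1 hb]; norm_num
  simp only [reflC, dotProduct_sub, dotProduct_smul, h, smul_eq_mul]
  module

lemma emb_dot_six {n : Fin 7 → ℤ} (hn : n ∈ C6) : toC (emb n) ⬝ᵥ toC (e 4 + e 5 + e 6) = 0 := by
  have h : ∀ n ∈ C6, toM n 4 + toM n 5 + toM n 6 = 0 := by decide +kernel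
  have h1 : ((toM n 4 + toM n 5 + toM n 6 : ℤ) : ℝ) = 0 := by exact_mod_cast h n hn
  rw [toC_dot, emb_eq_embM, Complex.ofReal_eq_zero]
  simp [embM, dotProduct, Fin.sum_univ_seven, e]
  push_cast at h1
  linear_combination c * h1

section Lie

variable {L : Type*} [LieRing L] [LieAlgebra ℂ L] {H : LieSubalgebra ℂ L}
  {φ : H ≃ₗ[ℂ] (Fin 7 → ℂ)} {E : (Fin 7 → ℝ) → L} {Λ : L ≃ₗ⁅ℂ⁆ L}

lemma rep26_le_grade_one : (rep26 φ Λ).toSubmodule ≤ grade Λ 1 := fun _ hx => mem_grade_one.2 hx.2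

variable [FiniteDimensional ℂ L] [LieAlgebra.IsKilling ℂ L] [H.IsCartanSubalgebra]
  (hE : IsChevalley φ E)
  (hR : Set.range (LieAlgebra.IsKilling.rootSystem H).root = form φ '' R7)
include hE hR

/-- If an involution fixes the image of the Cartan subalgebra under `G`, it acts on the images of
the root vectors by a character. -/
lemma exists_character {G : L ≃ₗ⁅ℂ⁆ L} (hinv : ∀ x, Λ (Λ x) = x)
    (hG : ∀ u, Λ (G (hh φ u)) = G (hh φ u)) : ∃ p : Fin 7 → ℤˣ, ∀ n ∈ C7, ∀ x,
      IsRootVector φ (emb n) x → Λ (G x) = (signChar p n : ℂ) • G x := by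
  -- The conjugate `T` fixes the Cartan subalgebra pointwise, so it acts by a scalar on each root
  -- line; the scalar is `±1` since `T` is an involution, and brackets make it multiplicative.
  let T : L ≃ₗ⁅ℂ⁆ L := (G.trans Λ).trans G.symm
  have hGT (x : L) : G (T x) = Λ (G x) := G.apply_symm_apply _
  have hT0 (u) : T (hh φ u) = hh φ u := G.injective (show G (T _) = G _ by rw [hGT, hG])
  have hT2 (x : L) : T (T x) = x := G.injective (show G (T _) = G _ by rw [hGT, hGT, hinv])
  have h1 (n) (hn : n ∈ C7) : ∃ t : ℤˣ, T (E (emb n)) = (t : ℂ) • E (emb n) := by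
    have h2 := (hE.root hn).map (N := T) (f := id) (g := id) hT0 (fun _ => rfl) (fun _ => rfl)
    obtain ⟨t, ht⟩ := (hE.root hn).exists_smul hR hn (hE.ne_zero hn) h2
    have h3 := hT2 (E (emb n))
    rw [ht, map_smul, ht, smul_smul] at h3
    have h4 : (t * t - 1) • E (emb n) = 0 := by rw [sub_smul, h3, one_smul, sub_self]
    have h5 := (smul_eq_zero.1 h4).resolve_right (hE.ne_zero hn)
    rcases mul_eq_zero.1 (show (t - 1) * (t + 1) = 0 by linear_combination h5) with h | h
    · exact ⟨1, by rw [ht, sub_eq_zero.1 h]; simp⟩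
    · exact ⟨-1, by rw [ht, eq_neg_of_add_eq_zero_left h]; simp⟩
  choose! χ hχ using h1
  have hadd : ∀ m ∈ C7, ∀ n ∈ C7, dotZ m n = -1 → χ (m + n) = χ m * χ n := by
    intro m hm n hn h
    have hmn := C7_add hm hn h
    obtain ⟨s, hs⟩ := hE.lie_of_dot_neg hm hn h
    have h2 := congrArg T hs
    rw [LieEquiv.map_lie, hχ m hm, hχ n hn, map_smul, hχ _ hmn, smul_lie, lie_smul, hs, smul_smul,
      smul_smul, smul_smul] at h2
    have h3 : χ m * χ n * s = s * χ (m + n) := units_eq_of_smul_eq (hE.ne_zero hmn) (by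
      push_cast; exact h2)
    rw [mul_comm s] at h3
    exact (mul_right_cancel h3).symm
  have hneg : ∀ n ∈ C7, χ (-n) = χ n := by
    intro n hn
    have h2 := congrArg T (hE.lie_neg hn)
    rw [LieEquiv.map_lie, hχ n hn, hχ _ (C7_neg hn), hT0, smul_lie, lie_smul, hE.lie_neg hn,
      smul_smul] at h2
    have h4 : χ n * χ (-n) = 1 := units_eq_of_smul_eq (hh_emb_ne_zero (φ := φ) hn) (by
      rw [Units.val_mul, Int.cast_mul, h2]; simp)
    rw [← inv_eq_of_mul_eq_one_right h4, Int.units_inv_eq_self]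
  refine ⟨fun i => χ (Pi.single i 1), fun n hn x hx => ?_⟩
  obtain ⟨t, rfl⟩ := (hE.root hn).exists_smul hR hn (hE.ne_zero hn) hx
  rw [← hGT, map_smul, hχ n hn, ← eq_signChar hadd hneg hn, map_smul, map_smul, map_smul,
    smul_comm]

/-- An automorphism that identifies the involution with the one that is trivial on the Cartan
subalgebra and on `e₆` and is `-1` on the other root spaces. -/
lemma exists_conj (hΛ : IsLift φ E Λ) : ∃ G : L ≃ₗ⁅ℂ⁆ L,
    (∀ u, Λ (G (hh φ u)) = G (hh φ u)) ∧
    ∀ n ∈ C7, Λ (G (E (emb n))) = (if n ∈ C6 then (1 : ℂ) else -1) • G (E (emb n)) := by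
  have hinv := hΛ.involutive hE hR
  obtain ⟨G, h1, h2, h3⟩ := exists_cayley_lam hE hR hΛ
  obtain ⟨p, hp⟩ := exists_character hE hR hinv h1
  have hG0 {n} (hn : n ∈ C7) : G (E (emb n)) ≠ 0 := fun h =>
    hE.ne_zero hn ((map_eq_zero_iff G G.injective).1 h)
  have hfix : ∀ n ∈ C7, lamZ n = n → signChar p n = 1 := fun n hn h =>
    units_eq_of_smul_eq (hG0 hn) (by rw [← hp n hn _ (hE.root hn), h3 n hn h]; simp)
  have hb : ∀ k, signChar p (orthB k) = -1 := fun k =>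
    units_eq_of_smul_eq (hG0 (orthB_facts.1 k)) (by
      rw [← hp _ (orthB_facts.1 k) _ (hE.root (orthB_facts.1 k)), h2 k]; simp)
  have key {q : Fin 7 → ℤˣ} (hq : ∀ i, q i = if i = 6 then -1 else 1) {n} (hn : n ∈ C7) :
      ((signChar q n : ℤ) : ℂ) = if n ∈ C6 then 1 else -1 := by
    rw [signChar_six hq hn]; split_ifs <;> simp
  rcases exists_orthB_of_signChar hfix hb with h | ⟨k, h⟩
  · exact ⟨G, h1, fun n hn => by rw [hp n hn _ (hE.root hn), key h hn]⟩
  -- Composing with a lift of the reflection in `orthB k` changes the character `p` into its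
  -- composite with that reflection. As `p` is `-1` at `orthB k`, the value at `α_i` is multiplied
  -- by `-1` to the power `(orthB k, α_i)`.
  · have hk := orthB_facts.1 k
    obtain ⟨N, hN⟩ := exists_isReflection hE hR hk
    have h1' (u) : Λ ((N.trans G) (hh φ u)) = (N.trans G) (hh φ u) := by
      rw [LieEquiv.trans_apply, hN.hh, h1]
    obtain ⟨q, hq⟩ := exists_character hE hR hinv h1'
    refine ⟨N.trans G, h1', fun n hn => ?_⟩
    have hqi : ∀ i, q i = if i = 6 then -1 else 1 := by
      intro i
      have hi := posRoots_subset (single_mem_posRoots i)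
      have h4 := (hE.root hi).map (β := emb (Pi.single i 1 -
        dotZ (orthB k) (Pi.single i 1) • orthB k)) hN.hh (reflC_reflC hk) (toC_emb_reflC _ _)
      have h5 := hp _ (C7_reflZ hk hi) _ h4
      have h6 : signChar q (Pi.single i 1) =
          signChar p (Pi.single i 1 - dotZ (orthB k) (Pi.single i 1) • orthB k) :=
        units_eq_of_smul_eq (v := G (N (E (emb (Pi.single i 1)))))
          (fun h => hE.ne_zero hi ((map_eq_zero_iff N N.injective).1
            ((map_eq_zero_iff G G.injective).1 h)))
          (by rw [← h5, ← LieEquiv.trans_apply, ← hq _ hi _ (hE.root hi)])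
      rw [signChar_single, sub_eq_add_neg, signChar_add, signChar_single, signChar_neg] at h6
      rw [h6, ← h i, ← hb k]
      congr 1
      simp only [signChar, ← Finset.prod_zpow, ← _root_.zpow_mul, Pi.smul_apply, smul_eq_mul,
        mul_comm]
    rw [hq n hn _ (hE.root hn), key hqi hn]

/-- Conjugation by `G` reduces to the involution that is `1` on the Cartan subalgebra and on `e₆`
and `-1` on the other root spaces. Its fixed space is `e₆` plus the line of `e₅ + e₆ + e₇`, which is
central because that vector is orthogonal to all roots of `e₆`. -/
theorem exists_e6_embedding (hΛ : IsLift φ E Λ) :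
    ∃ (ψ : e6 φ →ₗ⁅ℂ⁆ L) (z : L), Function.Injective ψ ∧ z ≠ 0 ∧
      (∀ x ∈ grade Λ 0, ⁅z, x⁆ = 0) ∧
      IsSum (grade Λ 0) ψ.range.toSubmodule (Submodule.span ℂ {z}) := by
  obtain ⟨G, h1, h2⟩ := exists_conj hE hR hΛ
  set z₀ : L := hh φ (toC (e 4 + e 5 + e 6)) with hz₀
  set M : Submodule ℂ L := (e6 φ).toSubmodule ⊔ Submodule.span ℂ {z₀} with hM
  have hMr : M = Submodule.span ℂ ({x | ∃ n ∈ C6, x = E (emb n) ∨ x = hh φ (toC (emb n))} ∪ {z₀}) := by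
    rw [hM, e6_toSubmodule hE hR, rootSpan, Submodule.span_union]
  have hgrade : grade Λ 0 = M.map (G : L →ₗ[ℂ] L) := by
    apply le_antisymm
    · intro x hx
      rw [mem_grade_zero] at hx
      obtain ⟨y, rfl⟩ := G.surjective x
      refine ⟨y, ?_, rfl⟩
      change Λ (G y) = G y at hx
      obtain ⟨u, a, rfl⟩ := hE.exists_coord hR y
      have h3 : ∀ n ∈ C7, (if n ∈ C6 then (1 : ℂ) else -1) * a n = a n := by
        refine (hE.coord_unique hR (u := u) (v := u) (G.injective ?_)).2
        change G _ = G _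
        rw [← hx]
        simp only [map_add, map_sum, map_smul, h1]
        refine congrArg _ (Finset.sum_congr rfl fun n hn => ?_)
        rw [h2 n (List.mem_toFinset.1 hn), smul_smul, mul_comm]
      refine add_mem ?_ (sum_mem fun n hn => ?_)
      · exact hh_mem_of_e6 (fun n hn => Submodule.mem_sup_left
          (by rw [e6_toSubmodule hE hR]; exact hh_mem_rootSpan hn))
          (Submodule.mem_sup_right (Submodule.mem_span_singleton_self _)) u
      · by_cases h : n ∈ C6
        · exact M.smul_mem _ (Submodule.mem_sup_left
            (by rw [e6_toSubmodule hE hR]; exact E_mem_rootSpan h))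
        · have h4 := h3 n (List.mem_toFinset.1 hn)
          rw [if_neg h] at h4
          have h5 : a n = 0 := by linear_combination -h4 / 2
          rw [h5, zero_smul]
          exact zero_mem _
    · rw [hMr, Submodule.map_span, Submodule.span_le]
      rintro _ ⟨x, ⟨n, hn, rfl | rfl⟩ | rfl, rfl⟩ <;> refine mem_grade_zero.2 ?_
      · have h3 := h2 n (C6_subset hn)
        rwa [if_pos hn, one_smul] at h3
      · exact h1 _
      · exact h1 _
  have hz0 : z₀ ≠ 0 := by
    intro h
    have h3 := congrFun (toC_injective (a₂ := 0) ((hh_injective φ (h.trans (hh_zero φ).symm)).trans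
      (by ext; simp [toC]))) 4
    simp [e] at h3
  refine ⟨(G : L →ₗ⁅ℂ⁆ L).comp (e6 φ).incl, G z₀, fun x y h => Subtype.ext (G.injective h),
    fun h => hz0 ((map_eq_zero_iff G G.injective).1 h), ?_, ?_⟩
  · rw [hgrade, hMr]
    rintro _ ⟨x, hx, rfl⟩
    change ⁅G z₀, G x⁆ = 0
    rw [← LieEquiv.map_lie]
    rw [show ⁅z₀, x⁆ = 0 from ?_, map_zero]
    induction hx using Submodule.span_induction with
    | mem x hx =>
      rcases hx with ⟨n, hn, rfl | rfl⟩ | rfl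
      · rw [hE.lie_hh (C6_subset hn), emb_dot_six hn, zero_smul]
      · exact lie_hh_hh φ _ _
      · exact lie_self _
    | zero => exact lie_zero _
    | add x y _ _ hx hy => rw [lie_add, hx, hy, add_zero]
    | smul t x _ hx => rw [lie_smul, hx, smul_zero]
  · have h3 : ((G : L →ₗ⁅ℂ⁆ L).comp (e6 φ).incl).range.toSubmodule =
        (e6 φ).toSubmodule.map (G : L →ₗ[ℂ] L) := by
      ext x
      constructor
      · rintro ⟨y, rfl⟩
        exact ⟨y, y.2, rfl⟩
      · rintro ⟨y, hy, rfl⟩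
        exact ⟨⟨y, hy⟩, rfl⟩
    have h4 : Submodule.span ℂ {G z₀} = (Submodule.span ℂ {z₀}).map (G : L →ₗ[ℂ] L) := by
      rw [Submodule.map_span, Set.image_singleton]; rfl
    rw [h3, h4, hgrade]
    refine ⟨Submodule.disjoint_map G.injective ((isCompl_e6_spI hE hR hΛ).disjoint.mono_right
      (Submodule.span_le.2 (Set.singleton_subset_iff.2 ?_))), by rw [← Submodule.map_sup]⟩
    exact Submodule.subset_span (Or.inr rfl)

end Lie

end

end E7

/-! ### The theorem -/

open E7 in
theorem mainTheorem3 {L : Type*} [LieRing L] [LieAlgebra ℂ L] [FiniteDimensional ℂ L]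
    [LieAlgebra.IsKilling ℂ L] (H : LieSubalgebra ℂ L) [H.IsCartanSubalgebra]
    (φ : H ≃ₗ[ℂ] (Fin 7 → ℂ))
    (hR : Set.range (LieAlgebra.IsKilling.rootSystem H).root = form φ '' R7) :
    -- the simple roots, the fundamental weight `ϖ₇` and the transformation `λ₇` it generates
    ((∀ i, simple i ∈ R7) ∧
      (∀ i j, simple i ⬝ᵥ simple j = (CartanMatrix.E₇ (sigma7 i) (sigma7 j) : ℝ)) ∧
      (∀ i, simple i ⬝ᵥ varpi7 = if i = 6 then 1 else 0) ∧
      lam ℝ ∈ Submonoid.closure (refl '' R7) ∧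
      (fun x => lam ℝ x + varpi7) '' alcove = alcove ∧
      (∀ x, lam ℝ (lam ℝ x) = x) ∧
      (∀ i, lam ℝ (simple i) = ![simple 4, simple 3, simple 2, simple 1, simple 0, simple 5,
        alpha0] i) ∧
      lam ℝ alpha0 = simple 6) ∧
    -- `λ₇` lifts to the Lie algebra
    (∃ (E : (Fin 7 → ℝ) → L) (Λ : L ≃ₗ⁅ℂ⁆ L), IsChevalley φ E ∧ IsLift φ E Λ) ∧
    ∀ (E : (Fin 7 → ℝ) → L) (Λ : L ≃ₗ⁅ℂ⁆ L), IsChevalley φ E → IsLift φ E Λ →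
      -- the grading
      ((∀ x, Λ (Λ x) = x) ∧
        DirectSum.IsInternal (grade Λ) ∧
        (∀ k l, ∀ x ∈ grade Λ k, ∀ y ∈ grade Λ l, ⁅x, y⁆ ∈ grade Λ (k + l)) ∧
        IsSum (grade Λ 0) (f4 φ Λ).toSubmodule (spV φ Λ) ∧
        (∃ (ψ : e6 φ →ₗ⁅ℂ⁆ L) (z : L), Function.Injective ψ ∧ z ≠ 0 ∧
          (∀ x ∈ grade Λ 0, ⁅z, x⁆ = 0) ∧
          IsSum (grade Λ 0) ψ.range.toSubmodule (Submodule.span ℂ {z}))) ∧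
      -- the invariant subalgebra is `f₄`, its simple roots and its Cartan subalgebra
      (HasSimpleRoots φ (f4 φ Λ) CartanMatrix.F₄ simpleF simpleCoF ∧
        (∀ u, hh φ u ∈ f4 φ Λ ↔ u 0 - u 1 - u 2 + u 3 = 0 ∧ u 5 = 0 ∧ u 6 = -u 4)) ∧
      -- `e₆ = f₄ ⊕ 26`
      (HasSimpleRoots φ (e6 φ) (CartanMatrix.E₆.submatrix sigma6 sigma6)
          (fun i => simple i.castSucc) (fun i => simple i.castSucc) ∧
        IsSum (e6 φ).toSubmodule (f4 φ Λ).toSubmodule (rep26 φ Λ).toSubmodule ∧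
        (rep26 φ Λ).toSubmodule ≤ grade Λ 1 ∧
        finrank ℂ (e6 φ) = 78 ∧ finrank ℂ (f4 φ Λ) = 52 ∧ finrank ℂ (rep26 φ Λ) = 26 ∧
        IsFundamental φ simpleF simpleCoF 3 (rep26 φ Λ)) ∧
      -- `e₆ = so(8) ⊕ J` and `so(8) = so(7) ⊕ 7`
      (IsSum (e6 φ).toSubmodule (so8 φ).toSubmodule (spJ φ) ∧
        finrank ℂ (so8 φ) = 28 ∧ finrank ℂ (spJ φ) = 50 ∧
        IsSum (spJ φ) (spJk φ Λ 0) (spJk φ Λ 1) ∧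
        HasSimpleRoots φ (so7 φ Λ) (CartanMatrix.B 3)
          (fun i => simpleF i.castSucc) (fun i => simpleCoF i.castSucc) ∧
        IsSum (so8 φ).toSubmodule (so7 φ Λ).toSubmodule (rep7 φ Λ).toSubmodule ∧
        IsFundamental φ (fun i : Fin 3 => simpleF i.castSucc) (fun i => simpleCoF i.castSucc) 0
          (rep7 φ Λ)) ∧
      -- `f₄ = so(7) ⊕ J₀` and `26 = J₁ ⊕ 7`
      (IsSum (f4 φ Λ).toSubmodule (so7 φ Λ).toSubmodule (spJk φ Λ 0) ∧
        finrank ℂ (so7 φ Λ) = 21 ∧ finrank ℂ (spJk φ Λ 0) = 31 ∧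
        IsSum (rep26 φ Λ).toSubmodule (spJk φ Λ 1) (rep7 φ Λ).toSubmodule ∧
        finrank ℂ (spJk φ Λ 1) = 19 ∧ finrank ℂ (rep7 φ Λ) = 7) ∧
      -- `e₇ = f₄ ⊕ V ⊕ g₁`
      (DirectSum.IsInternal ![(f4 φ Λ).toSubmodule, spV φ Λ, grade Λ 1] ∧
        finrank ℂ L = 133 ∧ finrank ℂ (spV φ Λ) = 27 ∧ finrank ℂ (grade Λ 1) = 54 ∧
        IsCompl (e6 φ).toSubmodule (spI φ)) ∧
      -- the GS bases
      (IsBasisOf (basisSo7 φ E) (so7 φ Λ).toSubmodule ∧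
        IsBasisOf (basisJ0 φ E) (spJk φ Λ 0) ∧
        IsBasisOf (Sum.elim (basisSo7 φ E) (basisJ0 φ E)) (f4 φ Λ).toSubmodule ∧
        IsBasisOf (basis7 φ E) (rep7 φ Λ).toSubmodule ∧
        IsBasisOf (basisJ1 φ E) (spJk φ Λ 1) ∧
        IsBasisOf (basisI E 0) (spV φ Λ) ∧
        IsBasisOf (basisG1 φ E) (grade Λ 1)) ∧
      -- the normalised Killing form on the Chevalley basis
      ((∀ u v, kf (hh φ u) (hh φ v) = u ⬝ᵥ v) ∧
        (∀ u, ∀ α ∈ R7, kf (hh φ u) (E α) = 0) ∧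
        (∀ α ∈ R7, kf (E α) (E (-α)) = 1) ∧
        (∀ α ∈ R7, ∀ β ∈ R7, β ≠ -α → kf (E α) (E β) = 0)) ∧
      -- the normalised Killing form on the root vectors of `f₄`
      ((∀ i j s t, kf (basisSo7 φ E (.fix i s)) (basisSo7 φ E (.fix j t)) =
          if i = j ∧ t = -s then 1 else 0) ∧
        (∀ i j s t, kf (basisSo7 φ E (.mov i s)) (basisSo7 φ E (.mov j t)) =
          if i = j ∧ t = -s then 2 else 0) ∧
        (∀ a b s t, kf (basisJ0 φ E (.R a s)) (basisJ0 φ E (.R b t)) =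
          if b = a + 4 ∧ t = -s then 2 else 0) ∧
        (∀ a b ha hb s t, kf (basisJ0 φ E (.L a ha s)) (basisJ0 φ E (.L b hb t)) =
          if b = a + 4 ∧ t = -s then 1 else 0) ∧
        (∀ s t, kf (basisJ0 φ E (.L4 s)) (basisJ0 φ E (.L4 t)) = if t = -s then 2 else 0)) ∧
      -- the normalised Killing form on the other GS generators
      ((∀ k l a b s t, kf (tRp E k a s) (tRp E l b t) =
          if b = a + 4 ∧ t = -s ∧ k + l = 0 then 1 else 0) ∧
        (∀ k l s t, kf (tLp4 E k s) (tLp4 E l t) =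
          if t = s ∧ k + l = 0 then (-1) ^ k.val else 0) ∧
        (∀ k l s t, kf (tL4 E k s) (tL4 E l t) =
          if t = -s ∧ k + l = 0 then (-1) ^ k.val else 0) ∧
        (∀ k l a b s t, kf (tR E k a s) (tR E l b t) =
          if b = a + 4 ∧ t = -s ∧ k + l = 0 then 1 else 0) ∧
        (∀ k l, ∀ a b : Fin 8, a ≠ 3 ∧ a ≠ 7 → b ≠ 3 ∧ b ≠ 7 → kf (tLp E k a) (tLp E l b) =
          if b = a + 4 ∧ k + l = 0 then (-1) ^ k.val else 0) ∧
        (∀ i j s t, kf (tM E i s) (tM E j t) = if i = j ∧ t = -s then 1 else 0) ∧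
        (∀ k l s t, kf (t5 E k s) (t5 E l t) = if t = -s ∧ k + l = 0 then 1 else 0) ∧
        (∀ k l, kf (t6 E k 1) (t6 E l (-1)) = if k + l = 0 then 1 else 0) ∧
        (∀ i j, kf (hh φ (toC (![hA1, hA2] i))) (hh φ (toC (![hA1, hA2] j))) =
          (CartanMatrix.A 2 i j : ℂ)) ∧
        (∀ i, kf (hh φ (toC hE5)) (hh φ (toC (![hA1, hA2] i))) = 0) ∧
        kf (hh φ (toC hE5)) (hh φ (toC hE5)) = 1) := by
  refine ⟨⟨simple_mem_R7, simple_dot, simple_dot_varpi7, lam_mem_weyl, image_alcove, lam_lam,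
    lam_simple, lam_alpha0⟩, exists_chevalley_lift hR, fun E Λ hE hΛ => ?_⟩
  exact ⟨⟨hΛ.involutive hE hR, isInternal_grade (hΛ.involutive hE hR),
      fun k l x hx y hy => lie_mem_grade hx hy, isSum_grade_zero hE hR hΛ,
      exists_e6_embedding hE hR hΛ⟩,
    ⟨f4_hasSimpleRoots hE hR hΛ, hh_mem_f4_iff hE hR hΛ⟩,
    ⟨e6_hasSimpleRoots hE hR, isSum_e6 hE hR hΛ, rep26_le_grade_one, finrank_e6 hE hR hΛ,
      finrank_f4 hE hR hΛ, finrank_rep26 hE hR hΛ, rep26_isFundamental hE hR hΛ⟩,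
    ⟨isSum_e6_so8 hE hR hΛ, finrank_so8 hE hR hΛ, finrank_spJ hE hR hΛ, isSum_spJ hE hR hΛ,
      so7_hasSimpleRoots hE hR hΛ, isSum_so8 hE hR hΛ, rep7_isFundamental hE hR hΛ⟩,
    ⟨isSum_f4 hE hR hΛ, finrank_so7 hE hR hΛ, finrank_spJk_zero hE hR hΛ, isSum_rep26 hE hR hΛ,
      finrank_spJk_one hE hR hΛ, finrank_rep7 hE hR hΛ⟩,
    ⟨isInternal_e7 hE hR hΛ, hE.finrank_eq hR, finrank_spV hE hR hΛ, finrank_grade_one hE hR hΛ,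
      isCompl_e6_spI hE hR hΛ⟩,
    gs_bases hE hR hΛ, kf_chevalley hE hR, kf_f4 hE hR, kf_generators hE hR⟩
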